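/- Let $L=\{P=2m\tau_1+2n\tau_2 : m,n\in\mathbb Z\}\subset\mathbb C$ be a square lattice ($2\tau_1=\ell$, $2\tau_2=i\ell$) or a hexagonal lattice ($2\tau_1=\ell$, $2\tau_2=\ell e^{i\pi/3}$), $\ell>0$, and let $S$ be the area of its fundamental parallelogram. Tubes of inner radius $b$ and outer radius $a$ are centred at the points of $L$, where $a>0$, $\nu=b/a\in[0,1)$ and $h=a/\ell\le\frac12$. The cores ($r<b$), the tubes ($b<r<a$) and the host medium have nonzero complex dielectric constants $\varepsilon_c,\varepsilon_i,\varepsilon_e$. Let $$\alpha=\frac{\varepsilon_i-\varepsilon_e}{\varepsilon_i+\varepsilon_e},\qquad \tilde\alpha=\frac{\varepsilon_i-\varepsilon_c}{\varepsilon_i+\varepsilon_c},\qquad \gamma_n=\frac{\alpha-\tilde\alpha\nu^{4n+2}}{1-\alpha\tilde\alpha\nu^{4n+2}}\quad(n\ge 0),$$ where all denominators are assumed to be nonzero, and $$S_1=0,\qquad S_k={\sum_{P\in L\setminus\{0\}}}\Bigl(\frac{\ell}{P}\Bigr)^{2k}\quad(k\ge2),\qquad f=\frac{\pi a^2}{S}.$$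 Let $\zeta$ be the Weierstrass zeta function of $L$, $\eta_1=\zeta(\tau_1)$, and $$\Psi=\begin{pmatrix}\operatorname{Re}\eta_1\operatorname{Im}2\tau_2&-\operatorname{Im}\eta_1\operatorname{Im}2\tau_2\\-\operatorname{Im}\eta_1\operatorname{Im}2\tau_2&\pi-\operatorname{Re}\eta_1\operatorname{Im}2\tau_2\end{pmatrix}.$$ Consider the infinite systems, for bounded complex sequences $x=(x_n)_{n\ge0}$ and $y=(y_n)_{n\ge0}$, $$x_n-\gamma_n\sum_{k\ge0}\frac{(2n+2k+1)!}{(2k)!\,(2n+1)!}S_{n+k+1}x_kh^{2n+2k+2}=\gamma_0\delta_{n,0},\qquad (\mathrm X)$$ $$y_n+\gamma_n\sum_{k\ge0}\frac{(2n+2k+1)!}{(2k)!\,(2n+1)!}S_{n+k+1}y_kh^{2n+2k+2}=\gamma_0\delta_{n,0}.\qquad (\mathrm Y)$$ When each has a unique bounded solution, let $\lambda,\mu$ be such that $x_0=\gamma_0\lambda$, $y_0=\gamma_0\mu$. A potential is a continuous function $u:\mathbb C\to\mathbb C$, $C^1$ up to the boundary in each phase and with $\nabla u$ periodic with periods $2\tau_1,2\tau_2$,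 such that $\nabla\cdot(\varepsilon\nabla u)=0$ in the cores, the tubes and the host medium, and $\varepsilon\,\partial u/\partial n$ is continuous across the circles $r=a$ and $r=b$ around the lattice points (except at points where two tubes touch). Here $\varepsilon$ denotes the piecewise constant dielectric function. Let $E=-\nabla u$, $D=\varepsilon E$, and let $\langle\cdot\rangle$ be the average over the fundamental parallelogram. A $2\times2$ complex matrix $T$ is called an effective tensor if $\langle D\rangle=T\langle E\rangle$ for every potential $u$. Then: 1. $\Psi=\frac{\pi}{2}I$. 2. If (X) and (Y) have unique bounded solutions, then $\lambda=\mu$ (provided $\gamma_0\ne0$, so that they are determined), and, if $1-\gamma_0\lambda f\neq0$, then $\varepsilon^*I$ with $$\varepsilon^*=\varepsilon_e\,\frac{1+\gamma_0\lambda f}{1-\gamma_0\lambda f}$$ is an effective tensor; if $h<\frac12$ it is the only one. 3. Fix $L,\nu,\varepsilon_c,\varepsilon_i,\varepsilon_e$ and regard $h$ as a real parameter in (X), (Y). For all sufficiently small $|h|$ the systems (X) and (Y) have unique bounded solutions, and $x_0=y_0=\gamma_0\lambda(h)$ with a function $\lambda$ that is real-analytic at $h=0$ and satisfies, as $h\to0$,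 $$\lambda=1+3\gamma_0\gamma_1S_2^2h^8+\bigl(9\gamma_0^2\gamma_1^2S_2^4+7\gamma_0\gamma_3S_4^2\bigr)h^{16}+O(h^{24})$$ for the square lattice, and $$\lambda=1+5\gamma_0\gamma_2S_3^2h^{12}+\gamma_0\bigl(25\gamma_0\gamma_2^2S_3^4+11\gamma_5S_6^2\bigr)h^{24}+O(h^{36})$$ for the hexagonal lattice. 4. For the square lattice $|S_2-3.15121|<10^{-5}$ and $|S_4-4.25577|<10^{-5}$; for the hexagonal lattice $|S_3-5.86303|<10^{-5}$ and $|S_6-6.00964|<10^{-5}$. -/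

import Mathlib

open scoped Topology ENNReal
open MeasureTheory Asymptotics

noncomputable section

namespace TubeArray

/-! ### The lattice of tube centres

A `PeriodPair` carries two `ℝ`-linearly independent periods; in the notation of the tube array
`L.ω₁ = 2τ₁`, `L.ω₂ = 2τ₂`, and `L.lattice` is the set of points `P = 2mτ₁ + 2nτ₂`. -/

/-- The square lattice: `2τ₁ = ℓ`, `2τ₂ = iℓ`. -/
def IsSquareLattice (L : PeriodPair) : Prop :=
  ∃ ℓ : ℝ, 0 < ℓ ∧ L.ω₁ = ℓ ∧ L.ω₂ = ℓ * Complex.I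

/-- The hexagonal lattice: `2τ₁ = ℓ`, `2τ₂ = ℓ e^{iπ/3}`. -/
def IsHexagonalLattice (L : PeriodPair) : Prop :=
  ∃ ℓ : ℝ, 0 < ℓ ∧ L.ω₁ = ℓ ∧ L.ω₂ = ℓ * Complex.exp (Complex.I * Real.pi / 3)

/-- `ℓ = min (2|τ₁|, 2|τ₂|, 2|τ₁ - τ₂|)`, the least distance between the tube centres. -/
def spacing (L : PeriodPair) : ℝ := min ‖L.ω₁‖ (min ‖L.ω₂‖ ‖L.ω₁ - L.ω₂‖)

/-- The dimensionless lattice sums `S_k = ∑' (ℓ / P)^{2k}` for `k ≥ 2`, with `S_1 = 0`. -/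
def latticeSum (L : PeriodPair) (k : ℕ) : ℂ :=
  if k = 1 then 0 else ∑' l : {l : L.lattice // l ≠ 0}, ((spacing L : ℂ) / (l : ℂ)) ^ (2 * k)

/-- The Weierstrass zeta function
`ζ(z) = 1/z + ∑' (1/(z - P) + 1/P + z/P²)`. -/
def weierstrassZeta (L : PeriodPair) (z : ℂ) : ℂ :=
  1 / z + ∑' l : {l : L.lattice // l ≠ 0}, (1 / (z - (l : ℂ)) + 1 / (l : ℂ) + z / (l : ℂ) ^ 2)

/-- `η₁ = ζ(τ₁)`. -/
def eta₁ (L : PeriodPair) : ℂ := weierstrassZeta L (L.ω₁ / 2)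

/-- The matrix `Ψ` of the lattice. -/
def Psi (L : PeriodPair) : Matrix (Fin 2) (Fin 2) ℝ :=
  !![(eta₁ L).re * L.ω₂.im, -(eta₁ L).im * L.ω₂.im;
     -(eta₁ L).im * L.ω₂.im, Real.pi - (eta₁ L).re * L.ω₂.im]

/-- The fundamental parallelogram with sides `2τ₁`, `2τ₂`, centred at the origin. -/
def cell (L : PeriodPair) : Set ℂ :=
  {z | ∃ s ∈ Set.Icc (-1 / 2 : ℝ) (1 / 2), ∃ t ∈ Set.Icc (-1 / 2 : ℝ) (1 / 2),
    z = s * L.ω₁ + t * L.ω₂}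

/-- The volume fraction of solid cylinders of radius `a`: area of a disk of radius `a` over the
area of the cell. -/
def volumeFraction (L : PeriodPair) (a : ℝ) : ℝ := Real.pi * a ^ 2 / volume.real (cell L)

/-! ### Material coefficients

`εc`, `εi`, `εe` are the dielectric constants of the core of the tubes, of the tubes, and of the
host medium, and `ν = b / a` is the ratio of the inner and the outer radius. -/

/-- `α = (εi - εe) / (εi + εe)`. -/
def alpha (εi εe : ℂ) : ℂ := (εi - εe) / (εi + εe)

/-- `α̃ = (εi - εc) / (εi + εc)`. -/
def alphaTilde (εc εi : ℂ) : ℂ := (εi - εc) / (εi + εc)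

/-- `γ_n = (α - α̃ ν^{4n+2}) / (1 - α α̃ ν^{4n+2})`. -/
def gam (εc εi εe : ℂ) (ν : ℝ) (n : ℕ) : ℂ :=
  (alpha εi εe - alphaTilde εc εi * (ν : ℂ) ^ (4 * n + 2)) /
    (1 - alpha εi εe * alphaTilde εc εi * (ν : ℂ) ^ (4 * n + 2))

/-! ### The infinite linear systems -/

/-- The numbers `(2n+2k+1)! / ((2k)! (2n+1)!) S_{n+k+1}`. -/
def coeffG (S : ℕ → ℂ) (n k : ℕ) : ℂ :=
  ((2 * n + 2 * k + 1).factorial : ℂ) / ((2 * k).factorial * (2 * n + 1).factorial) * S (n + k + 1)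

/-- The bounded sequence `x` solves
`x_n - σ γ_n ∑_k (2n+2k+1)! / ((2k)! (2n+1)!) S_{n+k+1} x_k h^{2n+2k+2} = γ_0 δ_{n,0}`;
`σ = 1` is the system for the `x_n` and `σ = -1` the system for the `y_n`. -/
def IsBoundedSolution (σ : ℂ) (γ S : ℕ → ℂ) (h : ℝ) (x : ℕ → ℂ) : Prop :=
  Memℓp x ∞ ∧
    ∀ n, x n - σ * γ n * ∑' k, coeffG S n k * x k * (h : ℂ) ^ (2 * n + 2 * k + 2) =
      if n = 0 then γ 0 else 0

/-- `x` is the unique bounded solution of the system. -/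
def IsUniqueBoundedSolution (σ : ℂ) (γ S : ℕ → ℂ) (h : ℝ) (x : ℕ → ℂ) : Prop :=
  IsBoundedSolution σ γ S h x ∧ ∀ x', IsBoundedSolution σ γ S h x' → x' = x

/-! ### The electric potential and the effective tensor -/

/-- The closed region outside all the tubes. -/
def host (L : PeriodPair) (a : ℝ) : Set ℂ := {z | ∀ p ∈ L.lattice, a ≤ ‖z - p‖}

/-- The closed tube around `p` with inner radius `b` and outer radius `a`. -/
def tube (p : ℂ) (a b : ℝ) : Set ℂ := {z | b ≤ ‖z - p‖ ∧ ‖z - p‖ ≤ a}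

open scoped Classical in
/-- The piecewise constant dielectric function of the array. -/
def epsilon (L : PeriodPair) (a b : ℝ) (εc εi εe : ℂ) (z : ℂ) : ℂ :=
  if ∃ p ∈ L.lattice, ‖z - p‖ < b then εc
  else if ∃ p ∈ L.lattice, ‖z - p‖ < a then εi
  else εe

/-- `u` is an electric potential of the array: it satisfies `∇ · (ε ∇u) = 0` in the core, in the
tube and in the host medium, it is continuous and has a continuous normal flux `ε ∂u/∂n` across the
circles of radius `a` and `b`, and `∇u` is periodic. As usual for a transmission problem, `u` is
`C¹` up to the boundary in each phase, so that the one-sided normal derivatives make sense. -/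
structure IsPotential (L : PeriodPair) (a b : ℝ) (εc εi εe : ℂ) (u : ℂ → ℂ) : Prop where
  continuous : Continuous u
  c1_core : ∀ p ∈ L.lattice, ContDiffOn ℝ 1 u (Metric.closedBall p b)
  c1_tube : ∀ p ∈ L.lattice, ContDiffOn ℝ 1 u (tube p a b)
  c1_host : ContDiffOn ℝ 1 u (host L a)
  harmonic_core : ∀ p ∈ L.lattice, ∀ z, ‖z - p‖ < b → InnerProductSpace.HarmonicAt u z
  harmonic_tube : ∀ p ∈ L.lattice, ∀ z, b < ‖z - p‖ → ‖z - p‖ < a →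
    InnerProductSpace.HarmonicAt u z
  harmonic_host : ∀ z, (∀ p ∈ L.lattice, a < ‖z - p‖) → InnerProductSpace.HarmonicAt u z
  flux_inner : ∀ p ∈ L.lattice, ∀ z, ‖z - p‖ = b →
    εc * fderivWithin ℝ u (Metric.closedBall p b) z (z - p) =
      εi * fderivWithin ℝ u (tube p a b) z (z - p)
  /-- The points where two tubes touch, if there are any, are left out. -/
  flux_outer : ∀ p ∈ L.lattice, ∀ z, ‖z - p‖ = a → (∀ q ∈ L.lattice, q ≠ p → a < ‖z - q‖) →
    εi * fderivWithin ℝ u (tube p a b) z (z - p) =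
      εe * fderivWithin ℝ u (host L a) z (z - p)
  periodic₁ : ∀ z, fderiv ℝ u (z + L.ω₁) = fderiv ℝ u z
  periodic₂ : ∀ z, fderiv ℝ u (z + L.ω₂) = fderiv ℝ u z

/-- The electric field `E = -∇u = -(∂u/∂x, ∂u/∂y)`. -/
def field (u : ℂ → ℂ) (z : ℂ) : Fin 2 → ℂ := ![-fderiv ℝ u z 1, -fderiv ℝ u z Complex.I]

/-- The average `⟨E⟩` of the electric field over the cell. -/
def avgField (L : PeriodPair) (u : ℂ → ℂ) : Fin 2 → ℂ :=
  fun i => ⨍ z in cell L, field u z i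

/-- The average `⟨D⟩` of the electric displacement `D = εE` over the cell. -/
def avgDisplacement (L : PeriodPair) (a b : ℝ) (εc εi εe : ℂ) (u : ℂ → ℂ) : Fin 2 → ℂ :=
  fun i => ⨍ z in cell L, epsilon L a b εc εi εe z * field u z i

/-- `T` relates the averages of displacement and field, `⟨D⟩ = T ⟨E⟩`, for every potential. -/
def IsEffectiveTensor (L : PeriodPair) (a b : ℝ) (εc εi εe : ℂ)
    (T : Matrix (Fin 2) (Fin 2) ℂ) : Prop :=
  ∀ u, IsPotential L a b εc εi εe u →
    avgDisplacement L a b εc εi εe u = T.mulVec (avgField L u)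

end TubeArray

end

open TubeArray

noncomputable section

namespace TubeArray

open Set Filter Metric

/-! ### Fundamental domains -/

/-! Put v(z) = u(conj z). In each phase ∂u/∂z is holomorphic, and ∂u/∂z̄ at z equals ∂v/∂z at conj
z, so a potential amounts to two periodic, piecewise holomorphic functions. Around a tube they are
described by the Fourier modes of z ∂u/∂z. Holomorphy in the core kills the non-positive modes,
modes in the tube scale like powers of the radius, and the transmission conditions couple mode m of
u to mode -m of v. Eliminating core and tube gives `mode_response`: seen from the host, mode -(2n+1)
of v is γ_n times mode 2n+1 of u.

The host supplies the other half of the relations. `host_stokes` is applied to ∂u/∂z times the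
periodic multipoles ∑ (z - P)^(-2n-1). For n = 0 the zeta function is made periodic by subtracting
(π/S) z̄, because for a lattice with a rotational symmetry the Legendre relation reads ζ(z + P) =
ζ(z) + (π/S) P̄ (`zeta_add`, which also yields Ψ). The Laurent expansion of the multipoles at the
origin has the lattice sums as coefficients, whence `hasSum_mode`. For σ = ±1 the combinations
mode(u) + σ mode(v) decouple; suitably weighted they solve (X) or (Y) with right-hand side
multiplied by a constant C that contains the host integrals of ∂u/∂z and ∂v/∂z. Unique solvability
makes them C times the solution (`mode_eq_mul`). The means of E and D involve only the host
integrals and the first modes, so they become proportional (`averaged_relation`), one component for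
each σ.

The equality λ = μ comes from the vanishing of S_k unless 2 ∣ k (square) or 3 ∣ k (hexagonal): a
sequence of signs and zeros conjugates the matrix S_{n+k+1} into its negative and carries solutions
of (X) to solutions of (Y) with the same entry at 0.

For h < 1/2 the tensor is unique because potentials with mean fields along both axes exist. A
bounded solution decays geometrically, its entries serve as multipole strengths, the resulting
series converge beyond the interfaces, and A(z) + σ A(z̄) glues to a potential (`exists_potential`).

For small h a Neumann series converges uniformly for complex h, which gives solvability, uniqueness
and analyticity; the expansions follow by truncating a few rows and eliminating. The lattice sums
are Eisenstein series at i and e^(iπ/3), evaluated from their q-expansions. -/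

/-- The Voronoi cell of the origin. -/
def voronoi (L : PeriodPair) : Set ℂ := {z | ∀ p ∈ L.lattice, ‖z‖ ≤ ‖z - p‖}

lemma isClosed_voronoi (L : PeriodPair) : IsClosed (voronoi L) := by
  have : voronoi L = ⋂ p ∈ L.lattice, {z | ‖z‖ ≤ ‖z - p‖} := by
    ext z; simp [voronoi]
  rw [this]
  exact isClosed_biInter fun p _ => isClosed_le (by fun_prop) (by fun_prop)

lemma countable_lattice (L : PeriodPair) : (L.lattice : Set ℂ).Countable :=
  Set.countable_coe_iff.mp (inferInstanceAs (Countable L.lattice))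

lemma exists_sub_mem_voronoi (L : PeriodPair) (z : ℂ) : ∃ p ∈ L.lattice, z - p ∈ voronoi L := by
  obtain ⟨p, hp, h⟩ := L.isClosed_lattice.exists_infDist_eq_dist ⟨0, L.lattice.zero_mem⟩ z
  refine ⟨p, hp, fun q hq => ?_⟩
  have := infDist_le_dist_of_mem (x := z) (L.lattice.add_mem hp hq)
  rw [h, dist_eq_norm, dist_eq_norm] at this
  rwa [sub_sub]

lemma norm_eq_infDist_of_mem_voronoi {L : PeriodPair} {z : ℂ} (hz : z ∈ voronoi L) :
    infDist z L.lattice = ‖z‖ := by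
  refine le_antisymm ?_ ?_
  · simpa using infDist_le_dist_of_mem (x := z) L.lattice.zero_mem
  · refine (le_infDist ⟨0, L.lattice.zero_mem⟩).mpr fun p hp => ?_
    rw [dist_eq_norm]; exact hz p hp

lemma volume_bisector (p q : ℂ) (h : p ≠ q) : volume {z : ℂ | ‖z - p‖ = ‖z - q‖} = 0 := by
  have : {z : ℂ | ‖z - p‖ = ‖z - q‖} = (AffineSubspace.perpBisector p q : Set ℂ) := by
    ext z
    simp [AffineSubspace.mem_perpBisector_iff_dist_eq, dist_eq_norm]
  rw [this]
  exact Measure.addHaar_affineSubspace _ _ (by simpa using h)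

/-- Two translates meet only inside the bisector of two lattice points, which is null. The Voronoi
cell is preferred to the parallelogram because it contains the whole central tube and inherits every
symmetry of the lattice. -/
lemma isAddFundamentalDomain_voronoi (L : PeriodPair) :
    IsAddFundamentalDomain L.lattice (voronoi L) volume where
  nullMeasurableSet := (isClosed_voronoi L).measurableSet.nullMeasurableSet
  ae_covers := Eventually.of_forall fun z => by
    obtain ⟨p, hp, h⟩ := exists_sub_mem_voronoi L z
    refine ⟨⟨-p, L.lattice.neg_mem hp⟩, ?_⟩
    rw [Submodule.vadd_def, vadd_eq_add]
    simpa [neg_add_eq_sub] using h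
  aedisjoint := by
    intro g g' hne
    refine measure_mono_null ?_ (volume_bisector g g' (by simpa using hne))
    rintro z ⟨⟨u, hu, rfl⟩, ⟨v, hv, hvu⟩⟩
    simp only [Submodule.vadd_def, vadd_eq_add] at hvu
    have e : (g : ℂ) + u - g = u := by ring
    have e' : (g : ℂ) + u - g' = v := by rw [← hvu]; ring
    simp only [mem_ofPred_eq, Submodule.vadd_def, vadd_eq_add, e, e']
    refine le_antisymm ?_ ?_
    · convert! hu (g' - g : ℂ) (L.lattice.sub_mem g'.2 g.2) using 2
      linear_combination hvu
    · convert! hv (g - g' : ℂ) (L.lattice.sub_mem g.2 g'.2) using 2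
      linear_combination -hvu

lemma volume_coord_eq (L : PeriodPair) (i : Fin 2) (c : ℝ) :
    volume {z : ℂ | L.basis.repr z i = c} = 0 := by
  have : {z : ℂ | L.basis.repr z i = c} =
      (AffineSubspace.mk' (c • L.basis i) (LinearMap.ker (L.basis.coord i)) : Set ℂ) := by
    ext z
    simp [AffineSubspace.mem_mk', sub_eq_zero, -Complex.real_smul]
  rw [this]
  refine Measure.addHaar_affineSubspace _ _ fun h => ?_
  have h1 : ((c + 1) • L.basis i) ∈ (AffineSubspace.mk' (c • L.basis i)
    (LinearMap.ker (L.basis.coord i))) := by rw [h]; trivial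
  simp [AffineSubspace.mem_mk', -Complex.real_smul] at h1

@[simp] lemma repr_combination_zero (L : PeriodPair) (s t : ℝ) :
    L.basis.repr (s * L.ω₁ + t * L.ω₂) 0 = s := by
  have : (s * L.ω₁ + t * L.ω₂ : ℂ) = s • L.basis 0 + t • L.basis 1 := by simp
  rw [this]
  simp [-Complex.real_smul, -PeriodPair.basis_zero, -PeriodPair.basis_one]

@[simp] lemma repr_combination_one (L : PeriodPair) (s t : ℝ) :
    L.basis.repr (s * L.ω₁ + t * L.ω₂) 1 = t := by
  have : (s * L.ω₁ + t * L.ω₂ : ℂ) = s • L.basis 0 + t • L.basis 1 := by simp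
  rw [this]
  simp [-Complex.real_smul, -PeriodPair.basis_zero, -PeriodPair.basis_one]

lemma mem_cell_iff (L : PeriodPair) (z : ℂ) :
    z ∈ cell L ↔ ∀ i, L.basis.repr z i ∈ Icc (-1 / 2 : ℝ) (1 / 2) := by
  rw [Fin.forall_fin_two]
  constructor
  · rintro ⟨s, hs, t, ht, rfl⟩
    rw [repr_combination_zero, repr_combination_one]
    exact ⟨hs, ht⟩
  · rintro ⟨h0, h1⟩
    refine ⟨_, h0, _, h1, ?_⟩
    conv_lhs => rw [← L.basis.sum_repr z]
    simp

lemma exists_repr_lattice (L : PeriodPair) {p : ℂ} (hp : p ∈ L.lattice) (i : Fin 2) :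
    ∃ m : ℤ, L.basis.repr p i = m := by
  obtain ⟨m, n, rfl⟩ := PeriodPair.mem_lattice.mp hp
  fin_cases i
  · exact ⟨m, by simpa using repr_combination_zero L m n⟩
  · exact ⟨n, by simpa using repr_combination_one L m n⟩

lemma exists_sub_mem_cell (L : PeriodPair) (z : ℂ) : ∃ p ∈ L.lattice, z - p ∈ cell L := by
  refine ⟨round (L.basis.repr z 0) * L.ω₁ + round (L.basis.repr z 1) * L.ω₂,
    PeriodPair.mem_lattice.mpr ⟨_, _, rfl⟩, ?_⟩
  have e0 := repr_combination_zero L (round (L.basis.repr z 0)) (round (L.basis.repr z 1))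
  have e1 := repr_combination_one L (round (L.basis.repr z 0)) (round (L.basis.repr z 1))
  simp only [Complex.ofReal_intCast] at e0 e1
  rw [mem_cell_iff, Fin.forall_fin_two]
  have h0 := abs_le.mp (abs_sub_round (L.basis.repr z 0))
  have h1 := abs_le.mp (abs_sub_round (L.basis.repr z 1))
  rw [map_sub, Finsupp.sub_apply, Finsupp.sub_apply, e0, e1]
  refine ⟨⟨?_, ?_⟩, ?_, ?_⟩ <;> linarith

instance (L : PeriodPair) : VAddInvariantMeasure L.lattice ℂ volume where
  measure_preimage_vadd c s _ := measure_preimage_add volume (c : ℂ) s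

lemma isClosed_cell (L : PeriodPair) : IsClosed (cell L) := by
  have : cell L = ⋂ i, {z | L.basis.repr z i ∈ Icc (-1 / 2 : ℝ) (1 / 2)} := by
    ext z; simp [mem_cell_iff]
  rw [this]
  refine isClosed_iInter fun i => isClosed_Icc.preimage ?_
  exact (L.basis.coord i).continuous_of_finiteDimensional

lemma isAddFundamentalDomain_cell (L : PeriodPair) :
    IsAddFundamentalDomain L.lattice (cell L) volume where
  nullMeasurableSet := (isClosed_cell L).measurableSet.nullMeasurableSet
  ae_covers := Eventually.of_forall fun z => by
    obtain ⟨p, hp, h⟩ := exists_sub_mem_cell L z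
    refine ⟨⟨-p, L.lattice.neg_mem hp⟩, ?_⟩
    rw [Submodule.vadd_def, vadd_eq_add]
    simpa [neg_add_eq_sub] using h
  aedisjoint := by
    intro g g' hne
    -- Distinct lattice points differ in some integer coordinate, and there the two translates can
    -- share only a common edge, where that coordinate is an integer plus or minus 1/2.
    refine measure_mono_null (t := ⋃ i : Fin 2, ⋃ m : ℤ, ({z : ℂ | L.basis.repr z i = m + 1 / 2} ∪
      {z : ℂ | L.basis.repr z i = m - 1 / 2})) ?_ ?_
    · rintro z ⟨⟨u, hu, rfl⟩, ⟨v, hv, hvu⟩⟩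
      simp only [Submodule.vadd_def, vadd_eq_add] at hvu
      rw [mem_cell_iff] at hu hv
      choose m hm using exists_repr_lattice L g.2
      choose m' hm' using exists_repr_lattice L g'.2
      have hex : ∃ i, m i ≠ m' i := by
        by_contra! hcon
        apply hne
        apply Subtype.ext
        apply L.basis.repr.injective
        ext i
        rw [hm, hm', hcon]
      obtain ⟨i, hi⟩ := hex
      have key : (m' i : ℝ) + L.basis.repr v i = m i + L.basis.repr u i := by
        rw [← hm, ← hm']
        simpa using congrArg (fun w => L.basis.repr w i) hvu
      simp only [mem_iUnion, mem_union, mem_ofPred_eq, Submodule.vadd_def, vadd_eq_add]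
      refine ⟨i, m i, ?_⟩
      have := hu i
      have := hv i
      simp only [mem_Icc] at *
      simp only [map_add, Finsupp.add_apply, hm]
      rcases lt_or_gt_of_ne hi with h | h
      · have h' : (m i : ℝ) + 1 ≤ m' i := by exact_mod_cast h
        left; linarith
      · have h' : (m' i : ℝ) + 1 ≤ m i := by exact_mod_cast h
        right; linarith
    · refine measure_iUnion_null fun i => measure_iUnion_null fun m => measure_union_null ?_ ?_
      · exact volume_coord_eq L i _
      · exact volume_coord_eq L i _

/-- The averages are defined over the parallelogram but computed over the Voronoi cell; periodicity
makes the choice of fundamental domain irrelevant. -/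
lemma setIntegral_cell_eq (L : PeriodPair) {E : Type*} [NormedAddCommGroup E] [NormedSpace ℝ E]
    {f : ℂ → E} (hf : ∀ p ∈ L.lattice, ∀ z, f (z + p) = f z) :
    ∫ z in cell L, f z = ∫ z in voronoi L, f z := by
  refine (isAddFundamentalDomain_cell L).setIntegral_eq (isAddFundamentalDomain_voronoi L) ?_
  intro g x
  rw [Submodule.vadd_def, vadd_eq_add, add_comm, hf _ g.2]

lemma isBounded_cell (L : PeriodPair) : Bornology.IsBounded (cell L) := by
  refine (isBounded_iff_forall_norm_le).mpr ⟨‖L.ω₁‖ + ‖L.ω₂‖, ?_⟩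
  rintro z ⟨s, hs, t, ht, rfl⟩
  have h1 : |s| ≤ 1 := abs_le.mpr ⟨by linarith [hs.1], by linarith [hs.2]⟩
  have h2 : |t| ≤ 1 := abs_le.mpr ⟨by linarith [ht.1], by linarith [ht.2]⟩
  refine (norm_add_le _ _).trans ?_
  rw [norm_mul, norm_mul, Complex.norm_real, Complex.norm_real, Real.norm_eq_abs, Real.norm_eq_abs]
  gcongr
  · exact mul_le_of_le_one_left (norm_nonneg _) h1
  · exact mul_le_of_le_one_left (norm_nonneg _) h2

lemma isCompact_cell (L : PeriodPair) : IsCompact (cell L) :=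
  Metric.isCompact_of_isClosed_isBounded (isClosed_cell L) (isBounded_cell L)

lemma isBounded_voronoi (L : PeriodPair) : Bornology.IsBounded (voronoi L) := by
  obtain ⟨C, hC⟩ := isBounded_iff_forall_norm_le.mp (isBounded_cell L)
  refine isBounded_iff_forall_norm_le.mpr ⟨C, fun z hz => ?_⟩
  obtain ⟨p, hp, h⟩ := exists_sub_mem_cell L z
  exact (hz p hp).trans (hC _ h)

lemma isCompact_voronoi (L : PeriodPair) : IsCompact (voronoi L) :=
  Metric.isCompact_of_isClosed_isBounded (isClosed_voronoi L) (isBounded_voronoi L)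

lemma volume_voronoi_eq (L : PeriodPair) : volume.real (voronoi L) = volume.real (cell L) := by
  rw [Measure.real, Measure.real,
    (isAddFundamentalDomain_voronoi L).measure_eq (isAddFundamentalDomain_cell L)]

lemma volume_cell_pos (L : PeriodPair) : 0 < volume.real (cell L) := by
  refine ENNReal.toReal_pos ?_ (isCompact_cell L).measure_lt_top.ne
  have := (isAddFundamentalDomain_cell L).measure_ne_zero (μ := volume) (NeZero.ne _)
  exact this

/-- The set of points with a strictly nearest lattice point, the origin. -/
def openVoronoi (L : PeriodPair) : Set ℂ := {z | ∀ p ∈ L.lattice, p ≠ 0 → ‖z‖ < ‖z - p‖}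

lemma openVoronoi_subset (L : PeriodPair) : openVoronoi L ⊆ voronoi L := by
  intro z hz p hp
  by_cases h : p = 0
  · simp [h]
  · exact (hz p hp h).le

/-- The distance to the closed set of nonzero lattice points is attained, so infinitely many strict
inequalities reduce to one between continuous functions. -/
lemma isOpen_openVoronoi (L : PeriodPair) : IsOpen (openVoronoi L) := by
  have hcl : IsClosed ((L.lattice : Set ℂ) \ {0}) := L.isClosed_of_subset_lattice sdiff_subset
  have hne : ((L.lattice : Set ℂ) \ {0}).Nonempty := by
    refine ⟨L.ω₁, L.ω₁_mem_lattice, ?_⟩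
    have := L.indep.ne_zero 0
    simpa using this
  have : openVoronoi L = {z | ‖z‖ < infDist z ((L.lattice : Set ℂ) \ {0})} := by
    ext z
    constructor
    · intro h
      obtain ⟨p, hp, e⟩ := hcl.exists_infDist_eq_dist hne z
      rw [mem_ofPred_eq, e, dist_eq_norm]
      exact h p hp.1 hp.2
    · intro h p hp hp0
      have hm : p ∈ (L.lattice : Set ℂ) \ {0} := ⟨hp, hp0⟩
      have h2 := infDist_le_dist_of_mem (x := z) hm
      rw [dist_eq_norm] at h2
      exact lt_of_lt_of_le h h2
  rw [this]
  exact isOpen_lt (by fun_prop) (continuous_infDist_pt _)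

lemma openVoronoi_ae_eq (L : PeriodPair) : openVoronoi L =ᵐ[volume] voronoi L := by
  refine (openVoronoi_subset L).eventuallyLE.antisymm ?_
  have hsub : voronoi L \ openVoronoi L ⊆
      ⋃ p ∈ (L.lattice : Set ℂ), {z : ℂ | p ≠ 0 ∧ ‖z - 0‖ = ‖z - p‖} := by
    rintro z ⟨hz, hz'⟩
    simp only [openVoronoi, mem_ofPred_eq, not_forall, not_lt] at hz'
    obtain ⟨p, hp, hp0, h⟩ := hz'
    simp only [mem_iUnion]
    exact ⟨p, hp, hp0, by simpa using le_antisymm (hz p hp) h⟩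
  rw [ae_le_set]
  refine measure_mono_null hsub ((measure_biUnion_null_iff (countable_lattice L)).mpr fun p hp => ?_)
  by_cases h : p = 0
  · simp [h]
  · exact measure_mono_null (fun z hz => hz.2) (volume_bisector 0 p (Ne.symm h))

/-! ### Integration of periodic functions -/

open scoped Pointwise in
lemma setIntegral_voronoi_add (L : PeriodPair) {E : Type*} [NormedAddCommGroup E]
    [NormedSpace ℝ E] {f : ℂ → E} (hf : ∀ p ∈ L.lattice, ∀ z, f (z + p) = f z) (w : ℂ) :
    ∫ z in voronoi L, f (z + w) = ∫ z in voronoi L, f z := by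
  have h1 : ∫ z in w +ᵥ voronoi L, f z = ∫ z in voronoi L, f z := by
    refine ((isAddFundamentalDomain_voronoi L).vadd_of_comm w).setIntegral_eq
      (isAddFundamentalDomain_voronoi L) ?_
    intro g x
    rw [Submodule.vadd_def, vadd_eq_add, add_comm, hf _ g.2]
  rw [← h1, ← (measurePreserving_add_right volume w).setIntegral_preimage_emb
    (measurableEmbedding_addRight w) f]
  congr 2
  ext z
  simp [mem_vadd_set, add_comm w]

/-- Difference quotients of a periodic function integrate to zero by translation invariance. They
are bounded by the Lipschitz constant and converge almost everywhere by Rademacher's theorem, so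
dominated convergence applies. No integral over the boundary of the cell is needed. -/
lemma integral_fderiv_eq_zero (L : PeriodPair) {G : ℂ → ℂ} (hG : LocallyLipschitz G)
    (hper : ∀ p ∈ L.lattice, ∀ z, G (z + p) = G z) (v : ℂ) :
    ∫ z in voronoi L, fderiv ℝ G z v = 0 := by
  obtain ⟨R, hR⟩ := isBounded_iff_forall_norm_le.mp (isBounded_voronoi L)
  -- This radius keeps every `z + t v` with `t ≤ 1` inside the ball, and the extra 1 makes the ball
  -- a neighbourhood of each point of the cell.
  obtain ⟨K, hK⟩ := (hG.locallyLipschitzOn (s := closedBall (0 : ℂ) (R + ‖v‖ + 1))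
    ).exists_lipschitzOnWith_of_compact (isCompact_closedBall _ _)
  set t : ℕ → ℝ := fun n => 1 / ((n : ℝ) + 1) with ht
  have htpos : ∀ n, 0 < t n := fun n => by positivity
  have htle : ∀ n, t n ≤ 1 := fun n => by
    rw [ht]; simp only; rw [div_le_one (by positivity)]; linarith [Nat.cast_nonneg (α := ℝ) n]
  have htlim : Tendsto t atTop (𝓝[≠] 0) := by
    rw [tendsto_nhdsWithin_iff]
    exact ⟨tendsto_one_div_add_atTop_nhds_zero_nat, Eventually.of_forall fun n => (htpos n).ne'⟩
  have hGc : Continuous G := hG.continuous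
  have hint : ∀ w, IntegrableOn (fun z => G (z + w)) (voronoi L) := fun w =>
    ContinuousOn.integrableOn_compact (isCompact_voronoi L) (by fun_prop)
  have hzero : ∀ n, ∫ z in voronoi L, (t n)⁻¹ • (G (z + (t n : ℂ) * v) - G z) = 0 := by
    intro n
    rw [integral_smul, integral_sub (hint _) (by simpa only [add_zero, IntegrableOn] using hint 0),
      setIntegral_voronoi_add L hper, sub_self, smul_zero]
  have hdiff : ∀ᵐ z ∂(volume.restrict (voronoi L)), DifferentiableAt ℝ G z := by
    rw [ae_restrict_iff' (isClosed_voronoi L).measurableSet]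
    filter_upwards [hK.ae_differentiableWithinAt_of_mem (μ := volume)] with z hz hzV
    have hb : ‖z‖ < R + ‖v‖ + 1 := by linarith [hR z hzV, norm_nonneg v]
    exact (hz (by simpa using hb.le)).differentiableAt
      (closedBall_mem_nhds_of_mem (by simpa using hb))
  have := tendsto_integral_of_dominated_convergence (μ := volume.restrict (voronoi L))
    (F := fun n z => (t n)⁻¹ • (G (z + (t n : ℂ) * v) - G z)) (f := fun z => fderiv ℝ G z v)
    (fun _ => K * ‖v‖) (fun n => by
      refine Continuous.aestronglyMeasurable ?_
      fun_prop) (by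
      have : IsFiniteMeasure (volume.restrict (voronoi L)) :=
        ⟨by simpa using (isCompact_voronoi L).measure_lt_top⟩
      exact integrable_const _) ?_ ?_
  · simp only [hzero] at this
    exact (tendsto_nhds_unique this tendsto_const_nhds)
  · intro n
    rw [ae_restrict_iff' (isClosed_voronoi L).measurableSet]
    refine Eventually.of_forall fun z hz => ?_
    have hz' := hR z hz
    have hn : ‖(t n : ℂ) * v‖ ≤ ‖v‖ := by
      rw [norm_mul, Complex.norm_real, Real.norm_of_nonneg (htpos n).le]
      exact mul_le_of_le_one_left (norm_nonneg _) (htle n)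
    have hd := hK.dist_le_mul (z + t n * v) (by
      have := norm_add_le z (t n * v); simp; linarith) z (by
      have := norm_nonneg v; simp; linarith)
    rw [dist_eq_norm, dist_eq_norm, add_sub_cancel_left, norm_mul, Complex.norm_real,
      Real.norm_of_nonneg (htpos n).le] at hd
    rw [norm_smul, norm_inv, Real.norm_of_nonneg (htpos n).le, inv_mul_le_iff₀ (htpos n)]
    linarith
  · filter_upwards [hdiff] with z hz
    have h1 : HasDerivAt (fun s : ℝ => G (z + s * v)) (fderiv ℝ G z v) 0 := by
      have h2 : HasDerivAt (fun s : ℝ => z + (s : ℂ) * v) v 0 := by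
        have := ((hasDerivAt_id (0 : ℝ)).ofReal_comp.mul_const v).const_add z
        simpa using this
      have h3 : HasFDerivAt G (fderiv ℝ G z) (z + ((0 : ℝ) : ℂ) * v) := by
        simpa using hz.hasFDerivAt
      exact h3.comp_hasDerivAt (0 : ℝ) h2
    have := h1.tendsto_slope_zero.comp htlim
    simpa [Function.comp_def] using this

/-! ### Polar coordinates -/

lemma integral_annulus {g : ℂ → ℂ} (hg : Measurable g) {r₁ r₂ : ℝ} (h₀ : 0 ≤ r₁)
    {M : ℝ} (hM : ∀ z, r₁ < ‖z‖ → ‖z‖ < r₂ → ‖g z‖ ≤ M) :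
    IntegrableOn (fun r : ℝ => ∫ θ in Ioo (-Real.pi) Real.pi,
        (r : ℂ) * g (r * Complex.exp (θ * Complex.I))) (Ioo r₁ r₂) ∧
    ∫ z in {z : ℂ | r₁ < ‖z‖ ∧ ‖z‖ < r₂}, g z = ∫ r in Ioo r₁ r₂,
      ∫ θ in Ioo (-Real.pi) Real.pi, (r : ℂ) * g (r * Complex.exp (θ * Complex.I)) := by
  set A : Set ℂ := {z : ℂ | r₁ < ‖z‖ ∧ ‖z‖ < r₂} with hA
  have hAm : MeasurableSet A := by
    refine MeasurableSet.inter ?_ ?_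
    · exact measurableSet_lt measurable_const measurable_norm
    · exact measurableSet_lt measurable_norm measurable_const
  have hexp : ∀ p : ℝ × ℝ, Complex.polarCoord.symm p = p.1 * Complex.exp (p.2 * Complex.I) := by
    intro p
    rw [Complex.polarCoord_symm_apply, Complex.exp_mul_I]; simp
  set k : ℝ × ℝ → ℂ := fun p => (p.1 : ℂ) * g (p.1 * Complex.exp (p.2 * Complex.I)) with hk
  have hkm : Measurable k := by
    refine Measurable.mul (by fun_prop) (hg.comp (by fun_prop))
  have hint : IntegrableOn k (Ioo r₁ r₂ ×ˢ Ioo (-Real.pi) Real.pi) (volume.prod volume) := by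
    refine Measure.integrableOn_of_bounded (M := |r₂| * M) ?_ hkm.aestronglyMeasurable ?_
    · rw [Measure.prod_prod]; simp [ENNReal.mul_eq_top]
    · rw [ae_restrict_iff' (measurableSet_Ioo.prod measurableSet_Ioo)]
      refine Eventually.of_forall fun p hp => ?_
      have h1 : r₁ < p.1 := hp.1.1
      have h2 : p.1 < r₂ := hp.1.2
      have hp0 : 0 < p.1 := h₀.trans_lt h1
      have hn : ‖(p.1 * Complex.exp (p.2 * Complex.I) : ℂ)‖ = p.1 := by
        rw [norm_mul, Complex.norm_exp_ofReal_mul_I, mul_one, Complex.norm_real,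
          Real.norm_of_nonneg hp0.le]
      rw [hk]
      simp only
      rw [norm_mul, Complex.norm_real, Real.norm_of_nonneg hp0.le]
      have := hM _ (hn.symm ▸ h1) (hn.symm ▸ h2)
      gcongr
      exact h2.le.trans (le_abs_self _)
  constructor
  · rw [IntegrableOn, ← Measure.prod_restrict] at hint
    exact hint.integral_prod_left
  rw [← setIntegral_prod k hint, ← integral_indicator hAm, ← Complex.integral_comp_polarCoord_symm]
  rw [← integral_indicator (by measurability), ← integral_indicator (by measurability)]
  congr 1
  ext p
  by_cases hp : p ∈ polarCoord.target
  · rw [indicator_of_mem hp, hexp]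
    obtain ⟨hp1, hp2⟩ := hp
    have hp0 : 0 < p.1 := hp1
    have hn : ‖(p.1 * Complex.exp (p.2 * Complex.I) : ℂ)‖ = p.1 := by
      rw [norm_mul, Complex.norm_exp_ofReal_mul_I, mul_one, Complex.norm_real,
        Real.norm_of_nonneg hp0.le]
    by_cases h : r₁ < p.1 ∧ p.1 < r₂
    · rw [indicator_of_mem (show _ ∈ A by rw [hA, mem_ofPred_eq, hn]; exact h),
        indicator_of_mem (show p ∈ Ioo r₁ r₂ ×ˢ Ioo (-Real.pi) Real.pi from ⟨h, hp2⟩)]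
      simp [hk]
    · rw [indicator_of_notMem (show _ ∉ A by rw [hA, mem_ofPred_eq, hn]; exact h),
        indicator_of_notMem (show p ∉ Ioo r₁ r₂ ×ˢ Ioo (-Real.pi) Real.pi from fun h' => h h'.1)]
      simp
  · rw [indicator_of_notMem hp, indicator_of_notMem]
    exact fun h => hp ⟨h₀.trans_lt h.1.1, h.2⟩

/-! ### Stokes' theorem in the host medium -/

/-- The open region outside all the tubes. -/
def openHost (L : PeriodPair) (a : ℝ) : Set ℂ := {z | ∀ p ∈ L.lattice, a < ‖z - p‖}

lemma openHost_eq (L : PeriodPair) (a : ℝ) : openHost L a = {z | a < infDist z L.lattice} := by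
  ext z
  constructor
  · intro h
    obtain ⟨p, hp, e⟩ := L.isClosed_lattice.exists_infDist_eq_dist ⟨0, L.lattice.zero_mem⟩ z
    rw [mem_ofPred_eq, e, dist_eq_norm]
    exact h p hp
  · intro h p hp
    have h2 := infDist_le_dist_of_mem (x := z) (show p ∈ (L.lattice : Set ℂ) from hp)
    rw [dist_eq_norm] at h2
    exact lt_of_lt_of_le h h2

lemma isOpen_openHost (L : PeriodPair) (a : ℝ) : IsOpen (openHost L a) := by
  rw [openHost_eq]
  exact isOpen_lt continuous_const (continuous_infDist_pt _)

lemma mem_openHost_of_mem_voronoi {L : PeriodPair} {a : ℝ} {z : ℂ} (hz : z ∈ voronoi L)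
    (h : a < ‖z‖) : z ∈ openHost L a := fun p hp => h.trans_le (hz p hp)

lemma openHost_add {L : PeriodPair} {a : ℝ} {z p : ℂ} (hp : p ∈ L.lattice)
    (hz : z ∈ openHost L a) : z + p ∈ openHost L a := fun q hq => by
  have := hz (q - p) (L.lattice.sub_mem hq hp)
  rwa [show z - (q - p) = z + p - q by ring] at this

lemma infDist_lattice_add (L : PeriodPair) {p : ℂ} (hp : p ∈ L.lattice) (z : ℂ) :
    infDist (z + p) L.lattice = infDist z L.lattice := by
  have key : ∀ (p : ℂ), p ∈ L.lattice → ∀ z, infDist (z + p) L.lattice ≤ infDist z L.lattice := by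
    intro p hp z
    obtain ⟨q, hq, e⟩ := L.isClosed_lattice.exists_infDist_eq_dist ⟨0, L.lattice.zero_mem⟩ z
    rw [e]
    refine (infDist_le_dist_of_mem (L.lattice.add_mem hq hp)).trans_eq ?_
    simp
  refine le_antisymm (key p hp z) ?_
  simpa using key (-p) (L.lattice.neg_mem hp) (z + p)

/-- The Wirtinger derivative `∂G/∂z̄`. -/
def dbar (G : ℂ → ℂ) (z : ℂ) : ℂ := (fderiv ℝ G z 1 + Complex.I * fderiv ℝ G z Complex.I) / 2

/-- The Wirtinger derivative `∂G/∂z`. -/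
def dz (G : ℂ → ℂ) (z : ℂ) : ℂ := (fderiv ℝ G z 1 - Complex.I * fderiv ℝ G z Complex.I) / 2

/-! ### Wirtinger calculus, touching points and cutoffs -/

lemma HasFDerivAt.dbar_eq {G : ℂ → ℂ} {G' : ℂ →L[ℝ] ℂ} {z : ℂ} (h : HasFDerivAt G G' z) :
    dbar G z = (G' 1 + Complex.I * G' Complex.I) / 2 := by
  rw [dbar, h.fderiv]

lemma dbar_congr {G H : ℂ → ℂ} {z : ℂ} (h : G =ᶠ[𝓝 z] H) : dbar G z = dbar H z := by
  rw [dbar, dbar, h.fderiv_eq]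

lemma dbar_mul {G H : ℂ → ℂ} {z : ℂ} (hG : DifferentiableAt ℝ G z) (hH : DifferentiableAt ℝ H z) :
    dbar (fun w => G w * H w) z = dbar G z * H z + G z * dbar H z := by
  rw [HasFDerivAt.dbar_eq (G := fun w => G w * H w) (hG.hasFDerivAt.mul hH.hasFDerivAt), dbar,
    dbar]
  simp only [add_apply, smul_apply, smul_eq_mul]
  ring

lemma hasFDerivAt_norm_complex {z : ℂ} (hz : z ≠ 0) :
    HasFDerivAt (fun w : ℂ => ‖w‖) ((1 / ‖z‖) • innerSL ℝ z) z := by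
  have h1 := (hasStrictFDerivAt_norm_sq z).hasFDerivAt
  have h2 := h1.sqrt (by positivity)
  have e : (fun w : ℂ => √(‖w‖ ^ 2)) = fun w => ‖w‖ := by
    ext w; exact Real.sqrt_sq (norm_nonneg _)
  simp only [e] at h2
  convert! h2 using 1
  rw [Real.sqrt_sq (norm_nonneg _)]
  ext v
  simp
  field_simp

/-- From |z|² = z z̄ one gets ∂|z|/∂z̄ = z/(2|z|). Applied to a radial cutoff, this is the density
that becomes the boundary integrand in Stokes' theorem. -/
lemma dbar_ofReal_norm {z : ℂ} (hz : z ≠ 0) (c d : ℝ) :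
    dbar (fun w => (((‖w‖ - c) / d : ℝ) : ℂ)) z = z / (2 * ‖z‖) / d := by
  have h1 := ((hasFDerivAt_norm_complex hz).sub_const c).mul_const (d⁻¹)
  have h2 := Complex.ofRealCLM.hasFDerivAt.comp z h1
  have h3 : HasFDerivAt (fun w : ℂ => (((‖w‖ - c) / d : ℝ) : ℂ)) _ z := h2
  rw [HasFDerivAt.dbar_eq h3]
  have : (z : ℂ) = z.re + z.im * Complex.I := (Complex.re_add_im z).symm
  simp [Complex.inner]
  conv_rhs => rw [this]
  have h0 : (‖z‖ : ℂ) ≠ 0 := by simpa using hz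
  by_cases hd : (d : ℂ) = 0
  · simp [hd]
  have hw : ‖(z.re : ℂ) + z.im * Complex.I‖ = ‖z‖ := by rw [← this]
  rw [hw]
  field_simp

lemma differentiableAt_ofReal_norm {z : ℂ} (hz : z ≠ 0) (c d : ℝ) :
    DifferentiableAt ℝ (fun w : ℂ => (((‖w‖ - c) / d : ℝ) : ℂ)) z := by
  have h1 := ((hasFDerivAt_norm_complex hz).sub_const c).mul_const (d⁻¹)
  exact (Complex.ofRealCLM.hasFDerivAt.comp z h1).differentiableAt

lemma integrableOn_fderiv {G : ℂ → ℂ} (hG : LocallyLipschitz G) {s : Set ℂ}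
    (hs : Bornology.IsBounded s) (v : ℂ) : IntegrableOn (fun z => fderiv ℝ G z v) s := by
  obtain ⟨R, hR⟩ := hs.subset_ball 0
  obtain ⟨K, hK⟩ := (hG.locallyLipschitzOn (s := closedBall (0 : ℂ) R)
    ).exists_lipschitzOnWith_of_compact (isCompact_closedBall _ _)
  refine IntegrableOn.mono_set ?_ hR
  refine Measure.integrableOn_of_bounded (M := K * ‖v‖) measure_ball_lt_top.ne
    (measurable_fderiv_apply_const ℝ G v).aestronglyMeasurable ?_
  rw [ae_restrict_iff' measurableSet_ball]
  refine Eventually.of_forall fun z hz => ?_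
  refine (ContinuousLinearMap.le_opNorm _ _).trans ?_
  gcongr
  exact norm_fderiv_le_of_lipschitzOn ℝ (closedBall_mem_nhds_of_mem hz) hK

lemma integral_dbar_eq_zero (L : PeriodPair) {G : ℂ → ℂ} (hG : LocallyLipschitz G)
    (hper : ∀ p ∈ L.lattice, ∀ z, G (z + p) = G z) : ∫ z in voronoi L, dbar G z = 0 := by
  simp only [dbar]
  rw [integral_div, integral_add (integrableOn_fderiv hG (isBounded_voronoi L) _)
    ((integrableOn_fderiv hG (isBounded_voronoi L) _).const_mul _), integral_const_mul,
    integral_fderiv_eq_zero L hG hper, integral_fderiv_eq_zero L hG hper]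
  simp

lemma injOn_circle {a : ℝ} (ha : 0 < a) :
    InjOn (fun θ : ℝ => (a : ℂ) * Complex.exp (θ * Complex.I)) (Ioo (-Real.pi) Real.pi) := by
  intro s hs t ht h
  have h1 : Complex.exp (s * Complex.I) = Complex.exp (t * Complex.I) :=
    mul_left_cancel₀ (by exact_mod_cast ha.ne') h
  have h2 := congrArg Complex.arg h1
  rwa [Complex.arg_exp_mul_I, Complex.arg_exp_mul_I,
    (toIocMod_eq_self Real.two_pi_pos).mpr ⟨hs.1, by linarith [hs.2]⟩,
    (toIocMod_eq_self Real.two_pi_pos).mpr ⟨ht.1, by linarith [ht.2]⟩] at h2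

/-- All but countably many points of the boundary of a disk of radius `a` lie outside the closures
of the other disks. -/
lemma ae_not_touching (L : PeriodPair) {a ℓ : ℝ} (ha : 0 < a) (haℓ : 2 * a ≤ ℓ)
    (hℓ : ∀ p ∈ L.lattice, p ≠ 0 → ℓ ≤ ‖p‖) :
    ∀ᵐ θ : ℝ, θ ∈ Ioo (-Real.pi) Real.pi →
      ∀ p ∈ L.lattice, p ≠ 0 → a < ‖(a : ℂ) * Complex.exp (θ * Complex.I) - p‖ := by
  set E : Set ℝ := {θ | θ ∈ Ioo (-Real.pi) Real.pi ∧ ∃ p ∈ L.lattice, p ≠ 0 ∧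
    ‖(a : ℂ) * Complex.exp (θ * Complex.I) - p‖ ≤ a} with hE
  have hc : E.Countable := by
    refine countable_of_injective_of_countable_image
      ((injOn_circle ha).mono fun θ hθ => hθ.1) ?_
    -- By the parallelogram law a point with `‖x‖ = a`, `‖x - p‖ ≤ a` and `‖p‖ ≥ 2 a` is the
    -- midpoint of 0 and `p`, so the bad points are indexed by lattice points.
    refine ((countable_lattice L).image fun p => p / 2).mono ?_
    rintro _ ⟨θ, ⟨-, p, hp, hp0, h⟩, rfl⟩
    refine ⟨p, hp, ?_⟩
    set x := (a : ℂ) * Complex.exp (θ * Complex.I) with hx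
    have hxn : ‖x‖ = a := by
      rw [hx, norm_mul, Complex.norm_exp_ofReal_mul_I, mul_one, Complex.norm_real,
        Real.norm_of_nonneg ha.le]
    have hpn := haℓ.trans (hℓ p hp hp0)
    have par := parallelogram_law_with_norm ℝ x (x - p)
    rw [show x - (x - p) = p by ring, hxn] at par
    have : ‖x + (x - p)‖ * ‖x + (x - p)‖ ≤ 0 := by
      nlinarith [norm_nonneg (x - p), norm_nonneg p]
    have h0 : x + (x - p) = 0 := by
      rw [← norm_eq_zero]; nlinarith [norm_nonneg (x + (x - p))]
    simp only
    linear_combination -h0 / 2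
  have := hc.ae_notMem volume
  filter_upwards [this] with θ hθ hθ' p hp hp0
  by_contra! hcon
  exact hθ ⟨hθ', p, hp, hp0, hcon⟩

/-- A piecewise linear cutoff, which vanishes on `(-∞, d]` and is equal to `1` on `[2d, ∞)`. -/
def ramp (d t : ℝ) : ℝ := max 0 (min 1 ((t - d) / d))

lemma ramp_nonneg (d t : ℝ) : 0 ≤ ramp d t := le_max_left _ _

lemma ramp_le_one (d t : ℝ) : ramp d t ≤ 1 := max_le zero_le_one (min_le_left _ _)

lemma ramp_of_le {d t : ℝ} (hd : 0 < d) (h : t ≤ d) : ramp d t = 0 :=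
  max_eq_left ((min_le_right _ _).trans (div_nonpos_of_nonpos_of_nonneg (by linarith) hd.le))

lemma ramp_of_ge {d t : ℝ} (hd : 0 < d) (h : 2 * d ≤ t) : ramp d t = 1 := by
  rw [ramp, min_eq_left, max_eq_right zero_le_one]
  rw [le_div_iff₀ hd]; linarith

lemma ramp_of_mem {d t : ℝ} (hd : 0 < d) (h : d ≤ t) (h' : t ≤ 2 * d) : ramp d t = (t - d) / d := by
  rw [ramp, min_eq_right, max_eq_right]
  · exact div_nonneg (by linarith) hd.le
  · rw [div_le_one hd]; linarith

lemma continuous_ramp (d : ℝ) : Continuous (ramp d) := by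
  unfold ramp; fun_prop

lemma locallyLipschitz_ramp (d : ℝ) : LocallyLipschitz (ramp d) := by
  have h : LocallyLipschitz fun t : ℝ => (t - d) / d :=
    ContDiff.locallyLipschitz (𝕂 := ℝ) (f := fun t : ℝ => (t - d) / d) (by fun_prop)
  exact (h.const_min 1).const_max 0

lemma locallyLipschitz_cutoff (L : PeriodPair) (a d : ℝ) :
    LocallyLipschitz fun z : ℂ => (ramp d (infDist z L.lattice - a) : ℂ) := by
  have h1 : LocallyLipschitz fun z : ℂ => infDist z L.lattice :=
    (lipschitz_infDist_pt _).locallyLipschitz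
  have h2 : LocallyLipschitz fun t : ℝ => t - a :=
    ContDiff.locallyLipschitz (𝕂 := ℝ) (f := fun t : ℝ => t - a) (by fun_prop)
  have h3 : LocallyLipschitz fun t : ℝ => (t : ℂ) := Complex.isometry_ofReal.lipschitz.locallyLipschitz
  exact h3.comp ((locallyLipschitz_ramp d).comp (h2.comp h1))

lemma exists_lipschitzOnWith_mul {f g : ℂ → ℂ} {x : ℂ}
    (hf : ∃ K, ∃ t ∈ 𝓝 x, LipschitzOnWith K f t) (hg : ∃ K, ∃ t ∈ 𝓝 x, LipschitzOnWith K g t) :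
    ∃ K, ∃ t ∈ 𝓝 x, LipschitzOnWith K (fun z => f z * g z) t := by
  obtain ⟨K, t, ht, hf⟩ := hf
  obtain ⟨K', t', ht', hg⟩ := hg
  have hm : LocallyLipschitz fun p : ℂ × ℂ => p.1 * p.2 :=
    ContDiff.locallyLipschitz (𝕂 := ℝ) (f := fun p : ℂ × ℂ => p.1 * p.2) (by fun_prop)
  obtain ⟨C, u, hu, hC⟩ := hm (f x, g x)
  have hp := (hf.mono (inter_subset_left (t := t'))).prodMk (hg.mono (inter_subset_right (s := t)))
  have hcf : ContinuousAt f x := hf.continuousOn.continuousAt ht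
  have hcg : ContinuousAt g x := hg.continuousOn.continuousAt ht'
  refine ⟨C * max K K', (t ∩ t') ∩ (fun z => (f z, g z)) ⁻¹' u,
    inter_mem (inter_mem ht ht') ((hcf.prodMk hcg) hu), ?_⟩
  exact hC.comp (hp.mono inter_subset_left) fun z hz => hz.2

variable {L : PeriodPair} {a ℓ : ℝ} {F : ℂ → ℂ}

/-- The cutoff vanishes at all distances below `a + d` from the lattice, a neighbourhood of the
closed disks, so the values of `F` outside the open host are irrelevant. -/
lemma locallyLipschitz_cutoff_mul (hF : ContDiffOn ℝ 1 F (openHost L a)) {d : ℝ} (hd : 0 < d) :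
    LocallyLipschitz fun z => (ramp d (infDist z L.lattice - a) : ℂ) * F z := by
  intro x
  by_cases hx : x ∈ openHost L a
  · refine exists_lipschitzOnWith_mul (locallyLipschitz_cutoff L a d x) ?_
    exact (hF.contDiffAt ((isOpen_openHost L a).mem_nhds hx)).exists_lipschitzOnWith
  · rw [openHost_eq, mem_ofPred_eq, not_lt] at hx
    refine ⟨0, {z | infDist z L.lattice < a + d}, ?_, ?_⟩
    · exact (isOpen_lt (continuous_infDist_pt _) continuous_const).mem_nhds
        (show infDist x L.lattice < a + d by linarith)
    · intro z hz w hw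
      simp only [mem_ofPred_eq] at hz hw
      simp [ramp_of_le hd (show infDist z L.lattice - a ≤ d by linarith),
        ramp_of_le hd (show infDist w L.lattice - a ≤ d by linarith)]

/-- Near a point of the open Voronoi cell the distance to the lattice is the norm, so the cutoff is
radial with three smooth regimes. The product rule produces a bulk term and a term on the ring `a +
d < ‖z‖ < a + 2 d`; the two corner circles are null. -/
lemma dbar_cutoff_mul (ha : 0 < a) (hF : ContDiffOn ℝ 1 F (openHost L a)) {d : ℝ} (hd : 0 < d)
    {z : ℂ} (hz : z ∈ openVoronoi L) (h1 : ‖z‖ ≠ a + d) (h2 : ‖z‖ ≠ a + 2 * d) :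
    dbar (fun z => (ramp d (infDist z L.lattice - a) : ℂ) * F z) z =
      {w : ℂ | a < ‖w‖}.indicator (fun w => (ramp d (‖w‖ - a) : ℂ) * dbar F w) z +
      {w : ℂ | a + d < ‖w‖ ∧ ‖w‖ < a + 2 * d}.indicator (fun w => F w * (w / (2 * ‖w‖)) / d) z := by
  have hev : ∀ᶠ w in 𝓝 z, infDist w L.lattice = ‖w‖ := by
    filter_upwards [(isOpen_openVoronoi L).mem_nhds hz] with w hw
    exact norm_eq_infDist_of_mem_voronoi (openVoronoi_subset L hw)
  have hFd : a < ‖z‖ → DifferentiableAt ℝ F z := fun h =>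
    (hF.contDiffAt ((isOpen_openHost L a).mem_nhds (mem_openHost_of_mem_voronoi
      (openVoronoi_subset L hz) h))).differentiableAt one_ne_zero
  have hcn : ContinuousAt (fun w : ℂ => ‖w‖) z := continuous_norm.continuousAt
  rcases lt_or_gt_of_ne h1 with h | h
  · have e : (fun z => (ramp d (infDist z L.lattice - a) : ℂ) * F z) =ᶠ[𝓝 z] fun _ => 0 := by
      filter_upwards [hev, hcn.eventually_lt_const h] with w hw hw'
      rw [hw, ramp_of_le hd (by linarith)]; simp
    rw [dbar_congr e, indicator_of_notMem (s := {w : ℂ | a + d < ‖w‖ ∧ ‖w‖ < a + 2 * d})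
      (fun hh => by linarith [hh.1]), add_zero]
    have hr : ramp d (‖z‖ - a) = 0 := ramp_of_le hd (by linarith)
    by_cases h' : a < ‖z‖
    · rw [indicator_of_mem (show z ∈ {w : ℂ | a < ‖w‖} from h'), hr]; simp [dbar]
    · rw [indicator_of_notMem (show z ∉ {w : ℂ | a < ‖w‖} from h')]; simp [dbar]
  have haz : a < ‖z‖ := by linarith
  have hz0 : z ≠ 0 := by rw [← norm_pos_iff]; linarith
  rw [indicator_of_mem (show z ∈ {w : ℂ | a < ‖w‖} from haz)]
  rcases lt_or_gt_of_ne h2 with h' | h'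
  · have e : (fun z => (ramp d (infDist z L.lattice - a) : ℂ) * F z) =ᶠ[𝓝 z]
        fun w => (((‖w‖ - (a + d)) / d : ℝ) : ℂ) * F w := by
      filter_upwards [hev, hcn.eventually_lt_const h', hcn.eventually_const_lt h] with w hw hw' hw''
      rw [hw, ramp_of_mem hd (by linarith) (by linarith), sub_sub]
    rw [dbar_congr e, dbar_mul (differentiableAt_ofReal_norm hz0 _ _) (hFd haz),
      dbar_ofReal_norm hz0, indicator_of_mem
        (show z ∈ {w : ℂ | a + d < ‖w‖ ∧ ‖w‖ < a + 2 * d} from ⟨h, h'⟩),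
      ramp_of_mem hd (by linarith) (by linarith), sub_sub]
    ring
  · have e : (fun z => (ramp d (infDist z L.lattice - a) : ℂ) * F z) =ᶠ[𝓝 z] F := by
      filter_upwards [hev, hcn.eventually_const_lt h'] with w hw hw'
      rw [hw, ramp_of_ge hd (by linarith)]; simp
    rw [dbar_congr e, indicator_of_notMem (s := {w : ℂ | a + d < ‖w‖ ∧ ‖w‖ < a + 2 * d})
      (fun hh => by linarith [hh.2]), ramp_of_ge hd (by linarith)]
    simp

lemma tendsto_average_right {m : ℝ → ℂ} {c : ℂ} (hm : Tendsto m (𝓝[>] a) (𝓝 c))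
    (hi : ∀ᶠ d in 𝓝[>] (0 : ℝ), IntegrableOn m (Ioo (a + d) (a + 2 * d))) :
    Tendsto (fun d : ℝ => (∫ r in Ioo (a + d) (a + 2 * d), m r) / d) (𝓝[>] 0) (𝓝 c) := by
  rw [Metric.tendsto_nhds]
  intro ε hε
  have h1 := (Metric.tendsto_nhds.mp hm) (ε / 2) (by positivity)
  rw [eventually_nhdsWithin_iff, Metric.eventually_nhds_iff] at h1
  obtain ⟨δ, hδ, h1⟩ := h1
  have h2 : ∀ᶠ d in 𝓝[>] (0 : ℝ), d ∈ Ioo 0 (δ / 2) := Ioo_mem_nhdsGT (by positivity)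
  filter_upwards [hi, h2] with d hd hd'
  have hd0 : 0 < d := hd'.1
  have hv : volume.real (Ioo (a + d) (a + 2 * d)) = d := by
    rw [Real.volume_real_Ioo_of_le (by linarith)]; ring
  have hfin : volume (Ioo (a + d) (a + 2 * d)) ≠ ⊤ := by simp
  have e : (∫ r in Ioo (a + d) (a + 2 * d), m r) / d - c =
      (∫ r in Ioo (a + d) (a + 2 * d), (m r - c)) / d := by
    rw [integral_sub hd (integrableOn_const hfin), setIntegral_const, hv]
    have : (d : ℂ) ≠ 0 := by exact_mod_cast hd0.ne'
    rw [Complex.real_smul]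
    field_simp
  rw [dist_eq_norm, e, norm_div, Complex.norm_real, Real.norm_of_nonneg hd0.le, div_lt_iff₀ hd0]
  have := norm_setIntegral_le_of_norm_le_const (f := fun r => m r - c) (C := ε / 2)
    (lt_top_iff_ne_top.mpr hfin) (fun r hr => by
      have := h1 (y := r) (by rw [dist_eq_norm, Real.norm_eq_abs, abs_lt]
                              constructor <;> linarith [hr.1, hr.2, hd'.2])
        (show a < r by linarith [hr.1])
      rw [dist_eq_norm] at this
      exact this.le)
  rw [hv] at this
  nlinarith

/-- The product of `F` with a periodic cutoff has ∂̄-derivative of total integral zero. The product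
rule splits this zero into a bulk term, whose weight tends to 1, and a radial average over a ring of
width `d`, which tends to the boundary integral as `d → 0`. Only boundedness and radial limits at
almost every angle are used, so touching tubes (`2 * a = ℓ`) are covered. -/
theorem host_stokes (ha : 0 < a) (haℓ : 2 * a ≤ ℓ) (hℓ : ∀ p ∈ L.lattice, p ≠ 0 → ℓ ≤ ‖p‖)
    (hper : ∀ p ∈ L.lattice, ∀ z ∈ openHost L a, F (z + p) = F z)
    (hF : ContDiffOn ℝ 1 F (openHost L a)) {M : ℝ} (hM : ∀ z ∈ openHost L a, ‖F z‖ ≤ M)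
    (hint : IntegrableOn (dbar F) (voronoi L ∩ {z | a < ‖z‖})) {b : ℝ → ℂ}
    (hb : ∀ᵐ θ : ℝ, θ ∈ Ioo (-Real.pi) Real.pi →
      Tendsto (fun r : ℝ => F (r * Complex.exp (θ * Complex.I))) (𝓝[>] a) (𝓝 (b θ))) :
    ∫ z in voronoi L ∩ {z | a < ‖z‖}, dbar F z =
      -(a / 2 * ∫ θ in Ioo (-Real.pi) Real.pi, b θ * Complex.exp (θ * Complex.I)) := by
  classical
  have hVm : MeasurableSet (voronoi L) := (isClosed_voronoi L).measurableSet
  have hHm : MeasurableSet (openHost L a) := (isOpen_openHost L a).measurableSet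
  have ham : MeasurableSet {z : ℂ | a < ‖z‖} := measurableSet_lt measurable_const measurable_norm
  have hAm : ∀ d, MeasurableSet {w : ℂ | a + d < ‖w‖ ∧ ‖w‖ < a + 2 * d} := fun d =>
    (measurableSet_lt measurable_const measurable_norm).inter
      (measurableSet_lt measurable_norm measurable_const)
  set k : ℂ → ℂ := fun w => F w * (w / (2 * ‖w‖)) with hk
  have hkM : ∀ z ∈ openHost L a, ‖k z‖ ≤ M := by
    intro z hz
    have h1 : ‖z / (2 * ‖z‖ : ℂ)‖ ≤ 1 := by
      rw [norm_div, norm_mul, Complex.norm_real, norm_norm, Complex.norm_ofNat]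
      exact div_le_one_of_le₀ (by linarith [norm_nonneg z]) (by positivity)
    rw [hk]
    simp only
    rw [norm_mul]
    calc _ ≤ ‖F z‖ * 1 := by gcongr
      _ ≤ M := by simpa using hM z hz
  have hM0 : ∀ z ∈ openHost L a, 0 ≤ M := fun z hz => (norm_nonneg _).trans (hM z hz)
  -- Cutting off with the indicator yields a globally measurable and bounded function, so polar
  -- coordinates apply although the Voronoi cell is not radial.
  set g : ℂ → ℂ := (voronoi L ∩ openHost L a).indicator k with hg
  have hgm : Measurable g := by
    have hF' : Measurable ((openHost L a).indicator F) := by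
      have := ContinuousOn.measurable_piecewise (f := F) (g := 0) hF.continuousOn
        continuousOn_const hHm
      rwa [piecewise_eq_indicator] at this
    have : g = (voronoi L).indicator fun w => (openHost L a).indicator F w * (w / (2 * ‖w‖)) := by
      ext w
      simp only [hg, hk, indicator_apply, mem_inter_iff]
      split_ifs <;> simp_all
    rw [this]
    exact (hF'.mul (by fun_prop)).indicator hVm
  have hgM : ∀ z, ‖g z‖ ≤ |M| := by
    intro z
    rw [hg, indicator_apply]
    split_ifs with h
    · exact (hkM z h.2).trans (le_abs_self _)
    · simp
  set m : ℝ → ℂ := fun r => ∫ θ in Ioo (-Real.pi) Real.pi,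
    (r : ℂ) * g (r * Complex.exp (θ * Complex.I)) with hm
  have hann : ∀ d, 0 < d → IntegrableOn m (Ioo (a + d) (a + 2 * d)) ∧
      ∫ z in {z : ℂ | a + d < ‖z‖ ∧ ‖z‖ < a + 2 * d}, g z = ∫ r in Ioo (a + d) (a + 2 * d), m r :=
    fun d hd => integral_annulus hgm (by linarith) (fun z _ _ => hgM z)
  have hstep : ∀ d, 0 < d → ∫ z in voronoi L ∩ {z | a < ‖z‖}, (ramp d (‖z‖ - a) : ℂ) * dbar F z =
      -((∫ r in Ioo (a + d) (a + 2 * d), m r) / d) := by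
    intro d hd
    have h0 := integral_dbar_eq_zero L (locallyLipschitz_cutoff_mul hF hd) (by
      intro p hp z
      rw [infDist_lattice_add L hp]
      by_cases hz : z ∈ openHost L a
      · rw [hper p hp z hz]
      · rw [openHost_eq, mem_ofPred_eq, not_lt] at hz
        simp [ramp_of_le hd (show infDist z L.lattice - a ≤ d by linarith)])
    have hae : ∀ᵐ z ∂(volume.restrict (voronoi L)),
        dbar (fun z => (ramp d (infDist z L.lattice - a) : ℂ) * F z) z =
        {w : ℂ | a < ‖w‖}.indicator (fun w => (ramp d (‖w‖ - a) : ℂ) * dbar F w) z +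
        {w : ℂ | a + d < ‖w‖ ∧ ‖w‖ < a + 2 * d}.indicator (fun w => k w / d) z := by
      rw [ae_restrict_iff' hVm]
      have hs1 : ∀ᵐ z : ℂ, z ∉ sphere (0 : ℂ) (a + d) :=
        measure_eq_zero_iff_ae_notMem.mp (Measure.addHaar_sphere _ _ _)
      have hs2 : ∀ᵐ z : ℂ, z ∉ sphere (0 : ℂ) (a + 2 * d) :=
        measure_eq_zero_iff_ae_notMem.mp (Measure.addHaar_sphere _ _ _)
      filter_upwards [hs1, hs2, (openVoronoi_ae_eq L).mem_iff] with z h1 h2 h3 hz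
      exact dbar_cutoff_mul ha hF hd (h3.mpr hz) (by simpa using h1) (by simpa using h2)
    rw [integral_congr_ae hae, integral_add, setIntegral_indicator ham,
      setIntegral_indicator (hAm d), integral_div] at h0
    · have e : ∫ z in {z : ℂ | a + d < ‖z‖ ∧ ‖z‖ < a + 2 * d}, g z =
          ∫ z in voronoi L ∩ {z : ℂ | a + d < ‖z‖ ∧ ‖z‖ < a + 2 * d}, k z := by
        rw [hg, setIntegral_indicator (hVm.inter hHm)]
        congr 2
        ext z
        constructor
        · rintro ⟨h1, h2, h3⟩; exact ⟨h2, h1⟩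
        · rintro ⟨h1, h2⟩
          exact ⟨h2, h1, mem_openHost_of_mem_voronoi h1 (by linarith [h2.1])⟩
      rw [← (hann d hd).2, e]
      linear_combination h0
    · rw [integrable_indicator_iff ham, IntegrableOn, Measure.restrict_restrict ham, inter_comm]
      refine hint.bdd_mul (c := 1) ?_ ?_
      · exact (Complex.continuous_ofReal.comp ((continuous_ramp d).comp
          (by fun_prop : Continuous fun z : ℂ => ‖z‖ - a))).aestronglyMeasurable
      · refine Eventually.of_forall fun z => ?_
        rw [Complex.norm_real, Real.norm_of_nonneg (ramp_nonneg _ _)]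
        exact ramp_le_one _ _
    · have hi : IntegrableOn g (voronoi L) :=
        Measure.integrableOn_of_bounded (M := |M|) (isCompact_voronoi L).measure_lt_top.ne
          hgm.aestronglyMeasurable (Eventually.of_forall hgM)
      have hi2 : IntegrableOn ({w : ℂ | a + d < ‖w‖ ∧ ‖w‖ < a + 2 * d}.indicator (fun w => g w / d))
        (voronoi L) := (hi.div_const _).indicator (hAm d)
      refine hi2.congr ?_
      rw [EventuallyEq, ae_restrict_iff' hVm]
      refine Eventually.of_forall fun z hz => ?_
      simp only [indicator_apply]
      split_ifs with h
      · rw [hg, indicator_of_mem (mem_inter hz (mem_openHost_of_mem_voronoi hz (by linarith [h.1])))]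
      · rfl
  have hlim1 : Tendsto (fun d : ℝ => ∫ z in voronoi L ∩ {z | a < ‖z‖},
      (ramp d (‖z‖ - a) : ℂ) * dbar F z) (𝓝[>] 0)
      (𝓝 (∫ z in voronoi L ∩ {z | a < ‖z‖}, dbar F z)) := by
    refine tendsto_integral_filter_of_dominated_convergence (fun z => ‖dbar F z‖) ?_ ?_ hint.norm ?_
    · refine Eventually.of_forall fun d => AEStronglyMeasurable.mul ?_ hint.1
      exact (Complex.continuous_ofReal.comp ((continuous_ramp d).comp
          (by fun_prop : Continuous fun z : ℂ => ‖z‖ - a))).aestronglyMeasurable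
    · refine Eventually.of_forall fun d => Eventually.of_forall fun z => ?_
      rw [norm_mul, Complex.norm_real, Real.norm_of_nonneg (ramp_nonneg _ _)]
      exact mul_le_of_le_one_left (norm_nonneg _) (ramp_le_one _ _)
    · rw [ae_restrict_iff' (hVm.inter ham)]
      refine Eventually.of_forall fun z hz => ?_
      have hz' : 0 < (‖z‖ - a) / 2 := by have : a < ‖z‖ := hz.2; linarith
      refine tendsto_const_nhds.congr' ?_
      filter_upwards [Ioo_mem_nhdsGT hz'] with d hd
      rw [ramp_of_ge hd.1 (by linarith [hd.2])]; simp
  have hlim2 : Tendsto m (𝓝[>] a)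
      (𝓝 (a / 2 * ∫ θ in Ioo (-Real.pi) Real.pi, b θ * Complex.exp (θ * Complex.I))) := by
    rw [← integral_const_mul]
    refine tendsto_integral_filter_of_dominated_convergence (fun _ => (a + 1) * |M|) ?_ ?_ ?_ ?_
    · refine Eventually.of_forall fun r => Measurable.aestronglyMeasurable ?_
      exact (hgm.comp (by fun_prop)).const_mul _
    · filter_upwards [Ioo_mem_nhdsGT (show a < a + 1 by linarith)] with r hr
      refine Eventually.of_forall fun θ => ?_
      rw [norm_mul, Complex.norm_real, Real.norm_of_nonneg (ha.le.trans hr.1.le)]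
      have := hgM (r * Complex.exp (θ * Complex.I))
      have h2 := hr.2.le
      have h3 : 0 ≤ a + 1 := by linarith
      gcongr
    · exact integrableOn_const (by simp)
    · rw [ae_restrict_iff' measurableSet_Ioo]
      filter_upwards [hb, ae_not_touching L ha haℓ hℓ] with θ h1 h2 hθ
      have hn : ∀ r : ℝ, 0 < r → ‖(r * Complex.exp (θ * Complex.I) : ℂ)‖ = r := fun r hr => by
        rw [norm_mul, Complex.norm_exp_ofReal_mul_I, mul_one, Complex.norm_real,
          Real.norm_of_nonneg hr.le]
      have hmem : (a : ℂ) * Complex.exp (θ * Complex.I) ∈ openVoronoi L := by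
        intro p hp hp0
        rw [hn a ha]
        exact h2 hθ p hp hp0
      have hcont : ContinuousAt (fun r : ℝ => (r : ℂ) * Complex.exp (θ * Complex.I)) a := by
        fun_prop
      -- At an angle without contact the ray stays in the Voronoi cell just beyond the circle, so
      -- the indicator in `g` is 1 there.
      have hev : ∀ᶠ r : ℝ in 𝓝[>] a, (r : ℂ) * Complex.exp (θ * Complex.I) ∈ openVoronoi L :=
        nhdsWithin_le_nhds (hcont ((isOpen_openVoronoi L).mem_nhds hmem))
      have hlim : Tendsto (fun r : ℝ => (r : ℂ) / 2 * (F (r * Complex.exp (θ * Complex.I)) *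
          Complex.exp (θ * Complex.I))) (𝓝[>] a)
          (𝓝 (a / 2 * (b θ * Complex.exp (θ * Complex.I)))) := by
        refine Tendsto.mul ?_ ((h1 hθ).mul tendsto_const_nhds)
        exact ((Complex.continuous_ofReal.tendsto a).div_const 2).mono_left nhdsWithin_le_nhds
      refine hlim.congr' ?_
      filter_upwards [hev, self_mem_nhdsWithin] with r hr hra
      have hr0 : 0 < r := ha.trans hra
      have hrV := openVoronoi_subset L hr
      have hrn := hn r hr0
      rw [hg, indicator_of_mem
        (mem_inter hrV (mem_openHost_of_mem_voronoi hrV (by rw [hrn]; exact hra))), hk]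
      simp only
      rw [hrn]
      have : (r : ℂ) ≠ 0 := by exact_mod_cast hr0.ne'
      field_simp
  have hlim3 := (tendsto_average_right hlim2 (by
    filter_upwards [self_mem_nhdsWithin] with d hd using (hann d hd).1)).neg
  refine tendsto_nhds_unique hlim1 (hlim3.congr' ?_)
  filter_upwards [self_mem_nhdsWithin] with d hd
  exact (hstep d hd).symm

/-! ### Square and hexagonal lattices -/

/-- The properties shared by the square and the hexagonal lattice with spacing `ℓ`. -/
structure IsTubeLattice (L : PeriodPair) (ℓ : ℝ) : Prop where
  pos : 0 < ℓ
  spacing_eq : spacing L = ℓ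
  omega₁_eq : L.ω₁ = ℓ
  norm_le : ∀ p ∈ L.lattice, p ≠ 0 → ℓ ≤ ‖p‖
  conj_mem : ∀ p ∈ L.lattice, (starRingEnd ℂ) p ∈ L.lattice
  exists_rotation : ∃ ρ : ℂ, ‖ρ‖ = 1 ∧ ρ ^ 2 ≠ 1 ∧ (∀ p ∈ L.lattice, ρ * p ∈ L.lattice) ∧
    (∀ p ∈ L.lattice, ρ⁻¹ * p ∈ L.lattice) ∧ L.ω₂ = ρ * ℓ

lemma IsSquareLattice.mul_I_mem {L : PeriodPair} (h : IsSquareLattice L) :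
    ∀ p ∈ L.lattice, Complex.I * p ∈ L.lattice := by
  obtain ⟨ℓ, hℓ, h1, h2⟩ := h
  intro p hp
  obtain ⟨m, n, rfl⟩ := PeriodPair.mem_lattice.mp hp
  refine PeriodPair.mem_lattice.mpr ⟨-n, m, ?_⟩
  rw [h1, h2]; push_cast; linear_combination (-(n : ℂ) * ℓ) * Complex.I_sq

lemma IsSquareLattice.isTubeLattice {L : PeriodPair} (h : IsSquareLattice L) :
    ∃ ℓ, IsTubeLattice L ℓ := by
  obtain ⟨ℓ, hℓ, h1, h2⟩ := id h
  have hsq : ∀ x y : ℝ, ‖(x * ℓ + y * (ℓ * Complex.I) : ℂ)‖ = √(x ^ 2 + y ^ 2) * ℓ := by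
    intro x y
    rw [show (x * ℓ + y * (ℓ * Complex.I) : ℂ) = (x + y * Complex.I) * ℓ by ring, norm_mul,
      Complex.norm_add_mul_I, Complex.norm_real, Real.norm_of_nonneg hℓ.le]
  refine ⟨ℓ, hℓ, ?_, h1, ?_, ?_, Complex.I, by simp, by norm_num, h.mul_I_mem, ?_, ?_⟩
  · have e := hsq 1 (-1)
    rw [spacing, h1, h2, show (ℓ - ℓ * Complex.I : ℂ) = (1 : ℝ) * ℓ + (-1 : ℝ) * (ℓ * Complex.I) by
      push_cast; ring, e]
    have : (1 : ℝ) ≤ √(1 ^ 2 + (-1) ^ 2) := by rw [Real.one_le_sqrt]; norm_num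
    simp only [norm_mul, Complex.norm_real, Complex.norm_I, mul_one, Real.norm_of_nonneg hℓ.le]
    rw [min_eq_left (a := ℓ) (b := √(1 ^ 2 + (-1) ^ 2) * ℓ) (by nlinarith), min_self]
  · intro p hp hp0
    obtain ⟨m, n, rfl⟩ := PeriodPair.mem_lattice.mp hp
    have e := hsq m n
    push_cast at e
    rw [h1, h2, e]
    refine le_mul_of_one_le_left hℓ.le ?_
    rw [Real.one_le_sqrt]
    have : (1 : ℤ) ≤ m ^ 2 + n ^ 2 := by
      by_contra! hcon
      have hm : m = 0 := by nlinarith [sq_nonneg m, sq_nonneg n]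
      have hn : n = 0 := by nlinarith [sq_nonneg m, sq_nonneg n]
      exact hp0 (by simp [hm, hn])
    exact_mod_cast this
  · intro p hp
    obtain ⟨m, n, rfl⟩ := PeriodPair.mem_lattice.mp hp
    refine PeriodPair.mem_lattice.mpr ⟨m, -n, ?_⟩
    rw [h1, h2]; simp
  · intro p hp
    have := L.lattice.neg_mem (h.mul_I_mem p hp)
    rwa [Complex.inv_I, neg_mul]
  · rw [h2]; ring

lemma exp_I_pi_div_three :
    Complex.exp (Complex.I * Real.pi / 3) = (1 / 2 : ℝ) + (√3 / 2 : ℝ) * Complex.I := by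
  rw [show Complex.I * (Real.pi : ℂ) / 3 = ((Real.pi / 3 : ℝ) : ℂ) * Complex.I by push_cast; ring,
    Complex.exp_mul_I, ← Complex.ofReal_cos, ← Complex.ofReal_sin, Real.cos_pi_div_three,
    Real.sin_pi_div_three]

lemma exp_I_pi_div_three_sq :
    Complex.exp (Complex.I * Real.pi / 3) ^ 2 = Complex.exp (Complex.I * Real.pi / 3) - 1 := by
  have h3 : ((√3 : ℝ) : ℂ) ^ 2 = 3 := by
    rw [← Complex.ofReal_pow, Real.sq_sqrt (by norm_num)]; norm_num
  rw [exp_I_pi_div_three]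
  push_cast
  linear_combination (1 / 4 * Complex.I ^ 2) * h3 + 3 / 4 * Complex.I_sq

lemma IsHexagonalLattice.mul_mem {L : PeriodPair} (h : IsHexagonalLattice L) :
    ∀ p ∈ L.lattice, Complex.exp (Complex.I * Real.pi / 3) * p ∈ L.lattice := by
  obtain ⟨ℓ, hℓ, h1, h2⟩ := h
  intro p hp
  obtain ⟨m, n, rfl⟩ := PeriodPair.mem_lattice.mp hp
  refine PeriodPair.mem_lattice.mpr ⟨-n, m + n, ?_⟩
  rw [h1, h2]; push_cast; linear_combination (-(n : ℂ) * ℓ) * exp_I_pi_div_three_sq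

/-- Squared lengths are ℓ² (m² + mn + n²), a positive integer times ℓ² away from 0, which gives the
minimal distance. The sixth root of unity ρ satisfies ρ² = ρ - 1 and ρ⁻¹ = conj ρ = 1 - ρ, so
rotation and conjugation preserve integer coordinates. -/
lemma IsHexagonalLattice.isTubeLattice {L : PeriodPair} (h : IsHexagonalLattice L) :
    ∃ ℓ, IsTubeLattice L ℓ := by
  obtain ⟨ℓ, hℓ, h1, h2⟩ := id h
  have hm := h.mul_mem
  set ρ := Complex.exp (Complex.I * Real.pi / 3) with hρ
  have hρ2 : ρ ^ 2 = ρ - 1 := exp_I_pi_div_three_sq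
  have hρn : ‖ρ‖ = 1 := by
    rw [hρ, show Complex.I * (Real.pi : ℂ) / 3 = ((Real.pi / 3 : ℝ) : ℂ) * Complex.I by
      push_cast; ring, Complex.norm_exp_ofReal_mul_I]
  have hρ0 : ρ ≠ 0 := Complex.exp_ne_zero _
  have hinv : ρ⁻¹ = 1 - ρ := by
    field_simp; linear_combination hρ2
  have hconj : (starRingEnd ℂ) ρ = 1 - ρ := by
    rw [hρ, exp_I_pi_div_three, map_add, map_mul, Complex.conj_ofReal, Complex.conj_ofReal,
      Complex.conj_I]
    push_cast; ring
  have hsq : ∀ x y : ℝ, ‖(x * ℓ + y * (ℓ * ρ) : ℂ)‖ = √(x ^ 2 + x * y + y ^ 2) * ℓ := by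
    intro x y
    rw [show (x * ℓ + y * (ℓ * ρ) : ℂ) = ((x + y / 2 : ℝ) + (y * √3 / 2 : ℝ) * Complex.I) * ℓ by
      rw [hρ, exp_I_pi_div_three]; push_cast; ring, norm_mul,
      Complex.norm_add_mul_I, Complex.norm_real, Real.norm_of_nonneg hℓ.le]
    congr 2
    have := Real.sq_sqrt (show (0 : ℝ) ≤ 3 by norm_num)
    linear_combination y ^ 2 / 4 * this
  refine ⟨ℓ, hℓ, ?_, h1, ?_, ?_, ρ, hρn, ?_, hm, ?_, ?_⟩
  · have e := hsq 1 (-1)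
    rw [spacing, h1, h2, show (ℓ - ℓ * ρ : ℂ) = (1 : ℝ) * ℓ + (-1 : ℝ) * (ℓ * ρ) by
      push_cast; ring, e]
    norm_num [hρn, abs_of_pos hℓ]
  · intro p hp hp0
    obtain ⟨m, n, rfl⟩ := PeriodPair.mem_lattice.mp hp
    have e := hsq m n
    push_cast at e
    rw [h1, h2, e]
    refine le_mul_of_one_le_left hℓ.le ?_
    rw [Real.one_le_sqrt]
    have : (1 : ℤ) ≤ m ^ 2 + m * n + n ^ 2 := by
      by_contra! hcon
      have hm : m = 0 := by
        by_contra h0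
        have := Int.one_le_abs h0
        nlinarith [sq_nonneg (m + 2 * n), sq_abs m]
      subst hm
      have hn : n = 0 := by nlinarith [sq_nonneg n]
      exact hp0 (by simp [hn])
    exact_mod_cast this
  · intro p hp
    obtain ⟨m, n, rfl⟩ := PeriodPair.mem_lattice.mp hp
    refine PeriodPair.mem_lattice.mpr ⟨m + n, -n, ?_⟩
    rw [h1, h2]; simp [hconj]; ring
  · intro h
    rw [hρ2] at h
    have h2 : ρ = 2 := by linear_combination h
    rw [h2] at hρn; norm_num at hρn
  · intro p hp
    have := L.lattice.sub_mem hp (hm p hp)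
    rwa [hinv, sub_mul, one_mul]
  · rw [h2]; ring

/-! ### Periodic multipoles -/

/-- The summands of the periodic multipoles. -/
def multipoleTerm (n : ℕ) (l z : ℂ) : ℂ :=
  ((z - l) ^ (2 * n + 1))⁻¹ + if n = 0 then 1 / l + z / l ^ 2 else 0

/-- The periodic multipoles `∑_P (z - P)^{-2n-1}`; for `n = 0`, the Weierstrass zeta function. -/
def multipole (L : PeriodPair) (n : ℕ) (z : ℂ) : ℂ := ∑' l : L.lattice, multipoleTerm n l z

/-- For n = 0 the three terms combine to z²/(l²(z - l)), which decays cubically; for n ≥ 1 the power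
is at least cubic by itself. The threshold `2 r` gives `‖z - l‖ ≥ ‖l‖ / 2`, and the threshold 1 lets
higher powers be replaced by cubes. -/
lemma multipoleTerm_bound (n : ℕ) {r : ℝ} (hr : 0 < r) {z l : ℂ} (hz : ‖z‖ < r)
    (h : max (2 * r) 1 ≤ ‖l‖) :
    ‖multipoleTerm n l z‖ ≤ (2 ^ (2 * n + 1) + 2 * r ^ 2) * ‖l‖ ^ (-3 : ℝ) := by
  have h2 : 2 * r ≤ ‖l‖ := (le_max_left _ _).trans h
  have h1 : 1 ≤ ‖l‖ := (le_max_right _ _).trans h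
  have hl : 0 < ‖l‖ := by linarith
  have hl0 : l ≠ 0 := norm_pos_iff.mp hl
  have hzl : ‖l‖ / 2 ≤ ‖z - l‖ := by
    rw [norm_sub_rev]; linarith [norm_sub_norm_le l z]
  have hzl0 : z - l ≠ 0 := norm_pos_iff.mp (by linarith)
  have e3 : ‖l‖ ^ (-3 : ℝ) = (‖l‖ ^ 3)⁻¹ := by
    rw [Real.rpow_neg hl.le]; norm_cast
  rw [e3, multipoleTerm]
  by_cases hn : n = 0
  · subst hn
    have : ((z - l) ^ (2 * 0 + 1))⁻¹ + (1 / l + z / l ^ 2) = z ^ 2 / (l ^ 2 * (z - l)) := by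
      field_simp; ring
    rw [if_pos rfl, this, norm_div, norm_pow, norm_mul, norm_pow]
    calc ‖z‖ ^ 2 / (‖l‖ ^ 2 * ‖z - l‖) ≤ r ^ 2 / (‖l‖ ^ 2 * (‖l‖ / 2)) := by gcongr
      _ = (2 * r ^ 2) * (‖l‖ ^ 3)⁻¹ := by field_simp
      _ ≤ _ := by gcongr; linarith [show (0 : ℝ) ≤ 2 ^ (2 * 0 + 1) by positivity]
  · rw [if_neg hn, add_zero, norm_inv, norm_pow]
    calc (‖z - l‖ ^ (2 * n + 1))⁻¹ ≤ ((‖l‖ / 2) ^ (2 * n + 1))⁻¹ := by gcongr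
      _ = 2 ^ (2 * n + 1) * (‖l‖ ^ (2 * n + 1))⁻¹ := by rw [div_pow, inv_div]; ring
      _ ≤ 2 ^ (2 * n + 1) * (‖l‖ ^ 3)⁻¹ := by
        gcongr
        omega
      _ ≤ _ := by gcongr; linarith [sq_nonneg r]

lemma summable_norm_lattice (L : PeriodPair) : Summable fun l : L.lattice => ‖(l : ℂ)‖ ^ (-3 : ℝ) :=
  ZLattice.summable_norm_rpow L.lattice _ (by simp; norm_num)

lemma hasSumLocallyUniformly_multipole (L : PeriodPair) (n : ℕ) :
    HasSumLocallyUniformly (fun (l : L.lattice) (z : ℂ) => multipoleTerm n l z)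
      (multipole L n) := by
  refine L.hasSumLocallyUniformly_aux _
    (fun r l => (2 ^ (2 * n + 1) + 2 * r ^ 2) * ‖(l : ℂ)‖ ^ (-3 : ℝ))
    (fun r _ => (summable_norm_lattice L).mul_left _) fun r hr => ?_
  filter_upwards [eventually_ge_atTop (max (2 * r) 1)] with R hR x hx l hl
  exact multipoleTerm_bound n hr hx (hl ▸ hR)

lemma hasSum_multipole (L : PeriodPair) (n : ℕ) (z : ℂ) :
    HasSum (fun l : L.lattice => multipoleTerm n l z) (multipole L n z) :=
  (hasSumLocallyUniformly_multipole L n).hasSum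

lemma differentiableOn_multipoleTerm (n : ℕ) (l : ℂ) :
    DifferentiableOn ℂ (multipoleTerm n l) {l}ᶜ := by
  intro z hz
  have : z - l ≠ 0 := sub_ne_zero.mpr hz
  unfold multipoleTerm
  refine DifferentiableAt.differentiableWithinAt ?_
  have h1 : DifferentiableAt ℂ (fun w : ℂ => (w - l) ^ (2 * n + 1)) z := by fun_prop
  refine (h1.fun_inv (pow_ne_zero _ this)).fun_add ?_
  split_ifs
  · fun_prop
  · fun_prop

lemma differentiableOn_multipole (L : PeriodPair) (n : ℕ) :
    DifferentiableOn ℂ (multipole L n) (L.lattice : Set ℂ)ᶜ := by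
  refine (hasSumLocallyUniformly_multipole L n).hasSumLocallyUniformlyOn.differentiableOn
    (.of_forall fun s => .fun_sum fun l _ => ?_) L.isClosed_lattice.isOpen_compl
  refine (differentiableOn_multipoleTerm n l).mono fun z hz => ?_
  rintro rfl
  exact hz l.2

lemma multipole_add (L : PeriodPair) {n : ℕ} (hn : n ≠ 0) {p : ℂ} (hp : p ∈ L.lattice) (z : ℂ) :
    multipole L n (z + p) = multipole L n z := by
  rw [multipole, ← (Equiv.addRight (⟨p, hp⟩ : L.lattice)).tsum_eq]
  refine tsum_congr fun l => ?_
  simp [multipoleTerm, hn]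

lemma multipole_zero_eq (L : PeriodPair) (z : ℂ) : multipole L 0 z = weierstrassZeta L z := by
  classical
  rw [multipole, (hasSum_multipole L 0 z).summable.tsum_eq_add_tsum_ite 0, weierstrassZeta]
  congr 1
  · simp [multipoleTerm]
  · rw [← tsum_subtype_eq_of_support_subset (s := {l : L.lattice | l ≠ 0})]
    · refine tsum_congr fun l => ?_
      have : (l : L.lattice) ≠ 0 := l.2
      simp [this, multipoleTerm, add_assoc]
    · intro l hl
      by_contra h0
      simp only [mem_ofPred_eq, not_not] at h0
      simp [h0] at hl

lemma deriv_weierstrassZeta (L : PeriodPair) {z : ℂ} (hz : z ∉ L.lattice) :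
    deriv (multipole L 0) z = -L.weierstrassP z := by
  have key : EqOn (deriv (multipole L 0)) (-L.weierstrassP) (L.lattice : Set ℂ)ᶜ := by
    have hd : ∀ l : L.lattice, DifferentiableOn ℂ (multipoleTerm 0 l) (L.lattice : Set ℂ)ᶜ :=
      fun l => (differentiableOn_multipoleTerm 0 l).mono fun z hz => by rintro rfl; exact hz l.2
    refine ((hasSumLocallyUniformly_multipole L 0).tendstoLocallyUniformlyOn.deriv
      (.of_forall fun s => .fun_sum fun l _ => hd l) L.isClosed_lattice.isOpen_compl).unique ?_
    refine (L.hasSumLocallyUniformly_weierstrassP.tendstoLocallyUniformlyOn.neg).congr ?_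
    intro s z hz
    simp only [Function.comp_apply, Pi.neg_apply]
    rw [deriv_fun_sum fun l _ => (hd l).differentiableAt (L.isClosed_lattice.isOpen_compl.mem_nhds hz),
      ← Finset.sum_neg_distrib]
    refine Finset.sum_congr rfl fun l _ => ?_
    have h0 : z - l ≠ 0 := sub_ne_zero.mpr (by rintro rfl; exact hz l.2)
    have h1 : HasDerivAt (fun z : ℂ => (z - l)) 1 z := (hasDerivAt_id z).sub_const _
    have h2 := (h1.inv h0).add (((hasDerivAt_id z).div_const ((l : ℂ) ^ 2)).const_add (1 / (l : ℂ)))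
    have e : multipoleTerm 0 l = (fun z : ℂ => (z - l))⁻¹ + fun z => 1 / (l : ℂ) + id z / (l : ℂ) ^ 2 := by
      ext w; simp [multipoleTerm]
    rw [e, h2.deriv]
    ring
  exact key hz

/-- The derivative of ζ is -℘, which is periodic, and the complement of a countable set in the plane
is connected; hence ζ(z + p) - ζ(z) is constant. -/
lemma exists_zeta_add (L : PeriodPair) {p : ℂ} (hp : p ∈ L.lattice) :
    ∃ c, ∀ z ∉ L.lattice, multipole L 0 (z + p) = multipole L 0 z + c := by
  have hmem : ∀ z : ℂ, z ∉ L.lattice → z + p ∉ L.lattice := fun z hz h =>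
    hz (by simpa using L.lattice.sub_mem h hp)
  have hdiff : ∀ z : ℂ, z ∉ L.lattice → DifferentiableAt ℂ (multipole L 0) z := fun z hz =>
    (differentiableOn_multipole L 0).differentiableAt (L.isClosed_lattice.isOpen_compl.mem_nhds hz)
  have hconn : IsPreconnected ((L.lattice : Set ℂ)ᶜ) :=
    ((countable_lattice L).isPathConnected_compl_of_one_lt_rank (by
      simp [Complex.rank_real_complex])).isConnected.isPreconnected
  have hshift : ∀ z : ℂ, z ∉ L.lattice →
      HasDerivAt (fun z => multipole L 0 (z + p)) (-L.weierstrassP z) z := by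
    intro z hz
    have h1 := (hdiff _ (hmem z hz)).hasDerivAt
    rw [deriv_weierstrassZeta L (hmem z hz)] at h1
    have h2 := HasDerivAt.comp_add_const z p h1
    rwa [L.weierstrassP_add_coe z ⟨p, hp⟩] at h2
  have hD : ∀ z : ℂ, z ∉ L.lattice →
      HasDerivAt (fun z => multipole L 0 (z + p) - multipole L 0 z) 0 z := by
    intro z hz
    have h1 := (hdiff _ hz).hasDerivAt
    rw [deriv_weierstrassZeta L hz] at h1
    simpa using (hshift z hz).fun_sub h1
  obtain ⟨c, hc⟩ := L.isClosed_lattice.isOpen_compl.exists_is_const_of_deriv_eq_zero hconn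
    (f := fun z => multipole L 0 (z + p) - multipole L 0 z)
    (fun z hz => (hD z hz).differentiableAt.differentiableWithinAt)
    (fun z hz => (hD z hz).deriv)
  exact ⟨c, fun z hz => by linear_combination hc z hz⟩

/-- Multiplication by ρ permutes the lattice, and each summand is homogeneous of degree -1 in (z,
l). With ρ = -1 this is the oddness of ζ. -/
lemma multipole_mul (L : PeriodPair) {ρ : ℂ} (hρ : ρ ≠ 0) (h : ∀ p ∈ L.lattice, ρ * p ∈ L.lattice)
    (h' : ∀ p ∈ L.lattice, ρ⁻¹ * p ∈ L.lattice) (z : ℂ) :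
    multipole L 0 (ρ * z) = ρ⁻¹ * multipole L 0 z := by
  let e : L.lattice ≃ L.lattice :=
    { toFun := fun p => ⟨ρ * p, h p p.2⟩
      invFun := fun p => ⟨ρ⁻¹ * p, h' p p.2⟩
      left_inv := fun p => by ext; simp [hρ]
      right_inv := fun p => by ext; simp [hρ] }
  rw [multipole, ← e.tsum_eq, multipole, ← tsum_mul_left]
  refine tsum_congr fun l => ?_
  have : ((e l : L.lattice) : ℂ) = ρ * l := rfl
  rw [this, multipoleTerm, multipoleTerm, ← mul_sub]
  simp only [mul_zero, zero_add, pow_one, if_true, mul_inv, mul_pow, div_eq_mul_inv]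
  field_simp

/-- The coefficients of the regular part of the multipoles at the origin. -/
def regCoeff (L : PeriodPair) (n k : ℕ) : ℂ :=
  ((2 * n + 2 * k + 1).choose (2 * n) : ℂ) *
    (latticeSum L (n + k + 1) / (spacing L : ℂ) ^ (2 * (n + k + 1)))

/-! ### Laurent expansion of the multipoles at the origin -/

variable {L : PeriodPair} {ℓ : ℝ}

lemma IsTubeLattice.div_le_one (hL : IsTubeLattice L ℓ) (l : {l : L.lattice // l ≠ 0}) :
    ℓ / ‖(l : ℂ)‖ ≤ 1 := by
  have h := hL.norm_le l l.1.2 (by simpa using l.2)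
  exact div_le_one_of_le₀ h (norm_nonneg _)

lemma summable_div_norm_lattice (L : PeriodPair) (ℓ : ℝ) :
    Summable fun l : {l : L.lattice // l ≠ 0} => (ℓ / ‖(l : ℂ)‖) ^ 3 := by
  have := ((summable_norm_lattice L).mul_left (ℓ ^ 3)).subtype {l : L.lattice | l ≠ 0}
  refine this.congr fun l => ?_
  simp only [Function.comp_apply]
  rw [Real.rpow_neg (norm_nonneg _), div_pow, div_eq_mul_inv]
  norm_cast

lemma IsTubeLattice.norm_div_pow_le (hL : IsTubeLattice L ℓ) {m : ℕ} (hm : 2 ≤ m)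
    (l : {l : L.lattice // l ≠ 0}) :
    ‖((spacing L : ℂ) / (l : ℂ)) ^ (2 * m)‖ ≤ (ℓ / ‖(l : ℂ)‖) ^ 3 := by
  rw [hL.spacing_eq, norm_pow, norm_div, Complex.norm_real, Real.norm_of_nonneg hL.pos.le]
  exact pow_le_pow_of_le_one (div_nonneg hL.pos.le (norm_nonneg _)) (hL.div_le_one l) (by omega)

lemma IsTubeLattice.summable_latticeSum (hL : IsTubeLattice L ℓ) {m : ℕ} (hm : 2 ≤ m) :
    Summable fun l : {l : L.lattice // l ≠ 0} => ((spacing L : ℂ) / (l : ℂ)) ^ (2 * m) :=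
  .of_norm_bounded (summable_div_norm_lattice L ℓ) (hL.norm_div_pow_le hm)

/-- Since ℓ/|P| ≤ 1, its cube dominates all higher powers, so one convergent sum bounds every S_m.
This uniform bound is all the infinite systems need to know about the lattice sums. -/
lemma IsTubeLattice.exists_norm_latticeSum_le (hL : IsTubeLattice L ℓ) :
    ∃ K : ℝ, 0 ≤ K ∧ ∀ m, 1 ≤ m → ‖latticeSum L m‖ ≤ K := by
  refine ⟨∑' l : {l : L.lattice // l ≠ 0}, (ℓ / ‖(l : ℂ)‖) ^ 3, ?_, fun m hm => ?_⟩
  · exact tsum_nonneg fun l => pow_nonneg (div_nonneg hL.pos.le (norm_nonneg _)) _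
  · rw [latticeSum]
    split_ifs with h
    · rw [norm_zero]
      exact tsum_nonneg fun l => pow_nonneg (div_nonneg hL.pos.le (norm_nonneg _)) _
    · exact tsum_of_norm_bounded (summable_div_norm_lattice L ℓ).hasSum (hL.norm_div_pow_le (by omega))

lemma summable_choose_odd (n : ℕ) {t : ℝ} (ht : |t| < 1) :
    Summable fun k : ℕ => ((2 * n + 2 * k + 1).choose (2 * n) : ℝ) * t ^ (2 * k + 1) := by
  have h := summable_choose_mul_geometric_of_norm_lt_one (2 * n) (r := t) (by simpa using ht)
  have hi : Function.Injective fun k : ℕ => 2 * k + 1 := fun a b h => by simpa using h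
  refine (h.comp_injective hi).congr fun k => ?_
  simp only [Function.comp_apply]
  rw [show 2 * k + 1 + 2 * n = 2 * n + 2 * k + 1 by ring]

/-- The terms of the power series of the even part of a multipole. -/
def expansionTerm (n : ℕ) (l z : ℂ) (k : ℕ) : ℂ :=
  if n + k + 1 = 1 then 0 else
    ((2 * n + 2 * k + 1).choose (2 * n) : ℂ) * z ^ (2 * k + 1) * l⁻¹ ^ (2 * (n + k + 1))

/-- Averaging over l and -l removes the even powers of z from the binomial series. For n = 0 the
convergence term z/l² of ζ cancels exactly the linear power, which is the reason for the convention
S_1 = 0. -/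
lemma hasSum_multipoleTerm (n : ℕ) {l z : ℂ} (hl : l ≠ 0) (hz : ‖z‖ < ‖l‖) :
    HasSum (expansionTerm n l z)
      (-(multipoleTerm n l z + multipoleTerm n (-l) z) / 2) := by
  have hx : ‖z / l‖ < 1 := by rwa [norm_div, div_lt_one (by positivity)]
  have hx' : ‖-(z / l)‖ < 1 := by rwa [norm_neg]
  have h1 := hasSum_choose_mul_geometric_of_norm_lt_one (2 * n) hx
  have h2 := hasSum_choose_mul_geometric_of_norm_lt_one (2 * n) hx'
  have h3 := ((h1.sub h2).div_const 2).mul_left (l⁻¹ ^ (2 * n + 1))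
  have hi : Function.Injective fun k : ℕ => 2 * k + 1 := fun a b h => by simpa using h
  rw [← hi.hasSum_iff] at h3
  swap
  · intro j hj
    have : Even j := by
      rw [← Nat.not_odd_iff_even]
      rintro ⟨k, rfl⟩
      exact hj ⟨k, rfl⟩
    rw [this.neg_pow]; simp
  have h4 : HasSum (fun k : ℕ =>
      ((2 * n + 2 * k + 1).choose (2 * n) : ℂ) * z ^ (2 * k + 1) * l⁻¹ ^ (2 * (n + k + 1)))
      (-(((z - l) ^ (2 * n + 1))⁻¹ + ((z - -l) ^ (2 * n + 1))⁻¹) / 2) := by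
    convert! h3 using 1
    · ext k
      simp only [Function.comp_apply]
      rw [show 2 * k + 1 + 2 * n = 2 * n + 2 * k + 1 by ring, (odd_two_mul_add_one k).neg_pow,
        div_eq_mul_inv z l, mul_pow]
      ring
    · have e1 : z - l = -(l * (1 - z / l)) := by field_simp; ring
      have e2 : z - -l = l * (1 - -(z / l)) := by field_simp; ring
      rw [e1, e2, (odd_two_mul_add_one n).neg_pow, mul_pow, mul_pow]
      simp only [mul_inv, inv_neg, one_div, inv_pow]
      ring
  by_cases hn : n = 0
  · subst hn
    have h5 := h4.sub (hasSum_ite_eq 0 (z * l⁻¹ ^ 2))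
    convert! h5 using 1
    · ext k
      by_cases hk : k = 0
      · simp [hk, expansionTerm]
      · simp [hk, expansionTerm]
    · simp only [multipoleTerm, if_true]
      field_simp
      ring
  · convert! h4 using 1
    · ext k; rw [expansionTerm, if_neg (by omega)]
    · simp [multipoleTerm, hn]

/-- Normalising by ℓ separates the variables: the terms are dominated by a binomial series in ‖z‖/ℓ
< 1 times the convergent sum of (ℓ/‖l‖)³. -/
lemma IsTubeLattice.summable_double (hL : IsTubeLattice L ℓ) (n : ℕ) {z : ℂ} (hz : ‖z‖ < ℓ) :
    Summable fun p : ℕ × {l : L.lattice // l ≠ 0} => expansionTerm n (p.2 : ℂ) z p.1 := by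
  have ht : |‖z‖ / ℓ| < 1 := by
    rw [abs_of_nonneg (div_nonneg (norm_nonneg _) hL.pos.le), div_lt_one hL.pos]; exact hz
  have hs := ((summable_choose_odd n ht).mul_left ((ℓ ^ (2 * n + 1))⁻¹)).mul_of_nonneg
    (summable_div_norm_lattice L ℓ)
    (fun k => by have := hL.pos.le; simp only [Pi.zero_apply]; positivity)
    (fun l => by have := hL.pos.le; simp only [Pi.zero_apply]; positivity)
  refine .of_norm_bounded hs fun p => ?_
  have hℓ := hL.pos
  have hl0 : ((p.2 : L.lattice) : ℂ) ≠ 0 := by simpa using p.2.2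
  rw [expansionTerm]
  split_ifs with h
  · rw [norm_zero]; positivity
  · have h1 := hL.norm_div_pow_le (m := n + p.1 + 1) (by omega) p.2
    rw [hL.spacing_eq, norm_pow, norm_div, Complex.norm_real, Real.norm_of_nonneg hℓ.le] at h1
    rw [norm_mul, norm_mul, Complex.norm_natCast, norm_pow, norm_pow, norm_inv]
    have e : ‖((p.2 : L.lattice) : ℂ)‖⁻¹ ^ (2 * (n + p.1 + 1)) = (ℓ ^ (2 * n + 1))⁻¹ *
        (ℓ ^ (2 * p.1 + 1))⁻¹ * (ℓ / ‖((p.2 : L.lattice) : ℂ)‖) ^ (2 * (n + p.1 + 1)) := by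
      have : ‖((p.2 : L.lattice) : ℂ)‖ ≠ 0 := by simpa using hl0
      rw [div_pow, inv_pow, show 2 * (n + p.1 + 1) = (2 * n + 1) + (2 * p.1 + 1) by ring, pow_add ℓ]
      field_simp
      ring
    rw [e]
    calc _ ≤ ((2 * n + 2 * p.1 + 1).choose (2 * n) : ℝ) * ‖z‖ ^ (2 * p.1 + 1) *
          ((ℓ ^ (2 * n + 1))⁻¹ * (ℓ ^ (2 * p.1 + 1))⁻¹ * (ℓ / ‖((p.2 : L.lattice) : ℂ)‖) ^ 3) := by
          gcongr
      _ = _ := by rw [div_pow ‖z‖]; ring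

lemma hasSum_multipoleTerm_ne_zero (L : PeriodPair) (n : ℕ) (z : ℂ) :
    HasSum (fun l : {l : L.lattice // l ≠ 0} => multipoleTerm n (l : ℂ) z)
      (multipole L n z - (z ^ (2 * n + 1))⁻¹) := by
  classical
  have h1 := (hasSum_multipole L n z).sub (hasSum_ite_eq (0 : L.lattice) ((z ^ (2 * n + 1))⁻¹))
  have hi : Function.Injective ((↑) : {l : L.lattice // l ≠ 0} → L.lattice) :=
    Subtype.val_injective
  rw [← hi.hasSum_iff] at h1
  · convert! h1 using 1
    ext l
    have : (l : L.lattice) ≠ 0 := l.2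
    simp [this]
  · intro l hl
    have : l = 0 := by simpa using hl
    subst this
    simp [multipoleTerm]

lemma hasSum_multipoleTerm_neg (L : PeriodPair) (n : ℕ) (z : ℂ) :
    HasSum (fun l : {l : L.lattice // l ≠ 0} => multipoleTerm n (-(l : ℂ)) z)
      (multipole L n z - (z ^ (2 * n + 1))⁻¹) := by
  let e : {l : L.lattice // l ≠ 0} ≃ {l : L.lattice // l ≠ 0} :=
    (Equiv.neg L.lattice).subtypeEquiv fun l => by simp
  have h := e.hasSum_iff.mpr (hasSum_multipoleTerm_ne_zero L n z)
  convert! h using 1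

lemma IsTubeLattice.hasSum_expansionTerm (hL : IsTubeLattice L ℓ) (n k : ℕ) (z : ℂ) :
    HasSum (fun l : {l : L.lattice // l ≠ 0} => expansionTerm n (l : ℂ) z k)
      (regCoeff L n k * z ^ (2 * k + 1)) := by
  have hℓ : (ℓ : ℂ) ≠ 0 := by exact_mod_cast hL.pos.ne'
  by_cases hk : n + k + 1 = 1
  · simp [hk, regCoeff, latticeSum, expansionTerm, hasSum_zero]
  · simp only [hk, if_false, expansionTerm]
    have h3 := (hL.summable_latticeSum (m := n + k + 1) (by omega)).hasSum.mul_left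
      (((2 * n + 2 * k + 1).choose (2 * n) : ℂ) * z ^ (2 * k + 1) / ℓ ^ (2 * (n + k + 1)))
    convert! h3 using 1
    · ext l
      rw [hL.spacing_eq, div_pow, inv_pow]
      field_simp
    · rw [regCoeff, latticeSum, if_neg hk, hL.spacing_eq]; ring

lemma hasSum_prod_fiberwise_swap {β κ : Type*} {f : β × κ → ℂ} {g : κ → ℂ} {s : ℂ}
    (hf : HasSum f s) (hg : ∀ c, HasSum (fun b => f (b, c)) (g c)) : HasSum g s :=
  ((Equiv.prodComm κ β).hasSum_iff.mpr hf).prod_fiberwise hg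

/-- The sum over l ≠ 0 may be averaged with its image under l ↦ -l; each averaged summand is an odd
power series, and absolute convergence of the double series allows summing over the lattice first.
-/
theorem IsTubeLattice.hasSum_multipole_expansion (hL : IsTubeLattice L ℓ) (n : ℕ) {z : ℂ}
    (hz : ‖z‖ < ℓ) :
    HasSum (fun k => regCoeff L n k * z ^ (2 * k + 1))
      ((z ^ (2 * n + 1))⁻¹ - multipole L n z) := by
  have hall := (((hasSum_multipoleTerm_ne_zero L n z).add
    (hasSum_multipoleTerm_neg L n z)).neg.div_const 2)
  have hs := (hL.summable_double n hz).hasSum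
  have hterm : ∀ l : {l : L.lattice // l ≠ 0}, HasSum (expansionTerm n (l : ℂ) z)
      (-(multipoleTerm n l z + multipoleTerm n (-(l : ℂ)) z) / 2) := fun l =>
    hasSum_multipoleTerm n (by simpa using l.2)
      (hz.trans_le (hL.norm_le l l.1.2 (by simpa using l.2)))
  have hval := (hasSum_prod_fiberwise_swap hs hterm).unique hall
  rw [hval] at hs
  have h := hs.prod_fiberwise fun k => hL.hasSum_expansionTerm n k z
  rwa [show -(multipole L n z - (z ^ (2 * n + 1))⁻¹ + (multipole L n z - (z ^ (2 * n + 1))⁻¹)) / 2 =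
    (z ^ (2 * n + 1))⁻¹ - multipole L n z by ring] at h

lemma IsTubeLattice.summable_regCoeff (hL : IsTubeLattice L ℓ) (n : ℕ) {r : ℝ} (h0 : 0 ≤ r)
    (hr : r < ℓ) : Summable fun k => ‖regCoeff L n k‖ * r ^ (2 * k + 1) := by
  have h := (hL.hasSum_multipole_expansion n (z := (r : ℂ))
    (by rwa [Complex.norm_real, Real.norm_of_nonneg h0])).summable.norm
  refine h.congr fun k => ?_
  rw [norm_mul, norm_pow, Complex.norm_real, Real.norm_of_nonneg h0]

/-! ### Fourier modes on a circle -/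

/-- The Fourier coefficients of a function of the angle. -/
def mode (m : ℤ) (β : ℝ → ℂ) : ℂ :=
  (1 / (2 * Real.pi)) * ∫ θ in Ioo (-Real.pi) Real.pi, β θ * Complex.exp (-(m * θ * Complex.I))

lemma integral_exp_int (j : ℤ) :
    ∫ θ in Ioo (-Real.pi) Real.pi, Complex.exp (j * θ * Complex.I) =
      if j = 0 then (2 * Real.pi : ℂ) else 0 := by
  rw [← integral_Ioc_eq_integral_Ioo, ← intervalIntegral.integral_of_le (by linarith [Real.pi_pos])]
  split_ifs with h
  · subst h; simp; ring
  · have hc : (j * Complex.I : ℂ) ≠ 0 := by simp [h]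
    have := integral_exp_mul_complex (a := -Real.pi) (b := Real.pi) hc
    have e : ∀ θ : ℝ, (j * θ * Complex.I : ℂ) = j * Complex.I * θ := fun θ => by ring
    simp only [e]
    rw [this]
    have h1 : Complex.exp (j * Complex.I * Real.pi) =
        Complex.exp (j * Complex.I * ((-Real.pi : ℝ) : ℂ)) := by
      rw [Complex.exp_eq_exp_iff_exists_int]
      exact ⟨j, by push_cast; ring⟩
    rw [h1, sub_self, zero_div]

lemma mode_exp (m j : ℤ) :
    mode m (fun θ => Complex.exp (j * θ * Complex.I)) = if j = m then 1 else 0 := by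
  have e : ∀ θ : ℝ, Complex.exp (j * θ * Complex.I) * Complex.exp (-(m * θ * Complex.I)) =
      Complex.exp ((j - m : ℤ) * θ * Complex.I) := fun θ => by
    rw [← Complex.exp_add]; congr 1; push_cast; ring
  simp only [mode, e, integral_exp_int, sub_eq_zero]
  split_ifs
  · have : (Real.pi : ℂ) ≠ 0 := by exact_mod_cast Real.pi_ne_zero
    field_simp
  · simp

lemma IntegrableOn.mul_exp_int {β : ℝ → ℂ} {s : Set ℝ} (hβ : IntegrableOn β s) (m : ℤ) :
    IntegrableOn (fun θ : ℝ => β θ * Complex.exp (-(m * θ * Complex.I))) s := by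
  refine Integrable.mul_bdd (c := 1) hβ (by fun_prop) ?_
  refine Eventually.of_forall fun θ => ?_
  rw [Complex.norm_exp]; simp

lemma mode_add {β β' : ℝ → ℂ} (h : IntegrableOn β (Ioo (-Real.pi) Real.pi))
    (h' : IntegrableOn β' (Ioo (-Real.pi) Real.pi)) (m : ℤ) :
    mode m (fun θ => β θ + β' θ) = mode m β + mode m β' := by
  simp only [mode, add_mul]
  rw [integral_add (IntegrableOn.mul_exp_int h m) (IntegrableOn.mul_exp_int h' m), mul_add]

lemma mode_const_mul (c : ℂ) (β : ℝ → ℂ) (m : ℤ) :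
    mode m (fun θ => c * β θ) = c * mode m β := by
  simp only [mode, mul_assoc]
  rw [integral_const_mul]; ring

lemma norm_mode_le {β : ℝ → ℂ} {M : ℝ} (hM : ∀ θ, ‖β θ‖ ≤ M) (m : ℤ) : ‖mode m β‖ ≤ M := by
  have hv : volume.real (Ioo (-Real.pi) Real.pi) = 2 * Real.pi := by
    rw [Real.volume_real_Ioo_of_le (by linarith [Real.pi_pos])]; ring
  have := norm_setIntegral_le_of_norm_le_const (μ := volume) (s := Ioo (-Real.pi) Real.pi)
    (f := fun θ => β θ * Complex.exp (-(m * θ * Complex.I))) (C := M) (by simp) (fun θ _ => by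
      rw [norm_mul, Complex.norm_exp]; simpa using hM θ)
  rw [hv] at this
  have hpi : (0 : ℝ) < 2 * Real.pi := by positivity
  rw [mode, norm_mul]
  have e : ‖(1 / (2 * Real.pi) : ℂ)‖ = (2 * Real.pi)⁻¹ := by
    rw [show (1 / (2 * Real.pi) : ℂ) = (((2 * Real.pi)⁻¹ : ℝ) : ℂ) by push_cast; ring,
      Complex.norm_real, Real.norm_of_nonneg (by positivity)]
  rw [e, inv_mul_le_iff₀ hpi]
  linarith

variable {L : PeriodPair} {ℓ a : ℝ}

lemma circle_pow (a θ : ℝ) (k : ℕ) : ((a : ℂ) * Complex.exp (θ * Complex.I)) ^ k =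
    (a : ℂ) ^ k * Complex.exp (-((-k : ℤ) * θ * Complex.I)) := by
  rw [mul_pow, ← Complex.exp_nat_mul]
  congr 2; push_cast; ring

/-- Integration of a function on a circle around the origin against a multipole. -/
lemma IsTubeLattice.hasSum_integral_mul_multipole (hL : IsTubeLattice L ℓ) (ha : 0 < a)
    (haℓ : a < ℓ) {β : ℝ → ℂ} (hβ : IntegrableOn β (Ioo (-Real.pi) Real.pi)) (n : ℕ) :
    HasSum (fun k : ℕ => regCoeff L n k * (a : ℂ) ^ (2 * k + 1) * mode (-(2 * k + 1 : ℕ)) β)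
      (((a : ℂ) ^ (2 * n + 1))⁻¹ * mode (2 * n + 1 : ℕ) β - (1 / (2 * Real.pi)) *
        ∫ θ in Ioo (-Real.pi) Real.pi, β θ * multipole L n (a * Complex.exp (θ * Complex.I))) := by
  have hn : ∀ θ : ℝ, ‖(a * Complex.exp (θ * Complex.I) : ℂ)‖ = a := fun θ => by
    rw [norm_mul, Complex.norm_exp_ofReal_mul_I, mul_one, Complex.norm_real,
      Real.norm_of_nonneg ha.le]
  have hexp := fun θ : ℝ => hL.hasSum_multipole_expansion n
    (z := a * Complex.exp (θ * Complex.I)) (by rw [hn]; exact haℓ)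
  set F : ℕ → ℝ → ℂ := fun k θ =>
    β θ * (regCoeff L n k * (a * Complex.exp (θ * Complex.I)) ^ (2 * k + 1)) with hF
  have hFe : ∀ k θ, F k θ = (regCoeff L n k * (a : ℂ) ^ (2 * k + 1)) *
      (β θ * Complex.exp (-((-(2 * k + 1 : ℕ) : ℤ) * θ * Complex.I))) := fun k θ => by
    rw [hF]; simp only; rw [circle_pow]; ring
  have hint : ∀ k, IntegrableOn (F k) (Ioo (-Real.pi) Real.pi) := fun k => by
    have := (IntegrableOn.mul_exp_int hβ (-(2 * k + 1 : ℕ))).const_mul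
      (regCoeff L n k * (a : ℂ) ^ (2 * k + 1))
    refine this.congr (Eventually.of_forall fun θ => (hFe k θ).symm)
  have hsum : Summable fun k => ∫ θ in Ioo (-Real.pi) Real.pi, ‖F k θ‖ := by
    refine ((hL.summable_regCoeff n ha.le haℓ).mul_left
      (∫ θ in Ioo (-Real.pi) Real.pi, ‖β θ‖)).congr fun k => ?_
    rw [← integral_mul_const]
    refine integral_congr_ae (Eventually.of_forall fun θ => ?_)
    simp only [hF]
    rw [norm_mul, norm_mul, norm_pow, hn]
  have h := (hasSum_integral_of_summable_integral_norm hint hsum).mul_left (1 / (2 * Real.pi) : ℂ)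
  have e1 : ∀ θ : ℝ, ∑' k, F k θ = β θ * (((a : ℂ) * Complex.exp (θ * Complex.I)) ^ (2 * n + 1))⁻¹ -
      β θ * multipole L n (a * Complex.exp (θ * Complex.I)) := fun θ => by
    rw [← mul_sub]; exact ((hexp θ).mul_left (β θ)).tsum_eq
  have e2 : ∀ θ : ℝ, (((a : ℂ) * Complex.exp (θ * Complex.I)) ^ (2 * n + 1))⁻¹ =
      ((a : ℂ) ^ (2 * n + 1))⁻¹ * Complex.exp (-((2 * n + 1 : ℕ) * θ * Complex.I)) := fun θ => by
    rw [circle_pow, mul_inv, ← Complex.exp_neg]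
    congr 2; push_cast; ring
  have i1 : IntegrableOn (fun θ : ℝ => β θ *
      (((a : ℂ) * Complex.exp (θ * Complex.I)) ^ (2 * n + 1))⁻¹) (Ioo (-Real.pi) Real.pi) := by
    have := (IntegrableOn.mul_exp_int hβ (2 * n + 1 : ℕ)).const_mul (((a : ℂ) ^ (2 * n + 1))⁻¹)
    refine this.congr (Eventually.of_forall fun θ => ?_)
    simp only [e2]; push_cast; ring
  have hcont : Continuous fun θ : ℝ => multipole L n (a * Complex.exp (θ * Complex.I)) := by
    rw [continuous_iff_continuousAt]
    intro θ
    have hnl : (a * Complex.exp (θ * Complex.I) : ℂ) ∉ L.lattice := fun h => by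
      have h1 := hL.norm_le _ h (by rw [← norm_pos_iff, hn]; exact ha)
      rw [hn] at h1; linarith
    have hc := ((differentiableOn_multipole L n).differentiableAt
      (L.isClosed_lattice.isOpen_compl.mem_nhds hnl)).continuousAt
    exact ContinuousAt.comp (f := fun θ : ℝ => (a * Complex.exp (θ * Complex.I) : ℂ)) hc
      (by fun_prop)
  have hbd : ∃ C, ∀ θ : ℝ, ‖multipole L n (a * Complex.exp (θ * Complex.I))‖ ≤ C := by
    refine ⟨((a : ℝ) ^ (2 * n + 1))⁻¹ + ∑' k, ‖regCoeff L n k‖ * a ^ (2 * k + 1), fun θ => ?_⟩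
    have h1 := tsum_of_norm_bounded (hL.summable_regCoeff n ha.le haℓ).hasSum
      (f := fun k => regCoeff L n k * (a * Complex.exp (θ * Complex.I)) ^ (2 * k + 1))
      (fun k => by rw [norm_mul, norm_pow, hn])
    rw [(hexp θ).tsum_eq, norm_sub_rev] at h1
    have h2 := norm_le_norm_add_norm_sub' (multipole L n (a * Complex.exp (θ * Complex.I)))
      ((((a : ℂ) * Complex.exp (θ * Complex.I)) ^ (2 * n + 1))⁻¹)
    rw [norm_inv, norm_pow, hn] at h2
    linarith
  obtain ⟨C, hC⟩ := hbd
  have i2 : IntegrableOn (fun θ : ℝ => β θ * multipole L n (a * Complex.exp (θ * Complex.I)))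
      (Ioo (-Real.pi) Real.pi) :=
    Integrable.mul_bdd (c := C) hβ hcont.aestronglyMeasurable (Eventually.of_forall hC)
  simp only [e1] at h
  rw [integral_sub i1 i2] at h
  convert! h using 1
  · ext k
    simp only [hFe]
    rw [integral_const_mul, mode]; ring
  · simp only [e2, mode]
    have : ∀ θ : ℝ, β θ * (((a : ℂ) ^ (2 * n + 1))⁻¹ *
        Complex.exp (-((2 * n + 1 : ℕ) * θ * Complex.I))) = ((a : ℂ) ^ (2 * n + 1))⁻¹ *
        (β θ * Complex.exp (-(((2 * n + 1 : ℕ) : ℤ) * θ * Complex.I))) := fun θ => by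
      push_cast; ring
    simp only [this]
    rw [integral_const_mul]; ring

/-! ### The Legendre relation -/

/-- Every host point is translated into the Voronoi cell, where the closed host is compact. -/
lemma exists_norm_le_of_periodic (L : PeriodPair) {a : ℝ} {F : ℂ → ℂ}
    (hF : ContinuousOn F (voronoi L ∩ {z | a ≤ ‖z‖}))
    (hper : ∀ p ∈ L.lattice, ∀ z ∈ host L a, F (z + p) = F z) :
    ∃ M, ∀ z ∈ host L a, ‖F z‖ ≤ M := by
  obtain ⟨M, hM⟩ := ((isCompact_voronoi L).inter_right
    (isClosed_le continuous_const continuous_norm)).exists_bound_of_continuousOn hF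
  refine ⟨M, fun z hz => ?_⟩
  obtain ⟨p, hp, h⟩ := exists_sub_mem_voronoi L z
  have hzp : z - p ∈ host L a := fun q hq => by
    have := hz (p + q) (L.lattice.add_mem hp hq)
    rwa [← sub_sub] at this
  have h1 := hper p hp (z - p) hzp
  rw [sub_add_cancel] at h1
  rw [h1]
  exact hM _ ⟨h, by simpa using hzp 0 L.lattice.zero_mem⟩

lemma voronoi_inter_subset_compl (L : PeriodPair) {a : ℝ} (ha : 0 < a) :
    voronoi L ∩ {z | a ≤ ‖z‖} ⊆ (L.lattice : Set ℂ)ᶜ := fun z hz h => by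
  have := hz.1 z h
  have h2 : a ≤ ‖z‖ := hz.2
  rw [sub_self, norm_zero] at this
  linarith

lemma host_subset_compl (L : PeriodPair) {a : ℝ} (ha : 0 < a) :
    host L a ⊆ (L.lattice : Set ℂ)ᶜ := fun z hz h => by
  have := hz z h
  rw [sub_self, norm_zero] at this
  linarith

lemma openHost_subset_host (L : PeriodPair) (a : ℝ) : openHost L a ⊆ host L a :=
  fun _ hz p hp => (hz p hp).le

lemma closedBall_subset_voronoi {L : PeriodPair} {a ℓ : ℝ} (haℓ : 2 * a ≤ ℓ)
    (hℓ : ∀ p ∈ L.lattice, p ≠ 0 → ℓ ≤ ‖p‖) : closedBall (0 : ℂ) a ⊆ voronoi L := fun z hz p hp => by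
  rw [mem_closedBall_zero_iff] at hz
  rcases eq_or_ne p 0 with rfl | h
  · simp
  · have := hℓ p hp h
    have h2 := norm_sub_norm_le p z
    rw [norm_sub_rev] at h2
    linarith

lemma volume_voronoi_inter {L : PeriodPair} {a ℓ : ℝ} (ha : 0 ≤ a) (haℓ : 2 * a ≤ ℓ)
    (hℓ : ∀ p ∈ L.lattice, p ≠ 0 → ℓ ≤ ‖p‖) :
    volume.real (voronoi L ∩ {z | a < ‖z‖}) = volume.real (cell L) - Real.pi * a ^ 2 := by
  have e : voronoi L ∩ {z | a < ‖z‖} = voronoi L \ closedBall 0 a := by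
    ext z; simp
  rw [e, measureReal_sdiff (closedBall_subset_voronoi haℓ hℓ) isClosed_closedBall.measurableSet
    (isCompact_voronoi L).measure_lt_top.ne, volume_voronoi_eq]
  congr 1
  rw [measureReal_def, Complex.volume_closedBall]
  simp [ENNReal.toReal_ofReal ha, mul_comm]

lemma contDiffOn_real_of_differentiableOn {F : ℂ → ℂ} {s : Set ℂ} (hs : IsOpen s)
    (hF : DifferentiableOn ℂ F s) : ContDiffOn ℝ 1 F s :=
  (hF.contDiffOn hs).restrict_scalars ℝ

lemma dbar_eq_zero_of_differentiableAt {F : ℂ → ℂ} {z : ℂ} (hF : DifferentiableAt ℂ F z) :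
    dbar F z = 0 := by
  rw [HasFDerivAt.dbar_eq (hF.hasDerivAt.hasFDerivAt.restrictScalars ℝ)]
  simp
  ring_nf
  simp

lemma dbar_const_mul_conj (B z : ℂ) : dbar (fun w => B * (starRingEnd ℂ) w) z = B := by
  have h : HasFDerivAt (fun w => B * (starRingEnd ℂ) w) (B • (Complex.conjCLE : ℂ →L[ℝ] ℂ)) z :=
    (Complex.conjCLE.hasFDerivAt (x := z)).const_mul B
  rw [HasFDerivAt.dbar_eq h]
  simp
  ring_nf
  simp
  ring

variable {L : PeriodPair} {ℓ : ℝ}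

/-- The lattice points whose increment is `B * conj p` form a subgroup, so the two generators
suffice. The first one defines `B`. The second is ρ times the first, and ζ(ρz) = ρ⁻¹ ζ(z) multiplies
the increment by ρ⁻¹ = conj ρ. Without the rotation a term linear in p would appear as well. -/
lemma IsTubeLattice.exists_zeta_add_eq (hL : IsTubeLattice L ℓ) :
    ∃ B : ℂ, ∀ p ∈ L.lattice, ∀ z ∉ L.lattice,
      multipole L 0 (z + p) = multipole L 0 z + B * (starRingEnd ℂ) p := by
  obtain ⟨ρ, hρ, -, h1, h2, hω⟩ := hL.exists_rotation
  have hρ0 : ρ ≠ 0 := norm_pos_iff.mp (by simp [hρ])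
  obtain ⟨c, hc⟩ := exists_zeta_add L L.ω₁_mem_lattice
  have hℓ : (ℓ : ℂ) ≠ 0 := by exact_mod_cast hL.pos.ne'
  refine ⟨c / ℓ, ?_⟩
  let A : AddSubgroup ℂ :=
    { carrier := {p | p ∈ L.lattice ∧ ∀ z ∉ L.lattice,
        multipole L 0 (z + p) = multipole L 0 z + c / ℓ * (starRingEnd ℂ) p}
      zero_mem' := ⟨L.lattice.zero_mem, fun z _ => by simp⟩
      add_mem' := by
        rintro p q ⟨hp, hp'⟩ ⟨hq, hq'⟩
        refine ⟨L.lattice.add_mem hp hq, fun z hz => ?_⟩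
        rw [← add_assoc, hq' _ (fun h => hz (by simpa using L.lattice.sub_mem h hp)), hp' z hz,
          map_add]
        ring
      neg_mem' := by
        rintro p ⟨hp, hp'⟩
        refine ⟨L.lattice.neg_mem hp, fun z hz => ?_⟩
        have := hp' (z + -p) (fun h => hz (by simpa using L.lattice.add_mem h hp))
        rw [neg_add_cancel_right] at this
        rw [this, map_neg]
        ring }
  have hA : L.lattice ≤ AddSubgroup.toIntSubmodule A := by
    rw [PeriodPair.lattice, Submodule.span_le]
    rintro p (rfl | rfl)
    · refine ⟨L.ω₁_mem_lattice, fun z hz => ?_⟩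
      rw [hc z hz, hL.omega₁_eq, Complex.conj_ofReal, div_mul_cancel₀ _ hℓ]
    · refine ⟨L.ω₂_mem_lattice, fun z hz => ?_⟩
      have hz' : ρ⁻¹ * z ∉ L.lattice := fun h => hz (by simpa [hρ0] using h1 _ h)
      have := hc _ hz'
      have e1 := multipole_mul L hρ0 h1 h2 (ρ⁻¹ * z + L.ω₁)
      have e2 := multipole_mul L hρ0 h1 h2 (ρ⁻¹ * z)
      rw [mul_add, mul_inv_cancel_left₀ hρ0, hL.omega₁_eq, ← hω] at e1
      rw [mul_inv_cancel_left₀ hρ0] at e2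
      rw [hL.omega₁_eq] at this
      rw [e1, e2, this, hω, map_mul, Complex.conj_ofReal,
        ← Complex.inv_eq_conj hρ]
      field_simp
  intro p hp
  exact (hA hp).2

/-- The function ζ(z) - B z̄ is periodic with ∂̄-derivative -B. Stokes outside a disk balances -B
times the remaining area against the residue 1 of ζ and the contribution of z̄ on the circle; the
terms in a² cancel and leave B S = π. -/
lemma IsTubeLattice.zeta_add (hL : IsTubeLattice L ℓ) {p z : ℂ} (hp : p ∈ L.lattice)
    (hz : z ∉ L.lattice) : multipole L 0 (z + p) =
      multipole L 0 z + Real.pi / volume.real (cell L) * (starRingEnd ℂ) p := by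
  obtain ⟨B, hB⟩ := hL.exists_zeta_add_eq
  suffices h : B * volume.real (cell L) = Real.pi by
    have h0 : (volume.real (cell L) : ℂ) ≠ 0 := by exact_mod_cast (volume_cell_pos L).ne'
    rw [hB p hp z hz, ← h, mul_div_cancel_right₀ _ h0]
  -- An auxiliary radius without physical meaning; any positive value with `2 * a ≤ ℓ` would serve.
  set a := ℓ / 4 with ha_def
  have ha : 0 < a := by have := hL.pos; positivity
  have haℓ : 2 * a ≤ ℓ := by have := hL.pos; linarith
  have hO : IsOpen (L.lattice : Set ℂ)ᶜ := L.isClosed_lattice.isOpen_compl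
  have hsub := (openHost_subset_host L a).trans (host_subset_compl L ha)
  have hFc : ContDiffOn ℝ 1 (fun z => multipole L 0 z - B * (starRingEnd ℂ) z)
      (L.lattice : Set ℂ)ᶜ := by
    refine (contDiffOn_real_of_differentiableOn hO (differentiableOn_multipole L 0)).sub ?_
    exact (contDiff_const.mul Complex.conjCLE.contDiff).contDiffOn
  have hper : ∀ p ∈ L.lattice, ∀ z ∈ host L a,
      multipole L 0 (z + p) - B * (starRingEnd ℂ) (z + p) =
      multipole L 0 z - B * (starRingEnd ℂ) z := fun p hp z hz => by
    rw [hB p hp z (host_subset_compl L ha hz), map_add]; ring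
  obtain ⟨M, hM⟩ := exists_norm_le_of_periodic L
    (hFc.continuousOn.mono (voronoi_inter_subset_compl L ha)) hper
  have hdbar : ∀ z ∈ voronoi L ∩ {z | a < ‖z‖},
      dbar (fun z => multipole L 0 z - B * (starRingEnd ℂ) z) z = -B := by
    intro z hz
    have hz' : z ∈ (L.lattice : Set ℂ)ᶜ := hsub (mem_openHost_of_mem_voronoi hz.1 hz.2)
    have hd := (differentiableOn_multipole L 0).differentiableAt (hO.mem_nhds hz')
    have h1 := dbar_eq_zero_of_differentiableAt hd
    have h2 := dbar_const_mul_conj B z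
    rw [dbar] at h1 h2 ⊢
    have hd' : DifferentiableAt ℝ (fun w => B * (starRingEnd ℂ) w) z :=
      ((Complex.conjCLE.hasFDerivAt (x := z)).const_mul B).differentiableAt
    rw [fderiv_fun_sub (hd.restrictScalars ℝ) hd']
    simp only [sub_apply]
    linear_combination h1 - h2
  have hmeas : MeasurableSet (voronoi L ∩ {z | a < ‖z‖}) :=
    (isClosed_voronoi L).measurableSet.inter (measurableSet_lt measurable_const measurable_norm)
  have hfin : volume (voronoi L ∩ {z | a < ‖z‖}) ≠ ⊤ :=
    ((measure_mono inter_subset_left).trans_lt (isCompact_voronoi L).measure_lt_top).ne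
  have key := host_stokes (F := fun z => multipole L 0 z - B * (starRingEnd ℂ) z) ha haℓ hL.norm_le
    (fun p hp z hz => hper p hp z (openHost_subset_host L a hz)) (hFc.mono hsub)
    (fun z hz => hM z (openHost_subset_host L a hz))
    ((integrableOn_const hfin (C := -B)).congr_fun (fun z hz => (hdbar z hz).symm) hmeas)
    (b := fun θ => multipole L 0 (a * Complex.exp (θ * Complex.I)) -
      B * (starRingEnd ℂ) (a * Complex.exp (θ * Complex.I))) ?_
  · rw [setIntegral_congr_fun hmeas hdbar, setIntegral_const, volume_voronoi_inter ha.le haℓ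
      hL.norm_le] at key
    have hβ : IntegrableOn (fun θ : ℝ => Complex.exp ((1 : ℤ) * θ * Complex.I))
        (Ioo (-Real.pi) Real.pi) :=
      ((by fun_prop : Continuous fun θ : ℝ => Complex.exp ((1 : ℤ) * θ * Complex.I)
        ).integrableOn_Icc (a := -Real.pi) (b := Real.pi)).mono_set Ioo_subset_Icc_self
    -- Testing the expansion of ζ against e^(iθ) extracts its residue: the regular part pairs with
    -- negative modes, all of which vanish.
    have h2 := hL.hasSum_integral_mul_multipole ha (by linarith) hβ 0
    have h3 : ∀ k : ℕ, regCoeff L 0 k * (a : ℂ) ^ (2 * k + 1) *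
        mode (-(2 * k + 1 : ℕ)) (fun θ : ℝ => Complex.exp ((1 : ℤ) * θ * Complex.I)) = 0 := by
      intro k
      rw [mode_exp, if_neg (by push_cast; omega), mul_zero]
    simp only [h3] at h2
    have h4 := h2.unique hasSum_zero
    rw [mode_exp, if_pos (by norm_num)] at h4
    have h5 : ∀ θ : ℝ, (multipole L 0 (a * Complex.exp (θ * Complex.I)) -
        B * (starRingEnd ℂ) (a * Complex.exp (θ * Complex.I))) * Complex.exp (θ * Complex.I) =
        Complex.exp ((1 : ℤ) * θ * Complex.I) * multipole L 0 (a * Complex.exp (θ * Complex.I))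
          - B * a := by
      intro θ
      have : (starRingEnd ℂ) (Complex.exp (θ * Complex.I)) * Complex.exp (θ * Complex.I) = 1 := by
        rw [← Complex.exp_conj, ← Complex.exp_add]; simp
      rw [map_mul, Complex.conj_ofReal, Int.cast_one, one_mul]
      linear_combination -(B * a) * this
    simp only [h5] at key
    rw [integral_sub, setIntegral_const] at key
    · simp only [measureReal_def, Real.volume_Ioo] at key
      rw [ENNReal.toReal_ofReal (by linarith [Real.pi_pos])] at key
      simp only [Complex.real_smul] at key
      have hpi : (Real.pi : ℂ) ≠ 0 := by exact_mod_cast Real.pi_ne_zero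
      have ha0 : (a : ℂ) ≠ 0 := by exact_mod_cast ha.ne'
      rw [measureReal_def]
      push_cast at key h4
      generalize (∫ θ : ℝ in Ioo (-Real.pi) Real.pi, Complex.exp (1 * θ * Complex.I) *
        multipole L 0 (a * Complex.exp (θ * Complex.I))) = J at key h4
      have h6 : a * J = 2 * Real.pi := by
        have : (a : ℂ)⁻¹ * 1 = 1 / (2 * Real.pi) * J := by
          have := sub_eq_zero.mp h4; simpa using this
        field_simp at this
        exact this.symm
      linear_combination -key + (1/2) * h6
    · have hc : Continuous fun θ : ℝ => Complex.exp ((1 : ℤ) * θ * Complex.I) *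
          multipole L 0 (a * Complex.exp (θ * Complex.I)) := by
        refine Continuous.mul (by fun_prop) ?_
        refine (differentiableOn_multipole L 0).continuousOn.comp_continuous (by fun_prop) ?_
        intro θ
        refine voronoi_inter_subset_compl L ha ⟨closedBall_subset_voronoi haℓ hL.norm_le ?_, ?_⟩ <;>
          simp [Complex.norm_exp_ofReal_mul_I, abs_of_pos ha]
      exact (hc.integrableOn_Icc (a := -Real.pi) (b := Real.pi)).mono_set Ioo_subset_Icc_self
    · exact integrableOn_const (by simp)
  · refine Eventually.of_forall fun θ _ => ?_
    have hz : (a : ℂ) * Complex.exp (θ * Complex.I) ∈ (L.lattice : Set ℂ)ᶜ := by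
      refine voronoi_inter_subset_compl L ha ⟨closedBall_subset_voronoi haℓ hL.norm_le ?_, ?_⟩ <;>
          simp [Complex.norm_exp_ofReal_mul_I, abs_of_pos ha]
    have h1 := (hFc.continuousOn.continuousAt (hO.mem_nhds hz)).tendsto
    refine h1.comp (Tendsto.mono_left ?_ nhdsWithin_le_nhds)
    exact (by fun_prop : Continuous fun r : ℝ => (r : ℂ) * Complex.exp (θ * Complex.I)).tendsto a

lemma IsTubeLattice.volume_cell_eq (hL : IsTubeLattice L ℓ) :
    volume.real (cell L) = ℓ * |L.ω₂.im| := by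
  let T : ℂ →ₗ[ℝ] ℂ := Complex.reLm.smulRight L.ω₁ + Complex.imLm.smulRight L.ω₂
  have hT : ∀ z, T z = z.re * L.ω₁ + z.im * L.ω₂ := fun z => by simp [T]
  have hcell : cell L = T '' (Complex.measurableEquivRealProd ⁻¹'
      (Icc (-1 / 2 : ℝ) (1 / 2) ×ˢ Icc (-1 / 2 : ℝ) (1 / 2))) := by
    ext z
    constructor
    · rintro ⟨s, hs, t, ht, rfl⟩
      exact ⟨⟨s, t⟩, ⟨hs, ht⟩, hT _⟩
    · rintro ⟨w, ⟨h1, h2⟩, rfl⟩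
      exact ⟨w.re, h1, w.im, h2, hT w⟩
  have hdet : LinearMap.det T = ℓ * L.ω₂.im := by
    rw [← LinearMap.det_toMatrix Complex.basisOneI, Matrix.det_fin_two]
    simp [LinearMap.toMatrix_apply, hT, hL.omega₁_eq]
  rw [hcell, measureReal_def, Measure.addHaar_image_linearMap, hdet,
    Complex.volume_preserving_equiv_real_prod.measure_preimage
      (measurableSet_Icc.prod measurableSet_Icc).nullMeasurableSet]
  rw [Measure.volume_eq_prod, Measure.prod_prod, Real.volume_Icc]
  have := hL.pos
  norm_num [abs_mul, abs_of_pos hL.pos]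
  positivity

/-- The Legendre relation at z = -ω₁/2 together with the oddness of ζ gives 2η₁ = πℓ/S. Since S = ℓ
Im ω₂, η₁ is the real number π/(2 Im ω₂). -/
theorem IsTubeLattice.psi_eq (hL : IsTubeLattice L ℓ) (him : 0 < L.ω₂.im) :
    Psi L = (Real.pi / 2) • (1 : Matrix (Fin 2) (Fin 2) ℝ) := by
  have hz : -(L.ω₁ / 2) ∉ L.lattice := fun h =>
    L.ω₁_div_two_notMem_lattice (by simpa using L.lattice.neg_mem h)
  have h1 := hL.zeta_add L.ω₁_mem_lattice hz
  have h2 := multipole_mul L (ρ := -1) (by norm_num) (fun p hp => by simpa using hp)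
    (fun p hp => by simpa [inv_neg] using hp) (L.ω₁ / 2)
  have e : -(L.ω₁ / 2) + L.ω₁ = L.ω₁ / 2 := by ring
  rw [e, ← neg_one_mul (L.ω₁ / 2), h2, hL.volume_cell_eq, hL.omega₁_eq, Complex.conj_ofReal] at h1
  rw [← hL.omega₁_eq, multipole_zero_eq, ← eta₁, abs_of_pos him, inv_neg, inv_one] at h1
  have hℓ : (ℓ : ℂ) ≠ 0 := by exact_mod_cast hL.pos.ne'
  have him' : (L.ω₂.im : ℂ) ≠ 0 := by exact_mod_cast him.ne'
  have h3 : eta₁ L = ((Real.pi / (2 * L.ω₂.im) : ℝ) : ℂ) := by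
    push_cast at h1 ⊢
    rw [hL.omega₁_eq] at h1
    field_simp at h1 ⊢
    linear_combination h1
  have him0 := him.ne'
  rw [Psi, h3, Complex.ofReal_re, Complex.ofReal_im]
  ext i j
  fin_cases i <;> fin_cases j <;> simp
  · field_simp
  · field_simp
    ring

/-! ### Regularity of potentials at the interfaces -/

-- For a real harmonic function f_x - i f_y is holomorphic; the real and imaginary parts of `u` are
-- treated separately and recombined.
open InnerProductSpace in
lemma differentiableAt_dz_of_harmonicAt {u : ℂ → ℂ} {z : ℂ} (h : HarmonicAt u z) :
    DifferentiableAt ℂ (dz u) z := by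
  have h1 := _root_.HarmonicAt.differentiableAt_complex_partial (h.comp_CLM Complex.reCLM)
  have h2 := _root_.HarmonicAt.differentiableAt_complex_partial (h.comp_CLM Complex.imCLM)
  refine ((h1.add (h2.const_mul Complex.I)).const_mul (1 / 2)).congr_of_eventuallyEq ?_
  filter_upwards [h.eventually] with w hw
  have hd := (hw.1.differentiableAt two_ne_zero).hasFDerivAt
  simp only [Pi.add_apply]
  rw [(Complex.reCLM.hasFDerivAt.comp w hd).fderiv, (Complex.imCLM.hasFDerivAt.comp w hd).fderiv, dz]
  simp only [ContinuousLinearMap.comp_apply, Complex.reCLM_apply, Complex.imCLM_apply]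
  nth_rewrite 1 [← Complex.re_add_im (fderiv ℝ u w 1)]
  nth_rewrite 1 [← Complex.re_add_im (fderiv ℝ u w Complex.I)]
  ring

open InnerProductSpace in
lemma HarmonicAt.comp_conj {u : ℂ → ℂ} {z : ℂ} (h : HarmonicAt u ((starRingEnd ℂ) z)) :
    HarmonicAt (fun w => u ((starRingEnd ℂ) w)) z := by
  have hlap : ∀ w, Laplacian.laplacian (fun w => u ((starRingEnd ℂ) w)) w =
      Laplacian.laplacian u ((starRingEnd ℂ) w) := by
    intro w
    rw [laplacian_eq_iteratedFDeriv_complexPlane, laplacian_eq_iteratedFDeriv_complexPlane]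
    have := Complex.conjCLE.iteratedFDerivWithin_comp_right u uniqueDiffOn_univ (mem_univ (Complex.conjCLE w)) 2
    simp only [preimage_univ, iteratedFDerivWithin_univ] at this
    have e : (fun w => u ((starRingEnd ℂ) w)) = u ∘ Complex.conjCLE := rfl
    simp only [e, this]
    simp only [ContinuousMultilinearMap.compContinuousLinearMap_apply, iteratedFDeriv_two_apply]
    simp
  refine ⟨h.1.comp z Complex.conjCLE.contDiff.contDiffAt, ?_⟩
  have hc : Tendsto (starRingEnd ℂ) (𝓝 z) (𝓝 ((starRingEnd ℂ) z)) :=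
    Complex.continuous_conj.tendsto z
  filter_upwards [hc.eventually h.2] with w hw
  rw [hlap, hw]
  rfl

/-- Being C¹ up to the boundary means that some derivative within `s` varies continuously, and in
the interior it is the true one. Unique differentiability of `s` is not required, so the statement
is also available at contact points of the host. -/
lemma exists_hasFDerivWithinAt_tendsto {u : ℂ → ℂ} {s : Set ℂ} (h : ContDiffOn ℝ 1 u s) {z : ℂ}
    (hz : z ∈ s) : ∃ D, HasFDerivWithinAt u D s z ∧
      Tendsto (fderiv ℝ u) (𝓝[interior s] z) (𝓝 D) := by
  obtain ⟨t, ht, -, -, f', hf, hc⟩ := (contDiffWithinAt_succ_iff_hasFDerivWithinAt' (n := 0)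
    (by simp)).mp (by simpa using h z hz)
  rw [insert_eq_of_mem hz] at ht
  refine ⟨f' z, hf z (mem_of_mem_nhdsWithin hz ht), ?_⟩
  have h1 : Tendsto f' (𝓝[interior s] z) (𝓝 (f' z)) :=
    hc.continuousWithinAt.mono interior_subset
  refine h1.congr' ?_
  filter_upwards [nhdsWithin_mono z interior_subset ht, self_mem_nhdsWithin] with w hw hw'
  exact ((hf w hw).hasFDerivAt (mem_interior_iff_mem_nhds.mp hw')).fderiv.symm

lemma exists_norm_fderiv_le {u : ℂ → ℂ} {s K : Set ℂ} (h : ContDiffOn ℝ 1 u s) (hK : IsCompact K)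
    (hKs : K ⊆ s) : ∃ M, ∀ z ∈ K ∩ interior s, ‖fderiv ℝ u z‖ ≤ M := by
  refine hK.induction_on (p := fun t => ∃ M, ∀ z ∈ t ∩ interior s, ‖fderiv ℝ u z‖ ≤ M) ?_ ?_ ?_ ?_
  · exact ⟨0, by simp⟩
  · rintro t t' htt' ⟨M, hM⟩
    exact ⟨M, fun z hz => hM z ⟨htt' hz.1, hz.2⟩⟩
  · rintro t t' ⟨M, hM⟩ ⟨M', hM'⟩
    refine ⟨max M M', ?_⟩
    rintro z ⟨hz | hz, hz'⟩
    · exact (hM z ⟨hz, hz'⟩).trans (le_max_left _ _)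
    · exact (hM' z ⟨hz, hz'⟩).trans (le_max_right _ _)
  · intro z hz
    obtain ⟨D, -, hD⟩ := exists_hasFDerivWithinAt_tendsto h (hKs hz)
    have h1 := hD.norm.eventually (gt_mem_nhds (lt_add_one ‖D‖))
    obtain ⟨t, ht, h2⟩ := eventually_nhdsWithin_iff.mp h1 |>.exists_mem
    exact ⟨t, mem_nhdsWithin_of_mem_nhds ht, ‖D‖ + 1, fun w hw => (h2 w hw.1 hw.2).le⟩

lemma uniqueDiffWithinAt_of_closedBall_subset {s : Set ℂ} {c z : ℂ} {r : ℝ} (hr : 0 < r)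
    (hz : z ∈ closedBall c r) (hs : closedBall c r ⊆ s) : UniqueDiffWithinAt ℝ s z := by
  refine (uniqueDiffWithinAt_convex (convex_closedBall c r) ?_ (subset_closure hz)).mono hs
  rw [interior_closedBall c hr.ne']
  exact nonempty_ball.mpr hr

lemma norm_sub_smul_self (z : ℂ) (hz : z ≠ 0) (t : ℝ) :
    ‖z - (t / ‖z‖ : ℝ) * z‖ = |‖z‖ - t| := by
  have h : 0 < ‖z‖ := norm_pos_iff.mpr hz
  have : z - (t / ‖z‖ : ℝ) * z = ((1 - t / ‖z‖ : ℝ) : ℂ) * z := by push_cast; ring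
  rw [this, norm_mul, Complex.norm_real, Real.norm_eq_abs]
  nth_rewrite 2 [← abs_of_pos h]
  rw [← abs_mul, sub_mul, one_mul, div_mul_cancel₀ _ h.ne']

lemma norm_smul_self (z : ℂ) (hz : z ≠ 0) {t : ℝ} (ht : 0 ≤ t) :
    ‖((t / ‖z‖ : ℝ) : ℂ) * z‖ = t := by
  have h : 0 < ‖z‖ := norm_pos_iff.mpr hz
  rw [norm_mul, Complex.norm_real, Real.norm_of_nonneg (by positivity), div_mul_cancel₀ _ h.ne']

lemma uniqueDiffOn_tube {a b : ℝ} (hb : 0 ≤ b) (hab : b < a) : UniqueDiffOn ℝ (tube 0 a b) := by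
  intro z hz
  simp only [tube, sub_zero, mem_ofPred_eq] at hz
  by_cases h0 : z = 0
  · subst h0
    have hb0 : b = 0 := le_antisymm (by simpa using hz.1) hb
    subst hb0
    refine uniqueDiffWithinAt_of_closedBall_subset (c := 0) hab (by simpa using hab.le) ?_
    intro w hw
    simpa [tube] using hw
  -- The disk centred on the middle circle, on the ray through `z`, with diameter equal to the
  -- thickness: it lies in the tube and contains `z`.
  · refine uniqueDiffWithinAt_of_closedBall_subset (r := (a - b) / 2)
      (c := (((a + b) / 2 / ‖z‖ : ℝ) : ℂ) * z) (by linarith) ?_ ?_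
    · rw [mem_closedBall, dist_eq_norm, norm_sub_smul_self z h0, abs_le]
      constructor <;> linarith
    · intro w hw
      rw [mem_closedBall, dist_eq_norm] at hw
      have e := norm_smul_self z h0 (show 0 ≤ (a + b) / 2 by linarith)
      have h1 := norm_sub_norm_le w ((((a + b) / 2 / ‖z‖ : ℝ) : ℂ) * z)
      have h2 := norm_sub_norm_le ((((a + b) / 2 / ‖z‖ : ℝ) : ℂ) * z) w
      rw [norm_sub_rev] at h2
      simp only [tube, sub_zero, mem_ofPred_eq]
      constructor <;> linarith

lemma exists_gap_of_not_touching (L : PeriodPair) {a ℓ : ℝ} (hℓ0 : 0 < ℓ)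
    (hℓ : ∀ p ∈ L.lattice, p ≠ 0 → ℓ ≤ ‖p‖) {z : ℂ}
    (h : ∀ p ∈ L.lattice, p ≠ 0 → a < ‖z - p‖) :
    ∃ δ > 0, ∀ p ∈ L.lattice, p ≠ 0 → a + δ ≤ ‖z - p‖ := by
  have hC : IsClosed ((L.lattice : Set ℂ) ∩ {p | ℓ ≤ ‖p‖}) :=
    L.isClosed_lattice.inter (isClosed_le continuous_const continuous_norm)
  have hmem : ∀ p ∈ L.lattice, p ≠ 0 → p ∈ (L.lattice : Set ℂ) ∩ {p | ℓ ≤ ‖p‖} :=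
    fun p hp hp0 => ⟨hp, hℓ p hp hp0⟩
  have hne : ((L.lattice : Set ℂ) ∩ {p | ℓ ≤ ‖p‖}).Nonempty :=
    ⟨_, hmem _ L.ω₁_mem_lattice (fun h0 => L.ω₁_div_two_notMem_lattice (by simp [h0]))⟩
  obtain ⟨q, hq, hq'⟩ := hC.exists_infDist_eq_dist hne z
  rw [dist_eq_norm] at hq'
  have hq0 : q ≠ 0 := by
    rintro rfl
    have : ℓ ≤ ‖(0 : ℂ)‖ := hq.2
    rw [norm_zero] at this
    linarith
  refine ⟨‖z - q‖ - a, sub_pos.mpr (h q hq.1 hq0), fun p hp hp0 => ?_⟩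
  have := infDist_le_dist_of_mem (x := z) (hmem p hp hp0)
  rw [dist_eq_norm, hq'] at this
  linarith

lemma uniqueDiffWithinAt_host (L : PeriodPair) {a ℓ : ℝ} (ha : 0 < a) (hℓ0 : 0 < ℓ)
    (hℓ : ∀ p ∈ L.lattice, p ≠ 0 → ℓ ≤ ‖p‖) {z : ℂ} (hz : ‖z‖ = a)
    (h : ∀ p ∈ L.lattice, p ≠ 0 → a < ‖z - p‖) : UniqueDiffWithinAt ℝ (host L a) z := by
  obtain ⟨δ, hδ, hgap⟩ := exists_gap_of_not_touching L hℓ0 hℓ h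
  have h0 : z ≠ 0 := norm_pos_iff.mp (by rw [hz]; exact ha)
  have hzc : ‖z - ((a + δ / 2) / ‖z‖ : ℝ) * z‖ = δ / 2 := by
    rw [norm_sub_smul_self z h0, hz, show a - (a + δ / 2) = -(δ / 2) by ring, abs_neg,
      abs_of_pos (by linarith)]
  -- A disk of diameter `δ` tangent to the tube from outside at `z`; all its points are within `δ`
  -- of `z`, so the gap keeps it away from the other tubes.
  refine uniqueDiffWithinAt_of_closedBall_subset (r := δ / 2)
      (c := (((a + δ / 2) / ‖z‖ : ℝ) : ℂ) * z) (by linarith) ?_ ?_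
  · rw [mem_closedBall, dist_eq_norm, hzc]
  · intro w hw p hp
    rw [mem_closedBall, dist_eq_norm] at hw
    rcases eq_or_ne p 0 with rfl | hp0
    · have e := norm_smul_self z h0 (show 0 ≤ a + δ / 2 by linarith)
      have h2 := norm_sub_norm_le ((((a + δ / 2) / ‖z‖ : ℝ) : ℂ) * z) w
      rw [norm_sub_rev] at h2
      rw [sub_zero]
      linarith
    · have h1 := hgap p hp hp0
      have h2 := norm_sub_le_norm_sub_add_norm_sub z w p
      have h3 := norm_sub_le_norm_sub_add_norm_sub z (((((a + δ / 2) / ‖z‖ : ℝ) : ℂ) * z)) w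
      rw [norm_sub_rev (_ * _) w] at h3
      linarith

variable {L : PeriodPair} {a b : ℝ} {εc εi εe : ℂ} {u : ℂ → ℂ}

lemma IsPotential.fderiv_add (hu : IsPotential L a b εc εi εe u) {p : ℂ} (hp : p ∈ L.lattice)
    (z : ℂ) : fderiv ℝ u (z + p) = fderiv ℝ u z := by
  let A : AddSubgroup ℂ :=
    { carrier := {p | ∀ z, fderiv ℝ u (z + p) = fderiv ℝ u z}
      zero_mem' := fun z => by simp
      add_mem' := fun {p q} hp hq z => by rw [← add_assoc, hq, hp]
      neg_mem' := fun {p} hp z => by have := hp (z + -p); rw [neg_add_cancel_right] at this; exact this.symm }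
  have hA : L.lattice ≤ AddSubgroup.toIntSubmodule A := by
    rw [PeriodPair.lattice, Submodule.span_le]
    rintro p (rfl | rfl)
    · exact hu.periodic₁
    · exact hu.periodic₂
  exact hA hp z

lemma fderivWithin_comp_conj {s : Set ℂ} {z : ℂ}
    (hs : UniqueDiffWithinAt ℝ ((starRingEnd ℂ) ⁻¹' s) z) (v : ℂ) :
    fderivWithin ℝ (fun w => u ((starRingEnd ℂ) w)) ((starRingEnd ℂ) ⁻¹' s) z v =
      fderivWithin ℝ u s ((starRingEnd ℂ) z) ((starRingEnd ℂ) v) := by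
  have := Complex.conjCLE.comp_right_fderivWithin (f := u) (s := s) (x := z) hs
  exact congrArg (fun D => D v) this

lemma fderiv_comp_conj (z v : ℂ) :
    fderiv ℝ (fun w => u ((starRingEnd ℂ) w)) z v =
      fderiv ℝ u ((starRingEnd ℂ) z) ((starRingEnd ℂ) v) := by
  have := Complex.conjCLE.comp_right_fderiv (f := u) (x := z)
  exact congrArg (fun D => D v) this

lemma norm_conj_sub_conj (z p : ℂ) : ‖(starRingEnd ℂ) z - (starRingEnd ℂ) p‖ = ‖z - p‖ := by
  rw [← map_sub, Complex.norm_conj]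

/-! ### Wirtinger coefficients of linear maps -/

/-- The coefficient of `v` in `D v`. -/
def wirt (D : ℂ →L[ℝ] ℂ) : ℂ := (D 1 - Complex.I * D Complex.I) / 2

/-- The coefficient of `conj v` in `D v`. -/
def wirtBar (D : ℂ →L[ℝ] ℂ) : ℂ := (D 1 + Complex.I * D Complex.I) / 2

lemma continuous_wirt : Continuous wirt := by unfold wirt; fun_prop

lemma apply_eq_wirt (D : ℂ →L[ℝ] ℂ) (v : ℂ) :
    D v = wirt D * v + wirtBar D * (starRingEnd ℂ) v := by
  have h : v = v.re • (1 : ℂ) + v.im • Complex.I := by simp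
  conv_lhs => rw [h, map_add, map_smul, map_smul]
  have h1 : (starRingEnd ℂ) v = v.re - v.im * Complex.I := by
    apply Complex.ext <;> simp
  have h2 : v = v.re + v.im * Complex.I := by simp
  rw [h1, Complex.real_smul, Complex.real_smul, wirt, wirtBar]
  nth_rewrite 3 [h2]
  linear_combination (v.im * D Complex.I) * Complex.I_sq

/-- With A = z ∂u and B = z̄ ∂̄u, the radial derivative is A + B and the tangential one is i(A - B).
The former is multiplied by c₁/c₂ across the interface and the latter is continuous; half the sum of
the two resulting equations isolates A on the far side. -/
lemma wirt_transmission {D₁ D₂ : ℂ →L[ℝ] ℂ} {c₁ c₂ z : ℂ} (hc : c₂ ≠ 0) (h : c₁ * D₁ z = c₂ * D₂ z)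
    (ht : D₁ (Complex.I * z) = D₂ (Complex.I * z)) :
    z * wirt D₂ = ((c₁ / c₂ + 1) * (z * wirt D₁) +
      (c₁ / c₂ - 1) * ((starRingEnd ℂ) z * wirtBar D₁)) / 2 := by
  rw [apply_eq_wirt D₁, apply_eq_wirt D₂] at h ht
  rw [map_mul, Complex.conj_I] at ht
  have ht' : wirt D₁ * z - wirtBar D₁ * (starRingEnd ℂ) z =
      wirt D₂ * z - wirtBar D₂ * (starRingEnd ℂ) z := by
    linear_combination (-Complex.I) * ht + (z * wirt D₁ - wirtBar D₁ * (starRingEnd ℂ) z -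
      z * wirt D₂ + wirtBar D₂ * (starRingEnd ℂ) z) * Complex.I_sq
  field_simp
  linear_combination (-1 : ℂ) * h - c₂ * ht'

lemma hasDerivAt_rotation (z : ℂ) :
    HasDerivAt (fun θ : ℝ => Complex.exp (θ * Complex.I) * z) (Complex.I * z) 0 := by
  have h : HasDerivAt (fun θ : ℝ => (θ : ℂ) * Complex.I) Complex.I 0 := by
    simpa using (Complex.ofRealCLM.hasDerivAt (x := 0)).mul_const Complex.I
  simpa using (h.cexp).mul_const z

/-- A short arc of the circle through `z` lies in both closed phases, so both directional
derivatives differentiate the same function of the angle. -/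
lemma tangential_eq {u : ℂ → ℂ} {D₁ D₂ : ℂ →L[ℝ] ℂ} {s₁ s₂ : Set ℂ} {z : ℂ}
    (h₁ : HasFDerivWithinAt u D₁ s₁ z) (h₂ : HasFDerivWithinAt u D₂ s₂ z)
    (hs₁ : ∀ᶠ θ : ℝ in 𝓝 0, Complex.exp (θ * Complex.I) * z ∈ s₁)
    (hs₂ : ∀ᶠ θ : ℝ in 𝓝 0, Complex.exp (θ * Complex.I) * z ∈ s₂) :
    D₁ (Complex.I * z) = D₂ (Complex.I * z) := by
  have key : ∀ {D : ℂ →L[ℝ] ℂ} {s : Set ℂ}, HasFDerivWithinAt u D s z →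
      (∀ᶠ θ : ℝ in 𝓝 0, Complex.exp (θ * Complex.I) * z ∈ s) →
      HasDerivAt (fun θ : ℝ => u (Complex.exp (θ * Complex.I) * z)) (D (Complex.I * z)) 0 := by
    intro D s h hs
    have hz : Complex.exp (((0 : ℝ) : ℂ) * Complex.I) * z = z := by simp
    have h' : HasFDerivWithinAt u D s (Complex.exp (((0 : ℝ) : ℂ) * Complex.I) * z) := by rwa [hz]
    have h3 := HasFDerivWithinAt.comp_hasDerivWithinAt
      (f := fun θ : ℝ => Complex.exp (θ * Complex.I) * z) (s := {θ : ℝ | Complex.exp (θ * Complex.I) * z ∈ s}) 0 h'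
      (hasDerivAt_rotation z).hasDerivWithinAt (fun θ hθ => hθ)
    exact h3.hasDerivAt hs
  exact (key h₁ hs₁).unique (key h₂ hs₂)

/-! ### Fourier modes of holomorphic functions -/

/-- The function `z F(z)` on the circle of radius `r`. -/
def circ (F : ℂ → ℂ) (r : ℝ) (θ : ℝ) : ℂ :=
  r * Complex.exp (θ * Complex.I) * F (r * Complex.exp (θ * Complex.I))

lemma mode_eq_intervalIntegral {β : ℝ → ℂ} (hβ : Function.Periodic β (2 * Real.pi)) (m : ℤ) :
    mode m β = (1 / (2 * Real.pi)) *
      ∫ θ in (0 : ℝ)..2 * Real.pi, β θ * Complex.exp (-(m * θ * Complex.I)) := by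
  have hper : Function.Periodic (fun θ : ℝ => β θ * Complex.exp (-(m * θ * Complex.I)))
      (2 * Real.pi) := by
    intro θ
    simp only
    rw [hβ θ]
    congr 1
    have : -((m : ℂ) * ((θ + 2 * Real.pi : ℝ) : ℂ) * Complex.I) =
        -(m * θ * Complex.I) - m * (2 * Real.pi * Complex.I) := by push_cast; ring
    rw [this, Complex.exp_periodic.sub_int_mul_eq]
  have := hper.intervalIntegral_add_eq 0 (-Real.pi)
  rw [zero_add, show -Real.pi + 2 * Real.pi = Real.pi by ring] at this
  rw [this, intervalIntegral.integral_of_le (by linarith [Real.pi_pos]),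
    ← integral_Ioc_eq_integral_Ioo.symm, mode]

lemma circ_periodic (F : ℂ → ℂ) (r : ℝ) : Function.Periodic (circ F r) (2 * Real.pi) := by
  intro θ
  have : Complex.exp (((θ + 2 * Real.pi : ℝ) : ℂ) * Complex.I) = Complex.exp (θ * Complex.I) := by
    push_cast
    rw [add_mul, Complex.exp_periodic]
  rw [circ, this, circ]

lemma mode_comp_neg (β : ℝ → ℂ) (m : ℤ) : mode m (fun θ => β (-θ)) = mode (-m) β := by
  rw [mode, mode]
  congr 1
  have hset : ∀ g : ℝ → ℂ, ∫ θ in Ioo (-Real.pi) Real.pi, g θ =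
      ∫ θ in (-Real.pi)..Real.pi, g θ := fun g => by
    rw [intervalIntegral.integral_of_le (by linarith [Real.pi_pos]), integral_Ioc_eq_integral_Ioo]
  have := intervalIntegral.integral_comp_neg (a := -Real.pi) (b := Real.pi)
    (fun θ : ℝ => β θ * Complex.exp (-((-m : ℤ) * θ * Complex.I)))
  rw [neg_neg] at this
  rw [hset, hset, ← this]
  congr 1
  ext θ
  simp

/-- Mode m of zF(z) is r^m times the Laurent coefficient of z^(m-1) in F. Cauchy's theorem therefore
gives pure power scaling between circles in an annulus of holomorphy and the vanishing of modes m ≤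
0 in a disk. -/
lemma mode_circ (F : ℂ → ℂ) {r : ℝ} (hr : 0 < r) (m : ℤ) :
    mode m (circ F r) = (r : ℂ) ^ m * ((2 * Real.pi * Complex.I)⁻¹ *
      ∮ z in C(0, r), z ^ (-m) * F z) := by
  rw [mode_eq_intervalIntegral (circ_periodic F r), circleIntegral, ← mul_assoc,
    ← intervalIntegral.integral_const_mul, ← intervalIntegral.integral_const_mul]
  congr 1
  ext θ
  have hr0 : (r : ℂ) ≠ 0 := by exact_mod_cast hr.ne'
  have hI := Complex.I_ne_zero
  have hpi : (Real.pi : ℂ) ≠ 0 := by exact_mod_cast Real.pi_ne_zero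
  have h1 : circleMap 0 r θ ^ (-m) = (r : ℂ) ^ (-m) * Complex.exp (-(m * θ * Complex.I)) := by
    rw [circleMap_zero, mul_zpow, ← Complex.exp_int_mul]
    congr 2
    push_cast
    ring
  rw [deriv_circleMap, h1, smul_eq_mul, circ, circleMap_zero, zpow_neg]
  have := zpow_ne_zero m hr0
  field_simp

lemma mode_circ_annulus {F : ℂ → ℂ} {r a : ℝ} (hr : 0 < r) (hra : r ≤ a)
    (hc : ContinuousOn F {z | r ≤ ‖z‖ ∧ ‖z‖ ≤ a})
    (hd : ∀ z, r < ‖z‖ → ‖z‖ < a → DifferentiableAt ℂ F z) (m : ℤ) :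
    mode m (circ F r) = ((r / a : ℝ) : ℂ) ^ m * mode m (circ F a) := by
  have ha : 0 < a := hr.trans_le hra
  rw [mode_circ F hr, mode_circ F ha,
    Complex.circleIntegral_eq_of_differentiable_on_annulus_off_countable hr hra countable_empty]
  · have hr0 : (r : ℂ) ≠ 0 := by exact_mod_cast hr.ne'
    have ha0 : (a : ℂ) ≠ 0 := by exact_mod_cast ha.ne'
    have : ((r / a : ℝ) : ℂ) ^ m * (a : ℂ) ^ m = (r : ℂ) ^ m := by
      rw [Complex.ofReal_div, ← mul_zpow, div_mul_cancel₀ _ ha0]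
    rw [← this, mul_assoc]
  · have e : closedBall (0 : ℂ) a \ ball 0 r = {z | r ≤ ‖z‖ ∧ ‖z‖ ≤ a} := by
      ext z; simp [and_comm]
    rw [e]
    refine ContinuousOn.mul ?_ hc
    refine continuousOn_id.zpow₀ _ fun z hz => Or.inl ?_
    exact norm_pos_iff.mp (hr.trans_le hz.1)
  · rintro z ⟨⟨h1, h2⟩, -⟩
    rw [mem_ball_zero_iff] at h1
    rw [mem_closedBall_zero_iff, not_le] at h2
    exact (differentiableAt_id.zpow (Or.inl (norm_pos_iff.mp (hr.trans h2)))).mul (hd z h2 h1)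

/-- The centre is exempt from holomorphy because a solid tube, `b = 0`, only provides it in the
punctured disk; continuity removes the singularity. -/
lemma mode_circ_disc {F : ℂ → ℂ} {a : ℝ} (ha : 0 < a) (hc : ContinuousOn F (closedBall 0 a))
    (hd : ∀ z, 0 < ‖z‖ → ‖z‖ < a → DifferentiableAt ℂ F z) (m : ℕ) :
    mode (-m) (circ F a) = 0 := by
  rw [mode_circ F ha, Complex.circleIntegral_eq_zero_of_differentiable_on_off_countable ha.le
    (countable_singleton (0 : ℂ))]
  · simp
  · refine ContinuousOn.mul ?_ hc
    simp only [neg_neg, zpow_natCast]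
    fun_prop
  · rintro z ⟨h1, h2⟩
    rw [mem_ball_zero_iff] at h1
    refine DifferentiableAt.fun_mul ?_ (hd z (norm_pos_iff.mpr h2) h1)
    simp only [neg_neg, zpow_natCast]
    fun_prop

/-- The mean over each circle is the constant Laurent coefficient, which is mode 1 of zF divided by
the radius. It does not depend on the radius, so the area integral is an elementary integral of s
ds. -/
lemma integral_annulus_eq_mode {F g : ℂ → ℂ} {r a : ℝ} (hr : 0 ≤ r) (hra : r < a)
    (hc : ContinuousOn F {z | r ≤ ‖z‖ ∧ ‖z‖ ≤ a})
    (hd : ∀ z, r < ‖z‖ → ‖z‖ < a → DifferentiableAt ℂ F z) (hg : Measurable g)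
    (hgF : ∀ z, r < ‖z‖ → ‖z‖ < a → g z = F z) :
    ∫ z in {z : ℂ | r < ‖z‖ ∧ ‖z‖ < a}, g z =
      Real.pi * (a ^ 2 - r ^ 2) / a * mode 1 (circ F a) := by
  have ha : 0 < a := hr.trans_lt hra
  have hK : IsCompact {z : ℂ | r ≤ ‖z‖ ∧ ‖z‖ ≤ a} := by
    have e : {z : ℂ | r ≤ ‖z‖ ∧ ‖z‖ ≤ a} = closedBall (0 : ℂ) a ∩ {z | r ≤ ‖z‖} := by
      ext z; simp [and_comm]
    rw [e]
    exact (isCompact_closedBall _ _).inter_right (isClosed_le continuous_const continuous_norm)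
  obtain ⟨M, hM⟩ := hK.exists_bound_of_continuousOn hc
  rw [(integral_annulus hg hr (M := M) fun z h1 h2 => by
    rw [hgF z h1 h2]; exact hM z ⟨h1.le, h2.le⟩).2]
  have h1 : ∀ s ∈ Ioo r a, ∫ θ in Ioo (-Real.pi) Real.pi,
      (s : ℂ) * g (s * Complex.exp (θ * Complex.I)) =
      ((s * (2 * Real.pi / a) : ℝ) : ℂ) * mode 1 (circ F a) := by
    intro s hs
    have hs0 : 0 < s := hr.trans_lt hs.1
    have h2 := mode_circ_annulus hs0 hs.2.le
      (hc.mono fun z hz => ⟨hs.1.le.trans hz.1, hz.2⟩)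
      (fun z h1 h2 => hd z (hs.1.trans h1) h2) 1
    have h3 : ∫ θ in Ioo (-Real.pi) Real.pi, (s : ℂ) * g (s * Complex.exp (θ * Complex.I)) =
        2 * Real.pi * mode 1 (circ F s) := by
      have hpi : (Real.pi : ℂ) ≠ 0 := by exact_mod_cast Real.pi_ne_zero
      rw [mode, ← mul_assoc, mul_one_div_cancel (by simp [hpi]), one_mul]
      refine setIntegral_congr_fun measurableSet_Ioo fun θ _ => ?_
      have hn : ‖(s : ℂ) * Complex.exp (θ * Complex.I)‖ = s := by
        simp [Complex.norm_exp_ofReal_mul_I, abs_of_pos hs0]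
      rw [hgF _ (by rw [hn]; exact hs.1) (by rw [hn]; exact hs.2), circ]
      have : Complex.exp (θ * Complex.I) * Complex.exp (-((1 : ℤ) * θ * Complex.I)) = 1 := by
        rw [← Complex.exp_add]; simp
      linear_combination (-(s : ℂ) * F (s * Complex.exp (θ * Complex.I))) * this
    rw [h3, h2]
    push_cast
    rw [zpow_one]
    ring
  rw [setIntegral_congr_fun measurableSet_Ioo h1, integral_mul_const]
  congr 1
  rw [integral_complex_ofReal, integral_mul_const, ← integral_Ioc_eq_integral_Ioo,
    ← intervalIntegral.integral_of_le hra.le, integral_id]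
  push_cast
  have ha0 : (a : ℂ) ≠ 0 := by exact_mod_cast ha.ne'
  field_simp

/-! ### Potentials near the central tube -/

/-- The properties of a potential which concern the central tube and the host medium. -/
structure IsCellPotential (L : PeriodPair) (a b : ℝ) (εc εi εe : ℂ) (u : ℂ → ℂ) : Prop where
  c1_core : ContDiffOn ℝ 1 u (closedBall 0 b)
  c1_tube : ContDiffOn ℝ 1 u (tube 0 a b)
  c1_host : ContDiffOn ℝ 1 u (host L a)
  holo_core : ∀ z, ‖z‖ < b → DifferentiableAt ℂ (dz u) z
  holo_tube : ∀ z, b < ‖z‖ → ‖z‖ < a → DifferentiableAt ℂ (dz u) z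
  holo_host : ∀ z ∈ openHost L a, DifferentiableAt ℂ (dz u) z
  flux_inner : ∀ z, ‖z‖ = b → εc * fderivWithin ℝ u (closedBall 0 b) z z =
    εi * fderivWithin ℝ u (tube 0 a b) z z
  flux_outer : ∀ z, ‖z‖ = a → (∀ q ∈ L.lattice, q ≠ 0 → a < ‖z - q‖) →
    εi * fderivWithin ℝ u (tube 0 a b) z z = εe * fderivWithin ℝ u (host L a) z z
  periodic : ∀ p ∈ L.lattice, ∀ z, fderiv ℝ u (z + p) = fderiv ℝ u z

variable {L : PeriodPair} {a b ℓ : ℝ} {εc εi εe : ℂ} {u : ℂ → ℂ}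

lemma IsPotential.isCellPotential (hu : IsPotential L a b εc εi εe u) :
    IsCellPotential L a b εc εi εe u where
  c1_core := hu.c1_core 0 L.lattice.zero_mem
  c1_tube := hu.c1_tube 0 L.lattice.zero_mem
  c1_host := hu.c1_host
  holo_core z hz := differentiableAt_dz_of_harmonicAt
    (hu.harmonic_core 0 L.lattice.zero_mem z (by simpa using hz))
  holo_tube z h h' := differentiableAt_dz_of_harmonicAt
    (hu.harmonic_tube 0 L.lattice.zero_mem z (by simpa using h) (by simpa using h'))
  holo_host z hz := differentiableAt_dz_of_harmonicAt (hu.harmonic_host z hz)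
  flux_inner z hz := by
    simpa using hu.flux_inner 0 L.lattice.zero_mem z (by simpa using hz)
  flux_outer z hz h := by
    simpa using hu.flux_outer 0 L.lattice.zero_mem z (by simpa using hz) h
  periodic p hp z := hu.fderiv_add hp z

lemma conj_preimage_tube (a b : ℝ) : (starRingEnd ℂ) ⁻¹' tube 0 a b = tube 0 a b := by
  ext z; simp [tube]

lemma conj_preimage_closedBall (b : ℝ) :
    (starRingEnd ℂ) ⁻¹' closedBall (0 : ℂ) b = closedBall 0 b := by
  ext z; simp

lemma conj_preimage_host (hconj : ∀ p ∈ L.lattice, (starRingEnd ℂ) p ∈ L.lattice) (a : ℝ) :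
    (starRingEnd ℂ) ⁻¹' host L a = host L a := by
  ext z
  constructor
  · intro h p hp
    have := h _ (hconj p hp)
    rwa [norm_conj_sub_conj] at this
  · intro h p hp
    have := h _ (hconj p hp)
    rwa [← norm_conj_sub_conj, Complex.conj_conj] at this

lemma uniqueDiffOn_closedBall (hb : 0 < b) : UniqueDiffOn ℝ (closedBall (0 : ℂ) b) :=
  fun _ hz => uniqueDiffWithinAt_of_closedBall_subset hb hz subset_rfl

/-- Lattice, tubes and transmission conditions are invariant under conjugation. Reflecting the
potential turns ∂̄ into ∂, so antiholomorphic parts never have to be treated separately. -/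
lemma IsPotential.isCellPotential_conj (hL : IsTubeLattice L ℓ) (ha : 0 < a)
    (hb : 0 ≤ b) (hab : b < a) (hu : IsPotential L a b εc εi εe u) :
    IsCellPotential L a b εc εi εe (fun z => u ((starRingEnd ℂ) z)) := by
  have hu' := hu.isCellPotential
  have hcomp : ∀ {s : Set ℂ}, ContDiffOn ℝ 1 u s → (starRingEnd ℂ) ⁻¹' s = s →
      ContDiffOn ℝ 1 (fun z => u ((starRingEnd ℂ) z)) s := by
    intro s hs e
    have := hs.comp (Complex.conjCLE.contDiff.contDiffOn (s := (starRingEnd ℂ) ⁻¹' s))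
      (fun z hz => hz)
    rw [e] at this
    exact this
  have hfw : ∀ {s : Set ℂ} {z : ℂ}, UniqueDiffWithinAt ℝ s z → (starRingEnd ℂ) ⁻¹' s = s →
      fderivWithin ℝ (fun z => u ((starRingEnd ℂ) z)) s z z =
      fderivWithin ℝ u s ((starRingEnd ℂ) z) ((starRingEnd ℂ) z) := by
    intro s z hs e
    have := fderivWithin_comp_conj (u := u) (s := s) (by rwa [e]) z
    rwa [e] at this
  have htube : ∀ {z : ℂ}, b ≤ ‖z‖ → ‖z‖ ≤ a → z ∈ tube 0 a b := fun h h' => by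
    simpa [tube] using And.intro h h'
  exact
  { c1_core := hcomp hu'.c1_core (conj_preimage_closedBall b)
    c1_tube := hcomp hu'.c1_tube (conj_preimage_tube a b)
    c1_host := hcomp hu'.c1_host (conj_preimage_host hL.conj_mem a)
    holo_core := fun z hz => differentiableAt_dz_of_harmonicAt (HarmonicAt.comp_conj
      (hu.harmonic_core 0 L.lattice.zero_mem _ (by simpa using hz)))
    holo_tube := fun z h h' => differentiableAt_dz_of_harmonicAt (HarmonicAt.comp_conj
      (hu.harmonic_tube 0 L.lattice.zero_mem _ (by simpa using h) (by simpa using h')))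
    holo_host := fun z hz => differentiableAt_dz_of_harmonicAt (HarmonicAt.comp_conj
      (hu.harmonic_host _ fun p hp => by
        have := hz _ (hL.conj_mem p hp)
        rwa [← norm_conj_sub_conj, Complex.conj_conj] at this))
    flux_inner := fun z hz => by
      -- For `b = 0` the inner circle is the origin and the flux condition, evaluated in the
      -- direction `z = 0`, is trivial.
      rcases hb.eq_or_lt with rfl | hb
      · rw [norm_eq_zero.mp hz, map_zero, map_zero, mul_zero, mul_zero]
      rw [hfw (uniqueDiffOn_closedBall hb z (by simp [hz])) (conj_preimage_closedBall b),
        hfw (uniqueDiffOn_tube hb.le hab z (htube hz.ge (hz.trans_le hab.le)))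
          (conj_preimage_tube a b)]
      exact hu'.flux_inner _ (by simpa using hz)
    flux_outer := fun z hz h => by
      rw [hfw (uniqueDiffOn_tube hb hab z (htube (hab.le.trans hz.ge) hz.le))
        (conj_preimage_tube a b), hfw (uniqueDiffWithinAt_host L ha hL.pos hL.norm_le hz h)
        (conj_preimage_host hL.conj_mem a)]
      refine hu'.flux_outer _ (by simpa using hz) fun q hq hq0 => ?_
      have := h _ (hL.conj_mem q hq) (by simpa using hq0)
      rwa [← norm_conj_sub_conj, Complex.conj_conj] at this
    periodic := fun p hp z => by
      ext v
      rw [fderiv_comp_conj, fderiv_comp_conj, map_add, hu'.periodic _ (hL.conj_mem p hp)] }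

/-- The boundary values of `∂u/∂z` from the set `s`. -/
def dzWithin (s : Set ℂ) (u : ℂ → ℂ) (z : ℂ) : ℂ := wirt (fderivWithin ℝ u s z)

lemma dzWithin_eq {s : Set ℂ} {z : ℂ} (hs : s ∈ 𝓝 z) : dzWithin s u z = dz u z := by
  rw [dzWithin, fderivWithin_of_mem_nhds hs, wirt, dz]

lemma continuousOn_dzWithin {s : Set ℂ} (hs : UniqueDiffOn ℝ s) (hu : ContDiffOn ℝ 1 u s) :
    ContinuousOn (dzWithin s u) s :=
  continuous_wirt.comp_continuousOn (hu.continuousOn_fderivWithin hs (by simp))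

lemma differentiableAt_dzWithin {s : Set ℂ} {z : ℂ} (hs : s ∈ 𝓝 z)
    (h : DifferentiableAt ℂ (dz u) z) : DifferentiableAt ℂ (dzWithin s u) z := by
  refine h.congr_of_eventuallyEq ?_
  filter_upwards [eventually_mem_nhds_iff.mpr hs] with w hw
  exact dzWithin_eq hw

lemma wirtBar_eq_dzWithin_conj {s : Set ℂ} {z : ℂ} (e : (starRingEnd ℂ) ⁻¹' s = s)
    (hs : UniqueDiffWithinAt ℝ s ((starRingEnd ℂ) z)) : wirtBar (fderivWithin ℝ u s z) =
      dzWithin s (fun w => u ((starRingEnd ℂ) w)) ((starRingEnd ℂ) z) := by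
  have h := fderivWithin_comp_conj (u := u) (s := s) (z := (starRingEnd ℂ) z) (by rwa [e])
  rw [e] at h
  rw [dzWithin, wirt, h, h, wirtBar]
  simp

lemma tube_mem_nhds {z : ℂ} (h : b < ‖z‖) (h' : ‖z‖ < a) : tube 0 a b ∈ 𝓝 z := by
  have h1 : ∀ᶠ w in 𝓝 z, b < ‖w‖ := continuous_norm.continuousAt.eventually (lt_mem_nhds h)
  have h2 : ∀ᶠ w in 𝓝 z, ‖w‖ < a := continuous_norm.continuousAt.eventually (gt_mem_nhds h')
  filter_upwards [h1, h2] with w h1 h2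
  simpa [tube] using And.intro h1.le h2.le

lemma tube_zero_eq (a b : ℝ) : tube 0 a b = {z | b ≤ ‖z‖ ∧ ‖z‖ ≤ a} := by
  ext z; simp [tube]

lemma conj_circle (r θ : ℝ) : (starRingEnd ℂ) (r * Complex.exp (θ * Complex.I)) =
    r * Complex.exp (((-θ : ℝ) : ℂ) * Complex.I) := by
  rw [map_mul, Complex.conj_ofReal, ← Complex.exp_conj]
  simp

lemma norm_circle {r : ℝ} (hr : 0 ≤ r) (θ : ℝ) : ‖(r : ℂ) * Complex.exp (θ * Complex.I)‖ = r := by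
  simp [Complex.norm_exp_ofReal_mul_I, abs_of_nonneg hr]

lemma norm_exp_mul_I_mul (θ : ℝ) (z : ℂ) : ‖Complex.exp (θ * Complex.I) * z‖ = ‖z‖ := by
  simp [Complex.norm_exp_ofReal_mul_I]

namespace IsCellPotential

/-- The boundary values of `∂u/∂z` in the central tube. -/
lemma continuousOn_tube (hu : IsCellPotential L a b εc εi εe u) (hb : 0 ≤ b) (hab : b < a) :
    ContinuousOn (dzWithin (tube 0 a b) u) {z | b ≤ ‖z‖ ∧ ‖z‖ ≤ a} := by
  rw [← tube_zero_eq]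
  exact continuousOn_dzWithin (uniqueDiffOn_tube hb hab) hu.c1_tube

lemma differentiableAt_tube (hu : IsCellPotential L a b εc εi εe u) (z : ℂ) (h : b < ‖z‖)
    (h' : ‖z‖ < a) : DifferentiableAt ℂ (dzWithin (tube 0 a b) u) z :=
  differentiableAt_dzWithin (tube_mem_nhds h h') (hu.holo_tube z h h')

lemma differentiableAt_core (hu : IsCellPotential L a b εc εi εe u) (z : ℂ) (h : ‖z‖ < b) :
    DifferentiableAt ℂ (dzWithin (closedBall 0 b) u) z :=
  differentiableAt_dzWithin (closedBall_mem_nhds_of_mem (by simpa using h)) (hu.holo_core z h)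

lemma circ_inner (hu : IsCellPotential L a b εc εi εe u) (hb : 0 < b) (hab : b < a)
    (hεi : εi ≠ 0) (θ : ℝ) :
    circ (dzWithin (tube 0 a b) u) b θ =
      (εc / εi + 1) / 2 * circ (dzWithin (closedBall 0 b) u) b θ + (εc / εi - 1) / 2 *
        circ (dzWithin (closedBall 0 b) (fun w => u ((starRingEnd ℂ) w))) b (-θ) := by
  set z : ℂ := b * Complex.exp (θ * Complex.I) with hz
  have hzn : ‖z‖ = b := norm_circle hb.le θ
  have hzt : z ∈ tube 0 a b := by rw [tube_zero_eq]; exact ⟨hzn.ge, hzn.trans_le hab.le⟩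
  have hzc : z ∈ closedBall (0 : ℂ) b := by simp [hzn]
  have ht := tangential_eq (z := z)
    ((hu.c1_core.differentiableOn (by simp)) z hzc).hasFDerivWithinAt
    ((hu.c1_tube.differentiableOn (by simp)) z hzt).hasFDerivWithinAt
    (Eventually.of_forall fun θ => by simp [Complex.norm_exp_ofReal_mul_I, hzn])
    (Eventually.of_forall fun θ => by
      rw [tube_zero_eq, mem_ofPred_eq, norm_exp_mul_I_mul]; exact ⟨hzn.ge, hzn.trans_le hab.le⟩)
  have h := wirt_transmission hεi (hu.flux_inner z hzn) ht
  rw [wirtBar_eq_dzWithin_conj (conj_preimage_closedBall b)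
    (uniqueDiffOn_closedBall hb _ (by simp [hzn]))] at h
  have e := conj_circle b θ
  rw [← hz] at e
  rw [circ, circ, circ, ← hz, ← e]
  rw [← dzWithin, ← dzWithin] at h
  linear_combination h

end IsCellPotential

lemma continuous_circ {F : ℂ → ℂ} {r : ℝ} (hr : 0 ≤ r) (hF : ContinuousOn F {z | ‖z‖ = r}) :
    Continuous (circ F r) := by
  unfold circ
  refine (by fun_prop : Continuous fun θ : ℝ => (r : ℂ) * Complex.exp (θ * Complex.I)).mul ?_
  exact hF.comp_continuous (by fun_prop) fun θ => norm_circle hr θ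

lemma _root_.Continuous.integrableOn_Ioo_pi {β : ℝ → ℂ} (h : Continuous β) :
    IntegrableOn β (Ioo (-Real.pi) Real.pi) :=
  (h.integrableOn_Icc (a := -Real.pi) (b := Real.pi)).mono_set Ioo_subset_Icc_self

lemma mode_reflect {β β' : ℝ → ℂ} (h : Continuous β) (h' : Continuous β') (c c' : ℂ) (m : ℤ) :
    mode m (fun θ => c * β θ + c' * β' (-θ)) = c * mode m β + c' * mode (-m) β' := by
  have h1 : IntegrableOn (fun θ => c * β θ) (Ioo (-Real.pi) Real.pi) :=
    (continuous_const.mul h).integrableOn_Ioo_pi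
  have h2 : IntegrableOn (fun θ => c' * β' (-θ)) (Ioo (-Real.pi) Real.pi) :=
    (continuous_const.mul (h'.comp continuous_neg)).integrableOn_Ioo_pi
  rw [mode_add h1 h2, mode_const_mul, mode_const_mul, mode_comp_neg β']

namespace IsCellPotential

/-- The core field has no modes of index at most 0, so in mode m of u and in mode -m of its
reflection one of the two terms of `circ_inner` drops out. Both modes in the tube become multiples
of a single mode of the core. -/
lemma mode_inner (hu : IsCellPotential L a b εc εi εe u)
    (hu' : IsCellPotential L a b εc εi εe fun w => u ((starRingEnd ℂ) w))
    (hb : 0 < b) (hab : b < a) (hεi : εi ≠ 0) (m : ℕ) :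
    mode m (circ (dzWithin (tube 0 a b) u) b) =
      (εc / εi + 1) / 2 * mode m (circ (dzWithin (closedBall 0 b) u) b) ∧
    mode (-m) (circ (dzWithin (tube 0 a b) (fun w => u ((starRingEnd ℂ) w))) b) =
      (εc / εi - 1) / 2 * mode m (circ (dzWithin (closedBall 0 b) u) b) := by
  have hc : ∀ {v : ℂ → ℂ}, IsCellPotential L a b εc εi εe v →
      ContinuousOn (dzWithin (closedBall 0 b) v) (closedBall 0 b) := fun hv =>
    continuousOn_dzWithin (uniqueDiffOn_closedBall hb) hv.c1_core
  have hI : ∀ {v : ℂ → ℂ}, IsCellPotential L a b εc εi εe v →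
      Continuous (circ (dzWithin (closedBall 0 b) v) b) := fun hv =>
    continuous_circ hb.le ((hc hv).mono fun z hz => by
      rw [mem_closedBall_zero_iff]; exact le_of_eq hz)
  have hz : ∀ {v : ℂ → ℂ}, IsCellPotential L a b εc εi εe v → ∀ m : ℕ,
      mode (-m) (circ (dzWithin (closedBall 0 b) v) b) = 0 := fun hv m =>
    mode_circ_disc hb (hc hv) (fun z _ h => hv.differentiableAt_core z h) m
  constructor
  · rw [show circ (dzWithin (tube 0 a b) u) b = _ from funext (hu.circ_inner hb hab hεi),
      mode_reflect (hI hu) (hI hu'), hz hu', mul_zero, add_zero]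
  · have e : (fun w => u ((starRingEnd ℂ) ((starRingEnd ℂ) w))) = u := by
      ext w; simp
    have h := funext (hu'.circ_inner hb hab hεi)
    simp only [e] at h
    change circ (dzWithin (tube 0 a b) fun w => u ((starRingEnd ℂ) w)) b = _ at h
    rw [h, mode_reflect (hI hu') (hI hu), hz hu', mul_zero, zero_add, neg_neg]

/-- The relation between the modes of the field in the tube imposed by the core. -/
lemma mode_tube (hu : IsCellPotential L a b εc εi εe u)
    (hu' : IsCellPotential L a b εc εi εe fun w => u ((starRingEnd ℂ) w))
    {ν : ℝ} (ha : 0 < a) (hν0 : 0 ≤ ν) (hν1 : ν < 1) (hb : b = ν * a) (hεi : εi ≠ 0)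
    (hic : εi + εc ≠ 0) {m : ℕ} (hm : m ≠ 0) :
    mode (-m) (circ (dzWithin (tube 0 a b) (fun w => u ((starRingEnd ℂ) w))) a) =
      -(alphaTilde εc εi * (ν : ℂ) ^ (2 * m)) * mode m (circ (dzWithin (tube 0 a b) u) a) := by
  -- A solid tube is treated apart: its field is holomorphic in the punctured disk and continuous,
  -- so the left side vanishes, as does the factor `ν ^ (2 * m)`.
  rcases hν0.eq_or_lt with rfl | hν
  · have hb0 : b = 0 := by simp [hb]
    subst hb0
    rw [mode_circ_disc ha]
    · simp [hm]
    · refine (hu'.continuousOn_tube le_rfl ha).mono fun z hz => ?_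
      simpa using hz
    · exact fun z h h' => hu'.differentiableAt_tube z h h'
  · have hb0 : 0 < b := by rw [hb]; positivity
    have hab : b < a := by rw [hb]; nlinarith
    obtain ⟨h1, -⟩ := hu.mode_inner hu' hb0 hab hεi m
    obtain ⟨-, h2⟩ := hu.mode_inner hu' hb0 hab hεi m
    -- Moving from the inner to the outer circle multiplies mode m by ν^(-m) and mode -m by ν^m.
    -- Eliminating the core mode then leaves the factor ν^(2m).
    have h3 := mode_circ_annulus hb0 hab.le (hu.continuousOn_tube hb0.le hab)
      (fun z h h' => hu.differentiableAt_tube z h h') m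
    have h4 := mode_circ_annulus hb0 hab.le (hu'.continuousOn_tube hb0.le hab)
      (fun z h h' => hu'.differentiableAt_tube z h h') (-m)
    have e : b / a = ν := by rw [hb, mul_div_cancel_right₀ _ ha.ne']
    rw [h1, e, zpow_natCast] at h3
    rw [h2, e, zpow_neg, zpow_natCast] at h4
    have hν' : (ν : ℂ) ^ m ≠ 0 := pow_ne_zero _ (by exact_mod_cast hν.ne')
    have hαt : alphaTilde εc εi * (εi + εc) = εi - εc := by
      rw [alphaTilde, div_mul_cancel₀ _ hic]
    generalize mode (-m) (circ (dzWithin (tube 0 a b) fun w => u ((starRingEnd ℂ) w)) a) = X at *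
    generalize mode m (circ (dzWithin (tube 0 a b) u) a) = Y at *
    generalize mode m (circ (dzWithin (closedBall 0 b) u) b) = Z at *
    rw [pow_mul', sq]
    have h4' : X = (ν : ℂ) ^ m * ((εc / εi - 1) / 2 * Z) := by
      rw [h4, mul_inv_cancel_left₀ hν']
    have : alphaTilde εc εi = (εi - εc) / (εi + εc) := rfl
    rw [h4', this]
    have h5 : (ν : ℂ) ^ m * Y = (εc + εi) / (2 * εi) * Z := by
      rw [← h3]; field_simp
    have h6 : -((εi - εc) / (εi + εc) * ((ν : ℂ) ^ m * (ν : ℂ) ^ m)) * Y =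
      -((εi - εc) / (εi + εc)) * (ν : ℂ) ^ m * ((ν : ℂ) ^ m * Y) := by ring
    rw [h6, h5]
    field_simp
    ring

lemma measurable_dz (u : ℂ → ℂ) : Measurable (dz u) := by
  unfold dz
  have h1 := measurable_fderiv_apply_const ℝ u 1
  have h2 := measurable_fderiv_apply_const ℝ u Complex.I
  exact (h1.sub (h2.const_mul _)).div_const _

lemma integral_tube (hu : IsCellPotential L a b εc εi εe u) (hb : 0 ≤ b) (hab : b < a) :
    ∫ z in {z : ℂ | b < ‖z‖ ∧ ‖z‖ < a}, dz u z =
      Real.pi * (a ^ 2 - b ^ 2) / a * mode 1 (circ (dzWithin (tube 0 a b) u) a) :=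
  integral_annulus_eq_mode hb hab (hu.continuousOn_tube hb hab) hu.differentiableAt_tube
    (measurable_dz u) fun _ h h' => (dzWithin_eq (tube_mem_nhds h h')).symm

lemma integral_core (hu : IsCellPotential L a b εc εi εe u)
    (hu' : IsCellPotential L a b εc εi εe fun w => u ((starRingEnd ℂ) w))
    (hb : 0 < b) (hab : b < a) (hεi : εi ≠ 0) (hic : εi + εc ≠ 0) :
    ∫ z in {z : ℂ | 0 < ‖z‖ ∧ ‖z‖ < b}, dz u z =
      Real.pi * b ^ 2 / a * (2 * εi / (εi + εc)) * mode 1 (circ (dzWithin (tube 0 a b) u) a) := by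
  have h1 := integral_annulus_eq_mode (F := dzWithin (closedBall 0 b) u) (g := dz u) le_rfl hb
    ((continuousOn_dzWithin (uniqueDiffOn_closedBall hb) hu.c1_core).mono fun z hz => by
      simpa using hz) (fun z _ h => hu.differentiableAt_core z h) (measurable_dz u)
      (fun z _ h => (dzWithin_eq (closedBall_mem_nhds_of_mem (by simpa using h))).symm)
  have h2 := (hu.mode_inner hu' hb hab hεi 1).1
  have h3 := mode_circ_annulus hb hab.le (hu.continuousOn_tube hb.le hab)
      (fun z h h' => hu.differentiableAt_tube z h h') 1
  simp only [Nat.cast_one] at h2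
  rw [h2, zpow_one] at h3
  have hb0 : (b : ℂ) ≠ 0 := by exact_mod_cast hb.ne'
  have ha0 : (a : ℂ) ≠ 0 := by exact_mod_cast (hb.trans hab).ne'
  rw [h1]
  generalize mode 1 (circ (dzWithin (tube 0 a b) u) a) = Y at *
  generalize mode 1 (circ (dzWithin (closedBall 0 b) u) b) = Z at *
  have h4 : Z = 2 * εi / (εi + εc) * (b / a * Y) := by
    push_cast at h3
    rw [← h3]
    have : εc + εi ≠ 0 := by rwa [add_comm]
    field_simp
    ring
  rw [h4]
  push_cast
  field_simp
  ring

end IsCellPotential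

/-! ### The field in the host medium -/

lemma norm_wirt_le (D : ℂ →L[ℝ] ℂ) : ‖wirt D‖ ≤ ‖D‖ := by
  have h1 := D.le_opNorm 1
  have h2 := D.le_opNorm Complex.I
  rw [norm_one, mul_one] at h1
  rw [Complex.norm_I, mul_one] at h2
  rw [wirt, norm_div, RCLike.norm_ofNat]
  have h3 := norm_sub_le (D 1) (Complex.I * D Complex.I)
  rw [norm_mul, Complex.norm_I, one_mul] at h3
  linarith

lemma openHost_subset_interior (L : PeriodPair) (a : ℝ) : openHost L a ⊆ interior (host L a) :=
  interior_maximal (openHost_subset_host L a) (isOpen_openHost L a)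

/-- The periodic multipoles, with the zeta function made periodic. -/
def perMultipole (L : PeriodPair) (n : ℕ) (z : ℂ) : ℂ :=
  multipole L n z - (if n = 0 then (Real.pi / volume.real (cell L) : ℂ) else 0) * (starRingEnd ℂ) z

/-- The function `z ∂u/∂z` on the outer boundary of the central tube, seen from the host medium. -/
def hostTrace (a b : ℝ) (εi εe : ℂ) (u : ℂ → ℂ) (θ : ℝ) : ℂ :=
  (εi / εe + 1) / 2 * circ (dzWithin (tube 0 a b) u) a θ + (εi / εe - 1) / 2 *
    circ (dzWithin (tube 0 a b) (fun w => u ((starRingEnd ℂ) w))) a (-θ)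

variable {L : PeriodPair} {a b ℓ : ℝ} {εc εi εe : ℂ} {u : ℂ → ℂ}

lemma IsTubeLattice.perMultipole_add (hL : IsTubeLattice L ℓ) (n : ℕ) {p z : ℂ}
    (hp : p ∈ L.lattice) (hz : z ∉ L.lattice) :
    perMultipole L n (z + p) = perMultipole L n z := by
  rw [perMultipole, perMultipole]
  split_ifs with hn
  · subst hn
    rw [hL.zeta_add hp hz, map_add]
    ring
  · rw [multipole_add L hn hp]
    simp

lemma contDiffOn_perMultipole (L : PeriodPair) (n : ℕ) :
    ContDiffOn ℝ 1 (perMultipole L n) (L.lattice : Set ℂ)ᶜ := by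
  refine (contDiffOn_real_of_differentiableOn L.isClosed_lattice.isOpen_compl
    (differentiableOn_multipole L n)).sub ?_
  exact (contDiff_const.mul Complex.conjCLE.contDiff).contDiffOn

lemma dbar_perMultipole (L : PeriodPair) (n : ℕ) {z : ℂ} (hz : z ∉ L.lattice) :
    dbar (perMultipole L n) z =
      -(if n = 0 then (Real.pi / volume.real (cell L) : ℂ) else 0) := by
  set B : ℂ := if n = 0 then (Real.pi / volume.real (cell L) : ℂ) else 0 with hB
  have hd := (differentiableOn_multipole L n).differentiableAt
    (L.isClosed_lattice.isOpen_compl.mem_nhds hz)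
  have h1 := dbar_eq_zero_of_differentiableAt hd
  have h2 := dbar_const_mul_conj B z
  have hd' : DifferentiableAt ℝ (fun w => B * (starRingEnd ℂ) w) z :=
    ((Complex.conjCLE.hasFDerivAt (x := z)).const_mul B).differentiableAt
  have e : perMultipole L n = fun w => multipole L n w - B * (starRingEnd ℂ) w := rfl
  rw [dbar] at h1 h2 ⊢
  rw [e, fderiv_fun_sub (hd.restrictScalars ℝ) hd']
  simp only [sub_apply]
  linear_combination h1 - h2

lemma circle_not_mem_lattice (hL : IsTubeLattice L ℓ) (ha : 0 < a) (haℓ : 2 * a ≤ ℓ) (θ : ℝ) :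
    (a : ℂ) * Complex.exp (θ * Complex.I) ∈ (L.lattice : Set ℂ)ᶜ :=
  voronoi_inter_subset_compl L ha ⟨closedBall_subset_voronoi haℓ hL.norm_le
    (by rw [mem_closedBall_zero_iff, norm_circle ha.le]), (norm_circle ha.le θ).ge⟩

lemma continuous_multipole_circle (hL : IsTubeLattice L ℓ) (ha : 0 < a) (haℓ : 2 * a ≤ ℓ) (n : ℕ) :
    Continuous fun θ : ℝ => multipole L n (a * Complex.exp (θ * Complex.I)) :=
  (differentiableOn_multipole L n).continuousOn.comp_continuous (by fun_prop)
    (circle_not_mem_lattice hL ha haℓ)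

namespace IsCellPotential

lemma continuous_hostTrace (hu : IsCellPotential L a b εc εi εe u)
    (hu' : IsCellPotential L a b εc εi εe fun w => u ((starRingEnd ℂ) w))
    (hb : 0 ≤ b) (hab : b < a) : Continuous (hostTrace a b εi εe u) := by
  have h : ∀ {v : ℂ → ℂ}, IsCellPotential L a b εc εi εe v →
      Continuous (circ (dzWithin (tube 0 a b) v) a) := fun hv =>
    continuous_circ (hb.trans hab.le) ((hv.continuousOn_tube hb hab).mono fun z hz => by
      exact ⟨hab.le.trans_eq (Eq.symm hz), le_of_eq hz⟩)
  exact (continuous_const.mul (h hu)).add (continuous_const.mul ((h hu').comp continuous_neg))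

lemma exists_norm_dz_le (hu : IsCellPotential L a b εc εi εe u) :
    ∃ M, ∀ z ∈ openHost L a, ‖dz u z‖ ≤ M := by
  obtain ⟨M, hM⟩ := exists_norm_fderiv_le hu.c1_host ((isCompact_voronoi L).inter_right
    (isClosed_le continuous_const continuous_norm) : IsCompact (voronoi L ∩ {z | a ≤ ‖z‖}))
    (fun z hz p hp => le_trans hz.2 (hz.1 p hp))
  refine ⟨M, fun z hz => ?_⟩
  obtain ⟨p, hp, h⟩ := exists_sub_mem_voronoi L z
  have h1 : z - p ∈ openHost L a := by
    rw [sub_eq_add_neg]; exact openHost_add (L.lattice.neg_mem hp) hz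
  have h2 := hu.periodic p hp (z - p)
  rw [sub_add_cancel] at h2
  refine (norm_wirt_le (fderiv ℝ u z)).trans ?_
  rw [h2]
  refine hM _ ⟨⟨h, ?_⟩, openHost_subset_interior L a h1⟩
  simpa using (h1 0 L.lattice.zero_mem).le

/-- The trace is written with values from the tube, which is regular along its whole boundary,
whereas the host may have contact points. Away from these, continuity of the tangential derivative
and of the flux identifies it with the radial limit from the host. -/
lemma tendsto_hostTrace (hL : IsTubeLattice L ℓ) (hu : IsCellPotential L a b εc εi εe u)
    (ha : 0 < a) (hb : 0 ≤ b) (hab : b < a) (hεe : εe ≠ 0) {θ : ℝ}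
    (hθ : ∀ p ∈ L.lattice, p ≠ 0 → a < ‖(a : ℂ) * Complex.exp (θ * Complex.I) - p‖) :
    Tendsto (fun r : ℝ => dz u (r * Complex.exp (θ * Complex.I))) (𝓝[>] a)
      (𝓝 ((a * Complex.exp (θ * Complex.I))⁻¹ * hostTrace a b εi εe u θ)) := by
  set z : ℂ := a * Complex.exp (θ * Complex.I) with hz
  have hzn : ‖z‖ = a := norm_circle ha.le θ
  obtain ⟨δ, hδ, hgap⟩ := exists_gap_of_not_touching L hL.pos hL.norm_le hθ
  have hzt : z ∈ tube 0 a b := by rw [tube_zero_eq]; exact ⟨hab.le.trans_eq hzn.symm, hzn.le⟩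
  have hnear : ∀ w, ‖w - z‖ < δ → ∀ p ∈ L.lattice, p ≠ 0 → a < ‖w - p‖ := fun w hw p hp hp0 => by
    have h1 := hgap p hp hp0
    have h2 := norm_sub_le_norm_sub_add_norm_sub z w p
    rw [norm_sub_rev z w] at h2
    linarith
  have hzh : z ∈ host L a := fun p hp => by
    rcases eq_or_ne p 0 with rfl | hp0
    · rw [sub_zero, hzn]
    · exact (hθ p hp hp0).le
  obtain ⟨D, hD, hlim⟩ := exists_hasFDerivWithinAt_tendsto hu.c1_host hzh
  have hDe : fderivWithin ℝ u (host L a) z = D :=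
    hD.fderivWithin (uniqueDiffWithinAt_host L ha hL.pos hL.norm_le hzn hθ)
  have hflux := hu.flux_outer z hzn hθ
  rw [hDe] at hflux
  have ht := tangential_eq (z := z)
    ((hu.c1_tube.differentiableOn (by simp)) z hzt).hasFDerivWithinAt hD
    (Eventually.of_forall fun θ => by
      rw [tube_zero_eq, mem_ofPred_eq, norm_exp_mul_I_mul]
      exact ⟨hab.le.trans_eq hzn.symm, hzn.le⟩) (by
      have hc : Tendsto (fun θ : ℝ => Complex.exp (θ * Complex.I) * z) (𝓝 0) (𝓝 z) := by
        have : Continuous fun θ : ℝ => Complex.exp (θ * Complex.I) * z := by fun_prop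
        simpa using this.tendsto 0
      filter_upwards [hc.eventually (ball_mem_nhds z hδ)] with φ hφ p hp
      rcases eq_or_ne p 0 with rfl | hp0
      · rw [sub_zero, norm_exp_mul_I_mul, hzn]
      · exact (hnear _ (by simpa [dist_eq_norm] using hφ) p hp hp0).le)
  have h := wirt_transmission hεe hflux ht
  rw [wirtBar_eq_dzWithin_conj (conj_preimage_tube a b) (uniqueDiffOn_tube hb hab _ (by
    rw [← mem_preimage, conj_preimage_tube]; exact hzt)), ← dzWithin] at h
  have e := conj_circle a θ
  rw [← hz] at e
  have h2 : z * wirt D = hostTrace a b εi εe u θ := by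
    rw [h, hostTrace, circ, circ, ← hz, ← e]
    ring
  have hz0 : z ≠ 0 := norm_pos_iff.mp (by rw [hzn]; exact ha)
  rw [← h2, inv_mul_cancel_left₀ hz0]
  refine ((continuous_wirt.tendsto D).comp hlim).comp (tendsto_nhdsWithin_iff.mpr ⟨?_, ?_⟩)
  · have : Continuous fun r : ℝ => (r : ℂ) * Complex.exp (θ * Complex.I) := by fun_prop
    exact (this.tendsto a).mono_left nhdsWithin_le_nhds
  · have h3 : ∀ᶠ r in 𝓝[>] a, r ∈ Ioo a (a + δ) := Ioo_mem_nhdsGT (by linarith)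
    filter_upwards [h3] with r hr
    refine openHost_subset_interior L a fun p hp => ?_
    rcases eq_or_ne p 0 with rfl | hp0
    · rw [sub_zero, norm_circle (ha.trans hr.1).le]
      exact hr.1
    · refine hnear _ ?_ p hp hp0
      rw [hz, ← sub_mul, norm_mul, Complex.norm_exp_ofReal_mul_I, mul_one, ← Complex.ofReal_sub,
        Complex.norm_real, Real.norm_of_nonneg (by linarith [hr.1])]
      linarith [hr.2]

/-- Stokes' theorem for the product of ∂u/∂z with a periodic multipole. The first factor is
holomorphic, so ∂̄ acts only on the term (π/S) z̄ present for n = 0; that is how the mean field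
enters the equations. -/
lemma stokes_perMultipole (hL : IsTubeLattice L ℓ) (hu : IsCellPotential L a b εc εi εe u)
    (ha : 0 < a) (haℓ : 2 * a ≤ ℓ) (hb : 0 ≤ b) (hab : b < a) (hεe : εe ≠ 0) (n : ℕ) :
    IntegrableOn (dz u) (voronoi L ∩ {z | a < ‖z‖}) ∧
    (if n = 0 then (Real.pi / volume.real (cell L) : ℂ) else 0) *
      ∫ z in voronoi L ∩ {z | a < ‖z‖}, dz u z =
    1 / 2 * ∫ θ in Ioo (-Real.pi) Real.pi, hostTrace a b εi εe u θ *
      perMultipole L n (a * Complex.exp (θ * Complex.I)) := by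
  obtain ⟨M, hM⟩ := hu.exists_norm_dz_le
  have hO : IsOpen (L.lattice : Set ℂ)ᶜ := L.isClosed_lattice.isOpen_compl
  have hsub := (openHost_subset_host L a).trans (host_subset_compl L ha)
  obtain ⟨M', hM'⟩ := exists_norm_le_of_periodic L
    ((contDiffOn_perMultipole L n).continuousOn.mono (voronoi_inter_subset_compl L ha))
    (fun p hp z hz => hL.perMultipole_add n hp (host_subset_compl L ha hz))
  have hdz : ContDiffOn ℝ 1 (dz u) (openHost L a) :=
    contDiffOn_real_of_differentiableOn (isOpen_openHost L a)
      fun z hz => (hu.holo_host z hz).differentiableWithinAt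
  have hmeas : MeasurableSet (voronoi L ∩ {z | a < ‖z‖}) :=
    (isClosed_voronoi L).measurableSet.inter (measurableSet_lt measurable_const measurable_norm)
  have hfin : volume (voronoi L ∩ {z | a < ‖z‖}) < ⊤ :=
    (measure_mono inter_subset_left).trans_lt (isCompact_voronoi L).measure_lt_top
  have hint : IntegrableOn (dz u) (voronoi L ∩ {z | a < ‖z‖}) :=
    Measure.integrableOn_of_bounded (M := M) hfin.ne (measurable_dz u).aestronglyMeasurable
      ((ae_restrict_iff' hmeas).mpr (Eventually.of_forall fun z hz =>
        hM z (mem_openHost_of_mem_voronoi hz.1 hz.2)))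
  refine ⟨hint, ?_⟩
  set B : ℂ := if n = 0 then (Real.pi / volume.real (cell L) : ℂ) else 0 with hB
  have hdbar : ∀ z ∈ voronoi L ∩ {z | a < ‖z‖},
      dbar (fun w => dz u w * perMultipole L n w) z = -B * dz u z := by
    intro z hz
    have hz' := mem_openHost_of_mem_voronoi hz.1 hz.2
    rw [dbar_mul ((hu.holo_host z hz').restrictScalars ℝ)
      (((contDiffOn_perMultipole L n).differentiableOn (by simp)).differentiableAt
        (hO.mem_nhds (hsub hz'))), dbar_eq_zero_of_differentiableAt (hu.holo_host z hz'),
      dbar_perMultipole L n (hsub hz')]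
    ring
  have key := host_stokes (F := fun z => dz u z * perMultipole L n z) ha haℓ hL.norm_le
    (fun p hp z hz => by
      have : dz u (z + p) = dz u z := by rw [dz, dz, hu.periodic p hp z]
      rw [this, hL.perMultipole_add n hp (hsub hz)])
    (hdz.mul ((contDiffOn_perMultipole L n).mono hsub)) (M := M * M')
    (fun z hz => by
      rw [norm_mul]
      have h1 := hM z hz
      have h2 := hM' z (openHost_subset_host L a hz)
      gcongr
      exact (norm_nonneg _).trans h1)
    (IntegrableOn.congr_fun (hint.const_mul (-B)) (fun z hz => (hdbar z hz).symm) hmeas)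
    (b := fun θ => (a * Complex.exp (θ * Complex.I))⁻¹ * hostTrace a b εi εe u θ *
      perMultipole L n (a * Complex.exp (θ * Complex.I))) ?_
  · rw [setIntegral_congr_fun hmeas hdbar, integral_const_mul] at key
    have h5 : ∀ θ : ℝ, (a * Complex.exp (θ * Complex.I))⁻¹ * hostTrace a b εi εe u θ *
        perMultipole L n (a * Complex.exp (θ * Complex.I)) * Complex.exp (θ * Complex.I) =
        (a : ℂ)⁻¹ * (hostTrace a b εi εe u θ *
          perMultipole L n (a * Complex.exp (θ * Complex.I))) := by
      intro θ
      have := Complex.exp_ne_zero (θ * Complex.I)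
      field_simp
    simp only [h5] at key
    rw [integral_const_mul] at key
    have ha0 : (a : ℂ) ≠ 0 := by exact_mod_cast ha.ne'
    generalize ∫ θ in Ioo (-Real.pi) Real.pi, hostTrace a b εi εe u θ *
      perMultipole L n (a * Complex.exp (θ * Complex.I)) = Q at *
    field_simp at key ⊢
    linear_combination (-1 : ℂ) * key
  · filter_upwards [ae_not_touching L ha haℓ hL.norm_le] with θ hθ hθ'
    refine (hu.tendsto_hostTrace hL ha hb hab hεe (hθ hθ')).mul ?_
    have h1 := ((contDiffOn_perMultipole L n).continuousOn.continuousAt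
      (hO.mem_nhds (circle_not_mem_lattice hL ha haℓ θ))).tendsto
    refine h1.comp (Tendsto.mono_left ?_ nhdsWithin_le_nhds)
    exact (by fun_prop : Continuous fun r : ℝ => (r : ℂ) * Complex.exp (θ * Complex.I)).tendsto a

/-- The linear relations between the Fourier modes of the field on the boundary of a tube. -/
theorem hasSum_mode (hL : IsTubeLattice L ℓ) (hu : IsCellPotential L a b εc εi εe u)
    (hu' : IsCellPotential L a b εc εi εe fun w => u ((starRingEnd ℂ) w))
    (ha : 0 < a) (haℓ : 2 * a ≤ ℓ) (hb : 0 ≤ b) (hab : b < a) (hεe : εe ≠ 0) (n : ℕ) :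
    HasSum (fun k : ℕ => regCoeff L n k * (a : ℂ) ^ (2 * n + 2 * k + 2) *
        mode (-(2 * k + 1 : ℕ)) (hostTrace a b εi εe u))
      (mode (2 * n + 1 : ℕ) (hostTrace a b εi εe u) - if n = 0 then
        a / volume.real (cell L) * (∫ z in voronoi L ∩ {z | a < ‖z‖}, dz u z) +
        volumeFraction L a * mode 1 (hostTrace a b εi εe u) else 0) := by
  have hc := hu.continuous_hostTrace hu' hb hab (εi := εi) (εe := εe)
  have h1 := (hL.hasSum_integral_mul_multipole ha (by linarith [hL.pos])
    hc.integrableOn_Ioo_pi n).mul_left ((a : ℂ) ^ (2 * n + 1))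
  have h2 := (hu.stokes_perMultipole hL ha haℓ hb hab hεe n).2
  set B : ℂ := if n = 0 then (Real.pi / volume.real (cell L) : ℂ) else 0 with hB
  -- On the circle z̄ = a e^(-iθ), so the correction that makes ζ periodic picks out mode 1; this is
  -- the source of the term with the volume fraction.
  have h3 : ∫ θ in Ioo (-Real.pi) Real.pi, hostTrace a b εi εe u θ *
      perMultipole L n (a * Complex.exp (θ * Complex.I)) =
      (∫ θ in Ioo (-Real.pi) Real.pi, hostTrace a b εi εe u θ *
        multipole L n (a * Complex.exp (θ * Complex.I))) -
      B * a * (2 * Real.pi * mode 1 (hostTrace a b εi εe u)) := by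
    have e : ∀ θ : ℝ, hostTrace a b εi εe u θ *
        perMultipole L n (a * Complex.exp (θ * Complex.I)) =
        hostTrace a b εi εe u θ * multipole L n (a * Complex.exp (θ * Complex.I)) -
        B * a * (hostTrace a b εi εe u θ * Complex.exp (-((1 : ℤ) * θ * Complex.I))) := by
      intro θ
      rw [perMultipole, ← hB, conj_circle]
      push_cast
      ring_nf
    simp only [e]
    rw [integral_sub, integral_const_mul, mode]
    · have hpi : (Real.pi : ℂ) ≠ 0 := by exact_mod_cast Real.pi_ne_zero
      rw [← mul_assoc (2 * Real.pi : ℂ), mul_one_div_cancel (by simp [hpi]), one_mul]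
    · exact (hc.mul (continuous_multipole_circle hL ha haℓ n)).integrableOn_Ioo_pi
    · exact (continuous_const.mul (hc.mul (by fun_prop))).integrableOn_Ioo_pi
  rw [h3] at h2
  have ha0 : (a : ℂ) ≠ 0 := by exact_mod_cast ha.ne'
  have hpi : (Real.pi : ℂ) ≠ 0 := by exact_mod_cast Real.pi_ne_zero
  convert! h1 using 1
  · ext k; ring
  · rw [mul_sub, mul_inv_cancel_left₀ (pow_ne_zero _ ha0)]
    congr 1
    generalize (∫ θ in Ioo (-Real.pi) Real.pi, hostTrace a b εi εe u θ *
        multipole L n (a * Complex.exp (θ * Complex.I))) = Q at *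
    have h4 : Q = 2 * (B * ∫ z in voronoi L ∩ {z | a < ‖z‖}, dz u z) +
        B * a * (2 * Real.pi * mode 1 (hostTrace a b εi εe u)) := by
      rw [h2]; ring
    rw [h4]
    split_ifs with hn
    · subst hn
      rw [hB, if_pos rfl, volumeFraction]
      push_cast
      field_simp
    · rw [hB, if_neg hn]
      ring

end IsCellPotential

/-! ### The linear systems for bounded sequences -/

lemma norm_coeffG_le {S : ℕ → ℂ} {K : ℝ} (hS : ∀ m, 1 ≤ m → ‖S m‖ ≤ K) (n k : ℕ) :
    ‖coeffG S n k‖ ≤ ((2 * n + 2 * k + 1).choose (2 * k) : ℝ) * K := by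
  have h : ((2 * n + 2 * k + 1).factorial : ℂ) / ((2 * k).factorial * (2 * n + 1).factorial) =
      ((2 * n + 2 * k + 1).choose (2 * k) : ℂ) := by
    rw [Nat.cast_choose ℂ (by omega), show 2 * n + 2 * k + 1 - 2 * k = 2 * n + 1 by omega]
  rw [coeffG, h, norm_mul, Complex.norm_natCast]
  exact mul_le_mul_of_nonneg_left (hS _ (by omega)) (Nat.cast_nonneg _)

lemma summable_choose_even (n : ℕ) {t : ℝ} (ht : |t| < 1) :
    Summable fun k : ℕ => ((2 * n + 2 * k + 1).choose (2 * k) : ℝ) * t ^ (2 * k) := by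
  have h := summable_choose_mul_geometric_of_norm_lt_one (R := ℝ) (2 * n + 1) (r := t) (by simpa using ht)
  refine (h.comp_injective (i := fun k : ℕ => 2 * k) (fun a b h => by simpa using h)).congr
    fun k => ?_
  simp only [Function.comp_apply]
  rw [show 2 * k + (2 * n + 1) = 2 * n + 2 * k + 1 by ring, ← Nat.choose_symm (by omega),
    show 2 * n + 2 * k + 1 - (2 * n + 1) = 2 * k by omega]

lemma _root_.Memℓp.exists_norm_le {x : ℕ → ℂ} (hx : Memℓp x ∞) : ∃ M, 0 ≤ M ∧ ∀ n, ‖x n‖ ≤ M := by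
  obtain ⟨M, hM⟩ := memℓp_infty_iff.mp hx
  have h : ∀ n, ‖x n‖ ≤ M := fun n => hM (mem_range_self n)
  exact ⟨M, (norm_nonneg _).trans (h 0), h⟩

lemma memℓp_infty_of_norm_le {x : ℕ → ℂ} {M : ℝ} (h : ∀ n, ‖x n‖ ≤ M) : Memℓp x ∞ :=
  memℓp_infty_iff.mpr ⟨M, by rintro _ ⟨n, rfl⟩; exact h n⟩

lemma summable_coeffG {S : ℕ → ℂ} {K : ℝ} (hS : ∀ m, 1 ≤ m → ‖S m‖ ≤ K) {h : ℝ} (hh : |h| < 1)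
    {x : ℕ → ℂ} (hx : Memℓp x ∞) (n : ℕ) :
    Summable fun k => coeffG S n k * x k * (h : ℂ) ^ (2 * n + 2 * k + 2) := by
  obtain ⟨M, hM0, hM⟩ := hx.exists_norm_le
  have hK : 0 ≤ K := (norm_nonneg _).trans (hS 1 le_rfl)
  refine .of_norm_bounded ((summable_choose_even n (t := |h|) (by rwa [abs_abs])).mul_left
    (K * M * |h| ^ (2 * n + 2))) fun k => ?_
  rw [norm_mul, norm_mul, norm_pow, Complex.norm_real, Real.norm_eq_abs]
  calc ‖coeffG S n k‖ * ‖x k‖ * |h| ^ (2 * n + 2 * k + 2)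
      ≤ (((2 * n + 2 * k + 1).choose (2 * k) : ℝ) * K) * M * |h| ^ (2 * n + 2 * k + 2) := by
        gcongr
        · exact norm_coeffG_le hS n k
        · exact hM k
    _ = _ := by ring

/-- The sequence x + (1 - C) X solves the normalised system and so equals X. Adding a multiple of X
instead of dividing by C covers the case C = 0. -/
lemma IsUniqueBoundedSolution.eq_mul {σ : ℂ} {γ S : ℕ → ℂ} {K h : ℝ} {X : ℕ → ℂ}
    (hX : IsUniqueBoundedSolution σ γ S h X) (hS : ∀ m, 1 ≤ m → ‖S m‖ ≤ K) (hh : |h| < 1)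
    {x : ℕ → ℂ} {C : ℂ} (hx : Memℓp x ∞)
    (hsol : ∀ n, x n - σ * γ n * ∑' k, coeffG S n k * x k * (h : ℂ) ^ (2 * n + 2 * k + 2) =
      if n = 0 then C * γ 0 else 0) : x = fun n => C * X n := by
  obtain ⟨M, -, hM⟩ := hx.exists_norm_le
  obtain ⟨M', -, hM'⟩ := hX.1.1.exists_norm_le
  have hy : IsBoundedSolution σ γ S h (fun n => x n + (1 - C) * X n) := by
    refine ⟨memℓp_infty_of_norm_le (M := M + ‖1 - C‖ * M') fun n => ?_, fun n => ?_⟩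
    · refine (norm_add_le _ _).trans ?_
      rw [norm_mul]
      gcongr
      · exact hM n
      · exact hM' n
    · have h1 := summable_coeffG hS hh hx n
      have h2 := summable_coeffG hS hh hX.1.1 n
      have e : ∑' k, coeffG S n k * (x k + (1 - C) * X k) * (h : ℂ) ^ (2 * n + 2 * k + 2) =
          ∑' k, coeffG S n k * x k * (h : ℂ) ^ (2 * n + 2 * k + 2) +
          (1 - C) * ∑' k, coeffG S n k * X k * (h : ℂ) ^ (2 * n + 2 * k + 2) := by
        rw [← tsum_mul_left, ← h1.tsum_add (h2.mul_left _)]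
        exact tsum_congr fun k => by ring
      have h3 := hsol n
      have h4 := hX.1.2 n
      rw [e]
      split_ifs at h3 h4 ⊢
      · linear_combination h3 + (1 - C) * h4
      · linear_combination h3 + (1 - C) * h4
  have := hX.2 _ hy
  ext n
  have h5 := congrFun this n
  linear_combination h5

/-- As ν < 1, the sequence γ_n converges to α, and convergent sequences are bounded; a uniform lower
bound on the denominators is not needed. -/
lemma exists_norm_gam_le (εc εi εe : ℂ) {ν : ℝ} (h0 : 0 ≤ ν) (h1 : ν < 1) :
    ∃ M, ∀ n, ‖gam εc εi εe ν n‖ ≤ M := by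
  have hν : Tendsto (fun n : ℕ => (ν : ℂ) ^ (4 * n + 2)) atTop (𝓝 0) := by
    refine (tendsto_pow_atTop_nhds_zero_of_norm_lt_one (by
      rwa [Complex.norm_real, Real.norm_of_nonneg h0])).comp (tendsto_atTop_mono (fun n => ?_) tendsto_id)
    dsimp only [id]; omega
  have : Tendsto (gam εc εi εe ν) atTop (𝓝 ((alpha εi εe - alphaTilde εc εi * 0) /
      (1 - alpha εi εe * alphaTilde εc εi * 0))) :=
    (tendsto_const_nhds.sub (tendsto_const_nhds.mul hν)).div
      (tendsto_const_nhds.sub (tendsto_const_nhds.mul hν)) (by simp)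
  obtain ⟨M, hM⟩ := this.norm.bddAbove_range
  exact ⟨M, fun n => hM (mem_range_self n)⟩

/-- Both sides have the factor (2n+2k+1)!/((2n)!(2k)!). The weights 2n+1 and 2k+1 explain why the
unknowns of the system are modes divided by 2n+1. -/
lemma coeffG_eq_regCoeff (L : PeriodPair) (a : ℝ) (n k : ℕ) :
    (2 * n + 1) * (coeffG (latticeSum L) n k * ((a / spacing L : ℝ) : ℂ) ^ (2 * n + 2 * k + 2)) =
      (2 * k + 1) * (regCoeff L n k * (a : ℂ) ^ (2 * n + 2 * k + 2)) := by
  rw [coeffG, regCoeff, Nat.cast_choose ℂ (by omega),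
    show 2 * n + 2 * k + 1 - 2 * n = 2 * k + 1 by omega, Nat.factorial_succ (2 * n),
    Nat.factorial_succ (2 * k)]
  push_cast
  rw [div_pow, show 2 * (n + k + 1) = 2 * n + 2 * k + 2 by ring]
  have h1 : ((2 * n).factorial : ℂ) ≠ 0 := by exact_mod_cast Nat.factorial_ne_zero _
  have h2 : ((2 * k).factorial : ℂ) ≠ 0 := by exact_mod_cast Nat.factorial_ne_zero _
  have h3 : (2 * n + 1 : ℂ) ≠ 0 := by exact_mod_cast Nat.succ_ne_zero (2 * n)
  have h4 : (2 * k + 1 : ℂ) ≠ 0 := by exact_mod_cast Nat.succ_ne_zero (2 * k)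
  field_simp

variable {L : PeriodPair} {a b ℓ ν : ℝ} {εc εi εe : ℂ} {u : ℂ → ℂ}

lemma conj_conj_comp (u : ℂ → ℂ) :
    (fun w => (fun w => u ((starRingEnd ℂ) w)) ((starRingEnd ℂ) w)) = u := by
  ext w; simp

lemma exists_norm_circ_le {F : ℂ → ℂ} {r : ℝ} (hr : 0 ≤ r) (hF : ContinuousOn F {z | ‖z‖ = r}) :
    ∃ M, ∀ θ, ‖circ F r θ‖ ≤ M := by
  have hK : IsCompact {z : ℂ | ‖z‖ = r} := by
    have : {z : ℂ | ‖z‖ = r} = sphere 0 r := by ext z; simp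
    rw [this]
    exact isCompact_sphere _ _
  obtain ⟨M, hM⟩ := hK.exists_bound_of_continuousOn hF
  refine ⟨r * M, fun θ => ?_⟩
  rw [circ, norm_mul, norm_circle hr]
  exact mul_le_mul_of_nonneg_left (hM _ (norm_circle hr θ)) hr

/-- Only the ratio of εi/εe - 1 to εi/εe + 1 matters, and it is α. With q = α̃ ν^(4n+2) the quotient
of the two boundary combinations is γ_n. -/
lemma response_algebra {q Y : ℂ} (hεe : εe ≠ 0) (hie : εi + εe ≠ 0)
    (h : 1 - alpha εi εe * q ≠ 0) :
    (εi / εe + 1) / 2 * (-q * Y) + (εi / εe - 1) / 2 * Y =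
      (alpha εi εe - q) / (1 - alpha εi εe * q) *
        ((εi / εe + 1) / 2 * Y + (εi / εe - 1) / 2 * (-q * Y)) := by
  have h1 : (εi / εe - 1) / 2 = alpha εi εe * ((εi / εe + 1) / 2) := by
    rw [alpha]; field_simp
  rw [h1]
  generalize (εi / εe + 1) / 2 = c
  have h2 : c * Y + alpha εi εe * c * (-q * Y) = (1 - alpha εi εe * q) * (c * Y) := by ring
  rw [h2, ← mul_assoc (_ / _), div_mul_cancel₀ _ h]
  ring

namespace IsCellPotential

lemma continuousOn_tube_outer (hu : IsCellPotential L a b εc εi εe u) (hb : 0 ≤ b) (hab : b < a) :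
    ContinuousOn (dzWithin (tube 0 a b) u) {z | ‖z‖ = a} :=
  (hu.continuousOn_tube hb hab).mono fun _ hz => ⟨hab.le.trans_eq (Eq.symm hz), le_of_eq hz⟩

lemma exists_norm_mode_le (hu : IsCellPotential L a b εc εi εe u)
    (hu' : IsCellPotential L a b εc εi εe fun w => u ((starRingEnd ℂ) w))
    (hb : 0 ≤ b) (hab : b < a) : ∃ M, ∀ m : ℤ, ‖mode m (hostTrace a b εi εe u)‖ ≤ M := by
  obtain ⟨M, hM⟩ := exists_norm_circ_le (hb.trans hab.le) (hu.continuousOn_tube_outer hb hab)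
  obtain ⟨M', hM'⟩ := exists_norm_circ_le (hb.trans hab.le) (hu'.continuousOn_tube_outer hb hab)
  refine ⟨‖(εi / εe + 1) / 2‖ * M + ‖(εi / εe - 1) / 2‖ * M', fun m => norm_mode_le (fun θ => ?_) m⟩
  rw [hostTrace]
  refine (norm_add_le _ _).trans ?_
  rw [norm_mul, norm_mul]
  gcongr
  · exact hM θ
  · exact hM' (-θ)

lemma mode_hostTrace (hu : IsCellPotential L a b εc εi εe u)
    (hu' : IsCellPotential L a b εc εi εe fun w => u ((starRingEnd ℂ) w))
    (hb : 0 ≤ b) (hab : b < a) (m : ℤ) :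
    mode m (hostTrace a b εi εe u) =
      (εi / εe + 1) / 2 * mode m (circ (dzWithin (tube 0 a b) u) a) +
      (εi / εe - 1) / 2 *
        mode (-m) (circ (dzWithin (tube 0 a b) (fun w => u ((starRingEnd ℂ) w))) a) :=
  mode_reflect (continuous_circ (hb.trans hab.le) (hu.continuousOn_tube_outer hb hab))
    (continuous_circ (hb.trans hab.le) (hu'.continuousOn_tube_outer hb hab)) _ _ m

/-- The response of a tube to the applied field. -/
lemma mode_response (hu : IsCellPotential L a b εc εi εe u)
    (hu' : IsCellPotential L a b εc εi εe fun w => u ((starRingEnd ℂ) w))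
    (ha : 0 < a) (hν0 : 0 ≤ ν) (hν1 : ν < 1) (hb : b = ν * a) (hεi : εi ≠ 0) (hεe : εe ≠ 0)
    (hie : εi + εe ≠ 0) (hic : εi + εc ≠ 0)
    (hγ : ∀ n : ℕ, 1 - alpha εi εe * alphaTilde εc εi * (ν : ℂ) ^ (4 * n + 2) ≠ 0) (n : ℕ) :
    mode (-(2 * n + 1 : ℕ)) (hostTrace a b εi εe fun w => u ((starRingEnd ℂ) w)) =
      gam εc εi εe ν n * mode (2 * n + 1 : ℕ) (hostTrace a b εi εe u) := by
  have hb0 : 0 ≤ b := by rw [hb]; positivity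
  have hab : b < a := by rw [hb]; nlinarith
  have h2 := hu'.mode_hostTrace (by rw [conj_conj_comp]; exact hu) hb0 hab
    (εi := εi) (εe := εe) (-(2 * n + 1 : ℕ))
  rw [conj_conj_comp, neg_neg] at h2
  rw [h2, hu.mode_hostTrace hu' hb0 hab,
    hu.mode_tube hu' ha hν0 hν1 hb hεi hic (Nat.succ_ne_zero (2 * n)), gam,
    show 2 * (2 * n).succ = 4 * n + 2 by omega]
  have hγn := hγ n
  rw [mul_assoc] at hγn ⊢
  exact response_algebra hεe hie hγn

/-- The modes of the field determine a solution of the linear system. -/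
lemma mode_eq_mul (hL : IsTubeLattice L ℓ) (hu : IsCellPotential L a b εc εi εe u)
    (hu' : IsCellPotential L a b εc εi εe fun w => u ((starRingEnd ℂ) w))
    (ha : 0 < a) (haℓ : 2 * a ≤ ℓ) (hν0 : 0 ≤ ν) (hν1 : ν < 1) (hb : b = ν * a) (hεi : εi ≠ 0)
    (hεe : εe ≠ 0) (hie : εi + εe ≠ 0) (hic : εi + εc ≠ 0)
    (hγ : ∀ n : ℕ, 1 - alpha εi εe * alphaTilde εc εi * (ν : ℂ) ^ (4 * n + 2) ≠ 0)
    {σ : ℂ} (hσ : σ ^ 2 = 1) {X : ℕ → ℂ}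
    (hX : IsUniqueBoundedSolution σ (gam εc εi εe ν) (latticeSum L) (a / spacing L) X) :
    gam εc εi εe ν 0 * (mode 1 (hostTrace a b εi εe u) +
        σ * mode 1 (hostTrace a b εi εe fun w => u ((starRingEnd ℂ) w))) =
      (a / volume.real (cell L) * ((∫ z in voronoi L ∩ {z | a < ‖z‖}, dz u z) +
        σ * ∫ z in voronoi L ∩ {z | a < ‖z‖}, dz (fun w => u ((starRingEnd ℂ) w)) z) +
      volumeFraction L a * (mode 1 (hostTrace a b εi εe u) +
        σ * mode 1 (hostTrace a b εi εe fun w => u ((starRingEnd ℂ) w)))) * X 0 := by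
  have hb0 : 0 ≤ b := by rw [hb]; positivity
  have hab : b < a := by rw [hb]; nlinarith
  have hu'' : IsCellPotential L a b εc εi εe fun w => (fun w => u ((starRingEnd ℂ) w))
    ((starRingEnd ℂ) w) := by rw [conj_conj_comp]; exact hu
  set v : ℂ → ℂ := fun w => u ((starRingEnd ℂ) w) with hv
  set γ := gam εc εi εe ν with hγdef
  set P : ℕ → ℂ := fun n => mode (2 * n + 1 : ℕ) (hostTrace a b εi εe u) with hP
  set Q : ℕ → ℂ := fun n => mode (2 * n + 1 : ℕ) (hostTrace a b εi εe v) with hQ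
  -- The response exchanges `u` and its reflection `v`: negative modes of one are given by positive
  -- modes of the other. The combinations `P + σ Q` diagonalise this exchange.
  have hr1 : ∀ n : ℕ, mode (-(2 * n + 1 : ℕ)) (hostTrace a b εi εe v) = γ n * P n :=
    hu.mode_response hu' ha hν0 hν1 hb hεi hεe hie hic hγ
  have hr2 : ∀ n : ℕ, mode (-(2 * n + 1 : ℕ)) (hostTrace a b εi εe u) = γ n * Q n := by
    have := hu'.mode_response hu'' ha hν0 hν1 hb hεi hεe hie hic hγ
    rwa [conj_conj_comp] at this
  have hs1 := hu.hasSum_mode hL hu' ha haℓ hb0 hab hεe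
  have hs2 := hu'.hasSum_mode hL hu'' ha haℓ hb0 hab hεe
  simp only [hr1] at hs2
  simp only [hr2] at hs1
  have hP0 : mode 1 (hostTrace a b εi εe u) = P 0 := rfl
  have hQ0 : mode 1 (hostTrace a b εi εe v) = Q 0 := rfl
  rw [hP0, hQ0] at *
  set C : ℂ := a / volume.real (cell L) * ((∫ z in voronoi L ∩ {z | a < ‖z‖}, dz u z) +
        σ * ∫ z in voronoi L ∩ {z | a < ‖z‖}, dz v z) +
      volumeFraction L a * (P 0 + σ * Q 0) with hC
  obtain ⟨K, -, hK⟩ := hL.exists_norm_latticeSum_le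
  have hh : |a / spacing L| < 1 := by
    have := hL.pos
    rw [hL.spacing_eq, abs_of_pos (by positivity), div_lt_one this]
    linarith
  obtain ⟨M, hM⟩ := hu.exists_norm_mode_le hu' hb0 hab (εi := εi) (εe := εe)
  obtain ⟨M', hM'⟩ := hu'.exists_norm_mode_le hu'' hb0 hab (εi := εi) (εe := εe)
  obtain ⟨G, hG⟩ := exists_norm_gam_le εc εi εe hν0 hν1
  have hne : ∀ n : ℕ, (2 * n + 1 : ℂ) ≠ 0 := fun n => by exact_mod_cast Nat.succ_ne_zero (2 * n)
  -- The factor `γ n` passes from the positive modes to the induced multipole strengths, and `1 / (2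
  -- n + 1)` converts `regCoeff` into `coeffG`. The constant `C` is the inhomogeneity of the row n =
  -- 0.
  have key := hX.eq_mul hK hh (x := fun n => γ n * (P n + σ * Q n) / (2 * n + 1)) (C := C) ?_ ?_
  · have := congrFun key 0
    simpa using this
  · refine memℓp_infty_of_norm_le (M := G * (M + ‖σ‖ * M')) fun n => ?_
    rw [norm_div, norm_mul]
    have h1 : (1 : ℝ) ≤ ‖(2 * n + 1 : ℂ)‖ := by
      rw [show (2 * n + 1 : ℂ) = ((2 * n + 1 : ℕ) : ℂ) by push_cast; ring, Complex.norm_natCast]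
      exact_mod_cast Nat.le_add_left 1 (2 * n)
    have h2 : ‖P n + σ * Q n‖ ≤ M + ‖σ‖ * M' := by
      refine (norm_add_le _ _).trans ?_
      rw [norm_mul]
      gcongr
      · exact hM _
      · exact hM' _
    refine (div_le_self (by positivity) h1).trans ?_
    have hG0 : 0 ≤ G := (norm_nonneg _).trans (hG 0)
    exact mul_le_mul (hG n) h2 (norm_nonneg _) hG0
  · intro n
    -- The relation for `u` sums `γ k * Q k` and the one for `v` sums `γ k * P k`; with σ² = 1, σ
    -- times the first plus the second is a relation for `P + σ Q` alone.
    have hsum := (((hs1 n).mul_left σ).add (hs2 n)).mul_left (1 / (2 * n + 1) : ℂ)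
    have e : ∀ k, coeffG (latticeSum L) n k * (γ k * (P k + σ * Q k) / (2 * k + 1)) *
        ((a / spacing L : ℝ) : ℂ) ^ (2 * n + 2 * k + 2) =
        1 / (2 * n + 1) * (σ * (regCoeff L n k * (a : ℂ) ^ (2 * n + 2 * k + 2) * (γ k * Q k)) +
          regCoeff L n k * (a : ℂ) ^ (2 * n + 2 * k + 2) * (γ k * P k)) := by
      intro k
      have h1 := coeffG_eq_regCoeff L a n k
      have hn := hne n
      have hk := hne k
      field_simp
      linear_combination (γ k * (P k + σ * Q k)) * h1
    rw [tsum_congr e, hsum.tsum_eq]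
    have hn := hne n
    split_ifs with h0
    · subst h0
      push_cast
      rw [hC]
      linear_combination (-(γ 0 * P 0) + γ 0 * (a / volume.real (cell L) *
        (∫ z in voronoi L ∩ {z | a < ‖z‖}, dz u z) + volumeFraction L a * P 0)) * hσ
    · field_simp
      linear_combination (-(γ n * P n)) * hσ

end IsCellPotential

/-! ### Averages and the effective tensor -/

variable {L : PeriodPair} {a b ℓ ν : ℝ} {εc εi εe : ℂ} {u : ℂ → ℂ}

lemma voronoi_ae_eq (hL : IsTubeLattice L ℓ) (haℓ : 2 * a ≤ ℓ) (hab : b < a) :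
    ((voronoi L ∩ {z | a < ‖z‖}) ∪ ({z | b < ‖z‖ ∧ ‖z‖ < a} ∪ {z | 0 < ‖z‖ ∧ ‖z‖ < b}) : Set ℂ)
      =ᵐ[volume] voronoi L := by
  have hsub : (voronoi L ∩ {z | a < ‖z‖}) ∪
      ({z | b < ‖z‖ ∧ ‖z‖ < a} ∪ {z | 0 < ‖z‖ ∧ ‖z‖ < b}) ⊆ voronoi L := by
    have hB := closedBall_subset_voronoi haℓ hL.norm_le
    rintro z (hz | hz | hz)
    · exact hz.1
    · exact hB (by simpa using hz.2.le)
    · exact hB (by simpa using (hz.2.trans hab).le)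
  refine hsub.eventuallyLE.antisymm ?_
  have hnull : volume (sphere (0 : ℂ) a ∪ sphere 0 b ∪ {0}) = 0 := by
    rw [measure_union_null_iff, measure_union_null_iff]
    exact ⟨⟨by rw [Measure.addHaar_sphere], by rw [Measure.addHaar_sphere]⟩, by simp⟩
  refine ae_le_set.mpr (measure_mono_null ?_ hnull)
  rintro z ⟨hz, hz'⟩
  by_contra hc
  simp only [mem_union, mem_sphere_zero_iff_norm, mem_singleton_iff, not_or] at hc
  refine hz' ?_
  have h0 : 0 < ‖z‖ := norm_pos_iff.mpr hc.2
  rcases lt_or_gt_of_ne hc.1.1 with h | h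
  · rcases lt_or_gt_of_ne hc.1.2 with h' | h'
    · exact Or.inr (Or.inr ⟨h0, h'⟩)
    · exact Or.inr (Or.inl ⟨h', h⟩)
  · exact Or.inl ⟨hz, h⟩

lemma integral_voronoi_split (hL : IsTubeLattice L ℓ) (haℓ : 2 * a ≤ ℓ)
    (hab : b < a) {g : ℂ → ℂ} (h1 : IntegrableOn g (voronoi L ∩ {z | a < ‖z‖}))
    (h2 : IntegrableOn g {z | b < ‖z‖ ∧ ‖z‖ < a}) (h3 : IntegrableOn g {z | 0 < ‖z‖ ∧ ‖z‖ < b}) :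
    IntegrableOn g (voronoi L) ∧
    ∫ z in voronoi L, g z = (∫ z in voronoi L ∩ {z | a < ‖z‖}, g z) +
      ((∫ z in {z | b < ‖z‖ ∧ ‖z‖ < a}, g z) + ∫ z in {z | 0 < ‖z‖ ∧ ‖z‖ < b}, g z) := by
  refine ⟨(h1.union (h2.union h3)).congr_set_ae (voronoi_ae_eq hL haℓ hab).symm, ?_⟩
  have hm : ∀ r s : ℝ, MeasurableSet {z : ℂ | r < ‖z‖ ∧ ‖z‖ < s} := fun r s =>
    (measurableSet_lt measurable_const measurable_norm).inter
      (measurableSet_lt measurable_norm measurable_const)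
  rw [← setIntegral_union _ (hm 0 b) h2 h3, ← setIntegral_union _ ((hm b a).union (hm 0 b)) h1
    (h2.union h3)]
  · exact setIntegral_congr_set (voronoi_ae_eq hL haℓ hab).symm
  · rw [Set.disjoint_left]
    rintro z hz (hz' | hz')
    · exact lt_asymm hz.2 hz'.2
    · exact lt_asymm (hab.trans hz.2) hz'.2
  · rw [Set.disjoint_left]
    rintro z hz hz'
    exact lt_asymm hz.1 hz'.2

lemma integrableOn_annulus {F g : ℂ → ℂ} {r s : ℝ}
    (hc : ContinuousOn F {z | r ≤ ‖z‖ ∧ ‖z‖ ≤ s})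
    (hgF : ∀ z, r < ‖z‖ → ‖z‖ < s → g z = F z) : IntegrableOn g {z : ℂ | r < ‖z‖ ∧ ‖z‖ < s} := by
  have hK : IsCompact {z : ℂ | r ≤ ‖z‖ ∧ ‖z‖ ≤ s} := by
    have e : {z : ℂ | r ≤ ‖z‖ ∧ ‖z‖ ≤ s} = closedBall (0 : ℂ) s ∩ {z | r ≤ ‖z‖} := by
      ext z; simp [and_comm]
    rw [e]
    exact (isCompact_closedBall _ _).inter_right (isClosed_le continuous_const continuous_norm)
  have hm : MeasurableSet {z : ℂ | r < ‖z‖ ∧ ‖z‖ < s} :=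
    (measurableSet_lt measurable_const measurable_norm).inter
      (measurableSet_lt measurable_norm measurable_const)
  have hsub : {z : ℂ | r < ‖z‖ ∧ ‖z‖ < s} ⊆ {z : ℂ | r ≤ ‖z‖ ∧ ‖z‖ ≤ s} :=
    fun z hz => ⟨hz.1.le, hz.2.le⟩
  exact ((hc.integrableOn_compact hK).mono_set hsub).congr_fun
    (fun z hz => (hgF z hz.1 hz.2).symm) hm

lemma epsilon_core {z : ℂ} (h : ‖z‖ < b) : epsilon L a b εc εi εe z = εc := by
  rw [epsilon, if_pos ⟨0, L.lattice.zero_mem, by simpa using h⟩]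

lemma epsilon_tube (hL : IsTubeLattice L ℓ) (haℓ : 2 * a ≤ ℓ) {z : ℂ} (h : b < ‖z‖)
    (h' : ‖z‖ < a) : epsilon L a b εc εi εe z = εi := by
  rw [epsilon, if_neg, if_pos ⟨0, L.lattice.zero_mem, by simpa using h'⟩]
  rintro ⟨p, hp, hpz⟩
  rcases eq_or_ne p 0 with rfl | hp0
  · rw [sub_zero] at hpz; linarith
  · have h1 := hL.norm_le p hp hp0
    have h2 := norm_sub_norm_le p z
    rw [norm_sub_rev] at h2
    linarith

lemma epsilon_host (hab : b < a) {z : ℂ} (h : z ∈ openHost L a) :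
    epsilon L a b εc εi εe z = εe := by
  rw [epsilon, if_neg, if_neg]
  · rintro ⟨p, hp, hpz⟩
    exact lt_asymm hpz (h p hp)
  · rintro ⟨p, hp, hpz⟩
    exact lt_asymm hpz (hab.trans (h p hp))

namespace IsCellPotential

lemma mode_zero (hu : IsCellPotential L a b εc εi εe u)
    (hu' : IsCellPotential L a b εc εi εe fun w => u ((starRingEnd ℂ) w))
    (ha : 0 < a) (hν0 : 0 ≤ ν) (hν1 : ν < 1) (hb : b = ν * a) (hεi : εi ≠ 0)
    (hic : εi + εc ≠ 0) :
    mode 1 (hostTrace a b εi εe u) = ((εi / εe + 1) / 2 + (εi / εe - 1) / 2 *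
      -(alphaTilde εc εi * (ν : ℂ) ^ 2)) * mode 1 (circ (dzWithin (tube 0 a b) u) a) ∧
    mode (-1) (hostTrace a b εi εe fun w => u ((starRingEnd ℂ) w)) =
      ((εi / εe + 1) / 2 * -(alphaTilde εc εi * (ν : ℂ) ^ 2) + (εi / εe - 1) / 2) *
        mode 1 (circ (dzWithin (tube 0 a b) u) a) := by
  have hb0 : 0 ≤ b := by rw [hb]; positivity
  have hab : b < a := by rw [hb]; nlinarith
  have h1 := hu.mode_hostTrace hu' hb0 hab (εi := εi) (εe := εe) 1
  have h2 := hu'.mode_hostTrace (by rw [conj_conj_comp]; exact hu) hb0 hab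
    (εi := εi) (εe := εe) (-1)
  rw [conj_conj_comp, neg_neg] at h2
  have h3 := hu.mode_tube hu' ha hν0 hν1 hb hεi hic one_ne_zero
  simp only [Nat.cast_one, mul_one] at h3
  rw [h1, h2, h3]
  constructor <;> ring

/-- Morally the divergence theorem: continuity of u and of the flux make the integrals of ∂u and ε∂u
over core and tube depend only on the outer trace, through the difference and the sum of mode 1 of u
and mode -1 of v, the latter being γ_0 times the former. The proof computes both from the tube mode.
-/
lemma integral_inclusion (hu : IsCellPotential L a b εc εi εe u)
    (hu' : IsCellPotential L a b εc εi εe fun w => u ((starRingEnd ℂ) w))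
    (ha : 0 < a) (hν0 : 0 ≤ ν) (hν1 : ν < 1) (hb : b = ν * a) (hεi : εi ≠ 0) (hεe : εe ≠ 0)
    (hie : εi + εe ≠ 0) (hic : εi + εc ≠ 0)
    (hγ : ∀ n : ℕ, 1 - alpha εi εe * alphaTilde εc εi * (ν : ℂ) ^ (4 * n + 2) ≠ 0) :
    (∫ z in {z | b < ‖z‖ ∧ ‖z‖ < a}, dz u z) + (∫ z in {z | 0 < ‖z‖ ∧ ‖z‖ < b}, dz u z) =
      Real.pi * a * (1 - gam εc εi εe ν 0) * mode 1 (hostTrace a b εi εe u) ∧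
    εi * (∫ z in {z | b < ‖z‖ ∧ ‖z‖ < a}, dz u z) +
      εc * (∫ z in {z | 0 < ‖z‖ ∧ ‖z‖ < b}, dz u z) =
      εe * (Real.pi * a * (1 + gam εc εi εe ν 0) * mode 1 (hostTrace a b εi εe u)) := by
  have hb0 : 0 ≤ b := by rw [hb]; positivity
  have hab : b < a := by rw [hb]; nlinarith
  have h1 := hu.integral_tube hb0 hab
  have h2 : ∫ z in {z : ℂ | 0 < ‖z‖ ∧ ‖z‖ < b}, dz u z = Real.pi * b ^ 2 / a *
      (2 * εi / (εi + εc)) * mode 1 (circ (dzWithin (tube 0 a b) u) a) := by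
    rcases hb0.eq_or_lt with h0 | h0
    · have : {z : ℂ | 0 < ‖z‖ ∧ ‖z‖ < b} = ∅ := by
        ext z; simp [← h0]
      rw [this, ← h0]
      simp
    · exact hu.integral_core hu' h0 hab hεi hic
  obtain ⟨h3, h4⟩ := hu.mode_zero hu' ha hν0 hν1 hb hεi hic (εe := εe)
  have h5 : mode (-1) (hostTrace a b εi εe fun w => u ((starRingEnd ℂ) w)) =
      gam εc εi εe ν 0 * mode 1 (hostTrace a b εi εe u) :=
    hu.mode_response hu' ha hν0 hν1 hb hεi hεe hie hic hγ 0
  have h6 : ∀ c : ℂ, c * (1 - gam εc εi εe ν 0) * mode 1 (hostTrace a b εi εe u) =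
    c * (mode 1 (hostTrace a b εi εe u) -
      mode (-1) (hostTrace a b εi εe fun w => u ((starRingEnd ℂ) w))) := fun c => by
        rw [h5]; ring
  have h7 : ∀ c : ℂ, c * (1 + gam εc εi εe ν 0) * mode 1 (hostTrace a b εi εe u) =
    c * (mode 1 (hostTrace a b εi εe u) +
      mode (-1) (hostTrace a b εi εe fun w => u ((starRingEnd ℂ) w))) := fun c => by
        rw [h5]; ring
  rw [h6, h7, h1, h2, h3, h4, hb, alphaTilde]
  have ha0 : (a : ℂ) ≠ 0 := by exact_mod_cast ha.ne'
  push_cast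
  constructor
  · field_simp
    ring
  · field_simp
    ring

lemma integrableOn_pieces (hu : IsCellPotential L a b εc εi εe u) (hb : 0 ≤ b) (hab : b < a) :
    IntegrableOn (dz u) {z | b < ‖z‖ ∧ ‖z‖ < a} ∧
    IntegrableOn (dz u) {z | 0 < ‖z‖ ∧ ‖z‖ < b} := by
  refine ⟨integrableOn_annulus (hu.continuousOn_tube hb hab)
    fun _ h h' => (dzWithin_eq (tube_mem_nhds h h')).symm, ?_⟩
  rcases hb.eq_or_lt with h0 | h0
  · have : {z : ℂ | 0 < ‖z‖ ∧ ‖z‖ < b} = ∅ := by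
      ext z; simp [← h0]
    rw [this]
    exact integrableOn_empty
  · refine integrableOn_annulus (F := dzWithin (closedBall 0 b) u) ?_ ?_
    · refine (continuousOn_dzWithin (uniqueDiffOn_closedBall h0) hu.c1_core).mono fun z hz => ?_
      simpa using hz
    · exact fun z _ h => (dzWithin_eq (closedBall_mem_nhds_of_mem (by simpa using h))).symm

/-- The integrals of `∂u/∂z` and of `ε ∂u/∂z` over the cell. -/
lemma integral_dz (hL : IsTubeLattice L ℓ) (hu : IsCellPotential L a b εc εi εe u)
    (hu' : IsCellPotential L a b εc εi εe fun w => u ((starRingEnd ℂ) w))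
    (ha : 0 < a) (haℓ : 2 * a ≤ ℓ) (hν0 : 0 ≤ ν) (hν1 : ν < 1) (hb : b = ν * a) (hεi : εi ≠ 0)
    (hεe : εe ≠ 0) (hie : εi + εe ≠ 0) (hic : εi + εc ≠ 0)
    (hγ : ∀ n : ℕ, 1 - alpha εi εe * alphaTilde εc εi * (ν : ℂ) ^ (4 * n + 2) ≠ 0) :
    IntegrableOn (dz u) (voronoi L) ∧
    IntegrableOn (fun z => epsilon L a b εc εi εe z * dz u z) (voronoi L) ∧
    ∫ z in voronoi L, dz u z = (∫ z in voronoi L ∩ {z | a < ‖z‖}, dz u z) +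
      Real.pi * a * (1 - gam εc εi εe ν 0) * mode 1 (hostTrace a b εi εe u) ∧
    ∫ z in voronoi L, epsilon L a b εc εi εe z * dz u z =
      εe * ((∫ z in voronoi L ∩ {z | a < ‖z‖}, dz u z) +
        Real.pi * a * (1 + gam εc εi εe ν 0) * mode 1 (hostTrace a b εi εe u)) := by
  have hb0 : 0 ≤ b := by rw [hb]; positivity
  have hab : b < a := by rw [hb]; nlinarith
  obtain ⟨h1, -⟩ := hu.stokes_perMultipole hL ha haℓ hb0 hab hεe 0
  obtain ⟨h2, h3⟩ := hu.integrableOn_pieces hb0 hab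
  obtain ⟨e1, e2⟩ := hu.integral_inclusion hu' ha hν0 hν1 hb hεi hεe hie hic hγ
  have hm : ∀ r s : ℝ, MeasurableSet {z : ℂ | r < ‖z‖ ∧ ‖z‖ < s} := fun r s =>
    (measurableSet_lt measurable_const measurable_norm).inter
      (measurableSet_lt measurable_norm measurable_const)
  have hmeas : MeasurableSet (voronoi L ∩ {z | a < ‖z‖}) :=
    (isClosed_voronoi L).measurableSet.inter (measurableSet_lt measurable_const measurable_norm)
  have c1 : EqOn (fun z => epsilon L a b εc εi εe z * dz u z) (fun z => εe * dz u z)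
      (voronoi L ∩ {z | a < ‖z‖}) := fun z hz => by
    simp only
    rw [epsilon_host hab (mem_openHost_of_mem_voronoi hz.1 hz.2)]
  have c2 : EqOn (fun z => epsilon L a b εc εi εe z * dz u z) (fun z => εi * dz u z)
      {z | b < ‖z‖ ∧ ‖z‖ < a} := fun z hz => by
    simp only
    rw [epsilon_tube hL haℓ hz.1 hz.2]
  have c3 : EqOn (fun z => epsilon L a b εc εi εe z * dz u z) (fun z => εc * dz u z)
      {z | 0 < ‖z‖ ∧ ‖z‖ < b} := fun z hz => by
    simp only
    rw [epsilon_core hz.2]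
  obtain ⟨i1, s1⟩ := integral_voronoi_split hL haℓ hab h1 h2 h3
  obtain ⟨i2, s2⟩ := integral_voronoi_split hL haℓ hab
    (IntegrableOn.congr_fun (h1.const_mul εe) c1.symm hmeas)
    (IntegrableOn.congr_fun (h2.const_mul εi) c2.symm (hm _ _))
    (IntegrableOn.congr_fun (h3.const_mul εc) c3.symm (hm _ _))
  refine ⟨i1, i2, ?_, ?_⟩
  · rw [s1, e1]
  · rw [s2, setIntegral_congr_fun hmeas c1, setIntegral_congr_fun (hm _ _) c2,
      setIntegral_congr_fun (hm _ _) c3, integral_const_mul, integral_const_mul,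
      integral_const_mul, e2]
    ring

/-- The averaged relation between displacement and field for one of the two symmetry types. -/
lemma averaged_relation (hL : IsTubeLattice L ℓ) (hu : IsCellPotential L a b εc εi εe u)
    (hu' : IsCellPotential L a b εc εi εe fun w => u ((starRingEnd ℂ) w))
    (ha : 0 < a) (haℓ : 2 * a ≤ ℓ) (hν0 : 0 ≤ ν) (hν1 : ν < 1) (hb : b = ν * a) (hεi : εi ≠ 0)
    (hεe : εe ≠ 0) (hie : εi + εe ≠ 0) (hic : εi + εc ≠ 0)
    (hγ : ∀ n : ℕ, 1 - alpha εi εe * alphaTilde εc εi * (ν : ℂ) ^ (4 * n + 2) ≠ 0)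
    {σ : ℂ} (hσ : σ ^ 2 = 1) {X : ℕ → ℂ}
    (hX : IsUniqueBoundedSolution σ (gam εc εi εe ν) (latticeSum L) (a / spacing L) X)
    (hne : 1 - X 0 * volumeFraction L a ≠ 0) :
    (∫ z in voronoi L, epsilon L a b εc εi εe z * dz u z) +
      σ * (∫ z in voronoi L, epsilon L a b εc εi εe z * dz (fun w => u ((starRingEnd ℂ) w)) z) =
    εe * ((1 + X 0 * volumeFraction L a) / (1 - X 0 * volumeFraction L a)) *
      ((∫ z in voronoi L, dz u z) +
        σ * ∫ z in voronoi L, dz (fun w => u ((starRingEnd ℂ) w)) z) := by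
  obtain ⟨-, -, h1, h2⟩ := hu.integral_dz hL hu' ha haℓ hν0 hν1 hb hεi hεe hie hic hγ
  obtain ⟨-, -, h3, h4⟩ := hu'.integral_dz hL (by rw [conj_conj_comp]; exact hu) ha haℓ hν0 hν1 hb
    hεi hεe hie hic hγ
  have key := hu.mode_eq_mul hL hu' ha haℓ hν0 hν1 hb hεi hεe hie hic hγ hσ hX
  rw [h1, h2, h3, h4]
  generalize mode 1 (hostTrace a b εi εe u) = P at *
  generalize mode 1 (hostTrace a b εi εe fun w => u ((starRingEnd ℂ) w)) = Q at *
  generalize ∫ z in voronoi L ∩ {z | a < ‖z‖}, dz u z = I at *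
  generalize ∫ z in voronoi L ∩ {z | a < ‖z‖}, dz (fun w => u ((starRingEnd ℂ) w)) z = J at *
  generalize gam εc εi εe ν 0 = g at *
  have ha0 : (a : ℂ) ≠ 0 := by exact_mod_cast ha.ne'
  have hS : (volume.real (cell L) : ℂ) ≠ 0 := by exact_mod_cast (volume_cell_pos L).ne'
  have hf : (volumeFraction L a : ℂ) = Real.pi * a ^ 2 / volume.real (cell L) := by
    rw [volumeFraction]; push_cast; rfl
  have hf' : Real.pi * (a : ℂ) = volumeFraction L a * (volume.real (cell L) / a) := by
    rw [hf]; field_simp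
  rw [hf']
  generalize (volumeFraction L a : ℂ) = f at *
  have key' : g * (P + σ * Q) = (1 / (volume.real (cell L) / a) * (I + σ * J) +
      f * (P + σ * Q)) * X 0 := by
    rw [key]; field_simp
  have hs0 : (volume.real (cell L) / a : ℂ) ≠ 0 := div_ne_zero hS ha0
  generalize (volume.real (cell L) / a : ℂ) = s at *
  have key2 : s * (g * (P + σ * Q)) = ((I + σ * J) + s * f * (P + σ * Q)) * X 0 := by
    rw [key']; field_simp
  rw [mul_assoc εe, div_mul_eq_mul_div, mul_div_assoc', eq_div_iff hne]
  linear_combination (2 * εe * f) * key2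

end IsCellPotential

variable {L : PeriodPair} {a b ℓ ν : ℝ} {εc εi εe : ℂ} {u : ℂ → ℂ}

lemma conj_preimage_voronoi (hconj : ∀ p ∈ L.lattice, (starRingEnd ℂ) p ∈ L.lattice) :
    (starRingEnd ℂ) ⁻¹' voronoi L = voronoi L := by
  ext z
  constructor
  · intro h p hp
    have := h _ (hconj p hp)
    rwa [norm_conj_sub_conj, Complex.norm_conj] at this
  · intro h p hp
    have := h _ (hconj p hp)
    rwa [← norm_conj_sub_conj, Complex.conj_conj, ← Complex.norm_conj] at this

lemma integrableOn_voronoi_conj (hconj : ∀ p ∈ L.lattice, (starRingEnd ℂ) p ∈ L.lattice)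
    {g : ℂ → ℂ} (hg : IntegrableOn g (voronoi L)) :
    IntegrableOn (fun z => g ((starRingEnd ℂ) z)) (voronoi L) ∧
    ∫ z in voronoi L, g ((starRingEnd ℂ) z) = ∫ z in voronoi L, g z := by
  have hmp : MeasurePreserving Complex.conjLIE volume volume := Complex.conjLIE.measurePreserving
  have he : MeasurableEmbedding Complex.conjLIE :=
    Complex.conjLIE.toHomeomorph.measurableEmbedding
  have hpre : Complex.conjLIE ⁻¹' voronoi L = voronoi L := conj_preimage_voronoi hconj
  have h1 := hmp.setIntegral_preimage_emb he g (voronoi L)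
  have h2 := hmp.integrableOn_comp_preimage he (f := g) (s := voronoi L)
  rw [hpre] at h1 h2
  exact ⟨h2.mpr hg, h1⟩

lemma epsilon_conj (hconj : ∀ p ∈ L.lattice, (starRingEnd ℂ) p ∈ L.lattice) (z : ℂ) :
    epsilon L a b εc εi εe ((starRingEnd ℂ) z) = epsilon L a b εc εi εe z := by
  have h : ∀ r : ℝ, (∃ p ∈ L.lattice, ‖(starRingEnd ℂ) z - p‖ < r) ↔
      ∃ p ∈ L.lattice, ‖z - p‖ < r := by
    intro r
    constructor
    · rintro ⟨p, hp, h⟩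
      exact ⟨_, hconj p hp, by rwa [← norm_conj_sub_conj, Complex.conj_conj]⟩
    · rintro ⟨p, hp, h⟩
      exact ⟨_, hconj p hp, by rwa [norm_conj_sub_conj]⟩
  classical
  unfold epsilon
  exact if_congr (h b) rfl (if_congr (h a) rfl rfl)

lemma epsilon_add {p : ℂ} (hp : p ∈ L.lattice) (z : ℂ) :
    epsilon L a b εc εi εe (z + p) = epsilon L a b εc εi εe z := by
  have h : ∀ r : ℝ, (∃ q ∈ L.lattice, ‖z + p - q‖ < r) ↔ ∃ q ∈ L.lattice, ‖z - q‖ < r := by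
    intro r
    constructor
    · rintro ⟨q, hq, h⟩
      exact ⟨q - p, L.lattice.sub_mem hq hp, by rwa [show z - (q - p) = z + p - q by ring]⟩
    · rintro ⟨q, hq, h⟩
      exact ⟨q + p, L.lattice.add_mem hq hp, by rwa [add_sub_add_right_eq_sub]⟩
  classical
  unfold epsilon
  exact if_congr (h b) rfl (if_congr (h a) rfl rfl)

/-- These are ∂_x = ∂ + ∂̄ and ∂_y = i(∂ - ∂̄), with ∂̄u rewritten through the reflected potential;
hence σ = 1 belongs to the first component of the field and σ = -1 to the second. -/
lemma fderiv_eq_dz (u : ℂ → ℂ) (z : ℂ) :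
    fderiv ℝ u z 1 = dz u z + dz (fun w => u ((starRingEnd ℂ) w)) ((starRingEnd ℂ) z) ∧
    fderiv ℝ u z Complex.I =
      Complex.I * (dz u z - dz (fun w => u ((starRingEnd ℂ) w)) ((starRingEnd ℂ) z)) := by
  have h : dz (fun w => u ((starRingEnd ℂ) w)) ((starRingEnd ℂ) z) =
      (fderiv ℝ u z 1 + Complex.I * fderiv ℝ u z Complex.I) / 2 := by
    rw [dz, fderiv_comp_conj, fderiv_comp_conj]
    simp
  rw [h, dz]
  constructor
  · ring
  · linear_combination (fderiv ℝ u z Complex.I) * Complex.I_sq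

/-- The cell averages of the field in terms of the complex derivative. -/
lemma avgField_eq (hL : IsTubeLattice L ℓ) (hper : ∀ p ∈ L.lattice, ∀ z, fderiv ℝ u (z + p) = fderiv ℝ u z)
    {ε : ℂ → ℂ} (hε : ∀ p ∈ L.lattice, ∀ z, ε (z + p) = ε z)
    (hεc : ∀ z, ε ((starRingEnd ℂ) z) = ε z)
    (h1 : IntegrableOn (fun z => ε z * dz u z) (voronoi L))
    (h2 : IntegrableOn (fun z => ε z * dz (fun w => u ((starRingEnd ℂ) w)) z) (voronoi L)) :
    (fun i => ⨍ z in cell L, ε z * field u z i) =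
      (-(1 / volume.real (cell L)) : ℂ) • ![(∫ z in voronoi L, ε z * dz u z) +
          1 * ∫ z in voronoi L, ε z * dz (fun w => u ((starRingEnd ℂ) w)) z,
        Complex.I * ((∫ z in voronoi L, ε z * dz u z) +
          -1 * ∫ z in voronoi L, ε z * dz (fun w => u ((starRingEnd ℂ) w)) z)] := by
  obtain ⟨h3, e3⟩ := integrableOn_voronoi_conj hL.conj_mem h2
  simp only [hεc] at h3 e3
  ext i
  rw [setAverage_eq, setIntegral_cell_eq]
  · fin_cases i
    · simp only [field, Fin.zero_eta, Matrix.cons_val_zero, Pi.smul_apply, smul_eq_mul,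
        Complex.real_smul]
      have : ∀ z, ε z * -fderiv ℝ u z 1 = -(ε z * dz u z + ε z *
          dz (fun w => u ((starRingEnd ℂ) w)) ((starRingEnd ℂ) z)) := fun z => by
        rw [(fderiv_eq_dz u z).1]; ring
      simp only [this]
      rw [integral_neg, integral_add h1 h3, e3]
      push_cast
      ring
    · simp only [field, Fin.mk_one, Matrix.cons_val_one, Pi.smul_apply, smul_eq_mul,
        Complex.real_smul, Matrix.cons_val_fin_one]
      have : ∀ z, ε z * -fderiv ℝ u z Complex.I = (-Complex.I) * (ε z * dz u z - ε z *
          dz (fun w => u ((starRingEnd ℂ) w)) ((starRingEnd ℂ) z)) := fun z => by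
        rw [(fderiv_eq_dz u z).2]; ring
      simp only [this]
      rw [integral_const_mul, integral_sub h1 h3, e3]
      push_cast
      ring
  · intro p hp z
    simp only [field, hε p hp, hper p hp]

/-- The effective tensor of the array is isotropic. -/
theorem IsTubeLattice.isEffectiveTensor (hL : IsTubeLattice L ℓ)
    (ha : 0 < a) (haℓ : 2 * a ≤ ℓ) (hν0 : 0 ≤ ν) (hν1 : ν < 1) (hεi : εi ≠ 0)
    (hεe : εe ≠ 0) (hie : εi + εe ≠ 0) (hic : εi + εc ≠ 0)
    (hγ : ∀ n : ℕ, 1 - alpha εi εe * alphaTilde εc εi * (ν : ℂ) ^ (4 * n + 2) ≠ 0)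
    {X Y : ℕ → ℂ}
    (hX : IsUniqueBoundedSolution 1 (gam εc εi εe ν) (latticeSum L) (a / spacing L) X)
    (hY : IsUniqueBoundedSolution (-1) (gam εc εi εe ν) (latticeSum L) (a / spacing L) Y)
    (hXY : X 0 = Y 0) (hne : 1 - X 0 * volumeFraction L a ≠ 0) :
    IsEffectiveTensor L a (ν * a) εc εi εe
      ((εe * ((1 + X 0 * volumeFraction L a) / (1 - X 0 * volumeFraction L a))) •
        (1 : Matrix (Fin 2) (Fin 2) ℂ)) := by
  intro u hu
  have hb0 : 0 ≤ ν * a := by positivity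
  have hab : ν * a < a := by nlinarith
  have h := hu.isCellPotential
  have h' := hu.isCellPotential_conj hL ha hb0 hab
  have h'' : IsCellPotential L a (ν * a) εc εi εe fun w => (fun w => u ((starRingEnd ℂ) w))
    ((starRingEnd ℂ) w) := by rw [conj_conj_comp]; exact h
  obtain ⟨i1, i2, -, -⟩ := h.integral_dz hL h' ha haℓ hν0 hν1 rfl hεi hεe hie hic hγ
  obtain ⟨i3, i4, -, -⟩ := h'.integral_dz hL h'' ha haℓ hν0 hν1 rfl hεi hεe hie hic hγ
  -- System (X) governs the first component of the averages and (Y) the second; since `X 0 = Y 0`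
  -- both carry the same factor, so the tensor is scalar.
  have r1 := h.averaged_relation hL h' ha haℓ hν0 hν1 rfl hεi hεe hie hic hγ (σ := 1)
    (by norm_num) hX hne
  have r2 := h.averaged_relation hL h' ha haℓ hν0 hν1 rfl hεi hεe hie hic hγ (σ := -1)
    (by norm_num) hY (by rwa [← hXY])
  rw [← hXY] at r2
  have a1 := avgField_eq hL (fun p hp z => hu.fderiv_add hp z) (ε := fun _ => 1)
    (fun _ _ _ => rfl) (fun _ => rfl) (by simpa using i1) (by simpa using i3)
  have a2 := avgField_eq hL (fun p hp z => hu.fderiv_add hp z)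
    (ε := epsilon L a (ν * a) εc εi εe) (fun p hp z => epsilon_add hp z)
    (epsilon_conj hL.conj_mem) i2 i4
  simp only [one_mul] at a1 r1
  have a1' : avgField L u = _ := a1
  have a2' : avgDisplacement L a (ν * a) εc εi εe u = _ := a2
  rw [a1', a2', Matrix.smul_mulVec, Matrix.one_mulVec, one_mul, r1, r2]
  ext i
  fin_cases i <;> simp <;> ring

/-! ### Decay of solutions and the associated series -/

lemma tsum_choose_even_le (n : ℕ) {s : ℝ} (h0 : 0 ≤ s) (h1 : s < 1) :
    ∑' k : ℕ, ((2 * n + 2 * k + 1).choose (2 * k) : ℝ) * s ^ (2 * k) ≤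
      1 / (1 - s) ^ (2 * n + 2) := by
  have hs : ‖s‖ < 1 := by rwa [Real.norm_of_nonneg h0]
  have h := summable_choose_mul_geometric_of_norm_lt_one (R := ℝ) (2 * n + 1) hs
  rw [show 2 * n + 2 = 2 * n + 1 + 1 by ring, ← tsum_choose_mul_geometric_of_norm_lt_one _ hs]
  have e : ∀ k : ℕ, ((2 * n + 2 * k + 1).choose (2 * k) : ℝ) * s ^ (2 * k) =
      ((2 * k + (2 * n + 1)).choose (2 * n + 1) : ℝ) * s ^ (2 * k) := fun k => by
    rw [show 2 * k + (2 * n + 1) = 2 * n + 2 * k + 1 by ring, ← Nat.choose_symm (by omega),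
      show 2 * n + 2 * k + 1 - 2 * k = 2 * n + 1 by omega]
  rw [tsum_congr e]
  have hinj : Function.Injective fun k : ℕ => 2 * k := fun a b h => by simpa using h
  exact tsum_comp_le_tsum_of_inj h (fun j => by positivity) hinj

/-- The binomial series sums to a power of 1/(1 - |w|), so the matrix maps bounded sequences to
geometrically decaying ones when |w| < 1/2. This smoothing drives the construction of potentials for
tubes that do not touch and the Neumann series for small h. -/
lemma norm_tsum_coeffG_le {S : ℕ → ℂ} {K : ℝ} (hS : ∀ m, 1 ≤ m → ‖S m‖ ≤ K) {w : ℂ} (hw : ‖w‖ < 1)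
    {x : ℕ → ℂ} {M : ℝ} (hx : ∀ n, ‖x n‖ ≤ M) (n : ℕ) :
    ‖∑' k, coeffG S n k * x k * w ^ (2 * n + 2 * k + 2)‖ ≤
      K * M * (‖w‖ / (1 - ‖w‖)) ^ (2 * n + 2) := by
  have hK : 0 ≤ K := (norm_nonneg _).trans (hS 1 le_rfl)
  have hM : 0 ≤ M := (norm_nonneg _).trans (hx 0)
  have hsum := (summable_choose_even n (t := ‖w‖) (by rwa [abs_of_nonneg (norm_nonneg w)])).mul_left
    (K * M * ‖w‖ ^ (2 * n + 2))
  refine (tsum_of_norm_bounded hsum.hasSum fun k => ?_).trans ?_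
  · rw [norm_mul, norm_mul, norm_pow]
    calc ‖coeffG S n k‖ * ‖x k‖ * ‖w‖ ^ (2 * n + 2 * k + 2)
        ≤ (((2 * n + 2 * k + 1).choose (2 * k) : ℝ) * K) * M * ‖w‖ ^ (2 * n + 2 * k + 2) := by
          gcongr
          · exact norm_coeffG_le hS n k
          · exact hx k
      _ = _ := by ring
  · rw [tsum_mul_left, div_pow]
    have := tsum_choose_even_le n (norm_nonneg w) hw
    calc K * M * ‖w‖ ^ (2 * n + 2) * _ ≤ K * M * ‖w‖ ^ (2 * n + 2) * (1 / (1 - ‖w‖) ^ (2 * n + 2)) := by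
          gcongr
      _ = _ := by ring

/-- An odd power series. -/
def oddSeries (a : ℝ) (c : ℕ → ℂ) (z : ℂ) : ℂ := ∑' n, c n * (z / a) ^ (2 * n + 1)

section OddSeries

variable {a R M q : ℝ} {c : ℕ → ℂ}

lemma norm_oddSeries_term_le (ha : 0 < a) (hc : ∀ n, ‖c n‖ * (R / a) ^ (2 * n + 1) ≤ M * q ^ (2 * n + 1))
    {z : ℂ} (hz : ‖z‖ ≤ R) (n : ℕ) : ‖c n * (z / a) ^ (2 * n + 1)‖ ≤ M * q ^ (2 * n + 1) := by
  refine le_trans ?_ (hc n)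
  rw [norm_mul, norm_pow, norm_div, Complex.norm_real, Real.norm_of_nonneg ha.le]
  gcongr

lemma summable_odd_geometric (h0 : 0 ≤ q) (h1 : q < 1) :
    Summable fun n : ℕ => M * q ^ (2 * n + 1) := by
  refine ((summable_geometric_of_lt_one h0 h1).comp_injective (i := fun n : ℕ => 2 * n + 1)
    (fun a b h => by simpa using h)).mul_left M

lemma summable_oddSeries (ha : 0 < a) (h0 : 0 ≤ q) (h1 : q < 1)
    (hc : ∀ n, ‖c n‖ * (R / a) ^ (2 * n + 1) ≤ M * q ^ (2 * n + 1)) {z : ℂ} (hz : ‖z‖ ≤ R) :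
    Summable fun n => c n * (z / a) ^ (2 * n + 1) :=
  .of_norm_bounded (summable_odd_geometric h0 h1) (norm_oddSeries_term_le ha hc hz)

lemma differentiableOn_oddSeries (ha : 0 < a) (h0 : 0 ≤ q) (h1 : q < 1)
    (hc : ∀ n, ‖c n‖ * (R / a) ^ (2 * n + 1) ≤ M * q ^ (2 * n + 1)) :
    DifferentiableOn ℂ (oddSeries a c) (ball 0 R) := by
  refine Complex.differentiableOn_tsum_of_summable_norm
    (F := fun (n : ℕ) (z : ℂ) => c n * (z / a) ^ (2 * n + 1)) (summable_odd_geometric (M := M) h0 h1)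
    (fun n => by fun_prop) isOpen_ball fun n z hz => ?_
  exact norm_oddSeries_term_le ha hc (by simpa using (mem_ball_zero_iff.mp hz).le) n

lemma oddSeries_zero : oddSeries a c 0 = 0 := by
  simp [oddSeries]

end OddSeries

variable {L : PeriodPair} {a ℓ : ℝ}

lemma norm_half_le {z p : ℂ} (hz : z ∈ voronoi L) (hp : p ∈ L.lattice) : ‖p‖ / 2 ≤ ‖z - p‖ := by
  have h1 := hz p hp
  have h2 := norm_sub_norm_le p z
  rw [norm_sub_rev] at h2
  linarith

/-- Of the 2n + 3 powers in the denominator, three are spent on summability, using ‖z - l‖ ≥ ‖l‖/2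
in the Voronoi cell, and the remaining 2n give the factor a^(-2n) uniformly in the lattice point. -/
lemma exists_norm_multipole_le (L : PeriodPair) (ha : 0 < a) :
    ∃ Q : ℝ, 0 ≤ Q ∧ ∀ n, ∀ z ∈ host L a, ‖multipole L (n + 1) z‖ ≤ Q * (a ^ (2 * n))⁻¹ := by
  classical
  set g : L.lattice → ℝ := fun l => (if l = 0 then (a ^ 3)⁻¹ else 0) + 8 * ‖(l : ℂ)‖ ^ (-3 : ℝ)
  have hg0 : ∀ l, 0 ≤ g l := fun l => by
    have : 0 ≤ ‖(l : ℂ)‖ ^ (-3 : ℝ) := by positivity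
    simp only [g]
    split_ifs <;> positivity
  have hg : Summable g := (summable_of_ne_finset_zero (s := {0}) (fun l hl => by
    rw [if_neg (by simpa using hl)])).add ((summable_norm_lattice L).mul_left 8)
  refine ⟨∑' l, g l, tsum_nonneg hg0, ?_⟩
  have key : ∀ n, ∀ z ∈ host L a, z ∈ voronoi L →
      ‖multipole L (n + 1) z‖ ≤ (∑' l, g l) * (a ^ (2 * n))⁻¹ := by
    intro n z hz hzV
    rw [multipole, ← tsum_mul_right]
    refine tsum_of_norm_bounded (hg.mul_right _).hasSum fun l => ?_
    have hzl : a ≤ ‖z - l‖ := hz l l.2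
    have hpos : 0 < ‖z - l‖ := ha.trans_le hzl
    have h1 : ‖multipoleTerm (n + 1) l z‖ = (‖z - l‖ ^ 3)⁻¹ * (‖z - l‖ ^ (2 * n))⁻¹ := by
      rw [multipoleTerm, if_neg (Nat.succ_ne_zero n), add_zero, norm_inv, norm_pow, ← mul_inv,
        ← pow_add]
      congr 2
      ring
    rw [h1]
    have h2 : (‖z - l‖ ^ 3)⁻¹ ≤ g l := by
      by_cases hl : l = 0
      · simp only [g, if_pos hl]
        have : (‖z - l‖ ^ 3)⁻¹ ≤ (a ^ 3)⁻¹ := by gcongr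
        have h3 : 0 ≤ ‖(l : ℂ)‖ ^ (-3 : ℝ) := by positivity
        linarith
      · simp only [g, if_neg hl, zero_add]
        have hl0 : 0 < ‖(l : ℂ)‖ := norm_pos_iff.mpr (by simpa using hl)
        have e3 : ‖(l : ℂ)‖ ^ (-3 : ℝ) = (‖(l : ℂ)‖ ^ 3)⁻¹ := by
          rw [Real.rpow_neg hl0.le]; norm_cast
        rw [e3]
        calc (‖z - l‖ ^ 3)⁻¹ ≤ ((‖(l : ℂ)‖ / 2) ^ 3)⁻¹ := by
              gcongr
              exact norm_half_le hzV l.2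
          _ = _ := by rw [div_pow, inv_div]; ring
    have h3 : (‖z - l‖ ^ (2 * n))⁻¹ ≤ (a ^ (2 * n))⁻¹ := by gcongr
    exact mul_le_mul h2 h3 (by positivity) (hg0 l)
  intro n z hz
  obtain ⟨p, hp, h⟩ := exists_sub_mem_voronoi L z
  have hzp : z - p ∈ host L a := fun q hq => by
    have := hz (p + q) (L.lattice.add_mem hp hq)
    rwa [← sub_sub] at this
  have := multipole_add L (Nat.succ_ne_zero n) hp (z - p)
  rw [sub_add_cancel] at this
  rw [this]
  exact key n _ hzp h

/-- The superposition of the multipoles induced in the tubes. -/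
def induced (L : PeriodPair) (a : ℝ) (x : ℕ → ℂ) (z : ℂ) : ℂ :=
  ∑' n, x n * (a : ℂ) ^ (2 * n + 1) * multipole L n z

/-! ### Convergence, holomorphy and quasi-periodicity of the induced field -/

section Induced

variable {x : ℕ → ℂ} {M t a' : ℝ}

lemma exists_norm_induced_term_le (L : PeriodPair) (ha : 0 < a) (ha' : 0 < a')
    (hx : ∀ n, ‖x n‖ ≤ M * t ^ (2 * n + 1)) :
    ∃ Q : ℝ, ∀ n, ∀ z ∈ host L a', ‖x (n + 1) * (a : ℂ) ^ (2 * (n + 1) + 1) *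
      multipole L (n + 1) z‖ ≤ Q * ((t * a / a') ^ 2) ^ n := by
  obtain ⟨Q, hQ0, hQ⟩ := exists_norm_multipole_le L ha'
  refine ⟨M * t ^ 3 * a ^ 3 * Q, fun n z hz => ?_⟩
  have hM0 : 0 ≤ M * t ^ (2 * (n + 1) + 1) := (norm_nonneg _).trans (hx (n + 1))
  rw [norm_mul, norm_mul, norm_pow, Complex.norm_real, Real.norm_of_nonneg ha.le]
  calc ‖x (n + 1)‖ * a ^ (2 * (n + 1) + 1) * ‖multipole L (n + 1) z‖
      ≤ (M * t ^ (2 * (n + 1) + 1)) * a ^ (2 * (n + 1) + 1) * (Q * (a' ^ (2 * n))⁻¹) := by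
        gcongr
        · exact hx _
        · exact hQ n z hz
    _ = _ := by
        rw [← pow_mul, div_pow, mul_pow]
        field_simp
        ring

lemma summable_induced (ha : 0 < a) (ha' : 0 < a') (ht : 0 ≤ t)
    (hta : t * a < a') (hx : ∀ n, ‖x n‖ ≤ M * t ^ (2 * n + 1)) {z : ℂ} (hz : z ∈ host L a') :
    Summable fun n => x n * (a : ℂ) ^ (2 * n + 1) * multipole L n z := by
  obtain ⟨Q, hQ⟩ := exists_norm_induced_term_le L ha ha' hx
  refine (summable_nat_add_iff 1).mp (.of_norm_bounded ((summable_geometric_of_lt_one (by positivity)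
    ?_).mul_left Q) fun n => hQ n z hz)
  exact pow_lt_one₀ (by positivity) ((div_lt_one ha').mpr hta) two_ne_zero

lemma differentiableOn_induced (ha : 0 < a) (ha' : 0 < a') (ht : 0 ≤ t)
    (hta : t * a < a') (hx : ∀ n, ‖x n‖ ≤ M * t ^ (2 * n + 1)) :
    DifferentiableOn ℂ (induced L a x) (openHost L a') := by
  obtain ⟨Q, hQ⟩ := exists_norm_induced_term_le L ha ha' hx
  have hsub := (openHost_subset_host L a').trans (host_subset_compl L ha')
  have h1 : DifferentiableOn ℂ (fun z => ∑' n, x (n + 1) * (a : ℂ) ^ (2 * (n + 1) + 1) *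
      multipole L (n + 1) z) (openHost L a') := by
    refine Complex.differentiableOn_tsum_of_summable_norm
      ((summable_geometric_of_lt_one (r := (t * a / a') ^ 2) (by positivity)
      (pow_lt_one₀ (by positivity) ((div_lt_one ha').mpr hta) two_ne_zero)).mul_left Q)
      (fun n => ?_) (isOpen_openHost L a') fun n z hz => hQ n z (openHost_subset_host L a' hz)
    exact ((differentiableOn_multipole L (n + 1)).mono hsub).const_mul _
  refine ((((differentiableOn_multipole L 0).mono hsub).const_mul
    (x 0 * (a : ℂ) ^ (2 * 0 + 1))).add h1).congr fun z hz => ?_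
  exact (summable_induced ha ha' ht hta hx (openHost_subset_host L a' hz)).tsum_eq_zero_add

/-- Only the n = 0 multipole, the zeta function, fails to be periodic, so the whole increment comes
from the dipole strength `x 0` and the Legendre relation. -/
lemma IsTubeLattice.induced_add (hL : IsTubeLattice L ℓ) (ha : 0 < a) (ha' : 0 < a') (ht : 0 ≤ t)
    (hta : t * a < a') (hx : ∀ n, ‖x n‖ ≤ M * t ^ (2 * n + 1)) {z p : ℂ} (hz : z ∈ openHost L a')
    (hp : p ∈ L.lattice) : induced L a x (z + p) =
      induced L a x z + x 0 * a * (Real.pi / volume.real (cell L)) * (starRingEnd ℂ) p := by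
  have h1 := summable_induced ha ha' ht hta hx (openHost_subset_host L a' hz)
  have h2 := summable_induced ha ha' ht hta hx (openHost_subset_host L a' (openHost_add hp hz))
  rw [induced, induced, h1.tsum_eq_zero_add, h2.tsum_eq_zero_add,
    hL.zeta_add hp (host_subset_compl L ha' (openHost_subset_host L a' hz))]
  simp only [multipole_add L (Nat.succ_ne_zero _) hp]
  ring

end Induced

variable {L : PeriodPair} {a ℓ : ℝ}

lemma coeffG_eq (S : ℕ → ℂ) (n k : ℕ) :
    coeffG S n k = ((2 * n + 2 * k + 1).choose (2 * k) : ℂ) * S (n + k + 1) := by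
  rw [coeffG, Nat.cast_choose ℂ (by omega), show 2 * n + 2 * k + 1 - 2 * k = 2 * n + 1 by omega]

lemma IsTubeLattice.norm_regCoeff_le (hL : IsTubeLattice L ℓ) {K : ℝ}
    (hK : ∀ m, 1 ≤ m → ‖latticeSum L m‖ ≤ K) (n k : ℕ) :
    ‖regCoeff L n k‖ ≤ ((2 * n + 2 * k + 1).choose (2 * n) : ℝ) * (K / ℓ ^ (2 * n + 2 * k + 2)) := by
  rw [regCoeff, norm_mul, Complex.norm_natCast, norm_div, norm_pow, hL.spacing_eq,
    Complex.norm_real, Real.norm_of_nonneg hL.pos.le, show 2 * (n + k + 1) = 2 * n + 2 * k + 2 by ring]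
  have := hL.pos
  gcongr
  exact hK _ (by omega)

lemma tsum_choose_odd_le (n : ℕ) {s : ℝ} (h0 : 0 ≤ s) (h1 : s < 1) :
    ∑' k : ℕ, ((2 * n + 2 * k + 1).choose (2 * n) : ℝ) * s ^ (2 * k + 1) ≤
      1 / (1 - s) ^ (2 * n + 1) := by
  have hs : ‖s‖ < 1 := by rwa [Real.norm_of_nonneg h0]
  have h := summable_choose_mul_geometric_of_norm_lt_one (R := ℝ) (2 * n) hs
  rw [← tsum_choose_mul_geometric_of_norm_lt_one _ hs]
  have e : ∀ k : ℕ, ((2 * n + 2 * k + 1).choose (2 * n) : ℝ) * s ^ (2 * k + 1) =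
      ((2 * k + 1 + 2 * n).choose (2 * n) : ℝ) * s ^ (2 * k + 1) := fun k => by
    rw [show 2 * k + 1 + 2 * n = 2 * n + 2 * k + 1 by ring]
  rw [tsum_congr e]
  have hinj : Function.Injective fun k : ℕ => 2 * k + 1 := fun a b h => by simpa using h
  exact tsum_comp_le_tsum_of_inj h (fun j => by positivity) hinj

lemma summable_prod_of_tsum_le {F : ℕ → ℕ → ℝ} {g : ℕ → ℝ} (h0 : ∀ n k, 0 ≤ F n k)
    (hF : ∀ n, Summable (F n)) (hg : ∀ n, ∑' k, F n k ≤ g n) (hs : Summable g) :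
    Summable fun i : ℕ × ℕ => F i.1 i.2 :=
  (summable_prod_of_nonneg (fun i => h0 i.1 i.2)).mpr
    ⟨hF, Summable.of_nonneg_of_le (fun n => tsum_nonneg (h0 n)) hg hs⟩

/-- Summing over the second index first is bounded by 1/(1 - s)^(2n+1); what remains is geometric
with ratio p/(1 - s), below 1 because p + s < 1. -/
lemma summable_double_choose {p s : ℝ} (hp : 0 ≤ p) (hs : 0 ≤ s) (h : p + s < 1) :
    Summable fun i : ℕ × ℕ => p ^ (2 * i.1 + 1) *
      (((2 * i.1 + 2 * i.2 + 1).choose (2 * i.1) : ℝ) * s ^ (2 * i.2 + 1)) := by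
  have hs1 : s < 1 := by linarith
  have hq1 : p / (1 - s) < 1 := (div_lt_one (by linarith)).mpr (by linarith)
  have hnn : ∀ n k : ℕ, 0 ≤ p ^ (2 * n + 1) *
      (((2 * n + 2 * k + 1).choose (2 * n) : ℝ) * s ^ (2 * k + 1)) := fun n k =>
    mul_nonneg (pow_nonneg hp _) (mul_nonneg (Nat.cast_nonneg _) (pow_nonneg hs _))
  have hle : ∀ n : ℕ, ∑' k : ℕ, p ^ (2 * n + 1) *
      (((2 * n + 2 * k + 1).choose (2 * n) : ℝ) * s ^ (2 * k + 1)) ≤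
        1 * (p / (1 - s)) ^ (2 * n + 1) := fun n => by
    rw [tsum_mul_left, one_mul, div_pow, div_eq_mul_one_div]
    exact mul_le_mul_of_nonneg_left (tsum_choose_odd_le n hs hs1) (pow_nonneg hp _)
  have hsum : ∀ n : ℕ, Summable fun k : ℕ => p ^ (2 * n + 1) *
      (((2 * n + 2 * k + 1).choose (2 * n) : ℝ) * s ^ (2 * k + 1)) := fun n =>
    Summable.mul_left _ (summable_choose_odd n (by rwa [abs_of_nonneg hs]))
  exact summable_prod_of_tsum_le hnn hsum hle
    (summable_odd_geometric (div_nonneg hp (by linarith)) hq1)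

section Expansion

variable {x : ℕ → ℂ} {M t : ℝ}

lemma IsTubeLattice.summable_expansion (hL : IsTubeLattice L ℓ) (ha : 0 < a) (ht : 0 ≤ t)
    (hx : ∀ n, ‖x n‖ ≤ M * t ^ (2 * n + 1)) {z : ℂ} (hz : t * a + ‖z‖ < ℓ) :
    Summable fun i : ℕ × ℕ =>
      x i.1 * (a : ℂ) ^ (2 * i.1 + 1) * (regCoeff L i.1 i.2 * z ^ (2 * i.2 + 1)) := by
  obtain ⟨K, hK0, hK⟩ := hL.exists_norm_latticeSum_le
  have hℓ := hL.pos
  have h := (summable_double_choose (p := t * a / ℓ) (s := ‖z‖ / ℓ) (by positivity) (by positivity)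
    (by rw [← add_div]; exact (div_lt_one hℓ).mpr hz)).mul_left (M * K)
  refine .of_norm_bounded h fun i => ?_
  have hM0 : 0 ≤ M * t ^ (2 * i.1 + 1) := (norm_nonneg _).trans (hx i.1)
  rw [norm_mul, norm_mul, norm_mul, norm_pow, norm_pow, Complex.norm_real, Real.norm_of_nonneg ha.le]
  calc ‖x i.1‖ * a ^ (2 * i.1 + 1) * (‖regCoeff L i.1 i.2‖ * ‖z‖ ^ (2 * i.2 + 1))
      ≤ (M * t ^ (2 * i.1 + 1)) * a ^ (2 * i.1 + 1) *
        ((((2 * i.1 + 2 * i.2 + 1).choose (2 * i.1) : ℝ) * (K / ℓ ^ (2 * i.1 + 2 * i.2 + 2))) *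
          ‖z‖ ^ (2 * i.2 + 1)) := by
        gcongr
        · exact hx _
        · exact hL.norm_regCoeff_le hK _ _
    _ = _ := by
        rw [div_pow, div_pow]
        field_simp
        ring

/-- The expansion of the induced field around the central tube. -/
lemma IsTubeLattice.induced_eq (hL : IsTubeLattice L ℓ) (ha : 0 < a) (ht : 0 ≤ t)
    (hx : ∀ n, ‖x n‖ ≤ M * t ^ (2 * n + 1)) {z : ℂ} (hz : t * a + ‖z‖ < ℓ)
    (hsum : Summable fun n => x n * (a : ℂ) ^ (2 * n + 1) * multipole L n z)
    (hsum' : Summable fun n => x n * ((a ^ 2 / z) / a) ^ (2 * n + 1)) :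
    induced L a x z = oddSeries a x (a ^ 2 / z) - oddSeries a (fun n => ∑' k,
      coeffG (latticeSum L) n k * x k * ((a / spacing L : ℝ) : ℂ) ^ (2 * n + 2 * k + 2)) z := by
  have hℓ := hL.pos
  have ha0 : (a : ℂ) ≠ 0 := by exact_mod_cast ha.ne'
  have hzℓ : ‖z‖ < ℓ := by have : 0 ≤ t * a := by positivity
                           linarith
  have hs := hL.summable_expansion ha ht hx hz
  have e1 : ∀ n, ∑' k, x n * (a : ℂ) ^ (2 * n + 1) * (regCoeff L n k * z ^ (2 * k + 1)) =
      x n * ((a ^ 2 / z) / a) ^ (2 * n + 1) - x n * (a : ℂ) ^ (2 * n + 1) * multipole L n z := by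
    intro n
    rw [tsum_mul_left, (hL.hasSum_multipole_expansion n hzℓ).tsum_eq, mul_sub]
    congr 1
    rw [show ((a : ℂ) ^ 2 / z) / a = a * z⁻¹ by field_simp, mul_pow, inv_pow]
    ring
  -- After interchanging the sums, the coefficient of the power 2k + 1 is row k of the matrix of the
  -- system applied to `x`.
  have e2 : ∀ k, ∑' n, x n * (a : ℂ) ^ (2 * n + 1) * (regCoeff L n k * z ^ (2 * k + 1)) =
      (∑' n, coeffG (latticeSum L) k n * x n * ((a / spacing L : ℝ) : ℂ) ^ (2 * k + 2 * n + 2)) *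
        (z / a) ^ (2 * k + 1) := by
    intro k
    rw [← tsum_mul_right]
    refine tsum_congr fun n => ?_
    rw [coeffG_eq, regCoeff, show 2 * k + 2 * n + 1 = 2 * n + 2 * k + 1 by ring,
      show k + n + 1 = n + k + 1 by ring, hL.spacing_eq, div_pow]
    push_cast
    rw [div_pow, show 2 * (n + k + 1) = 2 * k + 2 * n + 2 by ring]
    have : (ℓ : ℂ) ≠ 0 := by exact_mod_cast hℓ.ne'
    field_simp
    ring
  have h3 := hs.tsum_comm (f := fun n k =>
    x n * (a : ℂ) ^ (2 * n + 1) * (regCoeff L n k * z ^ (2 * k + 1)))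
  rw [tsum_congr e1, tsum_congr e2, hsum'.tsum_sub hsum] at h3
  rw [induced, oddSeries, oddSeries]
  linear_combination h3

end Expansion

/-- The complex potentials in the tube and in the host medium. -/
theorem IsTubeLattice.exists_complex_potentials (hL : IsTubeLattice L ℓ) (ha : 0 < a)
    (haℓ : 2 * a < ℓ) {εc εi εe : ℂ} (hie : εi + εe ≠ 0) {ν : ℝ}
    (hν0 : 0 ≤ ν) (hν1 : ν < 1)
    (hγ : ∀ n : ℕ, 1 - alpha εi εe * alphaTilde εc εi * (ν : ℂ) ^ (4 * n + 2) ≠ 0)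
    {σ : ℂ} (hσ : σ ^ 2 = 1) {x : ℕ → ℂ}
    (hx : IsBoundedSolution σ (gam εc εi εe ν) (latticeSum L) (a / spacing L) x) :
    ∃ Θ Φ X H : ℂ → ℂ, DifferentiableOn ℂ Θ (ball 0 (ℓ / 2)) ∧
      DifferentiableOn ℂ Φ (ball 0 (ℓ / 2)) ∧ DifferentiableOn ℂ X (ball 0 (ℓ / 2)) ∧ Θ 0 = 0 ∧
      (∀ z ∈ ball (0 : ℂ) (ℓ / 2), Θ z + alphaTilde εc εi * Θ (ν ^ 2 * z) = Φ z - σ * X z) ∧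
      (∀ z ∈ ball (0 : ℂ) (ℓ / 2), εi * (Θ z - alphaTilde εc εi * Θ (ν ^ 2 * z)) =
        εe * (Φ z + σ * X z)) ∧
      DifferentiableOn ℂ H (openHost L (2 * a ^ 2 / ℓ)) ∧
      (∀ z, 2 * a ^ 2 / ℓ < ‖z‖ → ‖z‖ < ℓ / 2 → H z = Φ z - X (a ^ 2 / z)) ∧
      ∀ p ∈ L.lattice, ∀ z ∈ openHost L (2 * a ^ 2 / ℓ), H (z + p) = H z + (σ / a * p -
        x 0 * a * (Real.pi / volume.real (cell L)) * (starRingEnd ℂ) p) := by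
  have hℓ := hL.pos
  have ha0 : (a : ℂ) ≠ 0 := by exact_mod_cast ha.ne'
  obtain ⟨K, hK0, hK⟩ := hL.exists_norm_latticeSum_le
  obtain ⟨M, hM0, hM⟩ := hx.1.exists_norm_le
  obtain ⟨G, hG⟩ := exists_norm_gam_le εc εi εe hν0 hν1
  have hG0 : 0 ≤ G := (norm_nonneg _).trans (hG 0)
  have hσ1 : ‖σ‖ = 1 := by
    have := congrArg norm hσ
    rw [norm_pow, norm_one] at this
    exact (pow_eq_one_iff_of_nonneg (norm_nonneg _) two_ne_zero).mp this
  set h := a / spacing L with hh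
  have hhℓ : h = a / ℓ := by rw [hh, hL.spacing_eq]
  have hh0 : 0 < h := by rw [hhℓ]; positivity
  have hh1 : |h| < 1 := by rw [abs_of_pos hh0, hhℓ, div_lt_one hℓ]; linarith
  -- This is h/(1 - h), the decay ratio from `norm_tsum_coeffG_le`; it is below 1 precisely when the
  -- tubes do not touch.
  set t := a / (ℓ - a) with ht_def
  have ht0 : 0 < t := by have : 0 < ℓ - a := by linarith
                         positivity
  have ht1 : t < 1 := by rw [ht_def, div_lt_one (by linarith)]; linarith
  have hht : |h| / (1 - |h|) = t := by
    have : ℓ - a ≠ 0 := by linarith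
    rw [abs_of_pos hh0, hhℓ, ht_def]
    field_simp
  set y : ℕ → ℂ := fun n => ∑' k, coeffG (latticeSum L) n k * x k * (h : ℂ) ^ (2 * n + 2 * k + 2)
    with hy
  have hyb : ∀ n, ‖y n‖ ≤ K * M * t ^ (2 * n + 2) := fun n => by
    have := norm_tsum_coeffG_le hK (w := (h : ℂ)) (by rwa [Complex.norm_real]) hM n
    rwa [Complex.norm_real, Real.norm_eq_abs, hht] at this
  -- Coefficients of the field acting on the central tube: the uniform applied field plus what the
  -- other tubes induce. In these terms the system says `x n = σ γ_n φ n`.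
  set φ : ℕ → ℂ := fun n => (if n = 0 then σ else 0) + y n with hφ
  have hxφ : ∀ n, x n = σ * gam εc εi εe ν n * φ n := fun n => by
    have := hx.2 n
    by_cases h0 : n = 0
    · subst h0
      simp only [hφ, if_true] at this ⊢
      linear_combination this - gam εc εi εe ν 0 * hσ
    · simp only [hφ, if_neg h0] at this ⊢
      linear_combination this
  have hφb : ∀ n, ‖φ n‖ ≤ (1 / t + K * M) * t ^ (2 * n + 1) := fun n => by
    have h1 : ‖if n = 0 then σ else 0‖ ≤ 1 / t * t ^ (2 * n + 1) := by
      split_ifs with h0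
      · subst h0
        rw [hσ1]
        field_simp
        norm_num
      · rw [norm_zero]; positivity
    have h2 : ‖y n‖ ≤ K * M * t ^ (2 * n + 1) := (hyb n).trans (by
      have : t ^ (2 * n + 2) ≤ t ^ (2 * n + 1) := pow_le_pow_of_le_one ht0.le ht1.le (by omega)
      gcongr)
    rw [add_mul]
    exact (norm_add_le _ _).trans (add_le_add h1 h2)
  set B := 1 / t + K * M with hB
  have hB0 : 0 ≤ B := by positivity
  have hxb : ∀ n, ‖x n‖ ≤ (G * B) * t ^ (2 * n + 1) := fun n => by
    rw [hxφ, norm_mul, norm_mul, hσ1, one_mul, mul_assoc]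
    gcongr
    · exact hG n
    · exact hφb n
  have hν : Tendsto (fun n : ℕ => (ν : ℂ) ^ (4 * n + 2)) atTop (𝓝 0) := by
    refine (tendsto_pow_atTop_nhds_zero_of_norm_lt_one (by
      rwa [Complex.norm_real, Real.norm_of_nonneg hν0])).comp
        (tendsto_atTop_mono (fun n => ?_) tendsto_id)
    dsimp only [id]; omega
  have hlim : Tendsto (fun n : ℕ => (1 - alpha εi εe) /
      (1 - alpha εi εe * alphaTilde εc εi * (ν : ℂ) ^ (4 * n + 2))) atTop
      (𝓝 ((1 - alpha εi εe) / (1 - alpha εi εe * alphaTilde εc εi * 0))) :=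
    tendsto_const_nhds.div (tendsto_const_nhds.sub (tendsto_const_nhds.mul hν)) (by simp)
  obtain ⟨D, hD⟩ := hlim.norm.bddAbove_range
  -- Coefficients of the potential in the tube, determined from `φ` by the two matching conditions
  -- `hrel1` and `hrel2`.
  set τ : ℕ → ℂ := fun n => (1 - alpha εi εe) /
      (1 - alpha εi εe * alphaTilde εc εi * (ν : ℂ) ^ (4 * n + 2)) * φ n with hτ
  have hD0 : 0 ≤ D := (norm_nonneg _).trans (hD (mem_range_self 0))
  have hτb : ∀ n, ‖τ n‖ ≤ (D * B) * t ^ (2 * n + 1) := fun n => by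
    rw [hτ]
    simp only
    rw [norm_mul, mul_assoc D B]
    gcongr
    · exact hD (mem_range_self n)
    · exact hφb n
  -- The ratio of the power series at radius ℓ/2, equal to ℓ/(2(ℓ - a)) and below 1. The potentials
  -- thus extend past the interface ‖z‖ = a, and no boundary regularity has to be discussed.
  set q := t * (ℓ / 2) / a with hq
  have hq0 : 0 ≤ q := by positivity
  have hq1 : q < 1 := by
    have : 0 < ℓ - a := by linarith
    rw [hq, ht_def]
    field_simp
    linarith
  have hser : ∀ {c : ℕ → ℂ} {C : ℝ}, (∀ n, ‖c n‖ ≤ C * t ^ (2 * n + 1)) →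
      ∀ n, ‖c n‖ * (ℓ / 2 / a) ^ (2 * n + 1) ≤ C * q ^ (2 * n + 1) := fun hc n => by
    rw [hq, mul_div_assoc, mul_pow, ← mul_assoc]
    exact mul_le_mul_of_nonneg_right (hc n) (by positivity)
  -- The radius 2a²/ℓ is the image of ℓ/2 under the inversion in the circle of radius a; the
  -- multipole series already converges down to it.
  have hat : t * a < 2 * a ^ 2 / ℓ := by
    have : 0 < ℓ - a := by linarith
    rw [ht_def, div_mul_eq_mul_div, div_lt_div_iff₀ this hℓ]
    nlinarith [mul_pos ha ha]
  have ha' : 0 < 2 * a ^ 2 / ℓ := by positivity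
  have ha'2 : 2 * a ^ 2 / ℓ < ℓ / 2 := by
    rw [div_lt_div_iff₀ hℓ two_pos]; nlinarith
  have hmem : ∀ z : ℂ, z ∈ ball (0 : ℂ) (ℓ / 2) → (ν : ℂ) ^ 2 * z ∈ ball (0 : ℂ) (ℓ / 2) := by
    intro z hz
    rw [mem_ball_zero_iff] at hz ⊢
    rw [norm_mul, norm_pow, Complex.norm_real, Real.norm_of_nonneg hν0]
    have : ν ^ 2 ≤ 1 := pow_le_one₀ hν0 hν1.le
    nlinarith [norm_nonneg z]
  have hscale : ∀ z ∈ ball (0 : ℂ) (ℓ / 2), oddSeries a τ (ν ^ 2 * z) =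
      ∑' n, (ν : ℂ) ^ (4 * n + 2) * (τ n * (z / a) ^ (2 * n + 1)) := fun z hz => by
    rw [oddSeries]
    refine tsum_congr fun n => ?_
    rw [mul_div_assoc, mul_pow, ← pow_mul, show 2 * (2 * n + 1) = 4 * n + 2 by ring]
    ring
  have hs : ∀ {c : ℕ → ℂ} {C : ℝ}, (∀ n, ‖c n‖ ≤ C * t ^ (2 * n + 1)) →
      ∀ z ∈ ball (0 : ℂ) (ℓ / 2), Summable fun n => c n * (z / a) ^ (2 * n + 1) :=
    fun hc z hz => summable_oddSeries ha hq0 hq1 (hser hc) (mem_ball_zero_iff.mp hz).le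
  have hsν : ∀ z ∈ ball (0 : ℂ) (ℓ / 2),
      Summable fun n => (ν : ℂ) ^ (4 * n + 2) * (τ n * (z / a) ^ (2 * n + 1)) := fun z hz => by
    refine (hs hτb _ (hmem z hz)).congr fun n => ?_
    rw [mul_div_assoc, mul_pow, ← pow_mul, show 2 * (2 * n + 1) = 4 * n + 2 by ring]
    ring
  have hα : alpha εi εe = (εi - εe) / (εi + εe) := rfl
  -- `hrel1` is continuity of the potential and `hrel2` continuity of the flux at the outer circle,
  -- coefficient by coefficient.
  have hrel1 : ∀ n, τ n + alphaTilde εc εi * ((ν : ℂ) ^ (4 * n + 2) * τ n) =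
      φ n - σ * x n := fun n => by
    have hn := hγ n
    rw [hxφ, hτ, gam]
    have e : σ * (σ * ((alpha εi εe - alphaTilde εc εi * (ν : ℂ) ^ (4 * n + 2)) /
      (1 - alpha εi εe * alphaTilde εc εi * (ν : ℂ) ^ (4 * n + 2))) * φ n) =
      ((alpha εi εe - alphaTilde εc εi * (ν : ℂ) ^ (4 * n + 2)) /
      (1 - alpha εi εe * alphaTilde εc εi * (ν : ℂ) ^ (4 * n + 2))) * φ n := by
      linear_combination (((alpha εi εe - alphaTilde εc εi * (ν : ℂ) ^ (4 * n + 2)) /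
      (1 - alpha εi εe * alphaTilde εc εi * (ν : ℂ) ^ (4 * n + 2))) * φ n) * hσ
    rw [e]
    field_simp
    ring
  have hrel2 : ∀ n, εi * (τ n - alphaTilde εc εi * ((ν : ℂ) ^ (4 * n + 2) * τ n)) =
      εe * (φ n + σ * x n) := fun n => by
    have hn := hγ n
    rw [hxφ, hτ, gam]
    have e : σ * (σ * ((alpha εi εe - alphaTilde εc εi * (ν : ℂ) ^ (4 * n + 2)) /
      (1 - alpha εi εe * alphaTilde εc εi * (ν : ℂ) ^ (4 * n + 2))) * φ n) =
      ((alpha εi εe - alphaTilde εc εi * (ν : ℂ) ^ (4 * n + 2)) /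
      (1 - alpha εi εe * alphaTilde εc εi * (ν : ℂ) ^ (4 * n + 2))) * φ n := by
      linear_combination (((alpha εi εe - alphaTilde εc εi * (ν : ℂ) ^ (4 * n + 2)) /
      (1 - alpha εi εe * alphaTilde εc εi * (ν : ℂ) ^ (4 * n + 2))) * φ n) * hσ
    rw [e]
    have hα' : εi * (1 - alpha εi εe) = εe * (1 + alpha εi εe) := by
      rw [hα]; field_simp; ring
    field_simp
    linear_combination (φ n * (1 - alphaTilde εc εi * (ν : ℂ) ^ (4 * n + 2))) * hα'
  refine ⟨oddSeries a τ, oddSeries a φ, oddSeries a x, fun z => σ / a * z - induced L a x z,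
    differentiableOn_oddSeries ha hq0 hq1 (hser hτb),
    differentiableOn_oddSeries ha hq0 hq1 (hser hφb),
    differentiableOn_oddSeries ha hq0 hq1 (hser hxb), oddSeries_zero, ?_, ?_, ?_, ?_, ?_⟩
  · intro z hz
    rw [hscale z hz, oddSeries, oddSeries, oddSeries, ← tsum_mul_left, ← tsum_mul_left,
      ← (hs hτb z hz).tsum_add ((hsν z hz).mul_left _),
      ← (hs hφb z hz).tsum_sub ((hs hxb z hz).mul_left _)]
    exact tsum_congr fun n => by linear_combination (z / a) ^ (2 * n + 1) * hrel1 n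
  · intro z hz
    rw [hscale z hz, oddSeries, oddSeries, oddSeries, ← tsum_mul_left, ← tsum_mul_left,
      ← (hs hτb z hz).tsum_sub ((hsν z hz).mul_left _),
      ← (hs hφb z hz).tsum_add ((hs hxb z hz).mul_left _), ← tsum_mul_left, ← tsum_mul_left]
    exact tsum_congr fun n => by linear_combination (z / a) ^ (2 * n + 1) * hrel2 n
  · exact (by fun_prop : Differentiable ℂ fun z : ℂ => σ / a * z).differentiableOn.sub
      (differentiableOn_induced ha ha' ht0.le hat hxb)
  · intro z h1 h2
    have hz0 : z ≠ 0 := norm_pos_iff.mp (ha'.trans h1)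
    have hzh : z ∈ host L (2 * a ^ 2 / ℓ) := by
      intro p hp
      have : z ∈ voronoi L := closedBall_subset_voronoi (a := ℓ / 2) (by linarith) hL.norm_le
        (by simpa using h2.le)
      exact h1.le.trans (this p hp)
    have hinv : (a : ℂ) ^ 2 / z ∈ ball (0 : ℂ) (ℓ / 2) := by
      rw [mem_ball_zero_iff, norm_div, norm_pow, Complex.norm_real, Real.norm_of_nonneg ha.le,
        div_lt_iff₀ (ha'.trans h1)]
      rw [div_lt_iff₀ hℓ] at h1
      linarith
    have hza : t * a + ‖z‖ < ℓ := by linarith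
    simp only
    rw [hL.induced_eq ha ht0.le hxb hza (summable_induced ha ha' ht0.le hat hxb hzh)
      (hs hxb _ hinv), ← hh]
    have e : oddSeries a φ z = σ / a * z + oddSeries a y z := by
      have hys : Summable fun n => y n * (z / a) ^ (2 * n + 1) := by
        refine hs (C := K * M) (fun n => (hyb n).trans ?_) z (by simpa using h2)
        have : t ^ (2 * n + 2) ≤ t ^ (2 * n + 1) := pow_le_pow_of_le_one ht0.le ht1.le (by omega)
        gcongr
      have hφs := hs hφb z (by simpa using h2)
      rw [oddSeries, oddSeries, hφs.tsum_eq_zero_add, hys.tsum_eq_zero_add]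
      simp only [hφ, if_pos, Nat.succ_ne_zero, if_neg, not_false_eq_true, zero_add]
      ring
    rw [e]
    ring
  · intro p hp z hz
    simp only
    rw [hL.induced_add ha ha' ht0.le hat hxb hz hp]
    ring

/-! ### Gluing potentials across circles -/

lemma exists_norm_eq_mem_segment {x y : ℂ} {r : ℝ} (hx : ‖x‖ ≤ r) (hy : r ≤ ‖y‖) :
    ∃ m ∈ segment ℝ x y, ‖m‖ = r := by
  have h := (convex_segment x y).isPreconnected.intermediate_value (left_mem_segment ℝ x y)
    (right_mem_segment ℝ x y) (f := fun w : ℂ => ‖w‖) continuous_norm.continuousOn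
  exact h ⟨hx, hy⟩

/-- A segment from inside to outside crosses the circle, and splitting it there makes the two
Lipschitz estimates add up along the segment without loss. -/
lemma exists_lipschitzOnWith_glue {f g u : ℂ → ℂ} {z : ℂ} {r : ℝ} (hf : ContDiffAt ℝ 1 f z)
    (hg : ContDiffAt ℝ 1 g z) (huf : ∀ᶠ w in 𝓝 z, ‖w‖ ≤ r → u w = f w)
    (hug : ∀ᶠ w in 𝓝 z, r ≤ ‖w‖ → u w = g w) : ∃ K, ∃ t ∈ 𝓝 z, LipschitzOnWith K u t := by
  obtain ⟨K₁, t₁, ht₁, h₁⟩ := hf.exists_lipschitzOnWith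
  obtain ⟨K₂, t₂, ht₂, h₂⟩ := hg.exists_lipschitzOnWith
  obtain ⟨δ, hδ, hsub⟩ := Metric.mem_nhds_iff.mp
    (inter_mem (inter_mem ht₁ ht₂) (inter_mem huf hug))
  have hF : ∀ x ∈ ball z δ, ∀ y ∈ ball z δ, ‖x‖ ≤ r → ‖y‖ ≤ r →
      dist (u x) (u y) ≤ max K₁ K₂ * dist x y := fun x hx y hy hxr hyr => by
    rw [(hsub hx).2.1 hxr, (hsub hy).2.1 hyr]
    refine (h₁.dist_le_mul x (hsub hx).1.1 y (hsub hy).1.1).trans ?_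
    gcongr
    exact le_max_left _ _
  have hG : ∀ x ∈ ball z δ, ∀ y ∈ ball z δ, r ≤ ‖x‖ → r ≤ ‖y‖ →
      dist (u x) (u y) ≤ max K₁ K₂ * dist x y := fun x hx y hy hxr hyr => by
    rw [(hsub hx).2.2 hxr, (hsub hy).2.2 hyr]
    refine (h₂.dist_le_mul x (hsub hx).1.2 y (hsub hy).1.2).trans ?_
    gcongr
    exact le_max_right _ _
  have hFG : ∀ x ∈ ball z δ, ∀ y ∈ ball z δ, ‖x‖ ≤ r → r ≤ ‖y‖ →
      dist (u x) (u y) ≤ max K₁ K₂ * dist x y := fun x hx y hy hxr hyr => by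
    obtain ⟨m, hm, hmr⟩ := exists_norm_eq_mem_segment hxr hyr
    have hmb := (convex_ball z δ).segment_subset hx hy hm
    have h3 := hF x hx m hmb hxr hmr.le
    have h4 := hG m hmb y hy hmr.ge hyr
    rw [← dist_add_dist_of_mem_segment hm, mul_add]
    exact (dist_triangle _ _ _).trans (add_le_add h3 h4)
  refine ⟨max K₁ K₂, ball z δ, ball_mem_nhds z hδ, LipschitzOnWith.of_dist_le_mul fun x hx y hy => ?_⟩
  rw [NNReal.coe_max]
  rcases le_total ‖x‖ r with h | h <;> rcases le_total ‖y‖ r with h' | h'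
  · exact hF x hx y hy h h'
  · exact hFG x hx y hy h h'
  · rw [dist_comm, dist_comm x]; exact hFG y hy x hx h' h
  · exact hG x hx y hy h h'

open InnerProductSpace in
lemma HarmonicAt.comp_sub_add {f : ℂ → ℂ} {z p : ℂ} (h : HarmonicAt f (z - p)) (c : ℂ) :
    HarmonicAt (fun w => f (w - p) + c) z := by
  have h1 : HarmonicAt (fun w => f (w - p)) z := by
    have hlap : ∀ w, Laplacian.laplacian (fun w => f (w - p)) w =
        Laplacian.laplacian f (w - p) := fun w => by
      rw [laplacian_eq_iteratedFDeriv_complexPlane, laplacian_eq_iteratedFDeriv_complexPlane]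
      simp only [iteratedFDeriv_comp_sub]
    refine ⟨h.1.comp z (contDiffAt_id.sub contDiffAt_const), ?_⟩
    have hc : Tendsto (fun w : ℂ => w - p) (𝓝 z) (𝓝 (z - p)) :=
      (continuous_id.sub continuous_const).tendsto z
    filter_upwards [hc.eventually h.2] with w hw
    rw [hlap, hw]
    rfl
  exact h1.add (harmonicAt_const c)

open scoped Pointwise in
lemma fderivWithin_vadd {u : ℂ → ℂ} {p c : ℂ} (h : ∀ z, u (z + p) = u z + c) (s : Set ℂ) (z : ℂ) :
    fderivWithin ℝ u (p +ᵥ s) (z + p) = fderivWithin ℝ u s z := by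
  rw [← fderivWithin_comp_add_right]
  simp only [h]
  exact fderivWithin_add_const c

lemma ContDiffOn.comp_sub_add {f : ℂ → ℂ} {s t : Set ℂ} {p : ℂ} (h : ContDiffOn ℝ 1 f s)
    (hst : ∀ z ∈ t, z - p ∈ s) (c : ℂ) : ContDiffOn ℝ 1 (fun w => f (w - p) + c) t :=
  (h.comp (contDiff_id.sub contDiff_const).contDiffOn hst).add contDiffOn_const

section Glue

open scoped Pointwise
open InnerProductSpace

variable {L : PeriodPair} {a b ℓ : ℝ} {εc εi εe : ℂ} {fc ft fh : ℂ → ℂ} {lin : ℂ →L[ℝ] ℂ}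

lemma vadd_tube (p : ℂ) (a b : ℝ) : p +ᵥ tube 0 a b = tube p a b := by
  ext z
  rw [mem_vadd_set_iff_neg_vadd_mem]
  simp [tube, neg_add_eq_sub]

lemma vadd_host {L : PeriodPair} {p : ℂ} (hp : p ∈ L.lattice) (a : ℝ) :
    p +ᵥ host L a = host L a := by
  ext z
  rw [mem_vadd_set_iff_neg_vadd_mem]
  simp only [host, mem_ofPred_eq, vadd_eq_add, neg_add_eq_sub]
  constructor
  · intro h q hq
    simpa using h (q - p) (L.lattice.sub_mem hq hp)
  · intro h q hq
    simpa [sub_sub, add_comm] using h (q + p) (L.lattice.add_mem hq hp)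

/-- The three pieces around the origin are transported to every tube with the increment `lin p`;
quasi-periodicity of the host piece makes the copies agree. As each piece is harmonic on its closed
phase, one-sided derivatives are ordinary derivatives of the pieces. -/
lemma exists_glued_potential (hL : IsTubeLattice L ℓ) (ha : 0 < a) (haℓ : 2 * a < ℓ) (hb : 0 ≤ b)
    (hba : b < a)
    (hc : ∀ z, ‖z‖ ≤ b → HarmonicAt fc z) (ht : ∀ z, b ≤ ‖z‖ → ‖z‖ ≤ a → HarmonicAt ft z)
    (hh : ∀ z ∈ host L a, HarmonicAt fh z)
    (hper : ∀ p ∈ L.lattice, ∀ z ∈ host L a, fh (z + p) = fh z + lin p)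
    (hct : ∀ z, ‖z‖ = b → fc z = ft z) (hth : ∀ z, ‖z‖ = a → ft z = fh z)
    (hct' : ∀ z, ‖z‖ = b → 0 < b → εc * fderiv ℝ fc z z = εi * fderiv ℝ ft z z)
    (hth' : ∀ z, ‖z‖ = a → εi * fderiv ℝ ft z z = εe * fderiv ℝ fh z z) :
    ∃ u, IsPotential L a b εc εi εe u ∧ LocallyLipschitz u ∧
      ∀ p ∈ L.lattice, ∀ z, u (z + p) = u z + lin p := by
  classical
  set u₀ : ℂ → ℂ := fun z => if ‖z‖ < b then fc z else if ‖z‖ < a then ft z else fh z with hu₀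
  set u : ℂ → ℂ := fun z => if h : ∃ p ∈ L.lattice, ‖z - p‖ < ℓ / 2 then
    u₀ (z - h.choose) + lin h.choose else fh z with hu
  -- Open disks of radius ℓ/2 around lattice points are disjoint, so the chosen lattice point is the
  -- given one.
  have hN : ∀ p ∈ L.lattice, ∀ z, ‖z - p‖ < ℓ / 2 → u z = u₀ (z - p) + lin p := by
    intro p hp z hz
    have h : ∃ p ∈ L.lattice, ‖z - p‖ < ℓ / 2 := ⟨p, hp, hz⟩
    have e : h.choose = p := by
      by_contra hne
      have h1 := hL.norm_le (h.choose - p) (L.lattice.sub_mem h.choose_spec.1 hp) (sub_ne_zero.mpr hne)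
      have h2 := norm_sub_le_norm_sub_add_norm_sub h.choose z p
      rw [norm_sub_rev h.choose z] at h2
      linarith [h.choose_spec.2]
    simp only [hu, dif_pos h]
    rw [e]
  have hhost_sub : ∀ p ∈ L.lattice, ∀ z ∈ host L a, z - p ∈ host L a := fun p hp z hz q hq => by
    have := hz (q + p) (L.lattice.add_mem hq hp)
    rwa [show z - (q + p) = z - p - q by ring] at this
  have hH : ∀ z ∈ host L a, u z = fh z := by
    intro z hz
    by_cases h : ∃ p ∈ L.lattice, ‖z - p‖ < ℓ / 2
    · obtain ⟨p, hp, hzp⟩ := h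
      have h1 := hz p hp
      rw [hN p hp z hzp, hu₀]
      simp only [if_neg (show ¬ ‖z - p‖ < b by linarith), if_neg (show ¬ ‖z - p‖ < a by linarith)]
      rw [← hper p hp _ (hhost_sub p hp z hz), sub_add_cancel]
    · simp only [hu, dif_neg h]
  have hC : ∀ p ∈ L.lattice, ∀ z, ‖z - p‖ ≤ b → u z = fc (z - p) + lin p := by
    intro p hp z hz
    rw [hN p hp z (by linarith), hu₀]
    simp only
    rcases hz.lt_or_eq with h | h
    · rw [if_pos h]
    · rw [if_neg (by linarith), if_pos (by linarith), hct _ h]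
  have hT : ∀ p ∈ L.lattice, ∀ z, b ≤ ‖z - p‖ → ‖z - p‖ ≤ a → u z = ft (z - p) + lin p := by
    intro p hp z hz hz'
    rw [hN p hp z (by linarith), hu₀]
    simp only
    rw [if_neg (by linarith)]
    rcases hz'.lt_or_eq with h | h
    · rw [if_pos h]
    · rw [if_neg (by linarith), hth _ h]
  have hqp : ∀ p ∈ L.lattice, ∀ z, u (z + p) = u z + lin p := by
    intro p hp z
    by_cases hz : z ∈ host L a
    · have hz' : z + p ∈ host L a := by
        have := hhost_sub (-p) (L.lattice.neg_mem hp) z hz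
        rwa [sub_neg_eq_add] at this
      rw [hH z hz, hH _ hz', hper p hp z hz]
    · simp only [host, mem_ofPred_eq, not_forall, not_le] at hz
      obtain ⟨q, hq, hzq⟩ := hz
      rw [hN q hq z (by linarith), hN (q + p) (L.lattice.add_mem hq hp) (z + p)
        (by rw [add_sub_add_right_eq_sub]; linarith), add_sub_add_right_eq_sub, map_add, add_assoc]
  have hone : (1 : WithTop ℕ∞) ≤ 2 := one_le_two
  have hnear0 : ∀ z, ‖z‖ ≤ a → ∃ K, ∃ t ∈ 𝓝 z, LipschitzOnWith K u t := by
    intro z hz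
    have h0 := L.lattice.zero_mem
    have eC : ∀ w, ‖w‖ ≤ b → u w = fc w := fun w hw => by simpa using hC 0 h0 w (by simpa using hw)
    have eT : ∀ w, b ≤ ‖w‖ → ‖w‖ ≤ a → u w = ft w := fun w hw hw' => by
      simpa using hT 0 h0 w (by simpa using hw) (by simpa using hw')
    have lt_ev : ∀ {r}, ‖z‖ < r → ∀ᶠ w in 𝓝 z, ‖w‖ < r := fun h =>
      (continuous_norm.tendsto z).eventually (gt_mem_nhds h)
    have gt_ev : ∀ {r}, r < ‖z‖ → ∀ᶠ w in 𝓝 z, r < ‖w‖ := fun h =>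
      (continuous_norm.tendsto z).eventually (lt_mem_nhds h)
    rcases lt_trichotomy ‖z‖ b with h | h | h
    · have hcd := (hc z h.le).1.of_le hone
      -- Gluing a function to itself: away from the interfaces there is only one smooth piece, and
      -- the radius plays no role.
      refine exists_lipschitzOnWith_glue (r := 0) hcd hcd ?_ ?_ <;>
      · filter_upwards [lt_ev h] with w hw _ using eC w hw.le
    · refine exists_lipschitzOnWith_glue (r := b) ((hc z h.le).1.of_le hone)
        ((ht z h.ge hz).1.of_le hone) (Eventually.of_forall fun w hw => eC w hw) ?_
      filter_upwards [lt_ev (h.trans_lt hba)] with w hw hw' using eT w hw' hw.le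
    · rcases hz.lt_or_eq with h' | h'
      · have hcd := (ht z h.le hz).1.of_le hone
        refine exists_lipschitzOnWith_glue (r := 0) hcd hcd ?_ ?_ <;>
        · filter_upwards [lt_ev h', gt_ev h] with w hw hw' _ using eT w hw'.le hw.le
      · have hzh : ∀ w, a ≤ ‖w‖ → ‖w‖ < ℓ / 2 → w ∈ host L a := fun w hw hw' p hp => by
          by_cases hp0 : p = 0
          · simpa [hp0] using hw
          · have h1 := hL.norm_le p hp hp0
            have h2 := norm_sub_norm_le p w
            rw [norm_sub_rev] at h2
            linarith
        refine exists_lipschitzOnWith_glue (r := a) ((ht z h.le hz).1.of_le hone)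
          ((hh z (hzh z h'.ge (by linarith))).1.of_le hone) ?_ ?_
        · filter_upwards [gt_ev h] with w hw hw' using eT w hw.le hw'
        · filter_upwards [lt_ev (show ‖z‖ < ℓ / 2 by linarith)] with w hw hw'
            using hH w (hzh w hw' hw)
  have hlip : LocallyLipschitz u := by
    intro z
    by_cases hz : z ∈ openHost L a
    · obtain ⟨K, t, ht, hK⟩ := ((hh z (openHost_subset_host L a hz)).1.of_le hone).exists_lipschitzOnWith
      refine ⟨K, t ∩ openHost L a, inter_mem ht ((isOpen_openHost L a).mem_nhds hz), ?_⟩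
      intro x hx y hy
      rw [hH x (openHost_subset_host L a hx.2), hH y (openHost_subset_host L a hy.2)]
      exact hK hx.1 hy.1
    · simp only [openHost, mem_ofPred_eq, not_forall, not_lt] at hz
      obtain ⟨p, hp, hzp⟩ := hz
      obtain ⟨K, t, ht, hK⟩ := hnear0 (z - p) hzp
      refine ⟨K, (fun w => w - p) ⁻¹' t, (continuous_id.sub continuous_const).continuousAt ht, ?_⟩
      intro x hx y hy
      have ex := hqp p hp (x - p)
      have ey := hqp p hp (y - p)
      rw [sub_add_cancel] at ex ey
      rw [ex, ey, edist_add_right]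
      simpa using hK hx hy
  have hfd : ∀ p ∈ L.lattice, ∀ z, fderiv ℝ u (z + p) = fderiv ℝ u z := fun p hp z => by
    rw [← fderiv_comp_add_right]
    simp only [hqp p hp]
    exact fderiv_add_const _
  have hF0 : ∀ {f : ℂ → ℂ} {s : Set ℂ} {z : ℂ}, UniqueDiffWithinAt ℝ s z → HarmonicAt f z →
      (∀ w ∈ s, u w = f w) → z ∈ s → fderivWithin ℝ u s z = fderiv ℝ f z := fun hs hf he hz => by
    rw [fderivWithin_congr he (he _ hz)]
    exact (hf.1.differentiableAt two_ne_zero).fderivWithin hs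
  have h0 := L.lattice.zero_mem
  refine ⟨u, ⟨hlip.continuous, ?_, ?_, ?_, ?_, ?_, ?_, ?_, ?_, ?_, ?_⟩, hlip, hqp⟩
  · intro p hp
    have h : ContDiffOn ℝ 1 fc (closedBall 0 b) := fun z hz =>
      ((hc z (by simpa using hz)).1.of_le hone).contDiffWithinAt
    refine (ContDiffOn.comp_sub_add h (t := closedBall p b) (p := p) (fun z hz => ?_) (lin p)).congr
      fun z hz => hC p hp z (by simpa [dist_eq_norm] using hz)
    simpa [dist_eq_norm] using hz
  · intro p hp
    have h : ContDiffOn ℝ 1 ft (tube 0 a b) := fun z hz =>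
      ((ht z (by simpa using hz.1) (by simpa using hz.2)).1.of_le hone).contDiffWithinAt
    refine (ContDiffOn.comp_sub_add h (t := tube p a b) (p := p) (fun z hz => ?_) (lin p)).congr
      fun z hz => hT p hp z hz.1 hz.2
    simpa [tube] using hz
  · exact ContDiffOn.congr (fun z hz => ((hh z hz).1.of_le hone).contDiffWithinAt) hH
  · intro p hp z hz
    refine (harmonicAt_congr_nhds ?_).mpr (HarmonicAt.comp_sub_add (hc _ hz.le) (lin p))
    filter_upwards [(isOpen_lt (continuous_id.sub continuous_const).norm continuous_const).mem_nhds
      hz] with w hw using hC p hp w (le_of_lt hw)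
  · intro p hp z hz hz'
    refine (harmonicAt_congr_nhds ?_).mpr (HarmonicAt.comp_sub_add (ht _ hz.le hz'.le) (lin p))
    filter_upwards [(isOpen_lt (continuous_id.sub continuous_const).norm continuous_const).mem_nhds
      hz', (isOpen_lt continuous_const (continuous_id.sub continuous_const).norm).mem_nhds
      hz] with w hw hw' using hT p hp w (le_of_lt hw') (le_of_lt hw)
  · intro z hz
    refine (harmonicAt_congr_nhds ?_).mpr (hh z (openHost_subset_host L a hz))
    filter_upwards [(isOpen_openHost L a).mem_nhds hz] with w hw
      using hH w (openHost_subset_host L a hw)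
  · intro p hp z hz
    rcases hb.eq_or_lt with h | h
    · have : z - p = 0 := norm_eq_zero.mp (hz.trans h.symm)
      simp [this]
    · have e1 := fderivWithin_vadd (hqp p hp) (closedBall 0 b) (z - p)
      have e2 := fderivWithin_vadd (hqp p hp) (tube 0 a b) (z - p)
      rw [sub_add_cancel] at e1 e2
      rw [vadd_tube] at e2
      rw [vadd_closedBall, vadd_eq_add, add_zero] at e1
      rw [e1, e2, hF0 (uniqueDiffOn_closedBall h _ (by simpa using hz.le)) (hc _ hz.le)
        (fun w hw => by simpa using hC 0 h0 w (by simpa using hw)) (by simpa using hz.le),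
        hF0 (uniqueDiffOn_tube hb hba _ (by simp [tube, hz, hba.le])) (ht _ hz.ge (by linarith))
        (fun w hw => by simpa using hT 0 h0 w hw.1 hw.2) (by simp [tube, hz, hba.le])]
      exact hct' _ hz h
  · intro p hp z hz _
    have hzp : z - p ∈ host L a := fun q hq => by
      by_cases hq0 : q = 0
      · simp [hq0, hz]
      · have h1 := hL.norm_le q hq hq0
        have h2 := norm_sub_norm_le q (z - p)
        rw [norm_sub_rev q (z - p)] at h2
        linarith
    have e1 := fderivWithin_vadd (hqp p hp) (host L a) (z - p)
    have e2 := fderivWithin_vadd (hqp p hp) (tube 0 a b) (z - p)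
    rw [sub_add_cancel] at e1 e2
    rw [vadd_tube] at e2
    rw [vadd_host hp] at e1
    rw [e1, e2, hF0 (uniqueDiffOn_tube hb hba _ (by simp [tube, hz, hba.le])) (ht _ (by linarith) hz.le)
        (fun w hw => by simpa using hT 0 h0 w hw.1 hw.2) (by simp [tube, hz, hba.le]),
      hF0 (uniqueDiffWithinAt_host L ha hL.pos hL.norm_le hz fun q hq hq0 => ?_) (hh _ hzp) hH hzp]
    · exact hth' _ hz
    · have h1 := hL.norm_le q hq hq0
      have h2 := norm_sub_norm_le q (z - p)
      rw [norm_sub_rev q (z - p)] at h2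
      linarith
  · exact hfd _ L.ω₁_mem_lattice
  · exact hfd _ L.ω₂_mem_lattice

end Glue

/-! ### Explicit potentials -/

/-- The combination `A(z) + σ A(z̄)`. -/
def symPart (σ : ℂ) (A : ℂ → ℂ) (z : ℂ) : ℂ := A z + σ * A ((starRingEnd ℂ) z)

open InnerProductSpace in
lemma harmonicAt_symPart {σ : ℂ} {A : ℂ → ℂ} {z : ℂ} (h : AnalyticAt ℂ A z)
    (h' : AnalyticAt ℂ A ((starRingEnd ℂ) z)) : HarmonicAt (symPart σ A) z :=
  h.harmonicAt.add (HarmonicAt.comp_conj (u := fun w => σ * A w)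
    (analyticAt_const.mul h').harmonicAt)

lemma fderiv_symPart_self {σ : ℂ} {A : ℂ → ℂ} {z : ℂ} (h : DifferentiableAt ℂ A z)
    (h' : DifferentiableAt ℂ A ((starRingEnd ℂ) z)) :
    fderiv ℝ (symPart σ A) z z = z * deriv A z +
      σ * ((starRingEnd ℂ) z * deriv A ((starRingEnd ℂ) z)) := by
  have h1 := h.hasDerivAt.hasFDerivAt.restrictScalars ℝ
  have h2 := (h'.hasDerivAt.hasFDerivAt.restrictScalars ℝ).comp z Complex.conjCLE.hasFDerivAt
  have h3 : HasFDerivAt (symPart σ A) _ z := h1.add (h2.const_mul σ)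
  rw [h3.fderiv]
  simp

/-- The inversion z ↦ c/z changes the sign of the Euler operator z d/dz. That sign distinguishes
flux continuity from continuity of the potential. -/
lemma mul_deriv_add_comp_div {P T : ℂ → ℂ} {κ c z : ℂ} (hz : z ≠ 0) (hP : DifferentiableAt ℂ P z)
    (hT : DifferentiableAt ℂ T (c / z)) :
    z * deriv (fun w => P w + κ * T (c / w)) z =
      z * deriv P z - κ * (c / z * deriv T (c / z)) := by
  have h1 : HasDerivAt (fun w => c / w) (-c / z ^ 2) z := by
    have := (hasDerivAt_const z c).div (hasDerivAt_id z) hz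
    rw [zero_mul, mul_one, zero_sub] at this
    exact this
  have h2 := hP.hasDerivAt.add ((hT.hasDerivAt.comp z h1).const_mul κ)
  have h3 : HasDerivAt (fun w => P w + κ * T (c / w)) _ z := h2
  rw [h3.deriv]
  field_simp
  ring

lemma analyticAt_comp_div {T : ℂ → ℂ} {c z : ℂ} (hz : z ≠ 0 ∨ c = 0) (hT : AnalyticAt ℂ T (c / z)) :
    AnalyticAt ℂ (fun w => T (c / w)) z := by
  rcases hz with hz | rfl
  · exact hT.comp (analyticAt_const.div analyticAt_id hz)
  · simpa using analyticAt_const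

/-- On the circle inversion coincides with conjugation. Thus inverted holomorphic terms in A(z) can
match the conjugate terms of A(z) + σ A(z̄). -/
lemma sq_div_eq_conj {z : ℂ} {r : ℝ} (hz : ‖z‖ = r) (hr : 0 < r) :
    (r : ℂ) ^ 2 / z = (starRingEnd ℂ) z := by
  have h0 : z ≠ 0 := norm_pos_iff.mp (hz ▸ hr)
  rw [div_eq_iff h0, mul_comm, Complex.mul_conj, Complex.normSq_eq_norm_sq, hz]
  push_cast
  rfl

variable {L : PeriodPair} {a b ℓ ν : ℝ} {εc εi εe : ℂ} {u : ℂ → ℂ} {lin : ℂ →L[ℝ] ℂ}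

lemma ae_differentiableAt_of_locallyLipschitz {G : ℂ → ℂ} (hG : LocallyLipschitz G) {s : Set ℂ}
    (hs : Bornology.IsBounded s) (hsm : MeasurableSet s) :
    ∀ᵐ z ∂(volume.restrict s), DifferentiableAt ℝ G z := by
  obtain ⟨R, hR⟩ := hs.subset_ball 0
  obtain ⟨K, hK⟩ := (hG.locallyLipschitzOn (s := closedBall (0 : ℂ) R)
    ).exists_lipschitzOnWith_of_compact (isCompact_closedBall _ _)
  rw [ae_restrict_iff' hsm]
  filter_upwards [hK.ae_differentiableWithinAt_of_mem (μ := volume)] with z hz hzs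
  exact (hz (ball_subset_closedBall (hR hzs))).differentiableAt (closedBall_mem_nhds_of_mem (hR hzs))

/-- The difference of `u` and its linear part is periodic and locally Lipschitz, so its gradient has
mean zero and only the linear part contributes. -/
lemma avgField_of_quasiperiodic (hu : LocallyLipschitz u)
    (hqp : ∀ p ∈ L.lattice, ∀ z, u (z + p) = u z + lin p) :
    avgField L u = ![-lin 1, -lin Complex.I] := by
  set G : ℂ → ℂ := fun z => u z - lin z with hG
  have hGl : LocallyLipschitz G := by
    intro z
    obtain ⟨K, t, ht, hK⟩ := hu z
    exact ⟨_, t, ht, hK.sub lin.lipschitz.lipschitzOnWith⟩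
  have hGp : ∀ p ∈ L.lattice, ∀ z, G (z + p) = G z := fun p hp z => by
    simp only [hG]; rw [hqp p hp, map_add]; ring
  have hfd : ∀ p ∈ L.lattice, ∀ z, fderiv ℝ u (z + p) = fderiv ℝ u z := fun p hp z => by
    rw [← fderiv_comp_add_right]
    simp only [hqp p hp]
    exact fderiv_add_const _
  have hcell := (volume_cell_pos L).ne'
  have key : ∀ v, ∫ z in voronoi L, fderiv ℝ u z v = volume.real (cell L) * lin v := by
    intro v
    have hae : ∀ᵐ z ∂(volume.restrict (voronoi L)),
        fderiv ℝ u z v = fderiv ℝ G z v + lin v := by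
      filter_upwards [ae_differentiableAt_of_locallyLipschitz hGl (isBounded_voronoi L)
        (isClosed_voronoi L).measurableSet] with z hz
      have : HasFDerivAt (fun w => G w + lin w) (fderiv ℝ G z + lin) z :=
        hz.hasFDerivAt.add lin.hasFDerivAt
      have e : (fun w => G w + lin w) = u := by ext w; simp [hG]
      rw [e] at this
      rw [this.fderiv]
      rfl
    rw [integral_congr_ae hae, integral_add (integrableOn_fderiv hGl (isBounded_voronoi L) v)
      (integrableOn_const (isCompact_voronoi L).measure_lt_top.ne), integral_fderiv_eq_zero L hGl hGp,
      setIntegral_const, volume_voronoi_eq, zero_add, Complex.real_smul]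
  have avg : ∀ v, ⨍ z in cell L, -fderiv ℝ u z v = -lin v := fun v => by
    rw [setAverage_eq, setIntegral_cell_eq, integral_neg, key, Complex.real_smul]
    · push_cast
      have : (volume.real (cell L) : ℂ) ≠ 0 := by exact_mod_cast hcell
      field_simp
    · intro p hp z
      rw [hfd p hp]
  ext i
  fin_cases i
  · exact avg 1
  · exact avg Complex.I

lemma alphaTilde_flux (hic : εi + εc ≠ 0) :
    εi * (1 - alphaTilde εc εi) = εc * (1 + alphaTilde εc εi) := by
  rw [alphaTilde]; field_simp; ring

/-- Core, tube and host carry the symmetrised complex potentials (1 + α̃) Θ(z), Θ(z) + α̃ σ Θ(b²/z)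
and H(z). On ‖z‖ = b the inverted argument is conj z, and σ² = 1 makes the first two agree. On ‖z‖ =
a it is ν² conj z, and the relations from `exists_complex_potentials` match tube and host. -/
theorem IsTubeLattice.exists_potential (hL : IsTubeLattice L ℓ) (ha : 0 < a)
    (haℓ : 2 * a < ℓ) (hν0 : 0 ≤ ν) (hν1 : ν < 1) (hie : εi + εe ≠ 0) (hic : εi + εc ≠ 0)
    (hγ : ∀ n : ℕ, 1 - alpha εi εe * alphaTilde εc εi * (ν : ℂ) ^ (4 * n + 2) ≠ 0)
    {σ : ℂ} (hσ : σ ^ 2 = 1) {x : ℕ → ℂ}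
    (hx : IsBoundedSolution σ (gam εc εi εe ν) (latticeSum L) (a / spacing L) x) :
    ∃ u, IsPotential L a (ν * a) εc εi εe u ∧ avgField L u =
      (-((1 - x 0 * volumeFraction L a) / a)) • ![σ + 1, Complex.I * (σ - 1)] := by
  obtain ⟨Θ, Φ, X, H, hΘ, hΦ, hX, hΘ0, hrel, hrel', hH, hHnear, hHper⟩ :=
    hL.exists_complex_potentials ha haℓ hie hν0 hν1 hγ hσ hx
  have hℓ := hL.pos
  have ha0 : (a : ℂ) ≠ 0 := by exact_mod_cast ha.ne'
  set α := alphaTilde εc εi with hα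
  have hb0 : 0 ≤ ν * a := by positivity
  have hba : ν * a < a := by nlinarith
  have ha' : 2 * a ^ 2 / ℓ < a := by rw [div_lt_iff₀ hℓ]; nlinarith
  have hsub : host L a ⊆ openHost L (2 * a ^ 2 / ℓ) := fun z hz p hp => ha'.trans_le (hz p hp)
  have hconj : ∀ {r : ℝ} {z : ℂ}, z ∈ openHost L r → (starRingEnd ℂ) z ∈ openHost L r :=
    fun hz p hp => by
      have := hz _ (hL.conj_mem p hp)
      rwa [← norm_conj_sub_conj, Complex.conj_conj] at this
  have anB : ∀ {F : ℂ → ℂ}, DifferentiableOn ℂ F (ball 0 (ℓ / 2)) → ∀ z, ‖z‖ < ℓ / 2 →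
      AnalyticAt ℂ F z := fun hF z hz => hF.analyticAt (isOpen_ball.mem_nhds (by simpa using hz))
  have anH : ∀ z ∈ openHost L (2 * a ^ 2 / ℓ), AnalyticAt ℂ H z := fun z hz =>
    hH.analyticAt ((isOpen_openHost L _).mem_nhds hz)
  set At : ℂ → ℂ := fun z => Θ z + α * σ * Θ (((ν * a : ℝ) : ℂ) ^ 2 / z) with hAt
  have hbz : ∀ z : ℂ, ν * a ≤ ‖z‖ → ‖((ν * a : ℝ) : ℂ) ^ 2 / z‖ < ℓ / 2 := fun z hz => by
    rw [norm_div, norm_pow, Complex.norm_real, Real.norm_of_nonneg hb0]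
    rcases hb0.eq_or_lt with h | h
    · rw [← h]; simp; positivity
    · have : 0 < ‖z‖ := h.trans_le hz
      rw [div_lt_iff₀ this]
      nlinarith
  have hAtan : ∀ z : ℂ, ν * a ≤ ‖z‖ → ‖z‖ ≤ a → AnalyticAt ℂ At z := fun z hz hz' => by
    refine (anB hΘ z (by linarith)).add (analyticAt_const.mul
      (analyticAt_comp_div ?_ (anB hΘ _ (hbz z hz))))
    rcases hb0.eq_or_lt with h | h
    · right; rw [← h]; simp
    · left; exact norm_pos_iff.mp (h.trans_le hz)
  have hcz : ∀ z : ℂ, ‖(starRingEnd ℂ) z‖ = ‖z‖ := Complex.norm_conj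
  have hDat : ∀ z : ℂ, ‖z‖ = a → ((ν * a : ℝ) : ℂ) ^ 2 / z = ν ^ 2 * (starRingEnd ℂ) z := fun z hz => by
    rw [← sq_div_eq_conj hz ha]; push_cast; ring
  have hνlt : ∀ z : ℂ, ‖z‖ ≤ a → ‖(ν : ℂ) ^ 2 * z‖ < ℓ / 2 := fun z hz => by
    rw [norm_mul, norm_pow, Complex.norm_real, Real.norm_of_nonneg hν0]
    have : ν ^ 2 ≤ 1 := pow_le_one₀ hν0 hν1.le
    nlinarith [norm_nonneg z]
  have hHz : ∀ z : ℂ, ‖z‖ = a → z ∈ host L a := fun z hz p hp => by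
    by_cases hp0 : p = 0
    · simp [hp0, hz]
    · have h1 := hL.norm_le p hp hp0
      have h2 := norm_sub_norm_le p z
      rw [norm_sub_rev] at h2
      linarith
  -- Slope of the linear part of the host potential: the applied field 1/a minus the depolarisation
  -- by the dipoles, which enters through the Legendre increment of ζ.
  set c : ℂ := (1 - x 0 * volumeFraction L a) / a with hc
  set lin : ℂ →L[ℝ] ℂ := (c * σ) • (ContinuousLinearMap.id ℝ ℂ) +
    c • (Complex.conjCLE : ℂ →L[ℝ] ℂ) with hlin
  have hlin_apply : ∀ z, lin z = c * σ * z + c * (starRingEnd ℂ) z := fun z => by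
    simp [hlin]
  have hceq : c = 1 / a - x 0 * a * (Real.pi / volume.real (cell L)) := by
    have : (volume.real (cell L) : ℂ) ≠ 0 := by exact_mod_cast (volume_cell_pos L).ne'
    rw [hc, volumeFraction]
    push_cast
    field_simp
  obtain ⟨u, hu, hul, huq⟩ := exists_glued_potential (εc := εc) (εi := εi) (εe := εe)
    (fc := symPart σ fun z => (1 + α) * Θ z) (ft := symPart σ At) (fh := symPart σ H) (lin := lin)
    hL ha haℓ hb0 hba
    (fun z hz => harmonicAt_symPart (analyticAt_const.mul (anB hΘ z (by linarith)))
      (analyticAt_const.mul (anB hΘ _ (by rw [hcz]; linarith))))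
    (fun z hz hz' => harmonicAt_symPart (hAtan z hz hz') (hAtan _ (by rwa [hcz]) (by rwa [hcz])))
    (fun z hz => harmonicAt_symPart (anH z (hsub hz)) (anH _ (hconj (hsub hz))))
    (fun p hp z hz => by
      rw [symPart, symPart, map_add, hHper p hp z (hsub hz), hHper _ (hL.conj_mem p hp) _
        (hconj (hsub hz)), hlin_apply, hceq, Complex.conj_conj]
      linear_combination (1 / a * (starRingEnd ℂ) p) * hσ)
    (fun z hz => by
      rcases hb0.eq_or_lt with h | h
      · rw [← h] at hz
        have : z = 0 := norm_eq_zero.mp hz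
        subst this
        simp [symPart, hAt, hΘ0]
      · have e := sq_div_eq_conj hz h
        have e' := sq_div_eq_conj ((hcz z).trans hz) h
        rw [Complex.conj_conj] at e'
        simp only [symPart, hAt]
        rw [e, e']
        linear_combination -α * Θ z * hσ)
    (fun z hz => by
      have e' := hDat _ ((hcz z).trans hz)
      rw [Complex.conj_conj] at e'
      have s := sq_div_eq_conj hz ha
      have s' := sq_div_eq_conj ((hcz z).trans hz) ha
      rw [Complex.conj_conj] at s'
      have r1 := hrel z (by simp [hz]; linarith)
      have r2 := hrel ((starRingEnd ℂ) z) (by simp [hz]; linarith)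
      simp only [symPart, hAt]
      rw [hDat z hz, e', hHnear z (by rw [hz]; exact ha') (by linarith),
        hHnear _ (by rw [hcz, hz]; exact ha') (by rw [hcz]; linarith), s, s']
      linear_combination r1 + σ * r2 + (α * Θ (ν ^ 2 * z) - X ((starRingEnd ℂ) z)) * hσ)
    (fun z hz hb => by
      have hz0 : z ≠ 0 := norm_pos_iff.mp (hz ▸ hb)
      have hz0' : (starRingEnd ℂ) z ≠ 0 := by simpa using hz0
      have e := sq_div_eq_conj hz hb
      have e' := sq_div_eq_conj ((hcz z).trans hz) hb
      rw [Complex.conj_conj] at e'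
      have d1 : DifferentiableAt ℂ Θ z := (anB hΘ z (by linarith)).differentiableAt
      have d2 : DifferentiableAt ℂ Θ ((starRingEnd ℂ) z) :=
        (anB hΘ _ (by rw [hcz]; linarith)).differentiableAt
      rw [fderiv_symPart_self (d1.const_mul _) (d2.const_mul _),
        fderiv_symPart_self (hAtan z hz.ge (by linarith)).differentiableAt
          (hAtan _ (by rw [hcz]; exact hz.ge) (by rw [hcz]; linarith)).differentiableAt,
        deriv_const_mul _ d1, deriv_const_mul _ d2, hAt,
        mul_deriv_add_comp_div hz0 d1 (by rwa [e]), mul_deriv_add_comp_div hz0' d2 (by rwa [e']), e, e']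
      have hfl := alphaTilde_flux (εc := εc) (εi := εi) hic
      rw [← hα] at hfl
      generalize deriv Θ z = p
      generalize deriv Θ ((starRingEnd ℂ) z) = q
      linear_combination -(z * p + σ * ((starRingEnd ℂ) z * q)) * hfl + εi * α * z * p * hσ)
    (fun z hz => by
      have hz0 : z ≠ 0 := norm_pos_iff.mp (hz ▸ ha)
      have hz' : ‖(starRingEnd ℂ) z‖ = a := (hcz z).trans hz
      have hz0' : (starRingEnd ℂ) z ≠ 0 := by simpa using hz0
      have s := sq_div_eq_conj hz ha
      have s' := sq_div_eq_conj hz' ha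
      have e := hDat z hz
      have e' := hDat _ hz'
      rw [Complex.conj_conj] at e' s'
      have D : ∀ {F : ℂ → ℂ}, DifferentiableOn ℂ F (ball 0 (ℓ / 2)) → ∀ w : ℂ, ‖w‖ ≤ a →
          DifferentiableAt ℂ F w := fun hF w hw => (anB hF w (by linarith)).differentiableAt
      have Dν : ∀ w : ℂ, ‖w‖ ≤ a → DifferentiableAt ℂ Θ (ν ^ 2 * w) := fun w hw =>
        (anB hΘ _ (hνlt w hw)).differentiableAt
      have hderiv : ∀ w : ℂ, ‖w‖ ≤ a → εi * (w * deriv Θ w - α * (ν ^ 2 * w * deriv Θ (ν ^ 2 * w))) =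
          εe * (w * deriv Φ w + σ * (w * deriv X w)) := fun w hw => by
        have h1 : HasDerivAt (fun v => Θ (ν ^ 2 * v)) (deriv Θ (ν ^ 2 * w) * ν ^ 2) w := by
          have := (hasDerivAt_id w).const_mul ((ν : ℂ) ^ 2)
          rw [mul_one] at this
          exact HasDerivAt.comp w (Dν w hw).hasDerivAt this
        have h2 := ((D hΘ w hw).hasDerivAt.sub (h1.const_mul α)).const_mul εi
        have h3 := ((D hΦ w hw).hasDerivAt.add ((D hX w hw).hasDerivAt.const_mul σ)).const_mul εe
        have h4 := h2.congr_of_eventuallyEq (f₁ := fun v => εe * (Φ v + σ * X v)) (by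
          filter_upwards [isOpen_ball.mem_nhds (show w ∈ ball (0 : ℂ) (ℓ / 2) by simp; linarith)]
            with v hv using (hrel' v hv).symm)
        have := h4.unique h3
        linear_combination w * this
      have hHd : ∀ w : ℂ, ‖w‖ = a → w * deriv H w = w * deriv Φ w +
          (starRingEnd ℂ) w * deriv X ((starRingEnd ℂ) w) := fun w hw => by
        have hw0 : w ≠ 0 := norm_pos_iff.mp (hw ▸ ha)
        have hs := sq_div_eq_conj hw ha
        have he : H =ᶠ[𝓝 w] fun v => Φ v + (-1) * X (a ^ 2 / v) := by
          filter_upwards [(isOpen_lt continuous_const continuous_norm).mem_nhds (hw ▸ ha' :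
            2 * a ^ 2 / ℓ < ‖w‖), (isOpen_lt continuous_norm continuous_const).mem_nhds
            (show ‖w‖ < ℓ / 2 by linarith)] with v hv hv'
          rw [hHnear v hv hv']
          ring
        rw [he.deriv_eq, mul_deriv_add_comp_div hw0 (D hΦ w hw.le)
          (by rw [hs]; exact D hX _ (by rw [hcz, hw])), hs]
        ring
      rw [fderiv_symPart_self (hAtan z (by linarith) hz.le).differentiableAt
          (hAtan _ (by linarith) hz'.le).differentiableAt,
        fderiv_symPart_self (anH z (hsub (hHz z hz))).differentiableAt
          (anH _ (hsub (hHz _ hz'))).differentiableAt, hHd z hz, hHd _ hz', Complex.conj_conj, hAt,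
        mul_deriv_add_comp_div hz0 (D hΘ z hz.le) (by rw [e]; exact Dν _ hz'.le),
        mul_deriv_add_comp_div hz0' (D hΘ _ hz'.le) (by rw [e']; exact Dν _ hz.le), e, e']
      have q1 := hderiv z hz.le
      have q2 := hderiv _ hz'.le
      linear_combination q1 + σ * q2 + (-εi * α * (ν ^ 2 * z * deriv Θ (ν ^ 2 * z)) +
        εe * ((starRingEnd ℂ) z * deriv X ((starRingEnd ℂ) z))) * hσ)
  refine ⟨u, hu, ?_⟩
  rw [avgField_of_quasiperiodic hul huq, hlin_apply, hlin_apply]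
  ext i
  fin_cases i
  · simp; ring
  · simp; ring

/-- For tubes that do not touch, the effective tensor is unique. -/
theorem IsTubeLattice.effectiveTensor_unique (hL : IsTubeLattice L ℓ) (ha : 0 < a)
    (haℓ : 2 * a < ℓ) (hν0 : 0 ≤ ν) (hν1 : ν < 1) (hie : εi + εe ≠ 0) (hic : εi + εc ≠ 0)
    (hγ : ∀ n : ℕ, 1 - alpha εi εe * alphaTilde εc εi * (ν : ℂ) ^ (4 * n + 2) ≠ 0)
    {X Y : ℕ → ℂ}
    (hX : IsBoundedSolution 1 (gam εc εi εe ν) (latticeSum L) (a / spacing L) X)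
    (hY : IsBoundedSolution (-1) (gam εc εi εe ν) (latticeSum L) (a / spacing L) Y)
    (hXY : X 0 = Y 0) (hne : 1 - X 0 * volumeFraction L a ≠ 0) {T T' : Matrix (Fin 2) (Fin 2) ℂ}
    (hT : IsEffectiveTensor L a (ν * a) εc εi εe T)
    (hT' : IsEffectiveTensor L a (ν * a) εc εi εe T') : T = T' := by
  have ha0 : (a : ℂ) ≠ 0 := by exact_mod_cast ha.ne'
  -- The mean field points along the first axis for σ = 1 and along the second for σ = -1. Both
  -- factors are nonzero by `hne`, so every column of the tensor is determined.
  obtain ⟨u, hu, eu⟩ := hL.exists_potential ha haℓ hν0 hν1 hie hic hγ (σ := 1) (by norm_num) hX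
  obtain ⟨v, hv, ev⟩ := hL.exists_potential ha haℓ hν0 hν1 hie hic hγ (σ := -1) (by norm_num) hY
  have h1 := (hT u hu).symm.trans (hT' u hu)
  have h2 := (hT v hv).symm.trans (hT' v hv)
  rw [← hXY] at ev
  rw [eu] at h1
  rw [ev] at h2
  have hc : -((1 - X 0 * volumeFraction L a) / (a : ℂ)) ≠ 0 := neg_ne_zero.mpr (div_ne_zero hne ha0)
  rw [Matrix.mulVec_smul, Matrix.mulVec_smul] at h1 h2
  have h1' := smul_right_injective _ hc h1
  have h2' := smul_right_injective _ hc h2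
  ext i j
  have g1 := congrFun h1' i
  have g2 := congrFun h2' i
  simp [Matrix.mulVec, dotProduct, Fin.sum_univ_two] at g1 g2
  fin_cases j
  · exact g1
  · rcases g2 with h | h
    · exact h
    · norm_num at h

/-! ### The solution of the infinite systems for small `h` -/

section Neumann

variable {σ : ℂ} {γ S : ℕ → ℂ} {K Γ : ℝ}

lemma norm_coeffG_mul_le (hS : ∀ m, 1 ≤ m → ‖S m‖ ≤ K) {x : ℕ → ℂ} {M r : ℝ} (hx : ∀ n, ‖x n‖ ≤ M)
    {w : ℂ} (hw : ‖w‖ ≤ r) (n k : ℕ) :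
    ‖coeffG S n k * x k * w ^ (2 * n + 2 * k + 2)‖ ≤
      K * M * r ^ (2 * n + 2) * (((2 * n + 2 * k + 1).choose (2 * k) : ℝ) * r ^ (2 * k)) := by
  have hK : 0 ≤ K := (norm_nonneg _).trans (hS 1 le_rfl)
  have hM : 0 ≤ M := (norm_nonneg _).trans (hx 0)
  rw [norm_mul, norm_mul, norm_pow]
  calc ‖coeffG S n k‖ * ‖x k‖ * ‖w‖ ^ (2 * n + 2 * k + 2)
      ≤ (((2 * n + 2 * k + 1).choose (2 * k) : ℝ) * K) * M * r ^ (2 * n + 2 * k + 2) := by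
        gcongr
        · exact norm_coeffG_le hS n k
        · exact hx k
    _ = _ := by ring

lemma summable_coeffG_mul (hS : ∀ m, 1 ≤ m → ‖S m‖ ≤ K) {x : ℕ → ℂ} {M : ℝ} (hx : ∀ n, ‖x n‖ ≤ M)
    {w : ℂ} (hw : ‖w‖ < 1) (n : ℕ) :
    Summable fun k => ‖coeffG S n k * x k * w ^ (2 * n + 2 * k + 2)‖ :=
  .of_nonneg_of_le (fun _ => norm_nonneg _) (fun k => norm_coeffG_mul_le hS hx le_rfl n k)
    ((summable_choose_even n (t := ‖w‖) (by rwa [abs_of_nonneg (norm_nonneg w)])).mul_left _)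

lemma norm_tsum_coeffG_le_two_mul (hS : ∀ m, 1 ≤ m → ‖S m‖ ≤ K) {x : ℕ → ℂ} {M : ℝ}
    (hx : ∀ n, ‖x n‖ ≤ M) {w : ℂ} (hw : ‖w‖ ≤ 1 / 4) (n : ℕ) :
    ‖∑' k, coeffG S n k * x k * w ^ (2 * n + 2 * k + 2)‖ ≤ K * M * (2 * ‖w‖) ^ (2 * n + 2) := by
  have hK : 0 ≤ K := (norm_nonneg _).trans (hS 1 le_rfl)
  have hM : 0 ≤ M := (norm_nonneg _).trans (hx 0)
  refine (norm_tsum_coeffG_le hS (by linarith) hx n).trans ?_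
  have h1 : 0 < 1 - ‖w‖ := by linarith
  have : ‖w‖ / (1 - ‖w‖) ≤ 2 * ‖w‖ := by
    rw [div_le_iff₀ h1]; nlinarith [norm_nonneg w]
  gcongr

/-- The two conditions on ρ make the operator of the system a contraction with factor 1/2 in the
supremum norm, uniformly for complex ‖w‖ ≤ ρ. -/
lemma norm_system_le (hS : ∀ m, 1 ≤ m → ‖S m‖ ≤ K) (hγ : ∀ n, ‖γ n‖ ≤ Γ) (hσ : ‖σ‖ ≤ 1) {ρ : ℝ}
    (hρ : ρ ≤ 1 / 4) (hρ' : Γ * K * (2 * ρ) ^ 2 ≤ 1 / 2) {x : ℕ → ℂ} {M : ℝ} (hx : ∀ n, ‖x n‖ ≤ M)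
    {w : ℂ} (hw : ‖w‖ ≤ ρ) (n : ℕ) :
    ‖σ * γ n * ∑' k, coeffG S n k * x k * w ^ (2 * n + 2 * k + 2)‖ ≤ 1 / 2 * M := by
  have hK : 0 ≤ K := (norm_nonneg _).trans (hS 1 le_rfl)
  have hΓ : 0 ≤ Γ := (norm_nonneg _).trans (hγ 0)
  have hM : 0 ≤ M := (norm_nonneg _).trans (hx 0)
  have h1 := norm_tsum_coeffG_le_two_mul hS hx (hw.trans hρ) n
  have h2 : (2 * ‖w‖) ^ (2 * n + 2) ≤ (2 * ρ) ^ 2 := by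
    refine (pow_le_pow_of_le_one (by positivity) (by linarith) (by omega : 2 ≤ 2 * n + 2)).trans ?_
    gcongr
  rw [norm_mul, norm_mul]
  calc ‖σ‖ * ‖γ n‖ * _ ≤ 1 * Γ * (K * M * (2 * ρ) ^ 2) := by
        gcongr
        · exact hγ n
        · exact h1.trans (by gcongr)
    _ = Γ * K * (2 * ρ) ^ 2 * M := by ring
    _ ≤ _ := by gcongr

/-- The terms of the Neumann series for the solution of the infinite system. -/
def neumannTerm (σ : ℂ) (γ S : ℕ → ℂ) : ℕ → ℕ → ℂ → ℂ
  | 0, n, _ => if n = 0 then 1 else 0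
  | j + 1, n, w => σ * γ n * ∑' k, coeffG S n k * neumannTerm σ γ S j k w * w ^ (2 * n + 2 * k + 2)

lemma norm_neumannTerm_le (hS : ∀ m, 1 ≤ m → ‖S m‖ ≤ K) (hγ : ∀ n, ‖γ n‖ ≤ Γ) (hσ : ‖σ‖ ≤ 1) {ρ : ℝ}
    (hρ : ρ ≤ 1 / 4) (hρ' : Γ * K * (2 * ρ) ^ 2 ≤ 1 / 2) {w : ℂ} (hw : ‖w‖ ≤ ρ) (j n : ℕ) :
    ‖neumannTerm σ γ S j n w‖ ≤ (1 / 2) ^ j := by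
  induction j generalizing n with
  | zero =>
    rw [neumannTerm, pow_zero]
    split_ifs <;> simp
  | succ j ih =>
    rw [neumannTerm, pow_succ']
    exact norm_system_le hS hγ hσ hρ hρ' ih hw n

lemma differentiableOn_neumannTerm (hS : ∀ m, 1 ≤ m → ‖S m‖ ≤ K) (hγ : ∀ n, ‖γ n‖ ≤ Γ)
    (hσ : ‖σ‖ ≤ 1) {ρ : ℝ} (hρ : ρ ≤ 1 / 4) (hρ' : Γ * K * (2 * ρ) ^ 2 ≤ 1 / 2) (j n : ℕ) :
    DifferentiableOn ℂ (neumannTerm σ γ S j n) (ball 0 ρ) := by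
  induction j generalizing n with
  | zero => exact differentiableOn_const _
  | succ j ih =>
    refine DifferentiableOn.const_mul ?_ _
    refine Complex.differentiableOn_tsum_of_summable_norm
      ((summable_choose_even n (t := 1 / 4) (by norm_num [abs_of_pos])).mul_left
        (K * (1 / 2) ^ j * (1 / 4) ^ (2 * n + 2)))
      (fun k => ((ih k).const_mul _).mul (differentiableOn_id.pow _)) isOpen_ball fun k w hw => ?_
    have hw' : ‖w‖ ≤ ρ := (mem_ball_zero_iff.mp hw).le
    exact norm_coeffG_mul_le hS (norm_neumannTerm_le hS hγ hσ hρ hρ' hw' j) (hw'.trans hρ) n k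

/-- The Neumann series. -/
def neumann (σ : ℂ) (γ S : ℕ → ℂ) (n : ℕ) (w : ℂ) : ℂ := ∑' j, neumannTerm σ γ S j n w

lemma summable_half_pow : Summable fun j : ℕ => (1 / 2 : ℝ) ^ j :=
  summable_geometric_of_lt_one (by norm_num) (by norm_num)

lemma norm_neumann_le (hS : ∀ m, 1 ≤ m → ‖S m‖ ≤ K) (hγ : ∀ n, ‖γ n‖ ≤ Γ) (hσ : ‖σ‖ ≤ 1) {ρ : ℝ}
    (hρ : ρ ≤ 1 / 4) (hρ' : Γ * K * (2 * ρ) ^ 2 ≤ 1 / 2) {w : ℂ} (hw : ‖w‖ ≤ ρ) (n : ℕ) :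
    ‖neumann σ γ S n w‖ ≤ 2 := by
  have h : HasSum (fun j : ℕ => (1 / 2 : ℝ) ^ j) 2 := by
    have := hasSum_geometric_of_lt_one (r := (1 / 2 : ℝ)) (by norm_num) (by norm_num)
    norm_num at this ⊢
    exact this
  exact tsum_of_norm_bounded h fun j => norm_neumannTerm_le hS hγ hσ hρ hρ' hw j n

lemma differentiableOn_neumann (hS : ∀ m, 1 ≤ m → ‖S m‖ ≤ K) (hγ : ∀ n, ‖γ n‖ ≤ Γ)
    (hσ : ‖σ‖ ≤ 1) {ρ : ℝ} (hρ : ρ ≤ 1 / 4) (hρ' : Γ * K * (2 * ρ) ^ 2 ≤ 1 / 2) (n : ℕ) :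
    DifferentiableOn ℂ (neumann σ γ S n) (ball 0 ρ) :=
  Complex.differentiableOn_tsum_of_summable_norm summable_half_pow
    (fun j => differentiableOn_neumannTerm hS hγ hσ hρ hρ' j n) isOpen_ball
    fun j _ hw => norm_neumannTerm_le hS hγ hσ hρ hρ' (mem_ball_zero_iff.mp hw).le j n

/-- Shifting the index of the Neumann series turns each term into the operator applied to its
predecessor. The bounds 2^(-j) times the row sums justify exchanging the order of summation. -/
lemma neumann_eq (hS : ∀ m, 1 ≤ m → ‖S m‖ ≤ K) (hγ : ∀ n, ‖γ n‖ ≤ Γ) (hσ : ‖σ‖ ≤ 1) {ρ : ℝ}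
    (hρ : ρ ≤ 1 / 4) (hρ' : Γ * K * (2 * ρ) ^ 2 ≤ 1 / 2) {w : ℂ} (hw : ‖w‖ ≤ ρ) (n : ℕ) :
    neumann σ γ S n w = (if n = 0 then 1 else 0) +
      σ * γ n * ∑' k, coeffG S n k * neumann σ γ S k w * w ^ (2 * n + 2 * k + 2) := by
  have hb := norm_neumannTerm_le hS hγ hσ hρ hρ' hw
  have hs : ∀ k, Summable fun j => neumannTerm σ γ S j k w := fun k =>
    .of_norm_bounded summable_half_pow fun j => hb j k
  have h1 := summable_coeffG_mul hS (x := fun _ => 1) (M := 1) (by simp) (w := w) (by linarith) n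
  have h2 : Summable fun i : ℕ × ℕ =>
      coeffG S n i.2 * neumannTerm σ γ S i.1 i.2 w * w ^ (2 * n + 2 * i.2 + 2) := by
    refine .of_norm_bounded (summable_half_pow.mul_of_nonneg h1 (fun _ => by positivity)
      fun _ => norm_nonneg _) fun i => ?_
    rw [mul_right_comm, norm_mul, mul_comm]
    have := hb i.1 i.2
    simp only [mul_one]
    gcongr
  have h3 := h2.tsum_comm (f := fun j k =>
    coeffG S n k * neumannTerm σ γ S j k w * w ^ (2 * n + 2 * k + 2))
  have h4 : ∀ k, ∑' j, coeffG S n k * neumannTerm σ γ S j k w * w ^ (2 * n + 2 * k + 2) =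
      coeffG S n k * neumann σ γ S k w * w ^ (2 * n + 2 * k + 2) := fun k => by
    rw [tsum_mul_right, tsum_mul_left, neumann]
  rw [neumann, (hs n).tsum_eq_zero_add]
  simp only [neumannTerm]
  rw [tsum_mul_left, ← h3, tsum_congr h4]

lemma eq_zero_of_homogeneous (hS : ∀ m, 1 ≤ m → ‖S m‖ ≤ K) (hγ : ∀ n, ‖γ n‖ ≤ Γ) (hσ : ‖σ‖ ≤ 1)
    {ρ : ℝ} (hρ : ρ ≤ 1 / 4) (hρ' : Γ * K * (2 * ρ) ^ 2 ≤ 1 / 2) {w : ℂ} (hw : ‖w‖ ≤ ρ)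
    {d : ℕ → ℂ} (hd : Memℓp d ∞)
    (h : ∀ n, d n = σ * γ n * ∑' k, coeffG S n k * d k * w ^ (2 * n + 2 * k + 2)) : d = 0 := by
  obtain ⟨M, hM0, hM⟩ := hd.exists_norm_le
  have hj : ∀ j n, ‖d n‖ ≤ (1 / 2) ^ j * M := fun j => by
    induction j with
    | zero => simpa using hM
    | succ j ih =>
      intro n
      rw [h n, pow_succ', mul_assoc (1 / 2 : ℝ)]
      exact norm_system_le hS hγ hσ hρ hρ' ih hw n
  ext n
  have hlim : Tendsto (fun j : ℕ => (1 / 2 : ℝ) ^ j * M) atTop (𝓝 0) := by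
    simpa using (tendsto_pow_atTop_nhds_zero_of_lt_one (r := (1 / 2 : ℝ)) (by norm_num)
      (by norm_num)).mul_const M
  exact norm_le_zero_iff.mp (ge_of_tendsto' hlim fun j => hj j n)

lemma isUniqueBoundedSolution_of_small (hS : ∀ m, 1 ≤ m → ‖S m‖ ≤ K) (hγ : ∀ n, ‖γ n‖ ≤ Γ)
    (hσ : ‖σ‖ ≤ 1) {ρ : ℝ} (hρ : ρ ≤ 1 / 4) (hρ' : Γ * K * (2 * ρ) ^ 2 ≤ 1 / 2) {h : ℝ}
    (hh : |h| ≤ ρ) {x : ℕ → ℂ} (hx : IsBoundedSolution σ γ S h x) :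
    IsUniqueBoundedSolution σ γ S h x := by
  refine ⟨hx, fun y hy => ?_⟩
  have hw : ‖(h : ℂ)‖ ≤ ρ := by rwa [Complex.norm_real]
  obtain ⟨M, -, hM⟩ := hx.1.exists_norm_le
  obtain ⟨M', -, hM'⟩ := hy.1.exists_norm_le
  refine sub_eq_zero.mp (eq_zero_of_homogeneous hS hγ hσ hρ hρ' hw (hy.1.sub hx.1) fun n => ?_)
  have s := (summable_coeffG_mul hS hM (w := (h : ℂ)) (by linarith) n).of_norm
  have s' := (summable_coeffG_mul hS hM' (w := (h : ℂ)) (by linarith) n).of_norm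
  have e : ∀ k, coeffG S n k * (y - x) k * (h : ℂ) ^ (2 * n + 2 * k + 2) =
      coeffG S n k * y k * (h : ℂ) ^ (2 * n + 2 * k + 2) -
        coeffG S n k * x k * (h : ℂ) ^ (2 * n + 2 * k + 2) := fun k => by
    rw [Pi.sub_apply]; ring
  rw [tsum_congr e, s'.tsum_sub s, Pi.sub_apply]
  linear_combination hy.2 n - hx.2 n

lemma isBoundedSolution_neumann (hS : ∀ m, 1 ≤ m → ‖S m‖ ≤ K) (hγ : ∀ n, ‖γ n‖ ≤ Γ)
    (hσ : ‖σ‖ ≤ 1) {ρ : ℝ} (hρ : ρ ≤ 1 / 4) (hρ' : Γ * K * (2 * ρ) ^ 2 ≤ 1 / 2) {h : ℝ}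
    (hh : |h| ≤ ρ) : IsBoundedSolution σ γ S h fun n => γ 0 * neumann σ γ S n h := by
  have hw : ‖(h : ℂ)‖ ≤ ρ := by rwa [Complex.norm_real]
  refine ⟨memℓp_infty_of_norm_le (M := ‖γ 0‖ * 2) fun n => ?_, fun n => ?_⟩
  · rw [norm_mul]
    have := norm_neumann_le hS hγ hσ hρ hρ' hw n
    gcongr
  · have e : ∀ k, coeffG S n k * (γ 0 * neumann σ γ S k h) * (h : ℂ) ^ (2 * n + 2 * k + 2) =
        γ 0 * (coeffG S n k * neumann σ γ S k h * (h : ℂ) ^ (2 * n + 2 * k + 2)) := fun k => by ring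
    simp only
    rw [tsum_congr e, tsum_mul_left, neumann_eq hS hγ hσ hρ hρ' hw n]
    split_ifs <;> ring

lemma exists_small_radius (Γ K : ℝ) (hΓ : 0 ≤ Γ) (hK : 0 ≤ K) :
    ∃ ρ > 0, ρ ≤ 1 / 4 ∧ Γ * K * (2 * ρ) ^ 2 ≤ 1 / 2 := by
  have h : 0 ≤ Γ * K := mul_nonneg hΓ hK
  have h1 : 0 < 1 + Γ * K := by linarith
  refine ⟨1 / (4 * (1 + Γ * K)), by positivity, ?_, ?_⟩
  · rw [div_le_div_iff₀ (by positivity) (by norm_num)]; linarith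
  · rw [mul_pow, div_pow, mul_pow, ← mul_div_assoc, ← mul_div_assoc, div_le_div_iff₀ (by positivity) (by norm_num)]
    nlinarith

end Neumann

/-! ### Symmetry of the lattice sums -/

variable {L : PeriodPair}

lemma pow_mul_mem {ρ : ℂ} (h : ∀ p ∈ L.lattice, ρ * p ∈ L.lattice) (m : ℕ) :
    ∀ p ∈ L.lattice, ρ ^ m * p ∈ L.lattice := by
  induction m with
  | zero => simp
  | succ m ih => intro p hp; rw [pow_succ', mul_assoc]; exact h _ (ih p hp)

/-- Rotating the summation variable gives S_k = ρ^(-2k) S_k. The finite order of ρ serves only to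
invert the rotation of the lattice by a power of ρ. -/
lemma latticeSum_eq_zero {ρ : ℂ} (h : ∀ p ∈ L.lattice, ρ * p ∈ L.lattice) {m : ℕ}
    (hm : ρ ^ (m + 1) = 1) {k : ℕ} (hk : ρ ^ (2 * k) ≠ 1) : latticeSum L k = 0 := by
  have h0 : ρ ≠ 0 := by rintro rfl; simp at hm
  rw [latticeSum]
  split_ifs with h1
  · rfl
  let e : {l : L.lattice // l ≠ 0} ≃ {l : L.lattice // l ≠ 0} :=
    { toFun := fun l => ⟨⟨ρ * l, h _ l.1.2⟩, fun hl => by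
        have : ρ * (l : ℂ) = 0 := congrArg Subtype.val hl
        exact l.2 (Subtype.ext ((mul_eq_zero.mp this).resolve_left h0))⟩
      invFun := fun l => ⟨⟨ρ ^ m * l, pow_mul_mem h m _ l.1.2⟩, fun hl => by
        have : ρ ^ m * (l : ℂ) = 0 := congrArg Subtype.val hl
        exact l.2 (Subtype.ext ((mul_eq_zero.mp this).resolve_left (pow_ne_zero _ h0)))⟩
      left_inv := fun l => by
        ext
        simp only
        rw [← mul_assoc, ← pow_succ, hm, one_mul]
      right_inv := fun l => by
        ext
        simp only
        rw [← mul_assoc, ← pow_succ', hm, one_mul] }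
  have h2 := e.tsum_eq fun l : {l : L.lattice // l ≠ 0} => ((spacing L : ℂ) / (l : ℂ)) ^ (2 * k)
  have h3 : ∀ l : {l : L.lattice // l ≠ 0}, ((spacing L : ℂ) / (e l : ℂ)) ^ (2 * k) =
      (ρ ^ (2 * k))⁻¹ * ((spacing L : ℂ) / (l : ℂ)) ^ (2 * k) := fun l => by
    have : (e l : ℂ) = ρ * l := rfl
    rw [this, ← inv_pow, ← mul_pow]
    congr 1
    rw [← div_div, div_eq_mul_inv, div_eq_mul_inv, div_eq_mul_inv]; ring
  rw [tsum_congr h3, tsum_mul_left] at h2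
  have h4 : (ρ ^ (2 * k))⁻¹ - 1 ≠ 0 := sub_ne_zero.mpr (by rwa [ne_eq, inv_eq_one])
  exact (mul_eq_zero.mp (show ((ρ ^ (2 * k))⁻¹ - 1) * _ = 0 by
    rw [sub_mul, one_mul, sub_eq_zero]; exact h2)).resolve_left h4

lemma IsSquareLattice.latticeSum_eq_zero (h : IsSquareLattice L) {k : ℕ} (hk : ¬ 2 ∣ k) :
    latticeSum L k = 0 := by
  refine TubeArray.latticeSum_eq_zero h.mul_I_mem (m := 3) (by simp) ?_
  rw [pow_mul, Complex.I_sq, (Nat.odd_iff.mpr (by omega)).neg_one_pow]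
  norm_num

lemma IsHexagonalLattice.latticeSum_eq_zero (h : IsHexagonalLattice L) {k : ℕ} (hk : ¬ 3 ∣ k) :
    latticeSum L k = 0 := by
  have h2 := exp_I_pi_div_three_sq
  have hm := h.mul_mem
  set ρ := Complex.exp (Complex.I * Real.pi / 3)
  have h6 : ρ ^ 6 = 1 := by linear_combination (ρ ^ 4 + ρ ^ 3 - ρ - 1) * h2
  refine TubeArray.latticeSum_eq_zero hm (m := 5) h6 ?_
  have hk' : k = 3 * (k / 3) + 1 ∨ k = 3 * (k / 3) + 2 := by omega
  rcases hk' with e | e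
  · rw [e, show 2 * (3 * (k / 3) + 1) = 6 * (k / 3) + 2 by ring, pow_add, pow_mul, h6, one_pow, one_mul]
    intro h1
    have h3 : ρ = 2 := by linear_combination h1 - h2
    rw [h3] at h1
    norm_num at h1
  · rw [e, show 2 * (3 * (k / 3) + 2) = 6 * (k / 3) + 4 by ring, pow_add, pow_mul, h6, one_pow, one_mul]
    intro h1
    have h3 : ρ = -1 := by linear_combination -h1 + (ρ ^ 2 + ρ) * h2
    rw [h3] at h2
    norm_num at h2

/-- A sequence `s` with `s 0 = 1` that changes the sign of the matrix `S_{n+k+1}` when rows and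
columns are multiplied by it. -/
structure IsSignSequence (S s : ℕ → ℂ) : Prop where
  zero : s 0 = 1
  norm_le : ∀ n, ‖s n‖ ≤ 1
  eq_neg : ∀ n k, S (n + k + 1) ≠ 0 → s k = -s n

lemma IsSquareLattice.exists_isSignSequence (h : IsSquareLattice L) :
    ∃ s, IsSignSequence (latticeSum L) s := by
  refine ⟨fun n => (-1) ^ n, by simp, by simp, fun n k hS => ?_⟩
  have h2 : 2 ∣ n + k + 1 := by by_contra hc; exact hS (h.latticeSum_eq_zero hc)
  rcases Nat.even_or_odd n with hn | hn
  · have hk : Odd k := by rw [Nat.odd_iff]; have := Nat.even_iff.mp hn; omega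
    simp only [hn.neg_one_pow, hk.neg_one_pow]
  · have hk : Even k := by rw [Nat.even_iff]; have := Nat.odd_iff.mp hn; omega
    simp only [hn.neg_one_pow, hk.neg_one_pow, neg_neg]

/-- Nonzero entries need 3 ∣ n + k + 1, which pairs the residues 0 and 2 and couples the residue 1
only to itself. That block decouples from index 0 and may be given the value 0, the only number
equal to its own negative. -/
lemma IsHexagonalLattice.exists_isSignSequence (h : IsHexagonalLattice L) :
    ∃ s, IsSignSequence (latticeSum L) s := by
  refine ⟨fun n => if n % 3 = 0 then 1 else if n % 3 = 1 then 0 else -1, by simp, fun n => ?_,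
    fun n k hS => ?_⟩
  · split_ifs <;> simp
  · have h3 : 3 ∣ n + k + 1 := by by_contra hc; exact hS (h.latticeSum_eq_zero hc)
    have hn : n % 3 = 0 ∧ k % 3 = 2 ∨ n % 3 = 1 ∧ k % 3 = 1 ∨ n % 3 = 2 ∧ k % 3 = 0 := by omega
    rcases hn with ⟨h1, h2⟩ | ⟨h1, h2⟩ | ⟨h1, h2⟩ <;> simp [h1, h2]

/-- Multiplying row n by s_n and using s_k = -s_n wherever the entry is nonzero flips the sign of
the interaction; s_0 = 1 preserves the right-hand side. -/
lemma IsSignSequence.isBoundedSolution {S s γ x : ℕ → ℂ} (hs : IsSignSequence S s) {σ : ℂ} {h : ℝ}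
    (hx : IsBoundedSolution σ γ S h x) : IsBoundedSolution (-σ) γ S h fun n => s n * x n := by
  obtain ⟨M, hM0, hM⟩ := hx.1.exists_norm_le
  refine ⟨memℓp_infty_of_norm_le (M := M) fun n => ?_, fun n => ?_⟩
  · rw [norm_mul]
    calc ‖s n‖ * ‖x n‖ ≤ 1 * M := by gcongr; exacts [hs.norm_le n, hM n]
      _ = M := one_mul M
  · have e : ∀ k, coeffG S n k * (s k * x k) * (h : ℂ) ^ (2 * n + 2 * k + 2) =
        -s n * (coeffG S n k * x k * (h : ℂ) ^ (2 * n + 2 * k + 2)) := fun k => by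
      by_cases hS : S (n + k + 1) = 0
      · simp [coeffG, hS]
      · rw [hs.eq_neg n k hS]; ring
    have := congrArg (fun v => s n * v) (hx.2 n)
    simp only at this ⊢
    rw [tsum_congr e, tsum_mul_left]
    by_cases hn : n = 0
    · subst hn
      simp only [if_true, hs.zero] at this ⊢
      linear_combination this
    · simp only [if_neg hn] at this ⊢
      linear_combination this

/-! ### Expansion of the solution in powers of `h` -/

section Expansion

variable {σ : ℂ} {γ S : ℕ → ℂ} {K Γ : ℝ}

lemma pow_isBigO_pow {m p : ℕ} (h : p ≤ m) :
    (fun w : ℂ => w ^ m) =O[𝓝 0] fun w => w ^ p := by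
  refine IsBigO.of_bound 1 ?_
  filter_upwards [ball_mem_nhds (0 : ℂ) one_pos] with w hw
  rw [norm_pow, norm_pow, one_mul]
  exact pow_le_pow_of_le_one (norm_nonneg _) (mem_ball_zero_iff.mp hw).le h

lemma norm_neumann_le_pow (hS : ∀ m, 1 ≤ m → ‖S m‖ ≤ K) (hγ : ∀ n, ‖γ n‖ ≤ Γ) (hσ : ‖σ‖ ≤ 1)
    {ρ : ℝ} (hρ : ρ ≤ 1 / 4) (hρ' : Γ * K * (2 * ρ) ^ 2 ≤ 1 / 2) {w : ℂ} (hw : ‖w‖ ≤ ρ) {n : ℕ}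
    (hn : n ≠ 0) : ‖neumann σ γ S n w‖ ≤ 2 * Γ * K * (2 * ‖w‖) ^ (2 * n + 2) := by
  have hΓ : 0 ≤ Γ := (norm_nonneg _).trans (hγ 0)
  rw [neumann_eq hS hγ hσ hρ hρ' hw n, if_neg hn, zero_add, norm_mul, norm_mul]
  have h1 := norm_tsum_coeffG_le_two_mul hS (norm_neumann_le hS hγ hσ hρ hρ' hw) (hw.trans hρ) n
  calc ‖σ‖ * ‖γ n‖ * _ ≤ 1 * Γ * (K * 2 * (2 * ‖w‖) ^ (2 * n + 2)) := by
        gcongr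
        exact hγ n
    _ = _ := by ring

/-- Column k of row n carries w^(2n+2k+2), and the k-th unknown is itself O(w^(2k+2)) for k ≠ 0.
Dropping the columns k ≥ N therefore costs w^(2n+4N+4); N ≠ 0 keeps the unknown at 0, which is not
small, out of the tail. -/
lemma neumann_isBigO (hS : ∀ m, 1 ≤ m → ‖S m‖ ≤ K) (hγ : ∀ n, ‖γ n‖ ≤ Γ) (hσ : ‖σ‖ ≤ 1)
    {ρ : ℝ} (hρ0 : 0 < ρ) (hρ : ρ ≤ 1 / 4) (hρ' : Γ * K * (2 * ρ) ^ 2 ≤ 1 / 2) (n N : ℕ)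
    (hN : N ≠ 0) :
    (fun w => neumann σ γ S n w - ((if n = 0 then 1 else 0) + σ * γ n * ∑ k ∈ Finset.range N,
      coeffG S n k * neumann σ γ S k w * w ^ (2 * n + 2 * k + 2))) =O[𝓝 0]
      fun w : ℂ => w ^ (2 * n + 4 * N + 4) := by
  have hK : 0 ≤ K := (norm_nonneg _).trans (hS 1 le_rfl)
  have hΓ : 0 ≤ Γ := (norm_nonneg _).trans (hγ 0)
  have hsum := (summable_nat_add_iff N).mpr (summable_choose_even n (t := 1 / 4) (by norm_num [abs_of_pos]))
  set Q : ℝ := ∑' k : ℕ, ((2 * n + 2 * (k + N) + 1).choose (2 * (k + N)) : ℝ) * (1 / 4) ^ (2 * (k + N))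
  set C : ℝ := K * (2 * Γ * K * 2 ^ (2 * N + 2)) * 4 ^ (2 * N) with hC
  refine IsBigO.of_bound (Γ * (C * Q)) ?_
  filter_upwards [ball_mem_nhds (0 : ℂ) hρ0] with w hw'
  have hw : ‖w‖ ≤ ρ := (mem_ball_zero_iff.mp hw').le
  have hw4 : ‖w‖ ≤ 1 / 4 := hw.trans hρ
  have hs := (summable_coeffG_mul hS (norm_neumann_le hS hγ hσ hρ hρ' hw) (w := w)
    (by linarith) n).of_norm
  rw [neumann_eq hS hγ hσ hρ hρ' hw n, add_sub_add_left_eq_sub, ← mul_sub,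
    ← hs.sum_add_tsum_nat_add N, add_sub_cancel_left, norm_mul, norm_mul]
  have key : ‖∑' k, coeffG S n (k + N) * neumann σ γ S (k + N) w *
      w ^ (2 * n + 2 * (k + N) + 2)‖ ≤ (C * ‖w‖ ^ (2 * n + 4 * N + 4)) * Q := by
    refine tsum_of_norm_bounded (hsum.hasSum.mul_left _) fun k => ?_
    have h1 := norm_neumann_le_pow hS hγ hσ hρ hρ' hw (n := k + N) (by omega)
    have h2 : (2 * ‖w‖) ^ (2 * (k + N) + 2) ≤ (2 * ‖w‖) ^ (2 * N + 2) :=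
      pow_le_pow_of_le_one (by positivity) (by linarith) (by omega)
    have h3 : ‖w‖ ^ (2 * n + 2 * (k + N) + 2) ≤
        ‖w‖ ^ (2 * n + 2 * N + 2) * (4 ^ (2 * N) * (1 / 4) ^ (2 * (k + N))) := by
      rw [show 2 * n + 2 * (k + N) + 2 = 2 * n + 2 * N + 2 + 2 * k by ring, pow_add]
      have e : (4 : ℝ) ^ (2 * N) * (1 / 4) ^ (2 * (k + N)) = (1 / 4) ^ (2 * k) := by
        rw [mul_add, pow_add, mul_left_comm, ← mul_pow]; norm_num
      rw [e]
      gcongr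
    rw [norm_mul, norm_mul, norm_pow]
    calc _ ≤ (((2 * n + 2 * (k + N) + 1).choose (2 * (k + N)) : ℝ) * K) *
          (2 * Γ * K * (2 * ‖w‖) ^ (2 * N + 2)) *
          (‖w‖ ^ (2 * n + 2 * N + 2) * (4 ^ (2 * N) * (1 / 4) ^ (2 * (k + N)))) := by
          gcongr
          · exact norm_coeffG_le hS n _
          · exact h1.trans (by gcongr)
      _ = _ := by rw [hC, mul_pow]; ring
  calc ‖σ‖ * ‖γ n‖ * _ ≤ 1 * Γ * ((C * ‖w‖ ^ (2 * n + 4 * N + 4)) * Q) := by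
        gcongr
        exact hγ n
    _ = _ := by rw [norm_pow]; ring

end Expansion

lemma isBigO_one_of_continuous {f : ℂ → ℂ} (hf : Continuous f) :
    f =O[𝓝 0] fun _ => (1 : ℂ) :=
  hf.continuousAt.norm.isBoundedUnder_le.isBigO_one ℂ

lemma IsBigO.pow_mul {f g : ℂ → ℂ} {p q : ℕ} (hf : f =O[𝓝 0] fun w => w ^ p)
    (hg : g =O[𝓝 0] fun w => w ^ q) : (fun w => f w * g w) =O[𝓝 0] fun w => w ^ (p + q) := by
  simpa only [pow_add] using hf.mul hg

/-- Second order expansion of the solution of `ξ = 1 + (A w^m + B w^{2m}) ξ + O(w^{3m})`. -/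
lemma isBigO_second_order {ξ : ℂ → ℂ} {A B : ℂ} {m : ℕ} (hξ : ξ =O[𝓝 0] fun _ => (1 : ℂ))
    (h : (fun w => ξ w - 1 - (A * w ^ m + B * w ^ (2 * m)) * ξ w) =O[𝓝 0] fun w => w ^ (3 * m)) :
    (fun w => ξ w - (1 + A * w ^ m + (A ^ 2 + B) * w ^ (2 * m))) =O[𝓝 0] fun w => w ^ (3 * m) := by
  have hw : (fun w : ℂ => w ^ (3 * m)) =O[𝓝 0] fun w => w ^ (3 * m) := isBigO_refl _ _
  -- With p = A w^m + B w^(2m) and ξ = 1 + pξ + e, iteration gives ξ = 1 + p + p² + p³ξ + (1 + p +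
  -- p²)e. The three estimates cover the excess part of p², the term p³ξ and the remainder.
  have h1 : (fun w : ℂ => (2 * A * B + B ^ 2 * w ^ m) * w ^ (3 * m)) =O[𝓝 0]
      fun w => w ^ (3 * m) := by
    simpa using (isBigO_one_of_continuous
      (f := fun w => 2 * A * B + B ^ 2 * w ^ m) (by fun_prop)).mul hw
  have h2 : (fun w : ℂ => (A + B * w ^ m) ^ 3 * ξ w * w ^ (3 * m)) =O[𝓝 0]
      fun w => w ^ (3 * m) := by
    simpa using ((isBigO_one_of_continuous
      (f := fun w => (A + B * w ^ m) ^ 3) (by fun_prop)).mul hξ).mul hw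
  have h3 := (isBigO_one_of_continuous (f := fun w => 1 + (A * w ^ m + B * w ^ (2 * m)) +
    (A * w ^ m + B * w ^ (2 * m)) ^ 2) (by fun_prop)).mul h
  simp only [one_mul] at h3
  refine ((h1.add h2).add h3).congr_left fun w => ?_
  rw [show 3 * m = m + m + m by ring, show 2 * m = m + m by ring, pow_add, pow_add]
  ring

section Expansion

variable {γ S : ℕ → ℂ} {K Γ : ℝ}

lemma neumann_isBigO_one (hS : ∀ m, 1 ≤ m → ‖S m‖ ≤ K) (hγ : ∀ n, ‖γ n‖ ≤ Γ)
    {ρ : ℝ} (hρ0 : 0 < ρ) (hρ : ρ ≤ 1 / 4) (hρ' : Γ * K * (2 * ρ) ^ 2 ≤ 1 / 2) (n : ℕ) :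
    neumann 1 γ S n =O[𝓝 0] fun _ => (1 : ℂ) := by
  refine IsBigO.of_bound 2 ?_
  filter_upwards [ball_mem_nhds (0 : ℂ) hρ0] with w hw
  simpa using norm_neumann_le hS hγ (by simp) hρ hρ' (mem_ball_zero_iff.mp hw).le n

lemma IsBigO.const_pow_mul {f : ℂ → ℂ} {q r : ℕ} (c : ℂ) (p : ℕ)
    (hf : f =O[𝓝 0] fun w => w ^ q) (h : r ≤ p + q) :
    (fun w => c * w ^ p * f w) =O[𝓝 0] fun w => w ^ r := by
  have h1 : (fun w : ℂ => c * w ^ p) =O[𝓝 0] fun w => w ^ p := (isBigO_refl _ _).const_mul_left c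
  exact (IsBigO.pow_mul h1 hf).trans (pow_isBigO_pow h)

/-- Only lattice sums of even index survive, so to this order unknown 0 sees only unknowns 1
(through S_2) and 3 (through S_4). Up to admissible errors both are multiples of unknown 0, and
substitution leaves a scalar equation in w⁸ for `isBigO_second_order`. -/
lemma neumann_square (hS : ∀ m, 1 ≤ m → ‖S m‖ ≤ K) (hγ : ∀ n, ‖γ n‖ ≤ Γ)
    {ρ : ℝ} (hρ0 : 0 < ρ) (hρ : ρ ≤ 1 / 4) (hρ' : Γ * K * (2 * ρ) ^ 2 ≤ 1 / 2)
    (hz : ∀ k, ¬ 2 ∣ k → S k = 0) :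
    (fun w => neumann 1 γ S 0 w - (1 + 3 * γ 0 * γ 1 * S 2 ^ 2 * w ^ 8 +
      (9 * γ 0 ^ 2 * γ 1 ^ 2 * S 2 ^ 4 + 7 * γ 0 * γ 3 * S 4 ^ 2) * w ^ 16)) =O[𝓝 0]
      fun w => w ^ 24 := by
  have z1 : S 1 = 0 := hz 1 (by norm_num)
  have z3 : S 3 = 0 := hz 3 (by norm_num)
  have z5 : S 5 = 0 := hz 5 (by norm_num)
  have b : ∀ n, neumann 1 γ S n =O[𝓝 0] fun w : ℂ => w ^ 0 := fun n => by
    simpa using neumann_isBigO_one hS hγ hρ0 hρ hρ' n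
  have B := fun n N hN => neumann_isBigO (σ := 1) hS hγ (by simp) hρ0 hρ hρ' n N hN
  -- Truncations 5, 4, 2, 2 of rows 0 to 3 leave the errors w^24, w^22, w^16, w^18, enough to reach
  -- w^24 in row 0 after substitution.
  have e0 : (fun w => neumann 1 γ S 0 w - 1 - γ 0 * (3 * S 2 * w ^ 4 * neumann 1 γ S 1 w +
      7 * S 4 * w ^ 8 * neumann 1 γ S 3 w)) =O[𝓝 0] fun w => w ^ 24 :=
    (B 0 5 (by norm_num)).congr_left fun w => by
      simp only [Finset.sum_range_succ, Finset.sum_range_zero, coeffG_eq]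
      norm_num [Nat.choose, z1, z3, z5]
      ring
  have e1 : (fun w => neumann 1 γ S 1 w - γ 1 * (S 2 * w ^ 4 * neumann 1 γ S 0 w +
      35 * S 4 * w ^ 8 * neumann 1 γ S 2 w)) =O[𝓝 0] fun w => w ^ 22 :=
    (B 1 4 (by norm_num)).congr_left fun w => by
      simp only [Finset.sum_range_succ, Finset.sum_range_zero, coeffG_eq]
      norm_num [Nat.choose, z1, z3, z5]
      left; ring
  have e2 : (fun w => neumann 1 γ S 2 w - γ 2 * (21 * S 4 * w ^ 8 * neumann 1 γ S 1 w)) =O[𝓝 0]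
      fun w => w ^ 16 :=
    (B 2 2 (by norm_num)).congr_left fun w => by
      simp only [Finset.sum_range_succ, Finset.sum_range_zero, coeffG_eq]
      norm_num [Nat.choose, z1, z3, z5]
      left; ring
  have e3 : (fun w => neumann 1 γ S 3 w - γ 3 * (S 4 * w ^ 8 * neumann 1 γ S 0 w)) =O[𝓝 0]
      fun w => w ^ 18 :=
    (B 3 2 (by norm_num)).congr_left fun w => by
      simp only [Finset.sum_range_succ, Finset.sum_range_zero, coeffG_eq]
      norm_num [Nat.choose, z1, z3, z5]
      left; ring
  have d1 : neumann 1 γ S 1 =O[𝓝 0] fun w : ℂ => w ^ 4 :=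
    ((e1.trans (pow_isBigO_pow (p := 4) (by norm_num))).add
      ((IsBigO.const_pow_mul (γ 1 * S 2) 4 (b 0) (r := 4) (by norm_num)).add
      (IsBigO.const_pow_mul (γ 1 * 35 * S 4) 8 (b 2) (r := 4) (by norm_num)))).congr_left
      fun w => by ring
  have d2 : neumann 1 γ S 2 =O[𝓝 0] fun w : ℂ => w ^ 12 :=
    ((e2.trans (pow_isBigO_pow (p := 12) (by norm_num))).add
      (IsBigO.const_pow_mul (γ 2 * 21 * S 4) 8 d1 (r := 12) (by norm_num))).congr_left
      fun w => by ring
  have r1 : (fun w => neumann 1 γ S 1 w - γ 1 * S 2 * w ^ 4 * neumann 1 γ S 0 w) =O[𝓝 0]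
      fun w => w ^ 20 :=
    ((e1.trans (pow_isBigO_pow (p := 20) (by norm_num))).add
      (IsBigO.const_pow_mul (γ 1 * 35 * S 4) 8 d2 (r := 20) (by norm_num))).congr_left
      fun w => by ring
  have main := isBigO_second_order (A := 3 * γ 0 * γ 1 * S 2 ^ 2) (B := 7 * γ 0 * γ 3 * S 4 ^ 2)
    (m := 8) (neumann_isBigO_one hS hγ hρ0 hρ hρ' 0)
    (((e0.add (IsBigO.const_pow_mul (γ 0 * 3 * S 2) 4 r1 (r := 24) (by norm_num))).add
      (IsBigO.const_pow_mul (γ 0 * 7 * S 4) 8 e3 (r := 24) (by norm_num))).congr_left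
      fun w => by ring)
  exact main.congr_left fun w => by ring

/-- The same elimination with S_k = 0 unless 3 ∣ k: unknown 0 interacts with 2 through S_3 and with
5 through S_6, while unknown 3 feeds back into 2 only at order w^30. The scalar equation is in w^12.
-/
lemma neumann_hexagonal (hS : ∀ m, 1 ≤ m → ‖S m‖ ≤ K) (hγ : ∀ n, ‖γ n‖ ≤ Γ)
    {ρ : ℝ} (hρ0 : 0 < ρ) (hρ : ρ ≤ 1 / 4) (hρ' : Γ * K * (2 * ρ) ^ 2 ≤ 1 / 2)
    (hz : ∀ k, ¬ 3 ∣ k → S k = 0) :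
    (fun w => neumann 1 γ S 0 w - (1 + 5 * γ 0 * γ 2 * S 3 ^ 2 * w ^ 12 +
      γ 0 * (25 * γ 0 * γ 2 ^ 2 * S 3 ^ 4 + 11 * γ 5 * S 6 ^ 2) * w ^ 24)) =O[𝓝 0]
      fun w => w ^ 36 := by
  have z1 : S 1 = 0 := hz 1 (by norm_num)
  have z2 : S 2 = 0 := hz 2 (by norm_num)
  have z4 : S 4 = 0 := hz 4 (by norm_num)
  have z5 : S 5 = 0 := hz 5 (by norm_num)
  have z7 : S 7 = 0 := hz 7 (by norm_num)
  have z8 : S 8 = 0 := hz 8 (by norm_num)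
  have b : ∀ n, neumann 1 γ S n =O[𝓝 0] fun w : ℂ => w ^ 0 := fun n => by
    simpa using neumann_isBigO_one hS hγ hρ0 hρ hρ' n
  have B := fun n N hN => neumann_isBigO (σ := 1) hS hγ (by simp) hρ0 hρ hρ' n N hN
  have e0 : (fun w => neumann 1 γ S 0 w - 1 - γ 0 * (5 * S 3 * w ^ 6 * neumann 1 γ S 2 w +
      11 * S 6 * w ^ 12 * neumann 1 γ S 5 w)) =O[𝓝 0] fun w => w ^ 36 :=
    (B 0 8 (by norm_num)).congr_left fun w => by
      simp only [Finset.sum_range_succ, Finset.sum_range_zero, coeffG_eq]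
      norm_num [Nat.choose, z1, z2, z4, z5, z7, z8]
      ring
  have e2 : (fun w => neumann 1 γ S 2 w - γ 2 * (S 3 * w ^ 6 * neumann 1 γ S 0 w +
      462 * S 6 * w ^ 12 * neumann 1 γ S 3 w)) =O[𝓝 0] fun w => w ^ 32 :=
    (B 2 6 (by norm_num)).congr_left fun w => by
      simp only [Finset.sum_range_succ, Finset.sum_range_zero, coeffG_eq]
      norm_num [Nat.choose, z1, z2, z4, z5, z7, z8]
      left; ring
  have e3 : (fun w => neumann 1 γ S 3 w - γ 3 * (330 * S 6 * w ^ 12 * neumann 1 γ S 2 w)) =O[𝓝 0]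
      fun w => w ^ 22 :=
    (B 3 3 (by norm_num)).congr_left fun w => by
      simp only [Finset.sum_range_succ, Finset.sum_range_zero, coeffG_eq]
      norm_num [Nat.choose, z1, z2, z4, z5, z7, z8]
      left; ring
  have e5 : (fun w => neumann 1 γ S 5 w - γ 5 * (S 6 * w ^ 12 * neumann 1 γ S 0 w)) =O[𝓝 0]
      fun w => w ^ 26 :=
    (B 5 3 (by norm_num)).congr_left fun w => by
      simp only [Finset.sum_range_succ, Finset.sum_range_zero, coeffG_eq]
      norm_num [Nat.choose, z1, z2, z4, z5, z7, z8]
      left; ring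
  have d2 : neumann 1 γ S 2 =O[𝓝 0] fun w : ℂ => w ^ 6 :=
    ((e2.trans (pow_isBigO_pow (p := 6) (by norm_num))).add
      ((IsBigO.const_pow_mul (γ 2 * S 3) 6 (b 0) (r := 6) (by norm_num)).add
      (IsBigO.const_pow_mul (γ 2 * 462 * S 6) 12 (b 3) (r := 6) (by norm_num)))).congr_left
      fun w => by ring
  have d3 : neumann 1 γ S 3 =O[𝓝 0] fun w : ℂ => w ^ 18 :=
    ((e3.trans (pow_isBigO_pow (p := 18) (by norm_num))).add
      (IsBigO.const_pow_mul (γ 3 * 330 * S 6) 12 d2 (r := 18) (by norm_num))).congr_left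
      fun w => by ring
  have r2 : (fun w => neumann 1 γ S 2 w - γ 2 * S 3 * w ^ 6 * neumann 1 γ S 0 w) =O[𝓝 0]
      fun w => w ^ 30 :=
    ((e2.trans (pow_isBigO_pow (p := 30) (by norm_num))).add
      (IsBigO.const_pow_mul (γ 2 * 462 * S 6) 12 d3 (r := 30) (by norm_num))).congr_left
      fun w => by ring
  have main := isBigO_second_order (A := 5 * γ 0 * γ 2 * S 3 ^ 2) (B := 11 * γ 0 * γ 5 * S 6 ^ 2)
    (m := 12) (neumann_isBigO_one hS hγ hρ0 hρ hρ' 0)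
    (((e0.add (IsBigO.const_pow_mul (γ 0 * 5 * S 3) 6 r2 (r := 36) (by norm_num))).add
      (IsBigO.const_pow_mul (γ 0 * 11 * S 6) 12 e5 (r := 36) (by norm_num))).congr_left
      fun w => by ring)
  exact main.congr_left fun w => by ring

lemma analyticAt_neumann_ofReal (hS : ∀ m, 1 ≤ m → ‖S m‖ ≤ K) (hγ : ∀ n, ‖γ n‖ ≤ Γ)
    {ρ : ℝ} (hρ0 : 0 < ρ) (hρ : ρ ≤ 1 / 4) (hρ' : Γ * K * (2 * ρ) ^ 2 ≤ 1 / 2) :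
    AnalyticAt ℝ (fun h : ℝ => neumann 1 γ S 0 h) 0 := by
  have h1 : AnalyticAt ℂ (neumann 1 γ S 0) ((0 : ℝ) : ℂ) :=
    (differentiableOn_neumann hS hγ (by simp) hρ hρ' 0).analyticAt (isOpen_ball.mem_nhds (by simpa))
  exact (h1.restrictScalars (𝕜 := ℝ)).comp (Complex.ofRealCLM.analyticAt 0)

lemma isBigO_comp_ofReal {f : ℂ → ℂ} {m : ℕ} (hf : f =O[𝓝 0] fun w => w ^ m) :
    (fun h : ℝ => f h) =O[𝓝 0] fun h : ℝ => h ^ m := by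
  have h0 : Tendsto (fun h : ℝ => (h : ℂ)) (𝓝 0) (𝓝 0) := by
    simpa using Complex.continuous_ofReal.tendsto 0
  refine (hf.comp_tendsto h0).trans (isBigO_of_le _ fun h => ?_)
  simp

lemma IsSignSequence.eventually_isUniqueBoundedSolution {s : ℕ → ℂ} (hs : IsSignSequence S s)
    (hS : ∀ m, 1 ≤ m → ‖S m‖ ≤ K) (hγ : ∀ n, ‖γ n‖ ≤ Γ)
    {ρ : ℝ} (hρ0 : 0 < ρ) (hρ : ρ ≤ 1 / 4) (hρ' : Γ * K * (2 * ρ) ^ 2 ≤ 1 / 2) :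
    ∀ᶠ h in 𝓝 (0 : ℝ),
      (∃ x, IsUniqueBoundedSolution 1 γ S h x ∧ x 0 = γ 0 * neumann 1 γ S 0 h) ∧
      (∃ y, IsUniqueBoundedSolution (-1) γ S h y ∧ y 0 = γ 0 * neumann 1 γ S 0 h) := by
  filter_upwards [ball_mem_nhds (0 : ℝ) hρ0] with h hh
  have hh' : |h| ≤ ρ := (mem_ball_zero_iff.mp hh).le
  have h1 := isBoundedSolution_neumann (σ := 1) hS hγ (by simp) hρ hρ' hh'
  exact ⟨⟨_, isUniqueBoundedSolution_of_small hS hγ (by simp) hρ hρ' hh' h1, rfl⟩,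
    ⟨_, isUniqueBoundedSolution_of_small hS hγ (by simp) hρ hρ' hh' (hs.isBoundedSolution h1),
      by simp [hs.zero]⟩⟩

end Expansion

/-! ### Numerical values of the lattice sums -/

open scoped ArithmeticFunction.sigma UpperHalfPlane
open EisensteinSeries

/-- A quantitative ratio test: (n+1)/n is largest at n = M, so all consecutive ratios from there on
are at most 1/2. -/
lemma pow_mul_geometric_le {r : ℝ} {k M : ℕ} (hM : 0 < M) (hr : 0 ≤ r)
    (hc : ((M + 1 : ℝ) / M) ^ k * r ≤ 1 / 2) (j : ℕ) :
    ((M + j : ℕ) : ℝ) ^ k * r ^ (M + j) ≤ (M : ℝ) ^ k * r ^ M * (1 / 2) ^ j := by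
  induction j with
  | zero => simp
  | succ j ih =>
    have hM' : (0 : ℝ) < M := by exact_mod_cast hM
    have h1 : ((M + (j + 1) : ℕ) : ℝ) ≤ ((M + 1 : ℝ) / M) * ((M + j : ℕ) : ℝ) := by
      rw [div_mul_eq_mul_div, le_div_iff₀ hM']
      push_cast
      nlinarith [(Nat.cast_nonneg j : (0 : ℝ) ≤ j)]
    calc ((M + (j + 1) : ℕ) : ℝ) ^ k * r ^ (M + (j + 1))
        ≤ (((M + 1 : ℝ) / M) * ((M + j : ℕ) : ℝ)) ^ k * r ^ (M + (j + 1)) := by gcongr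
      _ = (((M + 1 : ℝ) / M) ^ k * r) * (((M + j : ℕ) : ℝ) ^ k * r ^ (M + j)) := by
        rw [mul_pow, ← add_assoc, pow_succ]; ring
      _ ≤ 1 / 2 * ((M : ℝ) ^ k * r ^ M * (1 / 2) ^ j) := by gcongr
      _ = _ := by rw [pow_succ]; ring

/-- Since σ_{k-1}(n) ≤ n^k, the tail is dominated by a geometric series of ratio 1/2 and hence by
twice its first term. -/
lemma exists_qSeries_eq {k : ℕ} (hk : 1 ≤ k) {q : ℝ} {M : ℕ} (hM : 0 < M)
    (hc : ((M + 1 : ℝ) / M) ^ k * |q| ≤ 1 / 2) :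
    ∃ θ : ℂ, ‖θ‖ ≤ 2 * ((M : ℝ) ^ k * |q| ^ M) ∧ ∑' n : ℕ+, (σ (k - 1) n : ℂ) * (q : ℂ) ^ (n : ℕ) =
      ((∑ n ∈ Finset.range M, (σ (k - 1) n : ℝ) * q ^ n : ℝ) : ℂ) + θ := by
  have hb : ∀ j, ‖(σ (k - 1) (j + M) : ℂ) * (q : ℂ) ^ (j + M)‖ ≤
      (M : ℝ) ^ k * |q| ^ M * (1 / 2) ^ j := fun j => by
    refine le_trans ?_ (pow_mul_geometric_le hM (abs_nonneg q) hc j)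
    rw [norm_mul, norm_pow, Complex.norm_natCast, Complex.norm_real, Real.norm_eq_abs, add_comm j M]
    gcongr
    have := ArithmeticFunction.sigma_le_pow_succ (k - 1) (M + j)
    rw [Nat.sub_add_cancel hk] at this
    exact_mod_cast this
  have hg : HasSum (fun j : ℕ => (M : ℝ) ^ k * |q| ^ M * (1 / 2) ^ j)
      ((M : ℝ) ^ k * |q| ^ M * 2) := by
    have h := (hasSum_geometric_of_lt_one (r := (1 / 2 : ℝ)) (by norm_num) (by norm_num)).mul_left
      ((M : ℝ) ^ k * |q| ^ M)
    rwa [show (1 - 1 / 2 : ℝ)⁻¹ = 2 by norm_num] at h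
  have hs' : Summable fun j => (σ (k - 1) (j + M) : ℂ) * (q : ℂ) ^ (j + M) :=
    .of_norm_bounded hg.summable hb
  have hs := (summable_nat_add_iff (f := fun n => (σ (k - 1) n : ℂ) * (q : ℂ) ^ n) M).mp hs'
  refine ⟨∑' j, (σ (k - 1) (j + M) : ℂ) * (q : ℂ) ^ (j + M), ?_, ?_⟩
  · rw [mul_comm (2 : ℝ)]
    exact tsum_of_norm_bounded hg hb
  · have h1 := tsum_zero_pnat_eq_tsum_nat hs
    simp only [ArithmeticFunction.map_zero, Nat.cast_zero, zero_mul, zero_add] at h1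
    rw [h1, ← hs.sum_add_tsum_nat_add M]
    push_cast
    rfl

lemma latticeSum_eq_tsum_eisSummand {L : PeriodPair} {ℓ : ℝ} (hL : IsTubeLattice L ℓ) (z : ℍ)
    (hz : L.ω₂ = ℓ * z) {k : ℕ} (hk : k ≠ 1) (hk0 : k ≠ 0) :
    latticeSum L k = ∑' v, eisSummand (2 * k : ℕ) v z := by
  have hℓ : (ℓ : ℂ) ≠ 0 := by exact_mod_cast hL.pos.ne'
  rw [latticeSum, if_neg hk]
  -- The origin may be included because division by zero yields 0 there; the sum then runs over all
  -- of ℤ² like the Eisenstein series.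
  have h1 : ∑' l : {l : L.lattice // l ≠ 0}, ((spacing L : ℂ) / (l : ℂ)) ^ (2 * k) =
      ∑' l : L.lattice, ((spacing L : ℂ) / (l : ℂ)) ^ (2 * k) := by
    refine tsum_subtype_eq_of_support_subset (s := {l : L.lattice | l ≠ 0})
      (f := fun l : L.lattice => ((spacing L : ℂ) / (l : ℂ)) ^ (2 * k)) fun l hl => ?_
    rintro rfl
    apply hl
    simp [hk0]
  rw [h1, ← L.latticeEquivProd.symm.tsum_eq, ← (finTwoArrowEquiv ℤ).symm.tsum_eq,
    ← (Equiv.prodComm ℤ ℤ).tsum_eq]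
  refine tsum_congr fun x => ?_
  have e : ((L.latticeEquivProd.symm.toEquiv ((Equiv.prodComm ℤ ℤ) x) : L.lattice) : ℂ) =
      ℓ * (x.1 * z + x.2) := by
    have := L.latticeEquiv_symm_apply (x.2, x.1)
    rw [hL.omega₁_eq, hz] at this
    refine this.trans ?_
    push_cast
    ring
  have e' : ((spacing L : ℂ) / ((L.latticeEquivProd.symm ((Equiv.prodComm ℤ ℤ) x) : L.lattice) : ℂ))
      ^ (2 * k) = ((ℓ : ℂ) / (ℓ * (x.1 * z + x.2))) ^ (2 * k) := by
    rw [hL.spacing_eq, ← e]; rfl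
  refine e'.trans ?_
  rw [div_mul_eq_div_div, div_self hℓ, one_div, inv_pow, eisSummand, zpow_neg, zpow_natCast]
  rfl


/-- S_k is the Eisenstein series of weight 2k at ω₂/ℓ. Its q-expansion, cut after finitely many
terms, reduces the claim to one inequality between real numbers. -/
lemma norm_latticeSum_sub_lt {L : PeriodPair} {ℓ : ℝ} (hL : IsTubeLattice L ℓ) (z : ℍ)
    (hz : L.ω₂ = ℓ * z) {q : ℝ} (hq : Complex.exp (2 * Real.pi * Complex.I * z) = q) {k M : ℕ}
    (hk : 2 ≤ k) (hM : 0 < M) (hc : ((M + 1 : ℝ) / M) ^ (2 * k) * |q| ≤ 1 / 2) {ζ C c δ : ℝ}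
    (hζ : riemannZeta (2 * k : ℕ) = ζ) (hC : (-2 * Real.pi * Complex.I) ^ (2 * k) = (C : ℂ))
    (h : |2 * ζ + 2 * (C / (2 * k - 1).factorial) *
      (∑ n ∈ Finset.range M, (σ (2 * k - 1) n : ℝ) * q ^ n) - c| +
      2 * (|C| / (2 * k - 1).factorial) * (2 * ((M : ℝ) ^ (2 * k) * |q| ^ M)) < δ) :
    ‖latticeSum L k - c‖ < δ := by
  obtain ⟨θ, hθ, e⟩ := exists_qSeries_eq (k := 2 * k) (by omega) hM hc
  rw [latticeSum_eq_tsum_eisSummand hL z hz (by omega) (by omega),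
    tsum_eisSummand_eq_tsum_sigma_mul_cexp_pow (by omega) (even_two_mul k), hq, e, hζ, hC]
  set P := ∑ n ∈ Finset.range M, (σ (2 * k - 1) n : ℝ) * q ^ n
  have e2 : 2 * (ζ : ℂ) + 2 * ((C : ℂ) / ((2 * k - 1).factorial : ℂ)) * ((P : ℂ) + θ) - c =
      ((2 * ζ + 2 * (C / (2 * k - 1).factorial) * P - c : ℝ) : ℂ) +
        ((2 * (C / (2 * k - 1).factorial) : ℝ) : ℂ) * θ := by push_cast; ring
  rw [e2]
  refine (norm_add_le _ _).trans_lt (lt_of_le_of_lt ?_ h)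
  rw [Complex.norm_real, Real.norm_eq_abs, norm_mul, Complex.norm_real, Real.norm_eq_abs, abs_mul,
    abs_div, abs_two, Nat.abs_cast]
  gcongr

/-! ### Bernoulli numbers and even zeta values -/

lemma bernoulli'_six : bernoulli' 6 = 1 / 42 := by
  rw [bernoulli'_def]
  norm_num [Finset.sum_range_succ, bernoulli'_eq_zero_of_odd, Nat.choose]

lemma bernoulli'_eight : bernoulli' 8 = -1 / 30 := by
  have h5 : bernoulli' 5 = 0 := bernoulli'_eq_zero_of_odd (by decide) (by norm_num)
  have h7 : bernoulli' 7 = 0 := bernoulli'_eq_zero_of_odd (by decide) (by norm_num)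
  rw [bernoulli'_def]
  norm_num [Finset.sum_range_succ, Nat.choose, h5, h7, bernoulli'_six]

lemma bernoulli'_twelve : bernoulli' 12 = -691 / 2730 := by
  have h5 : bernoulli' 5 = 0 := bernoulli'_eq_zero_of_odd (by decide) (by norm_num)
  have h7 : bernoulli' 7 = 0 := bernoulli'_eq_zero_of_odd (by decide) (by norm_num)
  have h9 : bernoulli' 9 = 0 := bernoulli'_eq_zero_of_odd (by decide) (by norm_num)
  have h11 : bernoulli' 11 = 0 := bernoulli'_eq_zero_of_odd (by decide) (by norm_num)
  have h10 : bernoulli' 10 = 5 / 66 := by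
    rw [bernoulli'_def]
    norm_num [Finset.sum_range_succ, Nat.choose, h5, h7, h9, bernoulli'_six, bernoulli'_eight]
  rw [bernoulli'_def]
  norm_num [Finset.sum_range_succ, Nat.choose, h5, h7, h9, h11, h10, bernoulli'_six,
    bernoulli'_eight]

lemma riemannZeta_six : riemannZeta 6 = ((Real.pi ^ 6 / 945 : ℝ) : ℂ) := by
  have := riemannZeta_two_mul_nat (k := 3) (by norm_num)
  norm_num [bernoulli_eq_bernoulli'_of_ne_one, bernoulli'_six, Nat.factorial] at this ⊢
  rw [this]; ring

lemma riemannZeta_eight : riemannZeta 8 = ((Real.pi ^ 8 / 9450 : ℝ) : ℂ) := by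
  have := riemannZeta_two_mul_nat (k := 4) (by norm_num)
  norm_num [bernoulli_eq_bernoulli'_of_ne_one, bernoulli'_eight, Nat.factorial] at this ⊢
  rw [this]; ring

lemma riemannZeta_twelve : riemannZeta 12 = ((691 * Real.pi ^ 12 / 638512875 : ℝ) : ℂ) := by
  have := riemannZeta_two_mul_nat (k := 6) (by norm_num)
  norm_num [bernoulli_eq_bernoulli'_of_ne_one, bernoulli'_twelve, Nat.factorial] at this ⊢
  rw [this]; ring

/-! ### Rigorous bounds for the nome q -/

lemma abs_exp_sub_taylor_le {x : ℝ} (hx : |x| ≤ 1) :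
    |Real.exp x - ∑ m ∈ Finset.range 16, x ^ m / m.factorial| ≤ 1 / 10 ^ 13 * |x| ^ 16 := by
  refine (Real.exp_bound hx (n := 16) (by norm_num)).trans ?_
  rw [mul_comm]
  refine mul_le_mul_of_nonneg_right ?_ (by positivity)
  norm_num [Nat.factorial]

lemma exp_neg_two_pi_bounds : 0.00186744273 < Real.exp (-(2 * Real.pi)) ∧
    Real.exp (-(2 * Real.pi)) < 0.00186744274 := by
  have h1 := Real.pi_gt_d20
  have h2 := Real.pi_lt_d20
  -- The arguments enclose -π/4 = -2π/8, where the Taylor bound is valid; the result is raised to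
  -- the eighth power.
  have e1 := abs_exp_sub_taylor_le (x := -0.78539816339) (by norm_num [abs_le])
  have e2 := abs_exp_sub_taylor_le (x := -0.78539816340) (by norm_num [abs_le])
  norm_num [Finset.sum_range_succ, Nat.factorial, abs_le] at e1 e2
  have m1 : Real.exp (-(2 * Real.pi)) ≤ Real.exp (-0.78539816339) ^ 8 := by
    rw [← Real.exp_nat_mul]; apply Real.exp_le_exp.mpr; norm_num; linarith
  have m2 : Real.exp (-0.78539816340) ^ 8 ≤ Real.exp (-(2 * Real.pi)) := by
    rw [← Real.exp_nat_mul]; apply Real.exp_le_exp.mpr; norm_num; linarith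
  have b1 : Real.exp (-0.78539816339) ≤ 0.45593812777 := by norm_num; linarith [e1.2]
  have b2 : 0.45593812776 ≤ Real.exp (-0.78539816340) := by norm_num; linarith [e2.1]
  constructor
  · refine lt_of_lt_of_le ?_ ((pow_le_pow_left₀ (by norm_num) b2 8).trans m2)
    norm_num
  · refine lt_of_le_of_lt (m1.trans (pow_le_pow_left₀ (Real.exp_pos _).le b1 8)) ?_
    norm_num

lemma exp_neg_pi_sqrt_three_bounds : 0.00433342049 < Real.exp (-(Real.pi * √3)) ∧
    Real.exp (-(Real.pi * √3)) < 0.00433342053 := by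
  have h1 := Real.pi_gt_d20
  have h2 := Real.pi_lt_d20
  have s1 : 1.73205080756 < √3 := Real.lt_sqrt_of_sq_lt (by norm_num)
  have s2 : √3 < 1.73205080757 := (Real.sqrt_lt' (by norm_num)).mpr (by norm_num)
  have p1 : 3.14159265358 * 1.73205080756 ≤ Real.pi * √3 := by
    refine mul_le_mul ?_ s1.le (by norm_num) Real.pi_pos.le
    linarith
  have p2 : Real.pi * √3 ≤ 3.14159265359 * 1.73205080757 := by
    refine mul_le_mul ?_ s2.le (Real.sqrt_nonneg 3) (by norm_num)
    linarith
  -- These values enclose -π√3/8; as before, the eighth power recovers the exponential.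
  have e1 := abs_exp_sub_taylor_le (x := -0.6801747615) (by norm_num [abs_le])
  have e2 := abs_exp_sub_taylor_le (x := -0.6801747616) (by norm_num [abs_le])
  norm_num [Finset.sum_range_succ, Nat.factorial, abs_le] at e1 e2
  have m1 : Real.exp (-(Real.pi * √3)) ≤ Real.exp (-0.6801747615) ^ 8 := by
    rw [← Real.exp_nat_mul]; apply Real.exp_le_exp.mpr; norm_num; linarith
  have m2 : Real.exp (-0.6801747616) ^ 8 ≤ Real.exp (-(Real.pi * √3)) := by
    rw [← Real.exp_nat_mul]; apply Real.exp_le_exp.mpr; norm_num; linarith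
  have b1 : Real.exp (-0.6801747615) ≤ 0.50652846296 := by norm_num; linarith [e1.2]
  have b2 : 0.50652846290 ≤ Real.exp (-0.6801747616) := by norm_num; linarith [e2.1]
  constructor
  · refine lt_of_lt_of_le ?_ ((pow_le_pow_left₀ (by norm_num) b2 8).trans m2)
    norm_num
  · refine lt_of_le_of_lt (m1.trans (pow_le_pow_left₀ (Real.exp_pos _).le b1 8)) ?_
    norm_num

section Numerics

open scoped ArithmeticFunction.sigma UpperHalfPlane
open EisensteinSeries

variable {L : PeriodPair}

lemma pi_pow_bounds (k : ℕ) : (3.14159265358 : ℝ) ^ k ≤ Real.pi ^ k ∧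
    Real.pi ^ k ≤ (3.14159265359 : ℝ) ^ k := by
  have h1 := Real.pi_gt_d20
  have h2 := Real.pi_lt_d20
  exact ⟨pow_le_pow_left₀ (by norm_num) (by linarith) k,
    pow_le_pow_left₀ Real.pi_pos.le (by linarith) k⟩

/-- Enclosure of `2ζ + 2 (2π)^k / (k-1)! P` up to an error `E`. -/
lemma abs_value_add_lt {ζ C P E c z₀ z₁ C₀ C₁ p₀ p₁ e δ : ℝ} (hz : z₀ ≤ ζ ∧ ζ ≤ z₁)
    (hC : C₀ ≤ C ∧ C ≤ C₁) (hC₀ : 0 ≤ C₀) (hp : p₀ ≤ P ∧ P ≤ p₁) (hp₀ : 0 ≤ p₀)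
    (hE : E ≤ e) (hE₀ : 0 ≤ E) (h₀ : c - δ < 2 * z₀ + 2 * C₀ * p₀ - 2 * C₁ * e)
    (h₁ : 2 * z₁ + 2 * C₁ * p₁ + 2 * C₁ * e < c + δ) :
    |2 * ζ + 2 * C * P - c| + 2 * C * E < δ := by
  have a1 : C₀ * p₀ ≤ C * P := mul_le_mul hC.1 hp.1 hp₀ (hC₀.trans hC.1)
  have a2 : C * P ≤ C₁ * p₁ := mul_le_mul hC.2 hp.2 (hp₀.trans hp.1) ((hC₀.trans hC.1).trans hC.2)
  have a3 : C * E ≤ C₁ * e := mul_le_mul hC.2 hE hE₀ ((hC₀.trans hC.1).trans hC.2)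
  rw [← lt_sub_iff_add_lt, abs_lt]
  constructor <;> linarith [hz.1, hz.2]

lemma IsSquareLattice.exists_upperHalfPlane (h : IsSquareLattice L) :
    ∃ ℓ, IsTubeLattice L ℓ ∧ ∃ z : ℍ, L.ω₂ = ℓ * z ∧
      Complex.exp (2 * Real.pi * Complex.I * z) = (Real.exp (-(2 * Real.pi)) : ℝ) := by
  obtain ⟨ℓ, hL⟩ := h.isTubeLattice
  obtain ⟨ℓ', hℓ', h1, h2⟩ := h
  have e : ℓ = ℓ' := by
    have := hL.omega₁_eq.symm.trans h1
    exact_mod_cast this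
  refine ⟨ℓ, hL, UpperHalfPlane.I, by rw [h2, e]; rfl, ?_⟩
  rw [Complex.ofReal_exp, UpperHalfPlane.coe_I]
  congr 1
  push_cast
  linear_combination 2 * Real.pi * Complex.I_sq

/-- The period ratio e^(iπ/3) has real part 1/2, which makes q negative, and imaginary part √3/2. -/
lemma IsHexagonalLattice.exists_upperHalfPlane (h : IsHexagonalLattice L) :
    ∃ ℓ, IsTubeLattice L ℓ ∧ ∃ z : ℍ, L.ω₂ = ℓ * z ∧
      Complex.exp (2 * Real.pi * Complex.I * z) = (-Real.exp (-(Real.pi * √3)) : ℝ) := by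
  obtain ⟨ℓ, hL⟩ := h.isTubeLattice
  obtain ⟨ℓ', hℓ', h1, h2⟩ := h
  have e : ℓ = ℓ' := by
    have := hL.omega₁_eq.symm.trans h1
    exact_mod_cast this
  have him : 0 < (Complex.exp (Complex.I * Real.pi / 3)).im := by
    rw [exp_I_pi_div_three]; simp
  refine ⟨ℓ, hL, ⟨_, him⟩, by rw [h2, e], ?_⟩
  have e2 : (2 * Real.pi * Complex.I * Complex.exp (Complex.I * Real.pi / 3) : ℂ) =
      Real.pi * Complex.I + (-(Real.pi * √3) : ℝ) := by
    rw [exp_I_pi_div_three]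
    push_cast
    linear_combination (Real.pi * √3 : ℂ) * Complex.I_sq
  change Complex.exp (2 * Real.pi * Complex.I * Complex.exp (Complex.I * Real.pi / 3)) = _
  rw [e2, Complex.exp_add, Complex.exp_pi_mul_I]
  push_cast
  ring

lemma IsSquareLattice.norm_latticeSum_two_sub_lt (h : IsSquareLattice L) :
    ‖latticeSum L 2 - 3.15121‖ < 1 / 10 ^ 5 := by
  obtain ⟨ℓ, hL, z, hz, hq⟩ := h.exists_upperHalfPlane
  obtain ⟨q0, q1⟩ := exp_neg_two_pi_bounds
  set q := Real.exp (-(2 * Real.pi))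
  have q0' : (0 : ℝ) < q := Real.exp_pos _
  have hb := fun n => And.intro (pow_le_pow_left₀ (by norm_num) q0.le n)
    (pow_le_pow_left₀ q0'.le q1.le n)
  have hp := pi_pow_bounds 4
  have s2 : σ 3 2 = 9 := by rfl
  have b2 := hb 2
  have s3 : σ 3 3 = 28 := by rfl
  have b3 := hb 3
  have b4 := hb 4
  norm_num at hp b2 b3 b4
  have hP : 0.00189901096 ≤ ∑ n ∈ Finset.range 4, (σ 3 n : ℝ) * q ^ n ∧
      ∑ n ∈ Finset.range 4, (σ 3 n : ℝ) * q ^ n ≤ 0.00189901136 := by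
    norm_num [Finset.sum_range_succ, s2, s3]
    constructor <;> linarith
  have hE : 2 * (4 ^ 4 * q ^ 4) ≤ 6.289e-09 := by linarith
  have hζ : 1.082323224 ≤ Real.pi ^ 4 / 90 ∧ Real.pi ^ 4 / 90 ≤ 1.082323244 := by
    constructor <;> linarith
  have hC : 259.75748 ≤ (2 * Real.pi) ^ 4 / (4 - 1).factorial ∧
      (2 * Real.pi) ^ 4 / (4 - 1).factorial ≤ 259.75768 := by
    norm_num [Nat.factorial, mul_pow]
    constructor <;> linarith
  have key := abs_value_add_lt (c := 3.15121) (δ := 1 / 10 ^ 5) hζ hC (by norm_num) hP (by norm_num)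
    hE (by positivity) (by norm_num) (by norm_num)
  have := norm_latticeSum_sub_lt hL z hz hq (k := 2) (M := 4) (ζ := Real.pi ^ 4 / 90)
    (C := (2 * Real.pi) ^ 4) (c := 3.15121) (δ := 1 / 10 ^ 5) (by norm_num) (by norm_num)
    (by rw [abs_of_pos q0']; norm_num; linarith)
    (by norm_num [riemannZeta_four]) (by push_cast; rw [mul_pow, Complex.I_pow_four]; ring) ?_
  · exact_mod_cast this
  · rw [abs_of_pos q0', abs_of_nonneg (by positivity : (0 : ℝ) ≤ (2 * Real.pi) ^ 4)]
    exact_mod_cast key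

lemma IsSquareLattice.norm_latticeSum_four_sub_lt (h : IsSquareLattice L) :
    ‖latticeSum L 4 - 4.25577‖ < 1 / 10 ^ 5 := by
  obtain ⟨ℓ, hL, z, hz, hq⟩ := h.exists_upperHalfPlane
  obtain ⟨q0, q1⟩ := exp_neg_two_pi_bounds
  set q := Real.exp (-(2 * Real.pi))
  have q0' : (0 : ℝ) < q := Real.exp_pos _
  have hb := fun n => And.intro (pow_le_pow_left₀ (by norm_num) q0.le n)
    (pow_le_pow_left₀ q0'.le q1.le n)
  have hp := pi_pow_bounds 8
  have s2 : σ 7 2 = 129 := by rfl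
  have b2 := hb 2
  have s3 : σ 7 3 = 2188 := by rfl
  have b3 := hb 3
  have s4 : σ 7 4 = 16513 := by rfl
  have b4 := hb 4
  have s5 : σ 7 5 = 78126 := by rfl
  have b5 := hb 5
  have b6 := hb 6
  norm_num at hp b2 b3 b4 b5 b6
  have hP : 0.00233176145 ≤ ∑ n ∈ Finset.range 6, (σ 7 n : ℝ) * q ^ n ∧
      ∑ n ∈ Finset.range 6, (σ 7 n : ℝ) * q ^ n ≤ 0.00233176185 := by
    norm_num [Finset.sum_range_succ, s2, s3, s4, s5]
    constructor <;> linarith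
  have hE : 2 * (6 ^ 8 * q ^ 6) ≤ 1.439e-10 := by linarith
  have hζ : 1.004077346 ≤ Real.pi ^ 8 / 9450 ∧ Real.pi ^ 8 / 9450 ≤ 1.004077366 := by
    constructor <;> linarith
  have hC : 481.95703 ≤ (2 * Real.pi) ^ 8 / (8 - 1).factorial ∧
      (2 * Real.pi) ^ 8 / (8 - 1).factorial ≤ 481.95723 := by
    norm_num [Nat.factorial, mul_pow]
    constructor <;> linarith
  have key := abs_value_add_lt (c := 4.25577) (δ := 1 / 10 ^ 5) hζ hC (by norm_num) hP (by norm_num)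
    hE (by positivity) (by norm_num) (by norm_num)
  have := norm_latticeSum_sub_lt hL z hz hq (k := 4) (M := 6) (ζ := Real.pi ^ 8 / 9450)
    (C := (2 * Real.pi) ^ 8) (c := 4.25577) (δ := 1 / 10 ^ 5) (by norm_num) (by norm_num)
    (by rw [abs_of_pos q0']; norm_num; linarith)
    (by norm_num [riemannZeta_eight]) (by push_cast; rw [mul_pow, show Complex.I ^ 8 = 1 by rw [show 8 = 4 * 2 by norm_num, pow_mul, Complex.I_pow_four]; norm_num]; ring) ?_
  · exact_mod_cast this
  · rw [abs_of_pos q0', abs_of_nonneg (by positivity : (0 : ℝ) ≤ (2 * Real.pi) ^ 8)]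
    exact_mod_cast key

lemma IsHexagonalLattice.norm_latticeSum_three_sub_lt (h : IsHexagonalLattice L) :
    ‖latticeSum L 3 - 5.86303‖ < 1 / 10 ^ 5 := by
  obtain ⟨ℓ, hL, z, hz, hq⟩ := h.exists_upperHalfPlane
  obtain ⟨q0, q1⟩ := exp_neg_pi_sqrt_three_bounds
  set q := Real.exp (-(Real.pi * √3))
  have q0' : (0 : ℝ) < q := Real.exp_pos _
  have hb := fun n => And.intro (pow_le_pow_left₀ (by norm_num) q0.le n)
    (pow_le_pow_left₀ q0'.le q1.le n)
  have hp := pi_pow_bounds 6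
  have s2 : σ 5 2 = 33 := by rfl
  have b2 := hb 2
  have s3 : σ 5 3 = 244 := by rfl
  have b3 := hb 3
  have s4 : σ 5 4 = 1057 := by rfl
  have b4 := hb 4
  have s5 : σ 5 5 = 3126 := by rfl
  have b5 := hb 5
  have b6 := hb 6
  norm_num at hp b2 b3 b4 b5 b6
  -- In weight 6 the factor (-2πi)^6 is negative, and so is the q-series at a negative nome. The
  -- enclosure is stated for the two negated quantities, so that `abs_value_add_lt` applies with
  -- nonnegative bounds.
  have hP : 0.00373321632 ≤ -(∑ n ∈ Finset.range 6, (σ 5 n : ℝ) * (-q) ^ n) ∧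
      -(∑ n ∈ Finset.range 6, (σ 5 n : ℝ) * (-q) ^ n) ≤ 0.00373321672 := by
    norm_num [Finset.sum_range_succ, s2, s3, s4, s5, neg_pow q]
    constructor <;> linarith
  have hE : 2 * (6 ^ 6 * q ^ 6) ≤ 6.241e-10 := by linarith
  have hζ : 1.017343052 ≤ Real.pi ^ 6 / 945 ∧ Real.pi ^ 6 / 945 ≤ 1.017343072 := by
    constructor <;> linarith
  have hC : 512.74080 ≤ (2 * Real.pi) ^ 6 / (6 - 1).factorial ∧
      (2 * Real.pi) ^ 6 / (6 - 1).factorial ≤ 512.74100 := by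
    norm_num [Nat.factorial, mul_pow]
    constructor <;> linarith
  have key := abs_value_add_lt (c := 5.86303) (δ := 1 / 10 ^ 5) hζ hC (by norm_num) hP (by norm_num)
    hE (by positivity) (by norm_num) (by norm_num)
  have := norm_latticeSum_sub_lt hL z hz hq (k := 3) (M := 6) (ζ := Real.pi ^ 6 / 945)
    (C := -(2 * Real.pi) ^ 6) (c := 5.86303) (δ := 1 / 10 ^ 5) (by norm_num) (by norm_num)
    (by rw [abs_neg q, abs_of_pos q0']; norm_num; linarith)
    (by norm_num [riemannZeta_six]) (by push_cast; rw [mul_pow, show Complex.I ^ 6 = -1 by rw [show 6 = 2 * 3 by norm_num, pow_mul, Complex.I_sq]; norm_num]; ring) ?_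
  · exact_mod_cast this
  · rw [abs_neg q, abs_of_pos q0', abs_neg ((2 * Real.pi) ^ 6), abs_of_nonneg (by positivity : (0 : ℝ) ≤ (2 * Real.pi) ^ 6)]
    convert! key using 3
    ring

lemma IsHexagonalLattice.norm_latticeSum_six_sub_lt (h : IsHexagonalLattice L) :
    ‖latticeSum L 6 - 6.00964‖ < 1 / 10 ^ 5 := by
  obtain ⟨ℓ, hL, z, hz, hq⟩ := h.exists_upperHalfPlane
  obtain ⟨q0, q1⟩ := exp_neg_pi_sqrt_three_bounds
  set q := Real.exp (-(Real.pi * √3))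
  have q0' : (0 : ℝ) < q := Real.exp_pos _
  have hb := fun n => And.intro (pow_le_pow_left₀ (by norm_num) q0.le n)
    (pow_le_pow_left₀ q0'.le q1.le n)
  have hp := pi_pow_bounds 12
  have s2 : σ 11 2 = 2049 := by rfl
  have b2 := hb 2
  have s3 : σ 11 3 = 177148 := by rfl
  have b3 := hb 3
  have s4 : σ 11 4 = 4196353 := by rfl
  have b4 := hb 4
  have s5 : σ 11 5 = 48828126 := by rfl
  have b5 := hb 5
  have s6 : σ 11 6 = 362976252 := by rfl
  have b6 := hb 6
  have s7 : σ 11 7 = 1977326744 := by rfl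
  have b7 := hb 7
  have b8 := hb 8
  norm_num at hp b2 b3 b4 b5 b6 b7 b8
  have hP : 0.02113582896 ≤ ∑ n ∈ Finset.range 8, (σ 11 n : ℝ) * (-q) ^ n ∧
      ∑ n ∈ Finset.range 8, (σ 11 n : ℝ) * (-q) ^ n ≤ 0.02113583496 := by
    norm_num [Finset.sum_range_succ, s2, s3, s4, s5, s6, s7, neg_pow q]
    constructor <;> linarith
  have hE : 2 * (8 ^ 12 * q ^ 8) ≤ 1.726e-08 := by linarith
  have hζ : 1.000246077 ≤ 691 * Real.pi ^ 12 / 638512875 ∧ 691 * Real.pi ^ 12 / 638512875 ≤ 1.000246097 := by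
    constructor <;> linarith
  have hC : 94.84243 ≤ (2 * Real.pi) ^ 12 / (12 - 1).factorial ∧
      (2 * Real.pi) ^ 12 / (12 - 1).factorial ≤ 94.84245 := by
    norm_num [Nat.factorial, mul_pow]
    constructor <;> linarith
  have key := abs_value_add_lt (c := 6.00964) (δ := 1 / 10 ^ 5) hζ hC (by norm_num) hP (by norm_num)
    hE (by positivity) (by norm_num) (by norm_num)
  have := norm_latticeSum_sub_lt hL z hz hq (k := 6) (M := 8) (ζ := 691 * Real.pi ^ 12 / 638512875)
    (C := (2 * Real.pi) ^ 12) (c := 6.00964) (δ := 1 / 10 ^ 5) (by norm_num) (by norm_num)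
    (by rw [abs_neg q, abs_of_pos q0']; norm_num; linarith)
    (by norm_num [riemannZeta_twelve]) (by push_cast; rw [mul_pow, show Complex.I ^ 12 = 1 by rw [show 12 = 4 * 3 by norm_num, pow_mul, Complex.I_pow_four]; norm_num]; ring) ?_
  · exact_mod_cast this
  · rw [abs_neg q, abs_of_pos q0', abs_of_nonneg (by positivity : (0 : ℝ) ≤ (2 * Real.pi) ^ 12)]
    exact_mod_cast key

end Numerics

lemma IsSquareLattice.im_ω₂_pos {L : PeriodPair} (h : IsSquareLattice L) : 0 < L.ω₂.im := by
  obtain ⟨ℓ, hℓ, -, h2⟩ := h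
  simpa [h2] using hℓ

lemma IsHexagonalLattice.im_ω₂_pos {L : PeriodPair} (h : IsHexagonalLattice L) :
    0 < L.ω₂.im := by
  obtain ⟨ℓ, hℓ, -, h2⟩ := h
  have : Complex.I * Real.pi / 3 = ((Real.pi / 3 : ℝ) : ℂ) * Complex.I := by push_cast; ring
  rw [h2, this, Complex.im_ofReal_mul, Complex.exp_ofReal_mul_I_im, Real.sin_pi_div_three]
  positivity

end TubeArray

end

/-! ### The main theorem -/

open TubeArray
theorem mainTheorem3 (L : PeriodPair) (hL : IsSquareLattice L ∨ IsHexagonalLattice L)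
    (εc εi εe : ℂ) (hεc : εc ≠ 0) (hεi : εi ≠ 0) (hεe : εe ≠ 0)
    (hie : εi + εe ≠ 0) (hic : εi + εc ≠ 0)
    (ν : ℝ) (hν0 : 0 ≤ ν) (hν1 : ν < 1)
    (hγ : ∀ n : ℕ, 1 - alpha εi εe * alphaTilde εc εi * (ν : ℂ) ^ (4 * n + 2) ≠ 0)
    (γ S : ℕ → ℂ) (hγdef : γ = gam εc εi εe ν) (hSdef : S = latticeSum L) :
    -- `Ψ = (π/2) I`
    Psi L = (Real.pi / 2) • (1 : Matrix (Fin 2) (Fin 2) ℝ) ∧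
    -- `λ = μ` and the isotropic effective constant
    (∀ a : ℝ, 0 < a → a / spacing L ≤ 1 / 2 →
      ∀ x y : ℕ → ℂ,
        IsUniqueBoundedSolution 1 γ S (a / spacing L) x →
        IsUniqueBoundedSolution (-1) γ S (a / spacing L) y →
        ∀ lam mu : ℂ, x 0 = γ 0 * lam → y 0 = γ 0 * mu →
          (γ 0 ≠ 0 → lam = mu) ∧
          (1 - γ 0 * lam * volumeFraction L a ≠ 0 →
            IsEffectiveTensor L a (ν * a) εc εi εe
              ((εe * ((1 + γ 0 * lam * volumeFraction L a) /
                (1 - γ 0 * lam * volumeFraction L a))) • (1 : Matrix (Fin 2) (Fin 2) ℂ)) ∧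
            (a / spacing L < 1 / 2 →
              ∀ T, IsEffectiveTensor L a (ν * a) εc εi εe T →
                T = (εe * ((1 + γ 0 * lam * volumeFraction L a) /
                  (1 - γ 0 * lam * volumeFraction L a))) • (1 : Matrix (Fin 2) (Fin 2) ℂ)))) ∧
    -- the expansions of `λ = μ` in powers of `h`
    (∃ lam : ℝ → ℂ, AnalyticAt ℝ lam 0 ∧
      (∀ᶠ h in 𝓝 (0 : ℝ),
        (∃ x, IsUniqueBoundedSolution 1 γ S h x ∧ x 0 = γ 0 * lam h) ∧
        (∃ y, IsUniqueBoundedSolution (-1) γ S h y ∧ y 0 = γ 0 * lam h)) ∧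
      (IsSquareLattice L →
        (fun h : ℝ => lam h - (1 + 3 * γ 0 * γ 1 * S 2 ^ 2 * (h : ℂ) ^ 8
          + (9 * γ 0 ^ 2 * γ 1 ^ 2 * S 2 ^ 4 + 7 * γ 0 * γ 3 * S 4 ^ 2) * (h : ℂ) ^ 16))
          =O[𝓝 0] fun h : ℝ => h ^ 24) ∧
      (IsHexagonalLattice L →
        (fun h : ℝ => lam h - (1 + 5 * γ 0 * γ 2 * S 3 ^ 2 * (h : ℂ) ^ 12
          + γ 0 * (25 * γ 0 * γ 2 ^ 2 * S 3 ^ 4 + 11 * γ 5 * S 6 ^ 2) * (h : ℂ) ^ 24))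
          =O[𝓝 0] fun h : ℝ => h ^ 36)) ∧
    -- the numerical values of the lattice sums in the leading coefficients
    (IsSquareLattice L → ‖S 2 - 3.15121‖ < 1 / 10 ^ 5 ∧ ‖S 4 - 4.25577‖ < 1 / 10 ^ 5) ∧
    (IsHexagonalLattice L → ‖S 3 - 5.86303‖ < 1 / 10 ^ 5 ∧ ‖S 6 - 6.00964‖ < 1 / 10 ^ 5) := by
  subst hγdef hSdef
  obtain ⟨ℓ, hT⟩ : ∃ ℓ, IsTubeLattice L ℓ := hL.elim (·.isTubeLattice) (·.isTubeLattice)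
  obtain ⟨s, hs⟩ : ∃ s, IsSignSequence (latticeSum L) s :=
    hL.elim (·.exists_isSignSequence) (·.exists_isSignSequence)
  have him : 0 < L.ω₂.im := hL.elim (·.im_ω₂_pos) (·.im_ω₂_pos)
  obtain ⟨K, hK0, hK⟩ := hT.exists_norm_latticeSum_le
  obtain ⟨Γ, hΓ⟩ := exists_norm_gam_le εc εi εe hν0 hν1
  obtain ⟨ρ, hρ0, hρ, hρ'⟩ := exists_small_radius Γ K ((norm_nonneg _).trans (hΓ 0)) hK0
  refine ⟨hT.psi_eq him, ?_, ?_, ?_, ?_⟩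
  · intro a ha haℓ x y hx hy lam mu hlam hmu
    rw [hT.spacing_eq] at haℓ
    -- The sign sequence carries `x` to a bounded solution of (Y), which must be `y` by uniqueness;
    -- its value at 0 is unchanged.
    have hxy : x 0 = y 0 := by
      rw [← hy.2 _ (hs.isBoundedSolution hx.1)]
      simp [hs.zero]
    refine ⟨fun h0 => mul_left_cancel₀ h0 (by rw [← hlam, ← hmu, hxy]), ?_⟩
    rw [← hlam]
    intro hne
    have haℓ' : 2 * a ≤ ℓ := by
      rw [div_le_iff₀ hT.pos] at haℓ; linarith
    have hE := hT.isEffectiveTensor ha haℓ' hν0 hν1 hεi hεe hie hic hγ hx hy hxy hne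
    refine ⟨hE, fun hlt T hT' => ?_⟩
    rw [hT.spacing_eq, div_lt_iff₀ hT.pos] at hlt
    exact hT.effectiveTensor_unique ha (by linarith) hν0 hν1 hie hic hγ hx.1 hy.1 hxy hne hT' hE
  -- The Neumann series starts from the unit vector, so it is already divided by `γ 0`; this makes λ
  -- well defined even when `γ 0 = 0`.
  · exact ⟨fun h => neumann 1 (gam εc εi εe ν) (latticeSum L) 0 h,
      analyticAt_neumann_ofReal hK hΓ hρ0 hρ hρ',
      hs.eventually_isUniqueBoundedSolution hK hΓ hρ0 hρ hρ',
      fun h => isBigO_comp_ofReal (neumann_square hK hΓ hρ0 hρ hρ' fun _ => h.latticeSum_eq_zero),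
      fun h => isBigO_comp_ofReal
        (neumann_hexagonal hK hΓ hρ0 hρ hρ' fun _ => h.latticeSum_eq_zero)⟩
  · exact fun h => ⟨h.norm_latticeSum_two_sub_lt, h.norm_latticeSum_four_sub_lt⟩
  · exact fun h => ⟨h.norm_latticeSum_three_sub_lt, h.norm_latticeSum_six_sub_lt⟩
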